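/- Let $k$ be a field of any characteristic, $k^{\rm s}$ a separable closure, $\Gamma=\mathrm{Gal}(k^{\rm s}/k)$, acting on points from the right, $\mathcal B$ a quaternion algebra over $k$ with canonical involution $*$, and $n\in\{2,3\}$. Let $\mathrm H_n(\mathcal B)$ be the space of $x\in \mathrm M_n(\mathcal B)$ with ${}^t x^{*}=x$ whose diagonal entries are scalars (the last condition is automatic if $\mathrm{char}\,k\ne 2$). The algebraic group $G=\mathrm{GL}_n(\mathcal B)\times \mathrm{GL}_2$ acts on $V=\mathrm H_n(\mathcal B)\oplus \mathrm H_n(\mathcal B)$ by $$\Bigl(g_1,\begin{pmatrix}a&b\\c&d\end{pmatrix}\Bigr)\cdot(x_1,x_2)=\bigl(g_1(ax_1+bx_2)\,{}^tg_1^{*},\;g_1(cx_1+dx_2)\,{}^tg_1^{*}\bigr).$$ For $x\in V$ let $F_x(v_1,v_2)=\mathrm{Pfaff}_n(x_1v_1+x_2v_2)$, a binary form of degree $n$, where $\mathrm{Pfaff}_n$ is the polynomial square root of the reduced norm on $\mathrm H_n(\mathcal B)$ with value $1$ at the identity matrix. Call $x$ semi-stable, $x\in V^{\rm ss}$, if the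 discriminant of $F_x$ is non-zero, and for $x\in V^{\rm ss}(k)$ put $Z_x=\mathrm{Proj}\,k[v_1,v_2]/(F_x)$. The isomorphism class $[Z_x]$ of the $k$-scheme $Z_x$ depends only on the orbit $G(k)x$; let $\Phi\colon G(k)\backslash V^{\rm ss}(k)\to\{k\text{-schemes}\}/{\cong}$, $G(k)x\mapsto [Z_x]$, be the resulting map. Let $x\in V^{\rm ss}(k)$, let $G_x$ be its stabilizer and $G_x^\circ$ the identity component of $G_x$. Let $\mathrm{Aut}(Z_x)$ act on $Z_x$ from the right. Then the homomorphism $c_x\colon G_x\to \mathrm{Aut}(Z_x)$, $(g_1,g_2)\mapsto (v\mapsto vg_2)$, gives on $k^{\rm s}$-points an exact sequence $$1\to G_x^\circ\to G_x\to \mathrm{Aut}(Z_x)\to 1 .$$ The group $\mathrm{Aut}(Z_x)(k)$ acts from the right on $\mathrm H^1(k,G_x^\circ)$: if $t\in G_x(k^{\rm s})$ satisfies $c_x(t)=\gamma\in\mathrm{Aut}(Z_x)(k)$, then $\gamma$ sends the class of a $1$-cocycle $(h_\sigma)_{\sigma\in\Gamma}$ to the class of $(t^{-1}h_\sigma t^\sigma)_{\sigma\in\Gamma}$,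 which is again a $1$-cocycle with values in $G_x^\circ(k^{\rm s})$. There is a bijection $$\mathrm H^1(k,G_x^\circ)/\mathrm{Aut}(Z_x)(k)\;\longrightarrow\;\Phi^{-1}([Z_x])$$ with the following property: whenever $g\in G(k^{\rm s})$ is such that $(g^{-1}g^\sigma)_{\sigma\in\Gamma}$ is a $1$-cocycle with values in $G_x^\circ(k^{\rm s})$, the point $g\cdot x$ lies in $V^{\rm ss}(k)$ and the class of this cocycle corresponds to the orbit $G(k)\,(g\cdot x)$. -/

import Mathlib

universe u

noncomputable section

namespace HermitianPairs

open CategoryTheory AlgebraicGeometry MvPolynomial HomogeneousIdeal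
open scoped Quaternion Matrix

attribute [local instance] MvPolynomial.gradedAlgebra

/-! ### Quaternion algebras and Hermitian matrices -/

/-- A quaternion algebra over a field `k` of arbitrary characteristic, presented as
`i² = a + b i`, `j² = c`, `j i = b j - i j`. It is central simple exactly when the polynomial
`X² - b X - a` is separable and `c ≠ 0`, and every quaternion algebra has such a presentation. -/
structure QuatAlg (k : Type u) [Field k] where
  a : k
  b : k
  c : k
  disc_ne_zero : b ^ 2 + 4 * a ≠ 0
  c_ne_zero : c ≠ 0

variable {k : Type u} [Field k] (Q : QuatAlg k) (n : ℕ)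

/-- The base change `B ⊗ R` of the quaternion algebra to a commutative `k`-algebra `R`. Its
canonical involution is `star`. -/
abbrev QuatAlg.alg (R : Type u) [CommRing R] [Algebra k R] : Type u :=
  ℍ[R, algebraMap k R Q.a, algebraMap k R Q.b, algebraMap k R Q.c]

/-- Functoriality of `B ⊗ R` in `R`. -/
def QuatAlg.map {R S : Type u} [CommRing R] [Algebra k R] [CommRing S] [Algebra k S]
    (φ : R →ₐ[k] S) : Q.alg R →+* Q.alg S where
  toFun q := ⟨φ q.re, φ q.imI, φ q.imJ, φ q.imK⟩
  map_one' := by ext <;> simp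
  map_zero' := by ext <;> simp
  map_add' p q := by ext <;> simp
  map_mul' p q := by ext <;> simp

section Points

variable (R : Type u) [CommRing R] [Algebra k R]

/-- The reduced norm of `B ⊗ R`. -/
def qNorm {R : Type u} [CommRing R] [Algebra k R] (q : Q.alg R) : R := (q * star q).re

/-- The reduced trace of `B ⊗ R`. -/
def qTrace {R : Type u} [CommRing R] [Algebra k R] (q : Q.alg R) : R := (q + star q).re

/-- The `R`-points of the space of Hermitian matrices: `xᴴ = x` (conjugate transpose with respect
to the canonical involution) with diagonal entries scalar. The condition on the diagonal entries
is automatic if the characteristic is not two. -/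
def IsHerm (x : Matrix (Fin n) (Fin n) (Q.alg R)) : Prop :=
  xᴴ = x ∧ ∀ i, ∃ r : R, x i i = algebraMap R (Q.alg R) r

/-- Pairs of `n × n` matrices over `B ⊗ R`: the ambient space of `V(R)`. -/
def Amb : Type u := Fin 2 → Matrix (Fin n) (Fin n) (Q.alg R)

/-- `V(R)`: pairs of Hermitian matrices. -/
def V : Set (Amb Q n R) := {x | ∀ i, IsHerm Q n R (x i)}

/-- `G(R) = GL_n(B ⊗ R) × GL_2(R)`. -/
def Grp : Type u := (Matrix (Fin n) (Fin n) (Q.alg R))ˣ × (Matrix (Fin 2) (Fin 2) R)ˣ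

instance : Group (Grp Q n R) :=
  inferInstanceAs (Group ((Matrix (Fin n) (Fin n) (Q.alg R))ˣ × (Matrix (Fin 2) (Fin 2) R)ˣ))

variable {R Q n}

/-- The first component of `(g₁, g₂)`, as a matrix. -/
def Grp.fst (g : Grp Q n R) : Matrix (Fin n) (Fin n) (Q.alg R) := g.1.val

/-- The second component of `(g₁, g₂)`, as a matrix. -/
def Grp.snd (g : Grp Q n R) : Matrix (Fin 2) (Fin 2) R := g.2.val

/-- The second component of `(g₁, g₂)`, as an invertible matrix. -/
def Grp.sndUnit (g : Grp Q n R) : (Matrix (Fin 2) (Fin 2) R)ˣ := g.2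

theorem Grp.fst_mul (g h : Grp Q n R) : (g * h).fst = g.fst * h.fst := rfl

theorem Grp.snd_mul (g h : Grp Q n R) : (g * h).snd = g.snd * h.snd := rfl

theorem Grp.fst_one : (1 : Grp Q n R).fst = 1 := rfl

theorem Grp.snd_one : (1 : Grp Q n R).snd = 1 := rfl

theorem Grp.ext' {g h : Grp Q n R} (h₁ : g.fst = h.fst) (h₂ : g.snd = h.snd) : g = h :=
  Prod.ext (Units.ext h₁) (Units.ext h₂)

/-- The action
`(g₁, (p q; r s)) • (x₁, x₂) = (g₁ (p x₁ + q x₂) g₁ᴴ, g₁ (r x₁ + s x₂) g₁ᴴ)`. -/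
instance : MulAction (Grp Q n R) (Amb Q n R) where
  smul g x := fun i => g.fst * (∑ j, g.snd i j • x j) * g.fstᴴ
  one_smul x := by
    funext i
    change (1 : Grp Q n R).fst * (∑ j, (1 : Grp Q n R).snd i j • x j) * (1 : Grp Q n R).fstᴴ = x i
    fin_cases i <;> simp [Grp.fst_one, Grp.snd_one, Fin.sum_univ_two]
  mul_smul g h x := by
    funext i
    change (g * h).fst * (∑ j, (g * h).snd i j • x j) * (g * h).fstᴴ =
      g.fst * (∑ j, g.snd i j • (h.fst * (∑ l, h.snd j l • x l) * h.fstᴴ)) * g.fstᴴ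
    have key : (∑ j, (g * h).snd i j • x j) = ∑ j, g.snd i j • (∑ l, h.snd j l • x l) := by
      simp only [Grp.snd_mul, Matrix.mul_apply, Fin.sum_univ_two, smul_add, add_smul, mul_smul]
      abel
    rw [key, Grp.fst_mul, Matrix.conjTranspose_mul]
    have h2 : ∑ j, g.snd i j • (h.fst * (∑ l, h.snd j l • x l) * h.fstᴴ) =
        h.fst * (∑ j, g.snd i j • (∑ l, h.snd j l • x l)) * h.fstᴴ := by
      simp only [Matrix.mul_sum, Matrix.sum_mul, Matrix.mul_smul, Matrix.smul_mul]
    rw [h2]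
    simp only [Matrix.mul_assoc]

/-- Functoriality of `G(R)` in `R`. -/
def Grp.map {S : Type u} [CommRing S] [Algebra k S] (φ : R →ₐ[k] S) : Grp Q n R →* Grp Q n S :=
  MonoidHom.prodMap (Units.map (Q.map φ).mapMatrix.toMonoidHom)
    (Units.map (φ : R →+* S).mapMatrix.toMonoidHom)

/-- Functoriality of pairs of matrices, and hence of `V(R)`, in `R`. -/
def Amb.map {S : Type u} [CommRing S] [Algebra k S] (φ : R →ₐ[k] S) (x : Amb Q n R) :
    Amb Q n S :=
  fun i => (x i).map (Q.map φ)

/-- The Galois group acts on the points of `G` through the matrix entries. -/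
instance : MulDistribMulAction (R ≃ₐ[k] R) (Grp Q n R) where
  smul σ g := Grp.map (σ : R →ₐ[k] R) g
  one_smul _ := Grp.ext' rfl rfl
  mul_smul _ _ _ := Grp.ext' rfl rfl
  smul_mul σ := map_mul (Grp.map (σ : R →ₐ[k] R))
  smul_one σ := map_one (Grp.map (σ : R →ₐ[k] R))

end Points

/-! ### The Pfaffian, the binary form `F_x`, semi-stable points -/

/-- The Pfaffian of a Hermitian matrix of size `2` or `3`: the polynomial square root of the
reduced norm taking the value `1` at the identity matrix. -/
def pfaff {R : Type u} [CommRing R] [Algebra k R] :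
    (n : ℕ) → Matrix (Fin n) (Fin n) (Q.alg R) → R
  | 2, x => (x 0 0).re * (x 1 1).re - qNorm Q (x 0 1)
  | 3, x => (x 0 0).re * (x 1 1).re * (x 2 2).re + qTrace Q (x 0 1 * x 1 2 * x 2 0)
      - (x 0 0).re * qNorm Q (x 1 2) - (x 1 1).re * qNorm Q (x 0 2)
      - (x 2 2).re * qNorm Q (x 0 1)
  | _, _ => 0

section Form

variable {Q n}
variable {R : Type u} [CommRing R] [Algebra k R]

/-- The matrix `x(v) = x₁ v₁ + x₂ v₂` over the polynomial ring `R[v₁, v₂]`. -/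
def genericMatrix (x : Amb Q n R) : Matrix (Fin n) (Fin n) (Q.alg (MvPolynomial (Fin 2) R)) :=
  ∑ i, (X i : MvPolynomial (Fin 2) R) •
    (Amb.map (IsScalarTower.toAlgHom k R (MvPolynomial (Fin 2) R)) x) i

/-- The binary form `F_x(v) = Pfaff_n(x(v))`. -/
def formF (x : Amb Q n R) : MvPolynomial (Fin 2) R := pfaff Q n (genericMatrix x)

/-- A quaternion over the polynomial ring with all coordinates homogeneous of degree `d`. -/
def QHom (d : ℕ) (q : Q.alg (MvPolynomial (Fin 2) R)) : Prop :=
  q.re.IsHomogeneous d ∧ q.imI.IsHomogeneous d ∧ q.imJ.IsHomogeneous d ∧ q.imK.IsHomogeneous d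

theorem isHomogeneous_algebraMap_mul (c : k) {d : ℕ} {p : MvPolynomial (Fin 2) R}
    (hp : p.IsHomogeneous d) :
    (algebraMap k (MvPolynomial (Fin 2) R) c * p).IsHomogeneous d := by
  have := (isHomogeneous_C (Fin 2) (algebraMap k R c)).mul hp
  rw [zero_add] at this
  exact this

theorem QHom.star {d : ℕ} {q : Q.alg (MvPolynomial (Fin 2) R)} (h : QHom d q) :
    QHom d (star q) :=
  ⟨h.1.add (isHomogeneous_algebraMap_mul _ h.2.1), h.2.1.neg, h.2.2.1.neg, h.2.2.2.neg⟩

theorem QHom.mul {d e : ℕ} {p q : Q.alg (MvPolynomial (Fin 2) R)} (hp : QHom d p)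
    (hq : QHom e q) : QHom (d + e) (p * q) := by
  obtain ⟨a1, a2, a3, a4⟩ := hp
  obtain ⟨b1, b2, b3, b4⟩ := hq
  have m : ∀ (c : k) {x y : MvPolynomial (Fin 2) R}, x.IsHomogeneous d → y.IsHomogeneous e →
      (algebraMap k (MvPolynomial (Fin 2) R) c * x * y).IsHomogeneous (d + e) :=
    fun c x y hx hy => (isHomogeneous_algebraMap_mul c hx).mul hy
  have m2 : ∀ (c c' : k) {x y : MvPolynomial (Fin 2) R}, x.IsHomogeneous d →
      y.IsHomogeneous e → (algebraMap k (MvPolynomial (Fin 2) R) c *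
        algebraMap k (MvPolynomial (Fin 2) R) c' * x * y).IsHomogeneous (d + e) :=
    fun c c' x y hx hy => by rw [← map_mul]; exact m _ hx hy
  refine ⟨?_, ?_, ?_, ?_⟩
  · rw [QuaternionAlgebra.re_mul]
    exact (((a1.mul b1).add (m _ a2 b2)).add (m _ a3 b3)).add (m2 _ _ a3 b4) |>.sub (m2 _ _ a4 b4)
  · rw [QuaternionAlgebra.imI_mul]
    exact ((((a1.mul b2).add (a2.mul b1)).add (m _ a2 b2)).sub (m _ a3 b4)).add (m _ a4 b3)
  · rw [QuaternionAlgebra.imJ_mul]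
    exact ((((a1.mul b3).add (m _ a2 b4)).add (a3.mul b1)).add (m _ a3 b2)).sub (m _ a4 b2)
  · rw [QuaternionAlgebra.imK_mul]
    exact ((((a1.mul b4).add (a2.mul b3)).add (m _ a2 b4)).sub (a3.mul b2)).add (a4.mul b1)

theorem qHom_genericMatrix (x : Amb Q n R) (i j : Fin n) : QHom 1 (genericMatrix x i j) := by
  have hX : ∀ (l : Fin 2) (r : R), (X l * algebraMap R (MvPolynomial (Fin 2) R) r).IsHomogeneous
      1 := fun l r => (isHomogeneous_X R l).mul (isHomogeneous_C (Fin 2) r)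
  have e : genericMatrix x i j = ∑ l, (X l : MvPolynomial (Fin 2) R) •
      (Q.map (IsScalarTower.toAlgHom k R (MvPolynomial (Fin 2) R)) (x l i j)) := by
    simp [genericMatrix, Matrix.sum_apply, Amb.map]
  rw [e, Fin.sum_univ_two]
  refine ⟨?_, ?_, ?_, ?_⟩
  · exact (hX 0 _).add (hX 1 _)
  · exact (hX 0 _).add (hX 1 _)
  · exact (hX 0 _).add (hX 1 _)
  · exact (hX 0 _).add (hX 1 _)

theorem formF_isHomogeneous : ∀ (n : ℕ) (x : Amb Q n R), (formF x).IsHomogeneous n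
  | 0, _ => isHomogeneous_zero _ _ _
  | 1, _ => isHomogeneous_zero _ _ _
  | 2, x => by
    have h := qHom_genericMatrix x
    exact ((h 0 0).1.mul (h 1 1).1).sub ((h 0 1).mul (h 0 1).star).1
  | 3, x => by
    have h := qHom_genericMatrix x
    have t := ((h 0 1).mul (h 1 2)).mul (h 2 0)
    have N : ∀ i j l, ((genericMatrix x i i).re * qNorm Q (genericMatrix x j l)).IsHomogeneous 3 :=
      fun i j l => (h i i).1.mul ((h j l).mul (h j l).star).1
    exact (((((h 0 0).1.mul (h 1 1).1).mul (h 2 2).1).add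
      (t.1.add t.star.1)).sub (N _ _ _)).sub (N _ _ _) |>.sub (N _ _ _)
  | (n + 4), _ => isHomogeneous_zero _ _ _

/-- The coefficient of `v₁ ^ i * v₂ ^ j`. -/
def cf (F : MvPolynomial (Fin 2) R) (i j : ℕ) : R :=
  F.coeff (Finsupp.single 0 i + Finsupp.single 1 j)

/-- The discriminant of a binary quadratic or cubic form. -/
def disc (F : MvPolynomial (Fin 2) R) : ℕ → R
  | 2 => cf F 1 1 ^ 2 - 4 * cf F 2 0 * cf F 0 2
  | 3 => cf F 2 1 ^ 2 * cf F 1 2 ^ 2 - 4 * cf F 3 0 * cf F 1 2 ^ 3 - 4 * cf F 2 1 ^ 3 * cf F 0 3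
      + 18 * cf F 3 0 * cf F 2 1 * cf F 1 2 * cf F 0 3 - 27 * cf F 3 0 ^ 2 * cf F 0 3 ^ 2
  | _ => 0

/-- The relative invariant `P(x)`: the discriminant of `F_x`. -/
def invP (x : Amb Q n R) : R := disc (formF x) n

end Form

/-- The rational semi-stable points `V^ss(k)`. -/
def Vss : Type u := {x : Amb Q n k // x ∈ V Q n k ∧ invP x ≠ 0}

/-- Two semi-stable points are equivalent if they lie in the same `G(k)`-orbit. -/
instance orbSetoid : Setoid (Vss Q n) :=
  (MulAction.orbitRel (Grp Q n k) (Amb Q n k)).comap Subtype.val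

/-- The orbit space `G(k) \ V^ss(k)`. -/
def Orb : Type u := Quotient (orbSetoid Q n)

variable {Q n} in
/-- The `G(k)`-orbit of a semi-stable point. -/
def Vss.orbit (x : Vss Q n) : Orb Q n := Quotient.mk (orbSetoid Q n) x

/-! ### The scheme `Proj R[v₁, v₂] / (F)` -/

section QuotientGrading

variable {R A : Type u} [CommRing R] [CommRing A] [Algebra R A] (𝒜 : ℕ → Submodule R A)
  [GradedAlgebra 𝒜] (I : HomogeneousIdeal 𝒜)

/-- The grading on the quotient of a graded ring by a homogeneous ideal. -/
def quotGrading (i : ℕ) : Submodule R (A ⧸ I.toIdeal) :=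
  (𝒜 i).map (Ideal.Quotient.mkₐ R I.toIdeal).toLinearMap

/-- The projection from a graded piece to the graded piece of the quotient. -/
def quotPiece (i : ℕ) : 𝒜 i →ₗ[R] quotGrading 𝒜 I i :=
  ((Ideal.Quotient.mkₐ R I.toIdeal).toLinearMap.restrict fun _ hx =>
    Submodule.mem_map_of_mem hx)

/-- The decomposition of a quotient class into graded pieces. -/
def quotDecompose : (A ⧸ I.toIdeal) →+ DirectSum ℕ (fun i => quotGrading 𝒜 I i) :=
  QuotientAddGroup.lift I.toIdeal.toAddSubgroup
    ((DirectSum.map (fun i => (quotPiece 𝒜 I i).toAddMonoidHom)).comp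
      (DirectSum.decomposeAddEquiv 𝒜).toAddMonoidHom)
    (by
      intro x hx
      refine DFinsupp.ext fun i => Subtype.ext ?_
      change Ideal.Quotient.mk I.toIdeal ((DirectSum.decompose 𝒜 x i : 𝒜 i) : A) = 0
      exact Ideal.Quotient.eq_zero_iff_mem.mpr (I.isHomogeneous i hx))

theorem quotDecompose_mk_of {i : ℕ} (x : 𝒜 i) :
    quotDecompose 𝒜 I (Ideal.Quotient.mk I.toIdeal (x : A)) =
      DirectSum.of (fun i => quotGrading 𝒜 I i) i (quotPiece 𝒜 I i x) := by
  change (DirectSum.map (fun i => (quotPiece 𝒜 I i).toAddMonoidHom))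
    (DirectSum.decompose 𝒜 (x : A)) = _
  rw [DirectSum.decompose_coe, DirectSum.map_of]
  rfl

instance quotGradedAlgebra : GradedAlgebra (quotGrading 𝒜 I) where
  one_mem := ⟨1, SetLike.GradedOne.one_mem, map_one (Ideal.Quotient.mk I.toIdeal)⟩
  mul_mem := by
    rintro i j _ _ ⟨x, hx, rfl⟩ ⟨y, hy, rfl⟩
    exact ⟨x * y, SetLike.GradedMul.mul_mem hx hy, map_mul (Ideal.Quotient.mk I.toIdeal) x y⟩
  toDecomposition := DirectSum.Decomposition.ofAddHom _ (quotDecompose 𝒜 I)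
    (by
      ext q
      obtain ⟨x, rfl⟩ := Ideal.Quotient.mk_surjective q
      induction x using DirectSum.Decomposition.inductionOn 𝒜 with
      | zero => simp
      | homogeneous x =>
        simp only [AddMonoidHom.comp_apply, quotDecompose_mk_of]
        rw [DirectSum.coeAddMonoidHom_of]
        rfl
      | add x y hx hy =>
        rw [map_add, map_add, map_add, hx, hy])
    (by
      refine DirectSum.addHom_ext fun i y => ?_
      obtain ⟨_, x, hx, rfl⟩ := y
      simp only [AddMonoidHom.comp_apply, DirectSum.coeAddMonoidHom_of]
      exact quotDecompose_mk_of 𝒜 I ⟨x, hx⟩)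

end QuotientGrading

section Proj

variable {R : Type u} [CommRing R]

/-- The grading of `R[v₁, v₂]` by the degree. -/
abbrev polyGrading (R : Type u) [CommRing R] : ℕ → Submodule R (MvPolynomial (Fin 2) R) :=
  homogeneousSubmodule (Fin 2) R

/-- The homogeneous ideal generated by a form. -/
def formIdeal (F : MvPolynomial (Fin 2) R) {d : ℕ} (hF : F.IsHomogeneous d) :
    HomogeneousIdeal (polyGrading R) where
  __ := Ideal.span {F}
  is_homogeneous' := Ideal.homogeneous_span _ _ (by
    rintro _ rfl
    exact ⟨d, hF⟩)

/-- The irrelevant ideal of `R[v₁, v₂]` is generated by the coordinates. -/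
theorem irrelevant_le_of_X_mem (J : Ideal (MvPolynomial (Fin 2) R)) (h : ∀ i, X i ∈ J) {d : ℕ}
    (hd : 0 < d) {p : MvPolynomial (Fin 2) R} (hp : p.IsHomogeneous d) : p ∈ J := by
  rw [p.as_sum]
  refine J.sum_mem fun m hm => ?_
  have hm' : m ≠ 0 := by
    rintro rfl
    have := hp (mem_support_iff.mp hm)
    simp at this
    omega
  obtain ⟨j, hj⟩ := Finsupp.ne_iff.mp hm'
  exact J.mem_of_dvd (X_dvd_monomial.mpr (Or.inr hj)) (h j)

/-- The projective line `Proj R[v₁, v₂]`. -/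
def P1 (R : Type u) [CommRing R] : Scheme.{u} := Proj (polyGrading R)

/-- The substitution `f(v) ↦ f(v A)` for a `2 × 2` matrix `A`. -/
def substHom (A : Matrix (Fin 2) (Fin 2) R) : MvPolynomial (Fin 2) R →ₐ[R] MvPolynomial (Fin 2) R :=
  aeval fun j => ∑ i, A i j • (X i : MvPolynomial (Fin 2) R)

/-- The substitution as a homomorphism of graded rings. -/
def substGraded (A : Matrix (Fin 2) (Fin 2) R) : polyGrading R →+*ᵍ polyGrading R where
  __ := (substHom A : MvPolynomial (Fin 2) R →+* MvPolynomial (Fin 2) R)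
  map_mem := by
    intro d p hp
    have := IsHomogeneous.aeval (n := 1) hp (fun j => ∑ i, A i j • (X i : MvPolynomial (Fin 2) R))
      (fun j => IsHomogeneous.sum _ _ _ fun i _ => by
        rw [smul_eq_C_mul]
        exact (isHomogeneous_C_mul_X _ _))
    rw [one_mul] at this
    exact this

theorem irrelevant_substGraded (A : (Matrix (Fin 2) (Fin 2) R)ˣ) :
    irrelevant (polyGrading R) ≤ (irrelevant (polyGrading R)).map (substGraded A.val) := by
  rw [irrelevant_le]
  intro d hd p hp
  refine irrelevant_le_of_X_mem (((irrelevant (polyGrading R)).map (substGraded A.val)).toIdeal)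
    (fun i => ?_) hd hp
  have hL : ∀ j, (X j : MvPolynomial (Fin 2) R) ∈ irrelevant (polyGrading R) := fun j =>
    mem_irrelevant_of_mem _ one_pos (isHomogeneous_X R j)
  have e : (X i : MvPolynomial (Fin 2) R) =
      ∑ j, C (A⁻¹.val j i) * substGraded A.val (X j) := by
    have h1 : ∀ j, substGraded A.val (X j) = ∑ l, C (A.val l j) * (X l : MvPolynomial (Fin 2) R) :=
      fun j => by
        change substHom A.val (X j) = _
        simp [substHom, smul_eq_C_mul]
    have h2 : ∀ l, ∑ j, A.val l j * A⁻¹.val j i = if l = i then 1 else 0 := fun l => by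
      rw [← Matrix.mul_apply, ← Units.val_mul, mul_inv_cancel, Units.val_one, Matrix.one_apply]
    simp only [h1, Finset.mul_sum]
    rw [Finset.sum_comm]
    have h3 : ∀ l, ∑ j, C (A⁻¹.val j i) * (C (A.val l j) * (X l : MvPolynomial (Fin 2) R)) =
        C (if l = i then 1 else 0) * X l := fun l => by
      rw [← h2 l, map_sum, Finset.sum_mul]
      refine Finset.sum_congr rfl fun j _ => ?_
      rw [map_mul]
      ring
    rw [Finset.sum_congr rfl fun l _ => h3 l]
    simp
  rw [e]
  exact Ideal.sum_mem _ fun j _ => Ideal.mul_mem_left _ _ (Ideal.mem_map_of_mem _ (hL j))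

/-- The automorphism `v ↦ v A` of the projective line. -/
def actP1 (A : (Matrix (Fin 2) (Fin 2) R)ˣ) : P1 R ⟶ P1 R :=
  Proj.map (substGraded A.val) (irrelevant_substGraded A)

/-- The underlying scheme of `Proj R[v₁, v₂] / (F)`. -/
def projForm (F : MvPolynomial (Fin 2) R) {d : ℕ} (hF : F.IsHomogeneous d) : Scheme.{u} :=
  Proj (quotGrading (polyGrading R) (formIdeal F hF))

/-- `Proj R[v₁, v₂] / (F)` as a scheme over `R`. -/
def projFormOver (F : MvPolynomial (Fin 2) R) {d : ℕ} (hF : F.IsHomogeneous d) :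
    Over (Spec (CommRingCat.of R)) :=
  Over.mk (Y := projForm F hF)
    (Proj.toSpecZero (quotGrading (polyGrading R) (formIdeal F hF)) ≫
      Spec.map (CommRingCat.ofHom
        (algebraMap R (quotGrading (polyGrading R) (formIdeal F hF) 0))))

/-- The quotient map `R[v₁, v₂] → R[v₁, v₂] / (F)` as a homomorphism of graded rings. -/
def quotGraded (F : MvPolynomial (Fin 2) R) {d : ℕ} (hF : F.IsHomogeneous d) :
    polyGrading R →+*ᵍ quotGrading (polyGrading R) (formIdeal F hF) where
  __ := Ideal.Quotient.mk (formIdeal F hF).toIdeal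
  map_mem := fun hx => Submodule.mem_map_of_mem hx

theorem irrelevant_quotGraded (F : MvPolynomial (Fin 2) R) {d : ℕ} (hF : F.IsHomogeneous d) :
    irrelevant (quotGrading (polyGrading R) (formIdeal F hF)) ≤
      (irrelevant (polyGrading R)).map (quotGraded F hF) := by
  rw [irrelevant_le]
  rintro d hd _ ⟨p, hp, rfl⟩
  exact Ideal.mem_map_of_mem (quotGraded F hF) (mem_irrelevant_of_mem _ hd hp)

/-- The closed immersion of `Proj R[v₁, v₂] / (F)` into the projective line. -/
def projIncl (F : MvPolynomial (Fin 2) R) {d : ℕ} (hF : F.IsHomogeneous d) :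
    projForm F hF ⟶ P1 R :=
  Proj.map (quotGraded F hF) (irrelevant_quotGraded F hF)

section BaseChange

variable {S : Type u} [CommRing S] (φ : R →+* S) (F : MvPolynomial (Fin 2) R) {d : ℕ}
  (hF : F.IsHomogeneous d)

/-- The homomorphism `R[v₁, v₂] / (F) → S[v₁, v₂] / (F)` of graded rings. -/
def baseGraded :
    quotGrading (polyGrading R) (formIdeal F hF) →+*ᵍ
      quotGrading (polyGrading S) (formIdeal (MvPolynomial.map φ F) (hF.map φ)) where
  __ := Ideal.quotientMap (formIdeal (MvPolynomial.map φ F) (hF.map φ)).toIdeal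
    (MvPolynomial.map φ) (Ideal.span_le.mpr (by
      rintro _ rfl
      exact Ideal.subset_span rfl))
  map_mem := by
    rintro i _ ⟨p, hp, rfl⟩
    exact ⟨MvPolynomial.map φ p, IsHomogeneous.map hp φ, rfl⟩

theorem irrelevant_baseGraded :
    irrelevant (quotGrading (polyGrading S) (formIdeal (MvPolynomial.map φ F) (hF.map φ))) ≤
      (irrelevant (quotGrading (polyGrading R) (formIdeal F hF))).map (baseGraded φ F hF) := by
  rw [irrelevant_le]
  rintro d hd _ ⟨p, hp, rfl⟩
  refine irrelevant_le_of_X_mem (((irrelevant (quotGrading (polyGrading R)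
    (formIdeal F hF))).map (baseGraded φ F hF)).toIdeal.comap (Ideal.Quotient.mk _))
    (fun i => ?_) hd hp
  rw [Ideal.mem_comap]
  have : Ideal.Quotient.mk (formIdeal (MvPolynomial.map φ F) (hF.map φ)).toIdeal (X i) =
      baseGraded φ F hF (Ideal.Quotient.mk (formIdeal F hF).toIdeal (X i)) := by
    change _ = Ideal.Quotient.mk _ (MvPolynomial.map φ (X i))
    rw [map_X]
  rw [this]
  exact Ideal.mem_map_of_mem (baseGraded φ F hF) (mem_irrelevant_of_mem _ one_pos
    ⟨X i, isHomogeneous_X R i, rfl⟩)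

/-- The projection `Proj S[v₁, v₂] / (F) → Proj R[v₁, v₂] / (F)`. -/
def projBase : projForm (MvPolynomial.map φ F) (hF.map φ) ⟶ projForm F hF :=
  Proj.map (baseGraded φ F hF) (irrelevant_baseGraded φ F hF)

end BaseChange

end Proj

section ZeroScheme

variable {Q n}

/-- `Z_x = Proj k[v₁, v₂] / (F_x)` as a scheme over `k`. -/
def Z (x : Amb Q n k) : Over (Spec (CommRingCat.of k)) :=
  projFormOver (formF x) (formF_isHomogeneous n x)

variable (K : Type u) [Field K] [Algebra k K]

/-- The base change `Z_x ×ₖ K = Proj K[v₁, v₂] / (F_x)` as a scheme over `K`. -/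
def ZBase (x : Amb Q n k) : Over (Spec (CommRingCat.of K)) :=
  projFormOver (MvPolynomial.map (algebraMap k K) (formF x)) ((formF_isHomogeneous n x).map _)

/-- The projection `Z_x ×ₖ K → Z_x`. -/
def ZProj (x : Amb Q n k) : (ZBase K x).left ⟶ (Z x).left :=
  projBase (algebraMap k K) (formF x) (formF_isHomogeneous n x)

/-- The closed immersion of `Z_x ×ₖ K` into the projective line over `K`. -/
def ZIncl (x : Amb Q n k) : (ZBase K x).left ⟶ P1 K :=
  projIncl (MvPolynomial.map (algebraMap k K) (formF x)) ((formF_isHomogeneous n x).map _)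

variable {K}

/-- `α` is the automorphism `v ↦ v g₂` of `Z_x ×ₖ K`. -/
def IsInduced (x : Amb Q n k) (g : Grp Q n K) (α : Aut (ZBase K x)) : Prop :=
  α.hom.left ≫ ZIncl K x = ZIncl K x ≫ actP1 g.sndUnit

/-- `α` is the base change to `K` of the `k`-automorphism `γ` of `Z_x`. -/
def IsBaseChange (x : Amb Q n k) (γ : Aut (Z x)) (α : Aut (ZBase K x)) : Prop :=
  α.hom.left ≫ ZProj K x = ZProj K x ≫ γ.hom.left

end ZeroScheme

/-- The set of isomorphism classes of schemes over `k`. -/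
def IsoClass (k : Type u) [Field k] : Type (u + 1) :=
  Quotient (isIsomorphicSetoid (Over (Spec (CommRingCat.of k))))

/-- The isomorphism class of a scheme over `k`. -/
def isoClass (X : Over (Spec (CommRingCat.of k))) : IsoClass k :=
  Quotient.mk (isIsomorphicSetoid (Over (Spec (CommRingCat.of k)))) X

/-! ### The identity component of the stabilizer -/

section IdentityComponent

variable (K : Type u) [Field K] [Algebra k K]

/-- The coordinates of an element of `G(K)`. -/
inductive IsCoord : (Grp Q n K → K) → Prop
  | re (i j) : IsCoord fun g => (g.fst i j).re
  | imI (i j) : IsCoord fun g => (g.fst i j).imI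
  | imJ (i j) : IsCoord fun g => (g.fst i j).imJ
  | imK (i j) : IsCoord fun g => (g.fst i j).imK
  | snd (i j) : IsCoord fun g => g.snd i j

/-- Polynomial functions in the coordinates on `G(K)`. -/
def polyFun : Subalgebra K (Grp Q n K → K) := Algebra.adjoin K {f | IsCoord Q n K f}

/-- The Zariski topology on `G(K)`: the sets `{f ≠ 0}`, for `f` a polynomial in the coordinates,
form a basis. -/
@[reducible] def zariski : TopologicalSpace (Grp Q n K) :=
  TopologicalSpace.generateFrom {U | ∃ f ∈ polyFun Q n K, U = {g | f g ≠ 0}}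

variable {Q n K}

/-- A quaternion-valued function all of whose coordinates are polynomial. -/
def QPoly (q : Grp Q n K → Q.alg K) : Prop :=
  (fun g => (q g).re) ∈ polyFun Q n K ∧ (fun g => (q g).imI) ∈ polyFun Q n K ∧
    (fun g => (q g).imJ) ∈ polyFun Q n K ∧ (fun g => (q g).imK) ∈ polyFun Q n K

theorem QPoly.const_mul (c : Q.alg K) {q : Grp Q n K → Q.alg K} (hq : QPoly q) :
    QPoly fun g => c * q g := by
  obtain ⟨h1, h2, h3, h4⟩ := hq
  have m : ∀ (r : K) {f : Grp Q n K → K}, f ∈ polyFun Q n K →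
      (fun g => r * f g) ∈ polyFun Q n K := fun r f h => (polyFun Q n K).smul_mem h r
  have ad : ∀ {f f' : Grp Q n K → K}, f ∈ polyFun Q n K → f' ∈ polyFun Q n K →
      (fun g => f g + f' g) ∈ polyFun Q n K := fun h h' => (polyFun Q n K).add_mem h h'
  have sb : ∀ {f f' : Grp Q n K → K}, f ∈ polyFun Q n K → f' ∈ polyFun Q n K →
      (fun g => f g - f' g) ∈ polyFun Q n K := fun h h' => (polyFun Q n K).sub_mem h h'
  refine ⟨?_, ?_, ?_, ?_⟩
  · simp only [QuaternionAlgebra.re_mul]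
    exact sb (ad (ad (ad (m _ h1) (m _ h2)) (m _ h3)) (m _ h4)) (m _ h4)
  · simp only [QuaternionAlgebra.imI_mul]
    exact ad (sb (ad (ad (m _ h2) (m _ h1)) (m _ h2)) (m _ h4)) (m _ h3)
  · simp only [QuaternionAlgebra.imJ_mul]
    exact sb (ad (ad (ad (m _ h3) (m _ h4)) (m _ h1)) (m _ h2)) (m _ h2)
  · simp only [QuaternionAlgebra.imK_mul]
    exact ad (sb (ad (ad (m _ h4) (m _ h3)) (m _ h4)) (m _ h2)) (m _ h1)

theorem QPoly.sum {ι : Type} (s : Finset ι) {q : ι → Grp Q n K → Q.alg K}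
    (h : ∀ i ∈ s, QPoly (q i)) : QPoly (∑ i ∈ s, q i) :=
  Finset.sum_induction q QPoly
    (fun _ _ h h' => ⟨(polyFun Q n K).add_mem h.1 h'.1, (polyFun Q n K).add_mem h.2.1 h'.2.1,
      (polyFun Q n K).add_mem h.2.2.1 h'.2.2.1, (polyFun Q n K).add_mem h.2.2.2 h'.2.2.2⟩)
    ⟨(polyFun Q n K).zero_mem, (polyFun Q n K).zero_mem, (polyFun Q n K).zero_mem,
      (polyFun Q n K).zero_mem⟩ h

theorem polyFun_comp_mul (a : Grp Q n K) {f : Grp Q n K → K} (hf : f ∈ polyFun Q n K) :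
    (fun g => f (a * g)) ∈ polyFun Q n K := by
  have hc : ∀ {f}, IsCoord Q n K f → f ∈ polyFun Q n K := fun h => Algebra.subset_adjoin h
  have hq : ∀ i j, QPoly fun g : Grp Q n K => (a * g).fst i j := fun i j => by
    have := QPoly.sum Finset.univ (q := fun l (g : Grp Q n K) => a.fst i l * g.fst l j)
      fun l _ => QPoly.const_mul _ ⟨hc (.re l j), hc (.imI l j), hc (.imJ l j), hc (.imK l j)⟩
    convert this using 1
    funext g
    rw [Grp.fst_mul, Matrix.mul_apply, Finset.sum_apply]
  induction hf using Algebra.adjoin_induction with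
  | algebraMap r => exact (polyFun Q n K).algebraMap_mem r
  | add f f' _ _ h h' => exact (polyFun Q n K).add_mem h h'
  | mul f f' _ _ h h' => exact (polyFun Q n K).mul_mem h h'
  | mem f hf =>
    cases hf with
    | re i j => exact (hq i j).1
    | imI i j => exact (hq i j).2.1
    | imJ i j => exact (hq i j).2.2.1
    | imK i j => exact (hq i j).2.2.2
    | snd i j =>
      simp only [Grp.snd_mul, Matrix.mul_apply, Fin.sum_univ_two]
      exact (polyFun Q n K).add_mem ((polyFun Q n K).smul_mem (hc (.snd 0 j)) (a.snd i 0))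
        ((polyFun Q n K).smul_mem (hc (.snd 1 j)) (a.snd i 1))

/-- The connected component of the identity, in the Zariski topology, of a subgroup of `G(K)`. -/
def idCompSet (S : Subgroup (Grp Q n K)) : Set (Grp Q n K) :=
  @connectedComponentIn _ (zariski Q n K) (S : Set (Grp Q n K)) 1

theorem idCompSet_subset (S : Subgroup (Grp Q n K)) {g : Grp Q n K} (hg : g ∈ idCompSet S) :
    g ∈ S :=
  @connectedComponentIn_subset _ (zariski Q n K) _ _ g hg

theorem one_mem_idCompSet (S : Subgroup (Grp Q n K)) : 1 ∈ idCompSet S :=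
  @mem_connectedComponentIn _ (zariski Q n K) _ _ S.one_mem

theorem inv_mul_mem_idCompSet (S : Subgroup (Grp Q n K)) {g h : Grp Q n K}
    (hg : g ∈ idCompSet S) (hh : h ∈ idCompSet S) : g⁻¹ * h ∈ idCompSet S := by
  let _ := zariski Q n K
  have hc : Continuous fun x : Grp Q n K => g⁻¹ * x := by
    refine continuous_generateFrom_iff.mpr ?_
    rintro _ ⟨f, hf, rfl⟩
    exact TopologicalSpace.isOpen_generateFrom_of_mem ⟨_, polyFun_comp_mul g⁻¹ hf, rfl⟩
  refine (isPreconnected_connectedComponentIn.image (s := idCompSet S) _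
    hc.continuousOn).subset_connectedComponentIn (F := (S : Set (Grp Q n K)))
      ⟨g, hg, inv_mul_cancel g⟩ ?_ ⟨h, hh, rfl⟩
  rintro _ ⟨x, hx, rfl⟩
  exact S.mul_mem (S.inv_mem (idCompSet_subset S hg)) (idCompSet_subset S hx)

/-- The identity component, as a subgroup. -/
def idComp (S : Subgroup (Grp Q n K)) : Subgroup (Grp Q n K) where
  carrier := idCompSet S
  one_mem' := one_mem_idCompSet S
  inv_mem' {g} hg := by
    have := inv_mul_mem_idCompSet S hg (one_mem_idCompSet S)
    rwa [mul_one] at this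
  mul_mem' {g h} hg hh := by
    have h1 := inv_mul_mem_idCompSet S hg (one_mem_idCompSet S)
    rw [mul_one] at h1
    have h2 := inv_mul_mem_idCompSet S h1 hh
    rwa [inv_inv] at h2

variable (K)

/-- `x`, viewed in `V(K)`. -/
def ext (x : Amb Q n k) : Amb Q n K := Amb.map (Algebra.ofId k K) x

/-- The `K`-points `G_x(K)` of the stabilizer of `x`. -/
def stab (x : Amb Q n k) : Subgroup (Grp Q n K) := MulAction.stabilizer (Grp Q n K) (ext K x)

/-- The `K`-points `G_x°(K)` of the identity component of the stabilizer of `x`: the elements of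
`G_x(K)` which, over an algebraic closure of `K`, lie in the identity component. -/
def stabConn (x : Amb Q n k) : Subgroup (Grp Q n K) :=
  stab K x ⊓ (idComp (stab (AlgebraicClosure K) x)).comap
    (Grp.map (IsScalarTower.toAlgHom k K (AlgebraicClosure K)))

end IdentityComponent

/-! ### Galois cohomology -/

section Cohomology

variable (Γ : Type u) [Group Γ] [TopologicalSpace Γ] {A : Type u} [Group A]
  [MulDistribMulAction Γ A] (H : Subgroup A)

/-- Continuous 1-cocycles of `Γ` with values in `H`, for the discrete topology on `H`, where `Γ`
acts on `A` from the left and `H` is a `Γ`-stable subgroup of `A`. -/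
structure Cocycle where
  toFun : Γ → A
  mem' : ∀ σ, toFun σ ∈ H
  cont' : IsLocallyConstant toFun
  map_mul' : ∀ σ τ, toFun (σ * τ) = toFun σ * σ • toFun τ

/-- Two cocycles `h`, `h'` are equivalent if `h'_σ = g⁻¹ h_σ g^σ` for some `g ∈ H`. -/
instance cocycleSetoid : Setoid (Cocycle Γ H) where
  r h h' := ∃ g ∈ H, ∀ σ : Γ, h'.toFun σ = g⁻¹ * h.toFun σ * σ • g
  iseqv := by
    refine ⟨fun h => ⟨1, H.one_mem, fun σ => by simp⟩, ?_, ?_⟩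
    · rintro h h' ⟨g, hg, e⟩
      exact ⟨g⁻¹, H.inv_mem hg, fun σ => by rw [e, smul_inv']; group⟩
    · rintro h h' h'' ⟨g, hg, e⟩ ⟨g', hg', e'⟩
      exact ⟨g * g', H.mul_mem hg hg', fun σ => by rw [e', e, smul_mul']; group⟩

/-- The first cohomology set. -/
def H1 : Type u := Quotient (cocycleSetoid Γ H)

variable {Γ H}

/-- The cohomology class of a cocycle. -/
def Cocycle.cls (h : Cocycle Γ H) : H1 Γ H := Quotient.mk (cocycleSetoid Γ H) h

end Cohomology

variable {Q n} in
/-- The first Galois cohomology set `H¹(k, G_x°)`, computed with the separable closure `K` of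
`k`. -/
abbrev H1Stab (K : Type u) [Field K] [Algebra k K] (x : Amb Q n k) : Type u :=
  H1 (K ≃ₐ[k] K) (stabConn K x)

end HermitianPairs

end

/-! The argument is Galois descent along the orbit of `x` over the separable closure `K`. What has
to be supplied is the structure of the stabilizer and of the automorphisms of `Z_x`; both are read
off from the `n` zeros `u i` of `F_x` on the projective line over `K`.

Zero schemes. A non-zero discriminant makes `F_x` a product of pairwise independent linear forms
over `K` (`exists_splitsAt`), so `Z_x` is reduced and a morphism from it to a separated scheme is
determined by its effect on the points `u i` (`SplitsAt.hom_ext`). Because there are at most three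
zeros, a bijection between two such sets that commutes with the Galois group is induced by a
rational projectivity (`exists_rational_projectivity`). Hence isomorphisms of zero schemes are
projectivities, over `k` and over `K` alike (`SplitsAt.exists_eq_substMap`).

Hermitian pairs. Over a separably closed field a semi-stable pencil is congruent to the diagonal
pencil with entries `planeDet (u i) v` (`exists_congr_normalForm`). So two pairs with the same zeros
differ by an element of `GL_n` alone (`exists_smul_of_common_zeros`), and every projectivity
permuting the zeros lifts to the stabilizer (`exists_mem_stab`). This is the surjectivity of `c_x`.

Identity component. In the diagonal form, a stabilizer element fixing every zero consists of `n`
quaternions and a `2 × 2` matrix whose effect on the determinants is compensated by the reduced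
norms. Such elements are joined to the identity by curves built from transvections of `SL₂` and from
tori; conversely, a connected set containing the identity cannot move the zeros. So `G_x°` is the
kernel of the action on zeros (`mem_stabConn_iff`), which is the rest of the exact sequence.

Descent. By Hilbert's Theorem 90 for `G` (`Grp.exists_eq_inv_mul_of_cocycle`) each cocycle in `G_x°`
has the form `g⁻¹ σ(g)`, and `g • x` is then rational. The action of `g` on the zeros commutes with
the Galois group, so the zero schemes of `g • x` and `x` are isomorphic (`exists_point_of_cocycle`).
Conversely, if `Z_y ≅ Z_x`, a rational change of variables gives `y` the zeros of `x`; then `y = a •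
x` with `a` in `GL_n`, and `a⁻¹ σ(a)` has trivial second component, hence lies in `G_x°`
(`exists_cocycle_of_iso`). Two cocycles `c`, `c'` give the same orbit exactly when `c' = t⁻¹ c σ(t)`
with `t` in `G_x(K)` (`orbit_eq_of_cocycle`, `exists_isLift_of_orbit_eq`). As both lie in `G_x°`, so
does `t⁻¹ σ(t)`, and the automorphism given by `t` is defined over `k`: this is the orbit relation
of `Aut(Z_x)(k)` on cohomology. -/

noncomputable section

namespace HermitianPairs

open CategoryTheory AlgebraicGeometry MvPolynomial HomogeneousIdeal
open scoped Quaternion Matrix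

attribute [local instance] MvPolynomial.gradedAlgebra

/-! ### Points of `Proj` with values in a field -/

section ProjPoints

variable {A B σ τ : Type u} [CommRing A] [SetLike σ A] [AddSubgroupClass σ A]
  [CommRing B] [SetLike τ B] [AddSubgroupClass τ B]
  {𝒜 : ℕ → σ} {ℬ : ℕ → τ} [GradedRing 𝒜] [GradedRing ℬ]
  {K : Type u} [Field K]

open HomogeneousLocalization

/-- The value of a homogeneous fraction at a homomorphism to a field. -/
def awayEval (ev : A →+* K) (s : A) (hs : ev s ≠ 0) : Away 𝒜 s →+* K :=
  (IsLocalization.Away.lift (S := Localization.Away s) s (g := ev) (isUnit_iff_ne_zero.mpr hs)).comp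
    (algebraMap (Away 𝒜 s) (Localization.Away s))

theorem awayEval_mk (ev : A →+* K) {s : A} (hs : ev s ≠ 0) {d : ℕ} (hd : s ∈ 𝒜 d) (m : ℕ) (a : A)
    (ha : a ∈ 𝒜 (m • d)) : awayEval ev s hs (Away.mk 𝒜 hd m a ha) = ev a / ev s ^ m := by
  rw [awayEval, RingHom.comp_apply, HomogeneousLocalization.algebraMap_apply, Away.val_mk]
  rw [Localization.mk_eq_mk', eq_div_iff (pow_ne_zero _ hs), IsLocalization.Away.lift, mul_comm,
    ← map_pow]
  exact ((IsLocalization.lift_mk'_spec (M := Submonoid.powers s) (S := Localization.Away s) _ a _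
    (⟨s ^ m, m, rfl⟩ : Submonoid.powers s)).mp rfl).symm

/-- The `K`-point of `Proj` with homogeneous coordinates given by `ev`. -/
def projPt (ev : A →+* K) {s : A} (hs : ev s ≠ 0) {d : ℕ} (hd : s ∈ 𝒜 d) (d0 : 0 < d) :
    Spec (CommRingCat.of K) ⟶ Proj 𝒜 :=
  Spec.map (CommRingCat.ofHom (awayEval ev s hs)) ≫ Proj.awayι 𝒜 s hd d0

theorem awayEval_comp_awayMap (ev : A →+* K) {s t : A} (hst : ev (s * t) ≠ 0) {d e : ℕ}
    (hd : s ∈ 𝒜 d)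
    (he : t ∈ 𝒜 e) :
    (awayEval ev (s * t) hst).comp (awayMap 𝒜 he rfl) =
      awayEval ev s (left_ne_zero_of_mul (by rwa [← map_mul])) := by
  ext x
  obtain ⟨m, a, ha, rfl⟩ := Away.mk_surjective _ hd x
  have hs : ev s ≠ 0 := left_ne_zero_of_mul (b := ev t) (by rwa [← map_mul])
  have ht : ev t ≠ 0 := right_ne_zero_of_mul (a := ev s) (by rwa [← map_mul])
  rw [RingHom.comp_apply, awayMap_mk, awayEval_mk, awayEval_mk, map_mul, map_mul, map_pow]
  field_simp
  ring

theorem projPt_mul (ev : A →+* K) {s t : A} (hst : ev (s * t) ≠ 0) (hs : ev s ≠ 0) {d e : ℕ}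
    (hd : s ∈ 𝒜 d)
    (he : t ∈ 𝒜 e) (d0 : 0 < d) :
    projPt ev hst (SetLike.mul_mem_graded hd he) (d0.trans_le (d.le_add_right e)) =
      projPt ev hs hd d0 := by
  rw [projPt, projPt, ← awayEval_comp_awayMap ev hst hd he, CommRingCat.ofHom_comp, Spec.map_comp,
    Category.assoc, Proj.SpecMap_awayMap_awayι]

/-- The charts of `s` and of `t` are compared on the chart of `s * t`, so the point depends on `ev`
only. -/
theorem projPt_eq (ev : A →+* K) {s t : A} (hs : ev s ≠ 0) (ht : ev t ≠ 0) {d e : ℕ}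
    (hd : s ∈ 𝒜 d) (he : t ∈ 𝒜 e) (d0 : 0 < d) (e0 : 0 < e) :
    projPt ev hs hd d0 = projPt ev ht he e0 := by
  have hst : ev (s * t) ≠ 0 := by rw [map_mul]; exact mul_ne_zero hs ht
  have hts : ev (t * s) ≠ 0 := by rwa [mul_comm]
  rw [← projPt_mul ev hst hs hd he d0, ← projPt_mul ev hts ht he hd e0]
  congr 1 <;> simp [mul_comm, add_comm]

theorem projPt_map (f : 𝒜 →+*ᵍ ℬ) (hf : irrelevant ℬ ≤ (irrelevant 𝒜).map f) (ev : B →+* K)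
    {s : A} (hs : ev (f s) ≠ 0) (hs' : (ev.comp (f : A →+* B)) s ≠ 0) {d : ℕ} (hd : s ∈ 𝒜 d)
    (d0 : 0 < d) :
    projPt ev hs (f.2 hd) d0 ≫ Proj.map f hf = projPt (ev.comp (f : A →+* B)) hs' hd d0 := by
  rw [projPt, Category.assoc, Proj.awayι_comp_map _ _ d0 _ hd, ← Category.assoc, ← Spec.map_comp,
    ← CommRingCat.ofHom_comp]
  rw [projPt]
  congr 3
  ext x
  obtain ⟨m, a, ha, rfl⟩ := Away.mk_surjective _ hd x
  rw [RingHom.comp_apply, Away.map_mk, awayEval_mk]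
  exact (awayEval_mk _ hs' hd m a ha).symm

/-- Homogeneous fractions have degree zero, so the powers of `c` in numerator and denominator
cancel. -/
theorem projPt_smul (ev ev' : A →+* K) (c : K) (hc : c ≠ 0)
    (h : ∀ d, ∀ a ∈ 𝒜 d, ev' a = c ^ d * ev a) {s : A} (hs : ev s ≠ 0) (hs' : ev' s ≠ 0) {d : ℕ}
    (hd : s ∈ 𝒜 d) (d0 : 0 < d) : projPt ev' hs' hd d0 = projPt ev hs hd d0 := by
  rw [projPt, projPt]
  congr 3
  ext x
  obtain ⟨m, a, ha, rfl⟩ := Away.mk_surjective _ hd x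
  rw [awayEval_mk, awayEval_mk, h _ _ ha, h _ _ hd]
  rw [smul_eq_mul]
  field_simp
  ring

theorem specMap_projPt {K' : Type u} [Field K'] (φ : K →+* K') (ev : A →+* K) {s : A}
    (hs : ev s ≠ 0)
    (hs' : (φ.comp ev) s ≠ 0) {d : ℕ}
    (hd : s ∈ 𝒜 d) (d0 : 0 < d) :
    Spec.map (CommRingCat.ofHom φ) ≫ projPt ev hs hd d0 = projPt (φ.comp ev) hs' hd d0 := by
  rw [projPt, projPt, ← Category.assoc, ← Spec.map_comp, ← CommRingCat.ofHom_comp]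
  congr 3
  ext x
  obtain ⟨m, a, ha, rfl⟩ := Away.mk_surjective _ hd x
  rw [RingHom.comp_apply, awayEval_mk, awayEval_mk]
  simp

theorem projPt_apply_mem_basicOpen (ev : A →+* K) {s t : A} (hs : ev s ≠ 0) {d e : ℕ}
    (hd : s ∈ 𝒜 d) (d0 : 0 < d) (he : t ∈ 𝒜 e) (e0 : 0 < e) (x : Spec (CommRingCat.of K)) :
    projPt ev hs hd d0 x ∈ Proj.basicOpen 𝒜 t ↔ ev t ≠ 0 := by
  constructor
  · intro h
    rw [projPt, Scheme.Hom.comp_apply] at h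
    have h' : Spec.map (CommRingCat.ofHom (awayEval ev s hs)) x ∈
      Proj.awayι 𝒜 s hd d0 ⁻¹ᵁ Proj.basicOpen 𝒜 t := h
    rw [Proj.awayι_preimage_basicOpen 𝒜 hd d0 he e0] at h'
    have h2 : awayEval ev s hs (Away.isLocalizationElem hd he) ∉ x.asIdeal := h'
    intro h0
    apply h2
    rw [Away.isLocalizationElem, awayEval_mk, map_pow, h0, zero_pow d0.ne', zero_div]
    exact zero_mem _
  · intro ht
    rw [projPt_eq ev hs ht hd he d0 e0, projPt, Scheme.Hom.comp_apply,
      ← Proj.opensRange_awayι 𝒜 t he e0]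
    exact ⟨_, rfl⟩

/-- Partial converse of `projPt_smul`: both points lie in the chart of `s`, where the fraction `t /
s` takes the same value at `ev` and at `ev'`. -/
theorem eval_mul_eval_of_projPt_eq (ev ev' : A →+* K) {s t : A} (hs : ev s ≠ 0) {d : ℕ}
    (hd : s ∈ 𝒜 d) (d0 : 0 < d) {r : A} (hr : ev' r ≠ 0) {e : ℕ} (he : r ∈ 𝒜 e) (e0 : 0 < e)
    (h : projPt ev hs hd d0 = projPt ev' hr he e0) (ht : t ∈ 𝒜 d) :
    ev t * ev' s = ev' t * ev s := by
  have x : Spec (CommRingCat.of K) := (default : PrimeSpectrum K)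
  have hs' : ev' s ≠ 0 := by
    rw [← projPt_apply_mem_basicOpen ev' hr he e0 hd d0 x, ← h,
      projPt_apply_mem_basicOpen ev hs hd d0 hd d0 x]
    exact hs
  rw [projPt_eq ev' hr hs' he hd e0 d0, projPt, projPt, cancel_mono] at h
  have h1 := CommRingCat.hom_ext_iff.mp (Spec.map_injective h)
  have h2 := RingHom.congr_fun h1 (Away.mk 𝒜 hd 1 t (by simpa using ht))
  simp only [CommRingCat.hom_ofHom, awayEval_mk, pow_one] at h2
  field_simp at h2
  linear_combination h2

end ProjPoints

end HermitianPairs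

end



noncomputable section

namespace HermitianPairs

open CategoryTheory AlgebraicGeometry MvPolynomial HomogeneousIdeal
open scoped Quaternion Matrix

attribute [local instance] MvPolynomial.gradedAlgebra

/-! ### Geometric points of the zero scheme of a binary form -/

section FormPoints

open HomogeneousLocalization

variable {L K : Type u} [Field L] [Field K] [Algebra L K]
  {F F' : MvPolynomial (Fin 2) L} {d d' : ℕ} (hF : F.IsHomogeneous d) (hF' : F'.IsHomogeneous d')

theorem coord_ne_zero {u : Fin 2 → K} (hu : u ≠ 0) : ∃ i, u i ≠ 0 := Function.ne_iff.mp hu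

/-- Evaluation of `L[v₁, v₂] / (F)` at a zero of `F`. -/
def evalZero (u : Fin 2 → K) (h : aeval u F = 0) :
    MvPolynomial (Fin 2) L ⧸ (formIdeal F hF).toIdeal →+* K :=
  Ideal.Quotient.lift _ (aeval u : MvPolynomial (Fin 2) L →ₐ[L] K).toRingHom (by
    have : (formIdeal F hF).toIdeal ≤ RingHom.ker (aeval u : MvPolynomial (Fin 2) L →ₐ[L] K) :=
      Ideal.span_le.mpr (by rintro _ rfl; exact h)
    exact fun a ha => this ha)

theorem evalZero_mk (u : Fin 2 → K) (h : aeval u F = 0) (p : MvPolynomial (Fin 2) L) :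
    evalZero hF u h (Ideal.Quotient.mk (formIdeal F hF).toIdeal p) = aeval u p := rfl

/-- The coordinate functions on the zero scheme of a form. -/
abbrev coordZero (i : Fin 2) : MvPolynomial (Fin 2) L ⧸ (formIdeal F hF).toIdeal :=
  Ideal.Quotient.mk (formIdeal F hF).toIdeal (X i)

theorem coordZero_mem (i : Fin 2) : coordZero hF i ∈ quotGrading (polyGrading L)
    (formIdeal F hF) 1 :=
  ⟨X i, isHomogeneous_X L i, rfl⟩

theorem evalZero_coordZero (u : Fin 2 → K) (h : aeval u F = 0) (i : Fin 2) :
    evalZero hF u h (coordZero hF i) = u i := by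
  rw [evalZero_mk, aeval_X]

/-- The `K`-point of the zero scheme of `F` given by a zero `u` of `F`. -/
def zeroPt (u : Fin 2 → K) (hu : u ≠ 0) (h : aeval u F = 0) :
    Spec (CommRingCat.of K) ⟶ projForm F hF :=
  projPt (𝒜 := quotGrading (polyGrading L) (formIdeal F hF)) (evalZero hF u h)
    (s := coordZero hF (coord_ne_zero hu).choose)
    (by rw [evalZero_coordZero]; exact (coord_ne_zero hu).choose_spec) (coordZero_mem hF _) one_pos

/-- `zeroPt` is defined through a chosen non-zero coordinate; this frees later computations from
that choice. -/
theorem zeroPt_eq (u : Fin 2 → K) (hu : u ≠ 0) (h : aeval u F = 0)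
    {s : MvPolynomial (Fin 2) L ⧸ (formIdeal F hF).toIdeal} (hs : evalZero hF u h s ≠ 0) {e : ℕ}
    (he : s ∈ quotGrading (polyGrading L) (formIdeal F hF) e) (e0 : 0 < e) :
    zeroPt hF u hu h = projPt (evalZero hF u h) hs he e0 :=
  projPt_eq _ _ _ _ _ _ _

/-- The `K`-point of the projective line with homogeneous coordinates `u`. -/
def linePt (L : Type u) [Field L] [Algebra L K] (u : Fin 2 → K) (hu : u ≠ 0) :
    Spec (CommRingCat.of K) ⟶ P1 L :=
  projPt (𝒜 := polyGrading L) (aeval u : MvPolynomial (Fin 2) L →ₐ[L] K).toRingHom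
    (s := X (coord_ne_zero hu).choose)
    (by simpa using (coord_ne_zero hu).choose_spec) (isHomogeneous_X L _) one_pos

theorem linePt_eq (u : Fin 2 → K) (hu : u ≠ 0) {s : MvPolynomial (Fin 2) L}
    (hs : (aeval u : MvPolynomial (Fin 2) L →ₐ[L] K).toRingHom s ≠ 0) {e : ℕ}
      (he : s ∈ polyGrading L e)
    (e0 : 0 < e) : linePt L u hu = projPt _ hs he e0 :=
  projPt_eq _ _ _ _ _ _ _

theorem zeroPt_projIncl (u : Fin 2 → K) (hu : u ≠ 0) (h : aeval u F = 0) :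
    zeroPt hF u hu h ≫ projIncl F hF = linePt L u hu := by
  have hi := (coord_ne_zero hu).choose_spec
  exact projPt_map (quotGraded F hF) (irrelevant_quotGraded F hF) (evalZero hF u h)
    (s := X (coord_ne_zero hu).choose) (by
      change evalZero hF u h (coordZero hF _) ≠ 0
      rwa [evalZero_coordZero]) _ (isHomogeneous_X L _) one_pos

theorem aeval_substHom (A : Matrix (Fin 2) (Fin 2) L) (u : Fin 2 → K) (p : MvPolynomial (Fin 2) L) :
    aeval u (substHom A p) = aeval (u ᵥ* A.map (algebraMap L K)) p := by
  rw [substHom, ← AlgHom.comp_apply]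
  congr 1
  ext j
  simp [Matrix.vecMul, dotProduct, Algebra.smul_def, mul_comm]

theorem linePt_actP1 (A : (Matrix (Fin 2) (Fin 2) L)ˣ) (u : Fin 2 → K) (hu : u ≠ 0)
    (hu' : u ᵥ* A.val.map (algebraMap L K) ≠ 0) :
    linePt L u hu ≫ actP1 A = linePt L (u ᵥ* A.val.map (algebraMap L K)) hu' := by
  have hi := (coord_ne_zero hu').choose_spec
  have e : (aeval u : MvPolynomial (Fin 2) L →ₐ[L] K).toRingHom.comp
      (substGraded A.val : MvPolynomial (Fin 2) L →+* MvPolynomial (Fin 2) L) =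
      (aeval (u ᵥ* A.val.map (algebraMap L K)) : MvPolynomial (Fin 2) L →ₐ[L] K).toRingHom :=
    RingHom.ext fun p => aeval_substHom A.val u p
  have h1 : (aeval u : MvPolynomial (Fin 2) L →ₐ[L] K).toRingHom
      (substGraded A.val (X (coord_ne_zero hu').choose)) ≠ 0 := by
    have := RingHom.congr_fun e (X (coord_ne_zero hu').choose)
    rw [RingHom.comp_apply] at this
    refine this.trans_ne ?_
    simpa using hi
  rw [linePt_eq u hu h1 ((substGraded A.val).2 (isHomogeneous_X L _)) one_pos]
  refine (projPt_map (substGraded A.val) (irrelevant_substGraded A) _ _ 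
    (by rw [e]; simpa using hi) (isHomogeneous_X L _) one_pos).trans ?_
  simp only [e]
  rfl

theorem zeroPt_projBase (u : Fin 2 → K) (hu : u ≠ 0) (h : aeval u F = 0)
    (h' : aeval u (MvPolynomial.map (algebraMap L K) F) = 0) :
    zeroPt (hF.map (algebraMap L K)) u hu h' ≫ projBase (algebraMap L K) F hF = zeroPt hF u hu h :=
      by
  have hi := (coord_ne_zero hu).choose_spec
  have e : (evalZero (hF.map (algebraMap L K)) u h').comp
    (baseGraded (algebraMap L K) F hF : _ →+* _) =
      evalZero hF u h := by
    refine Ideal.Quotient.ringHom_ext (RingHom.ext fun p => ?_)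
    change aeval u (MvPolynomial.map (algebraMap L K) p) = aeval u p
    exact aeval_map_algebraMap _ _ _
  have h1 : evalZero (hF.map (algebraMap L K)) u h'
      (baseGraded (algebraMap L K) F hF (coordZero hF (coord_ne_zero hu).choose)) ≠ 0 := by
    have := RingHom.congr_fun e (coordZero hF (coord_ne_zero hu).choose)
    rw [RingHom.comp_apply] at this
    refine this.trans_ne ?_
    rwa [evalZero_coordZero]
  rw [zeroPt_eq (hF.map (algebraMap L K)) u hu h' h1
    ((baseGraded (algebraMap L K) F hF).2 (coordZero_mem hF _)) one_pos]
  refine (projPt_map (baseGraded (algebraMap L K) F hF) (irrelevant_baseGraded _ _ _) _ _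
    (by rw [e, evalZero_coordZero]; exact hi) (coordZero_mem hF _) one_pos).trans ?_
  simp only [e]
  rfl

/-- The homomorphism `L[v] / (F) → L[v] / (F')`, `f(v) ↦ f(v A)`. -/
def substQuot (A : Matrix (Fin 2) (Fin 2) L) (h : substHom A F ∈ Ideal.span {F'}) :
    quotGrading (polyGrading L) (formIdeal F hF) →+*ᵍ
      quotGrading (polyGrading L) (formIdeal F' hF') where
  __ := Ideal.quotientMap (formIdeal F' hF').toIdeal
    (substHom A : MvPolynomial (Fin 2) L →+* MvPolynomial (Fin 2) L) (Ideal.span_le.mpr (by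
      rintro _ rfl
      exact h))
  map_mem := by
    rintro i _ ⟨p, hp, rfl⟩
    exact ⟨substHom A p, (substGraded A).2 hp, rfl⟩

theorem irrelevant_substQuot (A : (Matrix (Fin 2) (Fin 2) L)ˣ)
    (h : substHom A.val F ∈ Ideal.span {F'}) :
    irrelevant (quotGrading (polyGrading L) (formIdeal F' hF')) ≤
      (irrelevant (quotGrading (polyGrading L) (formIdeal F hF))).map
        (substQuot hF hF' A.val h) := by
  rw [irrelevant_le]
  rintro e he _ ⟨p, hp, rfl⟩
  have h1 := (irrelevant_le _).mp (irrelevant_substGraded A) e he hp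
  have h2 : ((irrelevant (polyGrading L)).map (substGraded A.val)).toIdeal ≤
      (((irrelevant (quotGrading (polyGrading L) (formIdeal F hF))).map
        (substQuot hF hF' A.val h)).toIdeal).comap (Ideal.Quotient.mk (formIdeal F' hF').toIdeal) :=
        by
    refine Ideal.map_le_iff_le_comap.mpr fun q hq => ?_
    have h3 : Ideal.Quotient.mk (formIdeal F hF).toIdeal q ∈
        irrelevant (quotGrading (polyGrading L) (formIdeal F hF)) := by
      have : irrelevant (polyGrading L) ≤
          (irrelevant (quotGrading (polyGrading L) (formIdeal F hF))).comap (quotGraded F hF) := by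
        rw [irrelevant_le]
        intro i hi r hr
        exact mem_irrelevant_of_mem _ hi ⟨r, hr, rfl⟩
      exact this hq
    exact Ideal.mem_map_of_mem (substQuot hF hF' A.val h) h3
  exact h2 h1

/-- The morphism `v ↦ v A` from the zero scheme of `F'` to the zero scheme of `F`. -/
def substMap (A : (Matrix (Fin 2) (Fin 2) L)ˣ) (h : substHom A.val F ∈ Ideal.span {F'}) :
    projForm F' hF' ⟶ projForm F hF :=
  Proj.map (substQuot hF hF' A.val h) (irrelevant_substQuot hF hF' A h)

theorem zeroPt_substMap (A : (Matrix (Fin 2) (Fin 2) L)ˣ) (hA : substHom A.val F ∈ Ideal.span {F'})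
    (u : Fin 2 → K) (hu : u ≠ 0) (h : aeval u F' = 0)
    (hu' : u ᵥ* A.val.map (algebraMap L K) ≠ 0)
    (h' : aeval (u ᵥ* A.val.map (algebraMap L K)) F = 0) :
    zeroPt hF' u hu h ≫ substMap hF hF' A hA = zeroPt hF _ hu' h' := by
  have hi := (coord_ne_zero hu').choose_spec
  have e : (evalZero hF' u h).comp (substQuot hF hF' A.val hA : _ →+* _) = evalZero hF _ h' :=
    Ideal.Quotient.ringHom_ext (RingHom.ext fun p => aeval_substHom A.val u p)
  have h1 : evalZero hF' u h
      (substQuot hF hF' A.val hA (coordZero hF (coord_ne_zero hu').choose)) ≠ 0 := by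
    have := RingHom.congr_fun e (coordZero hF (coord_ne_zero hu').choose)
    rw [RingHom.comp_apply] at this
    refine this.trans_ne ?_
    rwa [evalZero_coordZero]
  rw [zeroPt_eq hF' u hu h h1 ((substQuot hF hF' A.val hA).2 (coordZero_mem hF _)) one_pos]
  refine (projPt_map (substQuot hF hF' A.val hA) (irrelevant_substQuot _ _ _ _) _ _
    (by rw [e, evalZero_coordZero]; exact hi) (coordZero_mem hF _) one_pos).trans ?_
  simp only [e]
  rfl

theorem eval₂_mul_of_isHomogeneous {R S : Type u} [CommRing R] [CommRing S] (f : R →+* S)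
    {p : MvPolynomial (Fin 2) R} {e : ℕ} (hp : p.IsHomogeneous e) (c : S) (w : Fin 2 → S) :
    eval₂ f (fun i => c * w i) p = c ^ e * eval₂ f w p := by
  rw [eval₂_eq', eval₂_eq', Finset.mul_sum]
  refine Finset.sum_congr rfl fun m hm => ?_
  have : c ^ e = ∏ i, c ^ m i := by
    have h := hp (mem_support_iff.mp hm)
    rw [Finset.prod_pow_eq_pow_sum, ← h, Finsupp.weight_apply, Finsupp.sum_fintype _ _ (by simp)]
    simp
  simp only [mul_pow, Finset.prod_mul_distrib, this]
  ring

theorem aeval_smul_of_isHomogeneous {p : MvPolynomial (Fin 2) L} {e : ℕ} (hp : p.IsHomogeneous e)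
    (c : K) (u : Fin 2 → K) : aeval (c • u) p = c ^ e * aeval u p :=
  eval₂_mul_of_isHomogeneous _ hp c u

theorem zeroPt_smul (u u' : Fin 2 → K) (hu : u ≠ 0) (h : aeval u F = 0) (hu' : u' ≠ 0)
    (h' : aeval u' F = 0) (c : K) (e : u' = c • u) : zeroPt hF u' hu' h' = zeroPt hF u hu h := by
  subst e
  have hc : c ≠ 0 := by rintro rfl; simp at hu'
  obtain ⟨i, hi⟩ := coord_ne_zero hu
  have hi' : (c • u) i ≠ 0 := by simp [hc, hi]
  rw [zeroPt_eq hF u hu h (s := coordZero hF i) (by rwa [evalZero_coordZero]) (coordZero_mem hF _)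
    one_pos, zeroPt_eq hF _ hu' h' (s := coordZero hF i) (by rwa [evalZero_coordZero])
    (coordZero_mem hF _) one_pos]
  refine projPt_smul _ _ c hc ?_ _ _ _ _
  rintro e _ ⟨p, hp, rfl⟩
  exact aeval_smul_of_isHomogeneous hp c u

theorem eq_smul_of_det_eq_zero {u u' : Fin 2 → K} (hu : u ≠ 0) (e : u 0 * u' 1 = u' 0 * u 1) :
    ∃ c : K, u' = c • u := by
  obtain ⟨i, hi⟩ := coord_ne_zero hu
  refine ⟨u' i / u i, funext fun j => ?_⟩
  rw [Pi.smul_apply, smul_eq_mul, div_mul_eq_mul_div, eq_div_iff hi]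
  fin_cases i <;> fin_cases j <;> simp <;>
    first | ring1 | linear_combination e | linear_combination -e

theorem exists_smul_of_zeroPt_eq {u u' : Fin 2 → K} {hu : u ≠ 0} {h : aeval u F = 0} {hu' : u' ≠ 0}
    {h' : aeval u' F = 0} (e : zeroPt hF u hu h = zeroPt hF u' hu' h') : ∃ c : K, u' = c • u := by
  refine eq_smul_of_det_eq_zero hu ?_
  have h0 : ∀ j, u j * u' (coord_ne_zero hu).choose = u' j * u (coord_ne_zero hu).choose := fun
    j => by
    have := eval_mul_eval_of_projPt_eq _ _ _ _ _ _ _ _ e (coordZero_mem hF j)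
    simpa only [evalZero_coordZero] using this
  generalize (coord_ne_zero hu).choose = i at h0
  have h1 := h0 0
  have h2 := h0 1
  clear h0
  fin_cases i <;> simp at h1 h2
  · linear_combination -h2
  · linear_combination h1

/-- The form has coefficients in `L`, so an endomorphism of `K` over `L` acts on points through
their coordinates. This is what makes morphisms over `L` commute with the Galois group. -/
theorem specMap_zeroPt (φ : K →ₐ[L] K) (u : Fin 2 → K) (hu : u ≠ 0) (h : aeval u F = 0)
    (hu' : φ ∘ u ≠ 0) (h' : aeval (φ ∘ u) F = 0) :
    Spec.map (CommRingCat.ofHom (φ : K →+* K)) ≫ zeroPt hF u hu h = zeroPt hF (φ ∘ u) hu' h' := by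
  have e : (φ : K →+* K).comp (evalZero hF u h) = evalZero hF (φ ∘ u) h' := by
    refine Ideal.Quotient.ringHom_ext (RingHom.ext fun p => ?_)
    change φ (aeval u p) = aeval (φ ∘ u) p
    rw [← AlgHom.comp_apply]
    congr 1
    ext i
    simp
  obtain ⟨i, hi⟩ := coord_ne_zero hu
  have hi' : (φ ∘ u) i ≠ 0 := by simpa using hi
  rw [zeroPt_eq hF u hu h (s := coordZero hF i) (by rwa [evalZero_coordZero]) (coordZero_mem hF _)
    one_pos, zeroPt_eq hF _ hu' h' (s := coordZero hF i) (by rwa [evalZero_coordZero])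
    (coordZero_mem hF _) one_pos]
  refine (specMap_projPt _ _ _ (by rw [e]; rwa [evalZero_coordZero]) _ _).trans ?_
  simp only [e]

end FormPoints

end HermitianPairs

end



/-! ### Morphisms from `Proj`: structure maps and density of points -/

noncomputable section

namespace HermitianPairs

open CategoryTheory AlgebraicGeometry MvPolynomial HomogeneousIdeal
open scoped Quaternion Matrix

attribute [local instance] MvPolynomial.gradedAlgebra

section ProjOver

open HomogeneousLocalization

variable {A B σ τ : Type u} [CommRing A] [SetLike σ A] [AddSubgroupClass σ A]
  [CommRing B] [SetLike τ B] [AddSubgroupClass τ B]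
  {𝒜 : ℕ → σ} {ℬ : ℕ → τ} [GradedRing 𝒜] [GradedRing ℬ]

/-- Both sides are compared on the affine charts of the source, where only the images of scalars
matter. -/
theorem projMap_toSpecZero (f : 𝒜 →+*ᵍ ℬ) (hf : irrelevant ℬ ≤ (irrelevant 𝒜).map f) {R : Type u}
    [CommRing R] (a : R →+* 𝒜 0) (b : R →+* ℬ 0) (hab : ∀ r, f (a r) = (b r : B)) :
    Proj.map f hf ≫ Proj.toSpecZero 𝒜 ≫ Spec.map (CommRingCat.ofHom a) =
      Proj.toSpecZero ℬ ≫ Spec.map (CommRingCat.ofHom b) := by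
  have key : ∀ (i : ℕ) (hi : 0 < i) (s : A) (hs : s ∈ 𝒜 i), Proj.awayι ℬ (f s) (f.2 hs) hi ≫
      Proj.map f hf ≫ Proj.toSpecZero 𝒜 ≫ Spec.map (CommRingCat.ofHom a) =
      Proj.awayι ℬ (f s) (f.2 hs) hi ≫ Proj.toSpecZero ℬ ≫ Spec.map (CommRingCat.ofHom b) := by
    intro i hi s hs
    rw [Proj.awayι_comp_map_assoc _ _ hi _ hs, Proj.awayι_toSpecZero_assoc,
      Proj.awayι_toSpecZero_assoc, ← Spec.map_comp, ← Spec.map_comp, ← Spec.map_comp,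
      ← CommRingCat.ofHom_comp, ← CommRingCat.ofHom_comp, ← CommRingCat.ofHom_comp]
    congr 2
    ext r
    change (Away.map f s (fromZeroRingHom 𝒜 _ (a r))).val = (fromZeroRingHom ℬ _ (b r)).val
    change Localization.mk (f (a r)) _ = Localization.mk (b r : B) _
    rw [hab]
    congr 1
    exact Subtype.ext (map_one f)
  exact (Proj.mapAffineOpenCover f hf).openCover.hom_ext _ _ fun s => key _ s.1.2 _ s.2.2

/-- The stalks are homogeneous localizations, which are subrings of ordinary localizations of a
reduced ring. -/
theorem isReduced_proj [_root_.IsReduced A] : AlgebraicGeometry.IsReduced (Proj 𝒜) := by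
  have : ∀ x : Proj 𝒜, _root_.IsReduced ((Proj 𝒜).presheaf.stalk x) := fun x => by
    have := x.isPrime
    have h1 : _root_.IsReduced (Localization.AtPrime x.asHomogeneousIdeal.toIdeal) := inferInstance
    have h2 : _root_.IsReduced (AtPrime 𝒜 x.asHomogeneousIdeal.toIdeal) :=
      isReduced_of_injective (algebraMap (AtPrime 𝒜 x.asHomogeneousIdeal.toIdeal)
        (Localization.AtPrime x.asHomogeneousIdeal.toIdeal)) (val_injective _)
    exact isReduced_of_injective (Proj.stalkIso 𝒜 x).hom.hom
      (Proj.stalkIso 𝒜 x).commRingCatIsoToRingEquiv.injective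
  exact isReduced_of_isReduced_stalk _

theorem projPt_toSpecZero {K : Type u} [Field K] (ev : A →+* K) {s : A} (hs : ev s ≠ 0) {d : ℕ}
    (hd : s ∈ 𝒜 d) (d0 : 0 < d) {R : Type u} [CommRing R] (a : R →+* 𝒜 0) (φ : R →+* K)
    (hφ : ∀ r, ev (a r : A) = φ r) :
    projPt ev hs hd d0 ≫ Proj.toSpecZero 𝒜 ≫ Spec.map (CommRingCat.ofHom a) =
      (Spec.map (CommRingCat.ofHom φ) : Spec (CommRingCat.of K) ⟶ Spec (CommRingCat.of R)) := by
  rw [projPt, Category.assoc, Proj.awayι_toSpecZero_assoc, ← Spec.map_comp, ← Spec.map_comp,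
    ← CommRingCat.ofHom_comp, ← CommRingCat.ofHom_comp]
  congr 2
  ext r
  rw [← hφ]
  change awayEval ev s hs (fromZeroRingHom 𝒜 _ (a r)) = _
  rw [awayEval, RingHom.comp_apply]
  change IsLocalization.Away.lift s _ (Localization.mk _ 1) = _
  rw [Localization.mk_one_eq_algebraMap, IsLocalization.Away.lift_eq]

/-- Points are dense as soon as every homogeneous element vanishing at all of them is zero. -/
theorem hom_ext_of_projPt {K : Type u} [Field K] {ι : Type u}
    (p : ι → (Spec (CommRingCat.of K) ⟶ Proj 𝒜))
    (hp : ∀ d > 0, ∀ s ∈ 𝒜 d, (∀ i x, p i x ∉ Proj.basicOpen 𝒜 s) → s = 0)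
    [_root_.IsReduced A] {Y : Scheme.{u}} [Y.IsSeparated] {f g : Proj 𝒜 ⟶ Y}
    (h : ∀ i, p i ≫ f = p i ≫ g) : f = g := by
  have := isReduced_proj (𝒜 := 𝒜)
  -- The points are assembled into one map. Once it is dominant, two morphisms from a reduced scheme
  -- to a separated one that agree after it are equal.
  let q : (∐ fun _ : ι => Spec (CommRingCat.of K)) ⟶ Proj 𝒜 := Limits.Sigma.desc p
  have hq : IsDominant q := by
    refine ⟨dense_iff_inter_open.mpr fun U hU hne => ?_⟩
    obtain ⟨x, hx⟩ := hne
    by_contra hcon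
    obtain ⟨_, ⟨s, rfl⟩, hxs, hsU⟩ :=
      (ProjectiveSpectrum.isTopologicalBasis_basic_opens 𝒜).exists_subset_of_mem_open hx hU
    have hxs' : x ∈ Proj.basicOpen 𝒜 s := hxs
    rw [Proj.basicOpen_eq_iSup_proj, TopologicalSpace.Opens.mem_iSup] at hxs'
    obtain ⟨i, hi⟩ := hxs'
    have hle : Proj.basicOpen 𝒜 (GradedRing.proj 𝒜 i s) ≤ Proj.basicOpen 𝒜 s := by
      rw [Proj.basicOpen_eq_iSup_proj 𝒜 s]
      exact le_iSup (fun i => Proj.basicOpen 𝒜 (GradedRing.proj 𝒜 i s)) i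
    -- A homogeneous factor `t` of positive degree outside the prime `x` exists because `x` does not
    -- contain the irrelevant ideal; it brings the degree into the range where `hp` applies.
    have ht := x.not_irrelevant_le
    rw [irrelevant_le] at ht
    push Not at ht
    obtain ⟨e, he, ht⟩ := ht
    obtain ⟨t, hte, htx⟩ := SetLike.not_le_iff_exists.mp ht
    have hmem : x ∈ Proj.basicOpen 𝒜 (GradedRing.proj 𝒜 i s * t) := by
      rw [Proj.basicOpen_mul]
      exact ⟨hi, htx⟩
    have h0 := hp (i + e) (by omega) (GradedRing.proj 𝒜 i s * t)
      (SetLike.mul_mem_graded (SetLike.coe_mem _) hte) fun j y hy => hcon ?_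
    · rw [h0, Proj.basicOpen_zero] at hmem
      exact hmem
    · rw [Proj.basicOpen_mul] at hy
      refine ⟨p j y, hsU (hle hy.1), ?_⟩
      refine ⟨Limits.Sigma.ι (fun _ : ι => Spec (CommRingCat.of K)) j y, ?_⟩
      rw [← Scheme.Hom.comp_apply, Limits.Sigma.ι_desc]
  refine ext_of_isDominant q (Limits.Sigma.hom_ext _ _ fun i => ?_)
  simpa [q] using h i

end ProjOver

end HermitianPairs

end



noncomputable section

namespace HermitianPairs

open MvPolynomial
open scoped Quaternion Matrix

attribute [local instance] MvPolynomial.gradedAlgebra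

/-- A finite field is perfect, so a finite separably closed field would be algebraically closed and
therefore infinite. -/
theorem infinite_of_isSepClosed (K : Type u) [Field K] [IsSepClosed K] : Infinite K := by
  by_contra h
  rw [not_infinite_iff_finite] at h
  have : IsAlgClosed K := inferInstance
  exact not_finite_iff_infinite.mpr (IsAlgClosed.instInfinite (K := K)) h

/-! ### Split binary forms -/

section Split

/-- The determinant of two vectors of the plane. -/
def planeDet {K : Type u} [Field K] (u w : Fin 2 → K) : K := u 0 * w 1 - w 0 * u 1

/-- The linear form vanishing at `u`. -/
def linForm {K : Type u} [Field K] (u : Fin 2 → K) : MvPolynomial (Fin 2) K :=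
  C (u 0) * X 1 - C (u 1) * X 0

variable {L K : Type u} [Field L] [Field K] [Algebra L K] {n : ℕ}

theorem eval_linForm (u w : Fin 2 → K) : eval w (linForm u) = planeDet u w := by
  simp [linForm, planeDet]; ring

/-- Modulo `linForm u` the coordinates become `u i` times a single variable, so the class of `p` is
governed by its restriction to the line through `u`. That restriction has infinitely many roots and
vanishes. -/
theorem linForm_dvd [Infinite K] {u : Fin 2 → K} (hu : u ≠ 0) {p : MvPolynomial (Fin 2) K}
    (h : ∀ c : K, c ≠ 0 → eval (c • u) p = 0) : linForm u ∣ p := by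
  obtain ⟨a, b, hab⟩ : ∃ a b, a * u 0 + b * u 1 = 1 := by
    obtain ⟨i, hi⟩ := Function.ne_iff.mp hu
    simp only [Pi.zero_apply] at hi
    fin_cases i
    · exact ⟨(u 0)⁻¹, 0, by simp at hi; simp [hi]⟩
    · exact ⟨0, (u 1)⁻¹, by simp at hi; simp [hi]⟩
  have hq : aeval (fun i => Polynomial.C (u i) * Polynomial.X) p = (0 : Polynomial K) := by
    refine Polynomial.eq_zero_of_infinite_isRoot _ ?_
    refine Set.Infinite.mono ?_ (Set.finite_singleton (0 : K)).infinite_compl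
    intro c hc
    have e : Polynomial.eval c (aeval (fun i => Polynomial.C (u i) * Polynomial.X) p) =
        eval (c • u) p := by
      rw [← Polynomial.coe_evalRingHom, aeval_def, hom_eval₂]
      refine congrArg₂ (fun a b => eval₂ a b p) (RingHom.ext fun r => Polynomial.eval_C)
        (funext fun i => ?_)
      change Polynomial.eval c (Polynomial.C (u i) * Polynomial.X) = c * u i
      rw [Polynomial.eval_mul, Polynomial.eval_C, Polynomial.eval_X, mul_comm]
    exact e.trans (h c hc)
  have h2 : (Ideal.Quotient.mkₐ K (Ideal.span {linForm u})) p = 0 := by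
    -- A linear form with value `1` at `u`; modulo `linForm u` one has `X i = u i * lam`.
    let lam : MvPolynomial (Fin 2) K := C a * X 0 + C b * X 1
    have e : (Ideal.Quotient.mkₐ K (Ideal.span {linForm u})) =
        ((Ideal.Quotient.mkₐ K (Ideal.span {linForm u})).comp (Polynomial.aeval lam)).comp
          (aeval (fun i => Polynomial.C (u i) * Polynomial.X)) := by
      ext i
      simp only [AlgHom.comp_apply, aeval_X, map_mul, Polynomial.aeval_C, Polynomial.aeval_X,
        Ideal.Quotient.mkₐ_eq_mk, algebraMap_eq]
      refine (Ideal.Quotient.eq (I := Ideal.span {linForm u})).mpr ?_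
      rw [Ideal.mem_span_singleton]
      have hC : (C a * C (u 0) + C b * C (u 1) : MvPolynomial (Fin 2) K) = 1 := by
        rw [← map_mul, ← map_mul, ← map_add, hab, map_one]
      fin_cases i
      · refine ⟨-C b, ?_⟩
        simp only [lam, linForm, Fin.zero_eta]
        linear_combination (-X 0) * hC
      · refine ⟨C a, ?_⟩
        simp only [lam, linForm, Fin.mk_one]
        linear_combination (-X 1) * hC
    rw [e, AlgHom.comp_apply, hq, map_zero]
  exact Ideal.mem_span_singleton.mp (Ideal.Quotient.eq_zero_iff_mem.mp h2)

/-- After one linear factor is divided out, the quotient still vanishes on the other lines because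
that factor does not. -/
theorem prod_linForm_dvd [Infinite K] {ι : Type} (s : Finset ι) {u : ι → Fin 2 → K}
    (h0 : ∀ i, u i ≠ 0)
    (hu : ∀ i j, i ≠ j → planeDet (u i) (u j) ≠ 0) {p : MvPolynomial (Fin 2) K}
    (h : ∀ i ∈ s, ∀ c : K, c ≠ 0 → eval (c • u i) p = 0) : (∏ i ∈ s, linForm (u i)) ∣ p := by
  classical
  induction s using Finset.induction_on generalizing p with
  | empty => simp
  | insert a s ha ih =>
    obtain ⟨q, rfl⟩ := linForm_dvd (h0 a) (h a (Finset.mem_insert_self _ _))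
    rw [Finset.prod_insert ha]
    refine mul_dvd_mul_left _ (ih fun i hi c hc => ?_)
    have := h i (Finset.mem_insert_of_mem hi) c hc
    rw [eval_mul, eval_linForm] at this
    refine (mul_eq_zero.mp this).resolve_left ?_
    have hne : a ≠ i := by rintro rfl; exact ha hi
    have : planeDet (u a) (c • u i) = c * planeDet (u a) (u i) := by simp [planeDet]; ring
    rw [this]
    exact mul_ne_zero hc (hu _ _ hne)

/-- `F` has, over `K`, exactly the simple zeros `u i`. -/
structure SplitsAt (F : MvPolynomial (Fin 2) L) (u : Fin n → Fin 2 → K) : Prop where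
  ne_zero : ∀ i, u i ≠ 0
  det_ne_zero : ∀ i j, i ≠ j → planeDet (u i) (u j) ≠ 0
  eq_prod : ∃ c : K, c ≠ 0 ∧ MvPolynomial.map (algebraMap L K) F = C c * ∏ i, linForm (u i)

variable {F : MvPolynomial (Fin 2) L} {u : Fin n → Fin 2 → K}

theorem SplitsAt.aeval_eq_zero_iff (h : SplitsAt F u) (w : Fin 2 → K) :
    aeval w F = 0 ↔ ∃ i, ∃ c : K, w = c • u i := by
  obtain ⟨c, hc, e⟩ := h.eq_prod
  have : aeval w F = c * ∏ i, planeDet (u i) w := by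
    rw [aeval_def, ← eval_map, e]
    simp [eval_linForm]
  rw [this, mul_eq_zero, Finset.prod_eq_zero_iff]
  constructor
  · rintro (h1 | ⟨i, -, hi⟩)
    · exact absurd h1 hc
    · exact ⟨i, eq_smul_of_det_eq_zero (h.ne_zero i) (sub_eq_zero.mp hi)⟩
  · rintro ⟨i, c, rfl⟩
    exact Or.inr ⟨i, Finset.mem_univ _, by simp [planeDet]; ring⟩

theorem SplitsAt.aeval_eq_zero (h : SplitsAt F u) (i : Fin n) : aeval (u i) F = 0 :=
  (h.aeval_eq_zero_iff _).mpr ⟨i, 1, (one_smul _ _).symm⟩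

theorem SplitsAt.base (h : SplitsAt F u) : SplitsAt (MvPolynomial.map (algebraMap L K) F) u :=
  ⟨h.ne_zero, h.det_ne_zero, by simpa [MvPolynomial.map_id] using h.eq_prod⟩

theorem exists_map_eq_of_forall_galois [IsGalois L K] {p : MvPolynomial (Fin 2) K}
    (h : ∀ σ : K ≃ₐ[L] K, MvPolynomial.map (σ : K →+* K) p = p) :
    ∃ q : MvPolynomial (Fin 2) L, MvPolynomial.map (algebraMap L K) q = p := by
  have : p ∈ (MvPolynomial.map (algebraMap L K) : MvPolynomial (Fin 2) L →+* _).range := by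
    refine mem_range_map_iff_coeffs_subset.mpr fun c hc => ?_
    obtain ⟨m, -, rfl⟩ := mem_coeffs_iff.mp hc
    refine (InfiniteGalois.mem_range_algebraMap_iff_fixed _).mpr fun σ => ?_
    have := congrArg (coeff m) (h σ)
    rwa [coeff_map] at this
  exact this

/-- Over `K` the product of the linear forms divides `p`, hence so does `F`. The quotient is unique,
so it is Galois invariant and has coefficients in `L`. -/
theorem SplitsAt.dvd [IsSepClosure L K] (h : SplitsAt F u) {p : MvPolynomial (Fin 2) L}
    (hp : ∀ i, ∀ c : K, c ≠ 0 → aeval (c • u i) p = 0) : F ∣ p := by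
  have := IsSepClosure.sep_closed (k := L) (K := K)
  have := infinite_of_isSepClosed K
  obtain ⟨c, hc, e⟩ := h.eq_prod
  obtain ⟨b, hb⟩ := prod_linForm_dvd Finset.univ h.ne_zero h.det_ne_zero
    (p := MvPolynomial.map (algebraMap L K) p) fun i _ c hc => by
      rw [eval_map, ← aeval_def]; exact hp i c hc
  have hb' : MvPolynomial.map (algebraMap L K) p =
      MvPolynomial.map (algebraMap L K) F * (C c⁻¹ * b) := by
    have h1 : (C c * C c⁻¹ : MvPolynomial (Fin 2) K) = 1 := by rw
      [← map_mul, mul_inv_cancel₀ hc, map_one]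
    rw [e, hb]
    linear_combination (-(∏ i, linForm (u i)) * b) * h1
  have hF0 : MvPolynomial.map (algebraMap L K) F ≠ 0 := by
    rw [e]
    refine mul_ne_zero (by simpa using hc) (Finset.prod_ne_zero_iff.mpr fun i _ h0 => ?_)
    obtain ⟨a, ha⟩ : ∃ w, planeDet (u i) w ≠ 0 := by
      obtain ⟨j, hj⟩ := Function.ne_iff.mp (h.ne_zero i)
      simp only [Pi.zero_apply] at hj
      fin_cases j
      · exact ⟨![0, 1], by simpa [planeDet] using hj⟩
      · exact ⟨![1, 0], by simpa [planeDet] using hj⟩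
    rw [← eval_linForm, h0, map_zero] at ha
    exact ha rfl
  have hσ : ∀ (σ : K ≃ₐ[L] K) (q : MvPolynomial (Fin 2) L), MvPolynomial.map (σ : K →+* K)
      (MvPolynomial.map (algebraMap L K) q) = MvPolynomial.map (algebraMap L K) q := fun σ q => by
    rw [MvPolynomial.map_map]
    congr 2
    exact RingHom.ext fun r => σ.commutes r
  obtain ⟨q, hq⟩ := exists_map_eq_of_forall_galois (L := L) (p := C c⁻¹ * b) fun σ => by
    have h2 := congrArg (MvPolynomial.map (σ : K →+* K)) hb'
    rw [_root_.map_mul, hσ, hσ, hb'] at h2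
    exact (mul_left_cancel₀ hF0 h2).symm
  refine ⟨q, MvPolynomial.map_injective _ (algebraMap L K).injective ?_⟩
  rw [hb', _root_.map_mul, hq]

/-- If a power of `p` is a multiple of `F`, then `p` vanishes on all the lines of zeros and is
itself a multiple of `F`. -/
theorem SplitsAt.isReduced [IsSepClosure L K] (h : SplitsAt F u) {d : ℕ} (hF : F.IsHomogeneous d) :
    _root_.IsReduced (MvPolynomial (Fin 2) L ⧸ (formIdeal F hF).toIdeal) := by
  refine ⟨fun x hx => ?_⟩
  obtain ⟨m, hm⟩ := hx
  obtain ⟨p, rfl⟩ := Ideal.Quotient.mk_surjective x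
  rw [← map_pow, Ideal.Quotient.eq_zero_iff_mem] at hm
  obtain ⟨q, hq⟩ := Ideal.mem_span_singleton.mp hm
  refine Ideal.Quotient.eq_zero_iff_mem.mpr (Ideal.mem_span_singleton.mpr (h.dvd fun i c hc => ?_))
  refine eq_zero_of_pow_eq_zero (n := m) ?_
  rw [← map_pow, hq, _root_.map_mul, (h.aeval_eq_zero_iff _).mpr ⟨i, c, rfl⟩, zero_mul]

open CategoryTheory AlgebraicGeometry

/-- Turns identities between morphisms into computations with the vectors `u i`: the source is
reduced, and a form vanishing at all its zeros is zero on it. -/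
theorem SplitsAt.hom_ext [IsSepClosure L K] (h : SplitsAt F u) {d : ℕ} (hF : F.IsHomogeneous d)
    {Y : Scheme.{_}} [Y.IsSeparated] {f g : projForm F hF ⟶ Y}
    (hfg : ∀ i, zeroPt hF (u i) (h.ne_zero i) (h.aeval_eq_zero i) ≫ f =
      zeroPt hF (u i) (h.ne_zero i) (h.aeval_eq_zero i) ≫ g) : f = g := by
  have := h.isReduced hF
  refine hom_ext_of_projPt (𝒜 := quotGrading (polyGrading L) (formIdeal F hF)) (ι := ULift (Fin n))
    (fun i => zeroPt hF (u i.down) (h.ne_zero i.down) (h.aeval_eq_zero i.down)) ?_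
    fun i => hfg i.down
  rintro e he _ ⟨p, hp, rfl⟩ hs
  refine Ideal.Quotient.eq_zero_iff_mem.mpr (Ideal.mem_span_singleton.mpr (h.dvd fun i c hc => ?_))
  have h1 := hs ⟨i⟩ (default : PrimeSpectrum K)
  have h2 := (projPt_apply_mem_basicOpen (evalZero hF (u i) (h.aeval_eq_zero i)) _ _ _
    (Submodule.mem_map_of_mem hp) he (default : PrimeSpectrum K)).not.mp h1
  rw [not_not] at h2
  rw [aeval_smul_of_isHomogeneous hp]
  exact mul_eq_zero_of_right _ h2

end Split

end HermitianPairs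

end



/-! ### Field-valued points of a zero scheme are zeros of the form -/

noncomputable section

namespace HermitianPairs

open CategoryTheory AlgebraicGeometry MvPolynomial HomogeneousIdeal
open scoped Quaternion Matrix

attribute [local instance] MvPolynomial.gradedAlgebra

section ProjFactor

open HomogeneousLocalization

variable {A σ : Type u} [CommRing A] [SetLike σ A] [AddSubgroupClass σ A]
  {𝒜 : ℕ → σ} [GradedRing 𝒜] {K : Type u} [Field K]

/-- The spectrum of a field is a single point, so the map lands in a chart as soon as that point
does. -/
theorem exists_awayHom_of_mem_basicOpen (h : Spec (CommRingCat.of K) ⟶ Proj 𝒜) {s : A} {d : ℕ}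
    (hd : s ∈ 𝒜 d) (d0 : 0 < d) (hs : h (default : PrimeSpectrum K) ∈ Proj.basicOpen 𝒜 s) :
    ∃ χ : Away 𝒜 s →+* K, h = Spec.map (CommRingCat.ofHom χ) ≫ Proj.awayι 𝒜 s hd d0 := by
  have hrange : Set.range h ⊆ Set.range (Proj.awayι 𝒜 s hd d0) := by
    rintro _ ⟨x, rfl⟩
    obtain rfl : x = (default : PrimeSpectrum K) := Subsingleton.elim (α := PrimeSpectrum K) _ _
    rw [← Proj.opensRange_awayι 𝒜 s hd d0] at hs
    exact hs
  refine ⟨(Spec.preimage (IsOpenImmersion.lift (Proj.awayι 𝒜 s hd d0) h hrange)).hom, ?_⟩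
  rw [CommRingCat.ofHom_hom, Spec.map_preimage, IsOpenImmersion.lift_fac]

theorem awayHom_comp_eq {s : A} {d : ℕ} (hd : s ∈ 𝒜 d) (d0 : 0 < d) (χ : Away 𝒜 s →+* K)
    {R : Type u} [CommRing R] (a : R →+* 𝒜 0) (φ : R →+* K)
    (h : (Spec.map (CommRingCat.ofHom χ) ≫ Proj.awayι 𝒜 s hd d0) ≫ Proj.toSpecZero 𝒜 ≫
      Spec.map (CommRingCat.ofHom a) = Spec.map (CommRingCat.ofHom φ)) :
    χ.comp ((fromZeroRingHom 𝒜 _).comp a) = φ := by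
  rw [Category.assoc, Proj.awayι_toSpecZero_assoc, ← Spec.map_comp, ← Spec.map_comp] at h
  exact CommRingCat.hom_ext_iff.mp (Spec.map_injective h)

theorem specMap_awayι_eq_projPt {s : A} {d : ℕ} (hd : s ∈ 𝒜 d) (d0 : 0 < d) (χ : Away 𝒜 s →+* K)
    (ev : A →+* K) (hs : ev s ≠ 0)
    (h : ∀ m a ha, χ (Away.mk 𝒜 hd m a ha) * ev s ^ m = ev a) :
    Spec.map (CommRingCat.ofHom χ) ≫ Proj.awayι 𝒜 s hd d0 = projPt ev hs hd d0 := by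
  rw [projPt]
  congr 3
  ext x
  obtain ⟨m, a, ha, rfl⟩ := Away.mk_surjective _ hd x
  rw [awayEval_mk, eq_div_iff (pow_ne_zero _ hs), h]

end ProjFactor

section OverField

open HomogeneousLocalization

variable {L K : Type u} [Field L] [Field K] [Algebra L K]
  {F F' : MvPolynomial (Fin 2) L} {d d' : ℕ} (hF : F.IsHomogeneous d) (hF' : F'.IsHomogeneous d')

theorem substMap_over (A : (Matrix (Fin 2) (Fin 2) L)ˣ) (hA : substHom A.val F ∈ Ideal.span {F'}) :
    substMap hF hF' A hA ≫ (projFormOver F hF).hom = (projFormOver F' hF').hom :=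
  projMap_toSpecZero _ _ _ _ fun r => by
    change Ideal.Quotient.mk _ (substHom A.val (algebraMap L _ r)) = _
    rw [AlgHom.commutes]
    rfl

theorem zeroPt_over (u : Fin 2 → K) (hu : u ≠ 0) (h : aeval u F = 0) :
    zeroPt hF u hu h ≫ (projFormOver F hF).hom = Spec.map (CommRingCat.ofHom (algebraMap L K)) :=
  projPt_toSpecZero _ _ _ _ _ _ fun r => by
    change aeval u (algebraMap L _ r) = _
    rw [AlgHom.commutes]

theorem iSup_basicOpen_coordZero :
    ⨆ i, Proj.basicOpen (quotGrading (polyGrading L) (formIdeal F hF)) (coordZero hF i) = ⊤ := by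
  refine top_le_iff.mp fun x _ => TopologicalSpace.Opens.mem_iSup.mpr ?_
  by_contra! H
  refine x.not_irrelevant_le ((irrelevant_le _).mpr ?_)
  rintro e he _ ⟨p, hp, rfl⟩
  exact irrelevant_le_of_X_mem (x.asHomogeneousIdeal.toIdeal.comap (Ideal.Quotient.mk _))
    (fun i => not_not.mp (H i)) he hp

/-- In a chart where the `i`-th coordinate is invertible the point is a ring homomorphism `χ`. Its
values at the fractions `X j / X i` serve as homogeneous coordinates, the `i`-th being `1`. -/
theorem exists_eq_zeroPt (h : Spec (CommRingCat.of K) ⟶ projForm F hF)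
    (hh : h ≫ (projFormOver F hF).hom = Spec.map (CommRingCat.ofHom (algebraMap L K))) :
    ∃ (u : Fin 2 → K) (hu : u ≠ 0) (h0 : aeval u F = 0), h = zeroPt hF u hu h0 := by
  let 𝒬 := quotGrading (polyGrading L) (formIdeal F hF)
  obtain ⟨i, hi⟩ := TopologicalSpace.Opens.mem_iSup.mp
    ((iSup_basicOpen_coordZero hF).ge (Set.mem_univ (h (default : PrimeSpectrum K))))
  have hs := coordZero_mem hF i
  obtain ⟨χ, hχ⟩ := exists_awayHom_of_mem_basicOpen (𝒜 := 𝒬) h hs one_pos hi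
  let f : L →+* Away 𝒬 (coordZero hF i) := (fromZeroRingHom 𝒬 _).comp (algebraMap L (𝒬 0))
  have hf : χ.comp f = algebraMap L K :=
    awayHom_comp_eq hs one_pos χ (algebraMap L (𝒬 0)) _ (by rw [← hχ]; exact hh)
  let w : Fin 2 → Away 𝒬 (coordZero hF i) := fun j =>
    Away.mk 𝒬 hs 1 (coordZero hF j) (by simpa using coordZero_mem hF j)
  have hmem : ∀ (m : ℕ) (p : MvPolynomial (Fin 2) L), p.IsHomogeneous m →
      Ideal.Quotient.mk (formIdeal F hF).toIdeal p ∈ 𝒬 (m • 1) := fun m p hp =>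
    ⟨p, by simpa using hp, rfl⟩
  -- Dehomogenisation: a form `p` of degree `m`, evaluated at the fractions `X l / X i`, equals `p /
  -- X i ^ m`. It is checked in the full localization, after multiplication by `X i ^ m`.
  have hΘ : ∀ (m : ℕ) (p : MvPolynomial (Fin 2) L) (hp : p.IsHomogeneous m), eval₂ f w p =
      Away.mk 𝒬 hs m (Ideal.Quotient.mk (formIdeal F hF).toIdeal p) (hmem m p hp) := by
    intro m p hp
    refine val_injective _ ?_
    rw [Away.val_mk]
    let ι := algebraMap (Away 𝒬 (coordZero hF i)) (Localization.Away (coordZero hF i))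
    let j := algebraMap (MvPolynomial (Fin 2) L ⧸ (formIdeal F hF).toIdeal)
      (Localization.Away (coordZero hF i))
    have hw : ∀ l, j (coordZero hF i) * ι (w l) = j (coordZero hF l) := fun l => by
      change j (coordZero hF i) * (w l).val = _
      rw [Away.val_mk]
      simp only [pow_one]
      rw [mul_comm, Localization.mk_eq_mk']
      exact IsLocalization.mk'_spec _ _ (⟨_, 1, pow_one _⟩ : Submonoid.powers (coordZero hF i))
    have hf' : ι.comp f = j.comp ((Ideal.Quotient.mk (formIdeal F hF).toIdeal).comp C) :=
      RingHom.ext fun r => Localization.mk_one_eq_algebraMap _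
    have h1 := eval₂_mul_of_isHomogeneous (ι.comp f) hp (j (coordZero hF i)) (fun l => ι (w l))
    have h2 : eval₂ (ι.comp f) (fun l => j (coordZero hF l)) p =
        j (Ideal.Quotient.mk (formIdeal F hF).toIdeal p) := by
      rw [hf', ← RingHom.comp_assoc]
      have := (hom_eval₂ p (C : L →+* MvPolynomial (Fin 2) L)
        (j.comp (Ideal.Quotient.mk (formIdeal F hF).toIdeal)) X)
      rw [eval₂_eta] at this
      exact this.symm
    simp only [hw] at h1
    rw [h2] at h1
    have h3 : (eval₂ f w p).val = eval₂ (ι.comp f) (fun l => ι (w l)) p := hom_eval₂ p f ι w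
    rw [h3, Localization.mk_eq_mk', eq_comm, IsLocalization.mk'_eq_iff_eq_mul, mul_comm]
    rw [map_pow]
    exact h1
  have hev : ∀ p, χ (eval₂ f w p) = aeval (fun j => χ (w j)) p := fun p => by
    rw [hom_eval₂, hf]; rfl
  have hui : χ (w i) = 1 := by
    rw [← map_one χ]
    congr 1
    refine val_injective _ ?_
    rw [Away.val_mk, val_one]
    simp only [pow_one]
    exact Localization.mk_self (⟨_, 1, pow_one _⟩ : Submonoid.powers (coordZero hF i))
  have hu : (fun j => χ (w j)) ≠ 0 := fun h0 => by
    have := congrFun h0 i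
    rw [hui] at this
    exact one_ne_zero this
  have h0 : aeval (fun j => χ (w j)) F = 0 := by
    rw [← hev, hΘ d F hF]
    have : Ideal.Quotient.mk (formIdeal F hF).toIdeal F = 0 :=
      Ideal.Quotient.eq_zero_iff_mem.mpr (Ideal.mem_span_singleton_self F)
    rw [← map_zero χ]
    congr 1
    refine val_injective _ ?_
    rw [Away.val_mk, this, Localization.mk_zero, val_zero]
  refine ⟨_, hu, h0, ?_⟩
  have hne : evalZero hF _ h0 (coordZero hF i) ≠ 0 := by
    rw [evalZero_coordZero, hui]; exact one_ne_zero
  rw [zeroPt_eq hF _ hu h0 hne hs one_pos, hχ]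
  refine specMap_awayι_eq_projPt _ _ _ _ _ ?_
  rintro m _ ⟨p, hp, rfl⟩
  rw [evalZero_coordZero, hui, one_pow, mul_one]
  exact ((hev p).symm.trans (congrArg χ (hΘ m p (by simpa using hp)))).symm

end OverField

end HermitianPairs

end



noncomputable section

namespace HermitianPairs

open MvPolynomial
open scoped Quaternion Matrix

attribute [local instance] MvPolynomial.gradedAlgebra

/-! ### Galois descent for projectivities of the line -/

section Descent

variable {L K : Type u} [Field L] [Field K] [Algebra L K]

theorem planeDet_smul_smul (a b : K) (u w : Fin 2 → K) :
    planeDet (a • u) (b • w) = a * b * planeDet u w := by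
  simp [planeDet]; ring

theorem planeDet_self (u : Fin 2 → K) : planeDet u u = 0 := by simp [planeDet]

theorem planeDet_swap (u w : Fin 2 → K) : planeDet w u = -planeDet u w := by simp [planeDet]

theorem planeDet_comp (σ : K →+* K) (u w : Fin 2 → K) :
    planeDet (σ ∘ u) (σ ∘ w) = σ (planeDet u w) := by simp [planeDet]

theorem planeDet_vecMul (A : Matrix (Fin 2) (Fin 2) K) (u w : Fin 2 → K) :
    planeDet (u ᵥ* A) (w ᵥ* A) = planeDet u w * A.det := by
  simp [planeDet, Matrix.vecMul, dotProduct, Fin.sum_univ_two, Matrix.det_fin_two]; ring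

theorem exists_smul_of_planeDet {u w : Fin 2 → K} (hu : u ≠ 0) (h : planeDet u w = 0) :
    ∃ c : K, w = c • u := eq_smul_of_det_eq_zero hu (sub_eq_zero.mp h)

theorem vecMul_ne_zero {u : Fin 2 → K} (hu : u ≠ 0) (A : (Matrix (Fin 2) (Fin 2) K)ˣ) :
    u ᵥ* A.val ≠ 0 := fun h => hu (by
  have := congrArg (· ᵥ* (A⁻¹).val) h
  simpa [Matrix.vecMul_vecMul] using this)

/-- The scalar multiple of a vector of the plane whose first non-zero coordinate is `1`. -/
def normVec (u : Fin 2 → K) : Fin 2 → K :=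
  open Classical in if u 0 ≠ 0 then (u 0)⁻¹ • u else (u 1)⁻¹ • u

theorem normVec_smul {c : K} (hc : c ≠ 0) (u : Fin 2 → K) : normVec (c • u) = normVec u := by
  have h : (c • u) 0 ≠ 0 ↔ u 0 ≠ 0 := by simp [hc]
  by_cases h0 : u 0 ≠ 0
  · rw [normVec, normVec, if_pos h0, if_pos (h.mpr h0), smul_smul, Pi.smul_apply, smul_eq_mul,
      mul_inv]
    congr 1
    field_simp
  · rw [normVec, normVec, if_neg h0, if_neg (h.not.mpr h0), smul_smul, Pi.smul_apply, smul_eq_mul,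
      mul_inv, mul_right_comm, inv_mul_cancel₀ hc, one_mul]

/-- The normalised vector is chosen compatibly with field automorphisms, so a Galois permutation of
lines becomes a permutation of vectors. -/
theorem normVec_comp (σ : K →+* K) (u : Fin 2 → K) : normVec (σ ∘ u) = σ ∘ normVec u := by
  have h : (σ ∘ u) 0 ≠ 0 ↔ u 0 ≠ 0 := by simp
  by_cases h0 : u 0 ≠ 0
  · rw [normVec, normVec, if_pos h0, if_pos (h.mpr h0)]
    ext; simp
  · rw [normVec, normVec, if_neg h0, if_neg (h.not.mpr h0)]
    ext; simp

theorem exists_normVec_eq {u : Fin 2 → K} (hu : u ≠ 0) : ∃ c : K, c ≠ 0 ∧ normVec u = c • u := by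
  unfold normVec
  split_ifs with h
  · exact ⟨_, inv_ne_zero h, rfl⟩
  · refine ⟨_, inv_ne_zero fun h1 => hu (funext fun i => ?_), rfl⟩
    fin_cases i
    · exact not_not.mp h
    · exact h1

theorem normVec_eq_of_planeDet {u w : Fin 2 → K} (hu : u ≠ 0) (hw : w ≠ 0) (h : planeDet u w = 0) :
    normVec u = normVec w := by
  obtain ⟨c, rfl⟩ := exists_smul_of_planeDet hu h
  exact (normVec_smul (by rintro rfl; simp at hw) u).symm

theorem exists_matrix_of_pairs {p q p' q' : Fin 2 → K} (h : planeDet p q ≠ 0)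
    (h' : planeDet p' q' ≠ 0) : ∃ A : Matrix (Fin 2) (Fin 2) K, A.det ≠ 0 ∧ p ᵥ* A = p' ∧ q ᵥ* A =
      q' := by
  let U : Matrix (Fin 2) (Fin 2) K := Matrix.of ![p, q]
  let W : Matrix (Fin 2) (Fin 2) K := Matrix.of ![p', q']
  have hU : U.det = planeDet p q := by simp [U, Matrix.det_fin_two, planeDet, mul_comm]
  have hW : W.det = planeDet p' q' := by simp [W, Matrix.det_fin_two, planeDet, mul_comm]
  have hUA : U * (U⁻¹ * W) = W := by
    rw [← Matrix.mul_assoc, Matrix.mul_nonsing_inv _ (by rw [hU]; exact isUnit_iff_ne_zero.mpr h),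
      Matrix.one_mul]
  refine ⟨U⁻¹ * W, fun h0 => h' ?_, ?_, ?_⟩
  · rw [← hW, ← hUA, Matrix.det_mul, h0, mul_zero]
  · exact congrFun hUA 0
  · exact congrFun hUA 1

theorem matrix_ext_of_vecMul {A B : Matrix (Fin 2) (Fin 2) K} {p q : Fin 2 → K}
    (h : planeDet p q ≠ 0) (hp : p ᵥ* A = p ᵥ* B) (hq : q ᵥ* A = q ᵥ* B) : A = B := by
  let U : Matrix (Fin 2) (Fin 2) K := Matrix.of ![p, q]
  have hU : U.det = planeDet p q := by simp [U, Matrix.det_fin_two, planeDet, mul_comm]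
  have e : U * A = U * B := by
    funext i
    fin_cases i
    · exact hp
    · exact hq
  have := congrArg (U⁻¹ * ·) e
  simpa only [← Matrix.mul_assoc, Matrix.nonsing_inv_mul _ (isUnit_iff_ne_zero.mpr (hU ▸ h)),
    Matrix.one_mul] using this

theorem comp_vecMul (σ : K →+* K) (A : Matrix (Fin 2) (Fin 2) K) (u : Fin 2 → K) :
    (σ ∘ u) ᵥ* A.map σ = σ ∘ (u ᵥ* A) := by
  ext i
  simp [Matrix.vecMul, dotProduct]

/-- A matrix characterized by a Galois stable condition is rational. -/
theorem exists_rational_matrix [IsGalois L K] (S : Set ((Fin 2 → K) × (Fin 2 → K)))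
    (hS : ∀ σ : K ≃ₐ[L] K, ∀ p ∈ S, (⇑σ ∘ p.1, ⇑σ ∘ p.2) ∈ S) (A : Matrix (Fin 2) (Fin 2) K)
    (hA : ∀ p ∈ S, p.1 ᵥ* A = p.2) {p q : (Fin 2 → K) × (Fin 2 → K)} (hp : p ∈ S) (hq : q ∈ S)
    (hpq : planeDet p.1 q.1 ≠ 0) (hdet : A.det ≠ 0) :
    ∃ A₀ : (Matrix (Fin 2) (Fin 2) L)ˣ, A₀.val.map (algebraMap L K) = A := by
  -- As `S` is stable, the conjugate of `A` satisfies the conditions that define `A`. Two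
  -- independent vectors determine the matrix, so it equals its conjugates.
  have key : ∀ (σ : K ≃ₐ[L] K), ∀ r ∈ S, r.1 ᵥ* A.map σ = r.2 := by
    intro σ r hr
    have h1 := hA _ (hS σ.symm r hr)
    have h2 := comp_vecMul (σ : K →+* K) A (σ.symm ∘ r.1)
    rw [h1] at h2
    have h3 : ∀ w : Fin 2 → K, ⇑(σ : K →+* K) ∘ (⇑σ.symm ∘ w) = w := fun w => by ext; simp
    rwa [h3, h3] at h2
  have hfix : ∀ σ : K ≃ₐ[L] K, A.map σ = A := fun σ =>
    matrix_ext_of_vecMul hpq ((key σ p hp).trans (hA p hp).symm) ((key σ q hq).trans (hA q hq).symm)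
  have hr : ∀ i j, ∃ a : L, algebraMap L K a = A i j := fun i j =>
    (InfiniteGalois.mem_range_algebraMap_iff_fixed _).mpr fun σ => congrFun (congrFun (hfix σ) i) j
  choose a ha using hr
  have hmap : (Matrix.of a).map (algebraMap L K) = A := by ext i j; exact ha i j
  refine ⟨Matrix.GeneralLinearGroup.mkOfDetNeZero (Matrix.of a) fun h0 => hdet ?_, hmap⟩
  rw [← hmap, ← RingHom.mapMatrix_apply, ← RingHom.map_det, h0, map_zero]

/-- Two lines do not determine a projectivity, but their normalised vectors determine a matrix, and
these vectors are permuted by the Galois group. -/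
theorem exists_rational_matrix_two [IsGalois L K] {u w : Fin 2 → Fin 2 → K} (hu0 : ∀ i, u i ≠ 0)
    (hw0 : ∀ i, w i ≠ 0) (hu : ∀ i j, i ≠ j → planeDet (u i) (u j) ≠ 0)
    (hw : ∀ i j, i ≠ j → planeDet (w i) (w j) ≠ 0)
    (hσ : ∀ (σ : K ≃ₐ[L] K) (i : Fin 2), ∃ j, planeDet (⇑σ ∘ u i) (u j) = 0 ∧
      planeDet (⇑σ ∘ w i) (w j) = 0) :
    ∃ A : (Matrix (Fin 2) (Fin 2) L)ˣ, ∀ i,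
      planeDet (u i ᵥ* A.val.map (algebraMap L K)) (w i) = 0 := by
  choose cu hcu hu1 using fun i => exists_normVec_eq (hu0 i)
  choose cw hcw hw1 using fun i => exists_normVec_eq (hw0 i)
  have hdu : planeDet (normVec (u 0)) (normVec (u 1)) ≠ 0 := by
    rw [hu1, hu1, planeDet_smul_smul]
    exact mul_ne_zero (mul_ne_zero (hcu 0) (hcu 1)) (hu 0 1 (by decide))
  have hdw : planeDet (normVec (w 0)) (normVec (w 1)) ≠ 0 := by
    rw [hw1, hw1, planeDet_smul_smul]
    exact mul_ne_zero (mul_ne_zero (hcw 0) (hcw 1)) (hw 0 1 (by decide))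
  obtain ⟨A, hdet, h0, h1⟩ := exists_matrix_of_pairs hdu hdw
  have hcomp : ∀ (σ : K ≃ₐ[L] K) {v : Fin 2 → K}, v ≠ 0 → ⇑σ ∘ v ≠ 0 := fun σ v hv h =>
    hv (funext fun i => by simpa using congrFun h i)
  have hA : ∀ i, normVec (u i) ᵥ* A = normVec (w i) := fun i => by
    fin_cases i
    · exact h0
    · exact h1
  obtain ⟨A₀, hA₀⟩ := exists_rational_matrix (L := L)
    (Set.range fun i => (normVec (u i), normVec (w i))) (by
      rintro σ _ ⟨i, rfl⟩
      obtain ⟨j, hj, hj'⟩ := hσ σ i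
      refine ⟨j, Prod.ext ?_ ?_⟩
      · exact (normVec_eq_of_planeDet (hcomp σ (hu0 i)) (hu0 j) hj).symm.trans
          (normVec_comp (σ : K →+* K) _)
      · exact (normVec_eq_of_planeDet (hcomp σ (hw0 i)) (hw0 j) hj').symm.trans
          (normVec_comp (σ : K →+* K) _)) A (by
      rintro _ ⟨i, rfl⟩
      exact hA i) ⟨0, rfl⟩ ⟨1, rfl⟩ hdu hdet
  refine ⟨A₀, fun i => ?_⟩
  have h := hA i
  rw [hu1, hw1, Matrix.smul_vecMul] at h
  have h2 := planeDet_smul_smul (cu i) (cw i) (u i ᵥ* A) (w i)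
  rw [h, planeDet_self] at h2
  rw [hA₀]
  exact (mul_eq_zero.mp h2.symm).resolve_left (mul_ne_zero (hcu i) (hcw i))

/-- Three vectors of the plane, scaled so as to have sum zero. -/
def balance (u : Fin 3 → Fin 2 → K) (i : Fin 3) : Fin 2 → K :=
  planeDet (u (i + 1)) (u (i + 2)) • u i

/-- The Plücker relation among three vectors of the plane. A linear map matching the first two
balanced vectors of two triples therefore matches the third. -/
theorem balance_sum (u : Fin 3 → Fin 2 → K) : balance u 2 = -balance u 0 - balance u 1 := by
  ext i
  fin_cases i <;> simp [balance, planeDet] <;> ring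

/-- Cyclic permutations respect the cyclic order of the three determinants; the others reverse it
and change each sign. The sign depends on `ρ` only, so it is the same for source and target. -/
theorem balance_comp_perm {ρ : Fin 3 → Fin 3} (hρ : Function.Injective ρ) :
    ∃ ε : K, ε * ε = 1 ∧ ∀ (u : Fin 3 → Fin 2 → K) i, balance (u ∘ ρ) i = ε • balance u (ρ i) := by
  by_cases h : ∀ i, ρ (i + 1) = ρ i + 1
  · refine ⟨1, one_mul 1, fun u i => ?_⟩
    have h2 : ρ (i + 2) = ρ i + 2 := by
      rw [show i + 2 = i + 1 + 1 by rw [add_assoc]; rfl, h, h, add_assoc]; rfl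
    simp [balance, h, h2]
  · have h' : ∀ i, ρ (i + 1) = ρ i + 2 ∧ ρ (i + 2) = ρ i + 1 := by
      revert hρ h; revert ρ; decide
    refine ⟨-1, by ring, fun u i => ?_⟩
    simp only [balance, Function.comp_apply, h' i]
    rw [planeDet_swap, smul_smul, neg_one_mul]

/-- Three vectors with sum zero on given distinct lines are unique up to a common scalar, whence a
matrix matching two triples. The balanced normalised vectors are permuted by the Galois group up to
a sign common to both triples. -/
theorem exists_rational_matrix_three [IsGalois L K] {u w : Fin 3 → Fin 2 → K} (hu0 : ∀ i, u i ≠ 0)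
    (hw0 : ∀ i, w i ≠ 0) (hu : ∀ i j, i ≠ j → planeDet (u i) (u j) ≠ 0)
    (hw : ∀ i j, i ≠ j → planeDet (w i) (w j) ≠ 0)
    (hσ : ∀ (σ : K ≃ₐ[L] K) (i : Fin 3), ∃ j, planeDet (⇑σ ∘ u i) (u j) = 0 ∧
      planeDet (⇑σ ∘ w i) (w j) = 0) :
    ∃ A : (Matrix (Fin 2) (Fin 2) L)ˣ, ∀ i,
      planeDet (u i ᵥ* A.val.map (algebraMap L K)) (w i) = 0 := by
  choose cu hcu hu1 using fun i => exists_normVec_eq (hu0 i)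
  choose cw hcw hw1 using fun i => exists_normVec_eq (hw0 i)
  let u' : Fin 3 → Fin 2 → K := fun i => normVec (u i)
  let w' : Fin 3 → Fin 2 → K := fun i => normVec (w i)
  have hu' : ∀ i j, i ≠ j → planeDet (u' i) (u' j) ≠ 0 := fun i j hij => by
    change planeDet (normVec (u i)) (normVec (u j)) ≠ 0
    rw [hu1, hu1, planeDet_smul_smul]
    exact mul_ne_zero (mul_ne_zero (hcu i) (hcu j)) (hu i j hij)
  have hw' : ∀ i j, i ≠ j → planeDet (w' i) (w' j) ≠ 0 := fun i j hij => by
    change planeDet (normVec (w i)) (normVec (w j)) ≠ 0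
    rw [hw1, hw1, planeDet_smul_smul]
    exact mul_ne_zero (mul_ne_zero (hcw i) (hcw j)) (hw i j hij)
  have hcomp : ∀ (σ : K ≃ₐ[L] K) {v : Fin 2 → K}, v ≠ 0 → ⇑σ ∘ v ≠ 0 := fun σ v hv h =>
    hv (funext fun i => by simpa using congrFun h i)
  have hne : ∀ i : Fin 3, i + 1 ≠ i + 2 := by decide
  have hbal : ∀ {v : Fin 3 → Fin 2 → K}, (∀ i j, i ≠ j → planeDet (v i) (v j) ≠ 0) →
      planeDet (balance v 0) (balance v 1) ≠ 0 := fun {v} hv => by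
    rw [balance, balance, planeDet_smul_smul]
    exact mul_ne_zero (mul_ne_zero (hv _ _ (hne 0)) (hv _ _ (hne 1))) (hv 0 1 (by decide))
  obtain ⟨A, hdet, h0, h1⟩ := exists_matrix_of_pairs (hbal hu') (hbal hw')
  have hA : ∀ i, balance u' i ᵥ* A = balance w' i := fun i => by
    fin_cases i
    · exact h0
    · exact h1
    · change balance u' 2 ᵥ* A = balance w' 2
      rw [balance_sum, balance_sum, Matrix.sub_vecMul, Matrix.neg_vecMul, h0, h1]
  have hbc : ∀ (σ : K ≃ₐ[L] K) (v : Fin 3 → Fin 2 → K) i,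
      ⇑σ ∘ balance v i = balance (fun j => ⇑σ ∘ v j) i := fun σ v i => by
    have := planeDet_comp (σ : K →+* K) (v (i + 1)) (v (i + 2))
    ext j
    have e : planeDet (⇑σ ∘ v (i + 1)) (⇑σ ∘ v (i + 2)) = σ (planeDet (v (i + 1)) (v (i + 2))) :=
      this
    simp [balance, e]
  obtain ⟨A₀, hA₀⟩ := exists_rational_matrix (L := L)
    -- The multiples by square roots of one are included because odd permutations change the sign.
    -- The same `ε` occurs in both entries, so `A` still matches all pairs.
    {p | ∃ ε : K, ε * ε = 1 ∧ ∃ i, p = (ε • balance u' i, ε • balance w' i)} (by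
      rintro σ _ ⟨ε, hε, i, rfl⟩
      choose ρ hρu hρw using hσ σ
      have eu : (fun j => ⇑σ ∘ u' j) = u' ∘ ρ := funext fun j =>
        ((normVec_eq_of_planeDet (hcomp σ (hu0 j)) (hu0 _) (hρu j)).symm.trans
          (normVec_comp (σ : K →+* K) _)).symm
      have ew : (fun j => ⇑σ ∘ w' j) = w' ∘ ρ := funext fun j =>
        ((normVec_eq_of_planeDet (hcomp σ (hw0 j)) (hw0 _) (hρw j)).symm.trans
          (normVec_comp (σ : K →+* K) _)).symm
      have hinj : Function.Injective ρ := fun i j hij => by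
        by_contra hne
        have h1 : ⇑σ ∘ u' i = ⇑σ ∘ u' j := (congrFun eu i).trans
          ((congrArg u' hij).trans (congrFun eu j).symm)
        refine hu' i j hne ?_
        rw [σ.injective.comp_left h1, planeDet_self]
      obtain ⟨δ, hδ, hbp⟩ := balance_comp_perm (K := K) hinj
      refine ⟨σ ε * δ, ?_, ρ i, Prod.ext ?_ ?_⟩
      · rw [mul_mul_mul_comm, ← map_mul, hε, map_one, hδ, one_mul]
      · have : ⇑σ ∘ (ε • balance u' i) = σ ε • (⇑σ ∘ balance u' i) := by ext; simp
        change ⇑σ ∘ (ε • balance u' i) = _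
        rw [this, hbc, eu, hbp, smul_smul]
      · have : ⇑σ ∘ (ε • balance w' i) = σ ε • (⇑σ ∘ balance w' i) := by ext; simp
        change ⇑σ ∘ (ε • balance w' i) = _
        rw [this, hbc, ew, hbp, smul_smul]) A (by
      rintro _ ⟨ε, -, i, rfl⟩
      simp only [Matrix.smul_vecMul, hA]) ⟨1, one_mul 1, 0, rfl⟩ ⟨1, one_mul 1, 1, rfl⟩
      (by simpa using hbal hu') hdet
  refine ⟨A₀, fun i => ?_⟩
  have h := hA i
  have e1 : balance u' i = (planeDet (u' (i + 1)) (u' (i + 2)) * cu i) • u i := by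
    rw [balance, show u' i = cu i • u i from hu1 i, smul_smul]
  have e2 : balance w' i = (planeDet (w' (i + 1)) (w' (i + 2)) * cw i) • w i := by
    rw [balance, show w' i = cw i • w i from hw1 i, smul_smul]
  rw [e1, e2, Matrix.smul_vecMul] at h
  have h2 := planeDet_smul_smul (planeDet (u' (i + 1)) (u' (i + 2)) * cu i)
    (planeDet (w' (i + 1)) (w' (i + 2)) * cw i) (u i ᵥ* A) (w i)
  rw [h, planeDet_self] at h2
  rw [hA₀]
  exact (mul_eq_zero.mp h2.symm).resolve_left (mul_ne_zero
    (mul_ne_zero (hu' _ _ (hne i)) (hcu i)) (mul_ne_zero (hw' _ _ (hne i)) (hcw i)))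

/-- Two Galois stable families of two or three points of the line with the same Galois action
correspond under a rational projectivity. -/
theorem exists_rational_projectivity [IsGalois L K] {n : ℕ} (hn : n = 2 ∨ n = 3)
    {u w : Fin n → Fin 2 → K} (hu0 : ∀ i, u i ≠ 0)
    (hw0 : ∀ i, w i ≠ 0) (hu : ∀ i j, i ≠ j → planeDet (u i) (u j) ≠ 0)
    (hw : ∀ i j, i ≠ j → planeDet (w i) (w j) ≠ 0)
    (hσ : ∀ (σ : K ≃ₐ[L] K) (i : Fin n), ∃ j, planeDet (⇑σ ∘ u i) (u j) = 0 ∧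
      planeDet (⇑σ ∘ w i) (w j) = 0) :
    ∃ A : (Matrix (Fin 2) (Fin 2) L)ˣ, ∀ i,
      planeDet (u i ᵥ* A.val.map (algebraMap L K)) (w i) = 0 := by
  rcases hn with rfl | rfl
  · exact exists_rational_matrix_two hu0 hw0 hu hw hσ
  · exact exists_rational_matrix_three hu0 hw0 hu hw hσ

end Descent

end HermitianPairs

end



noncomputable section

namespace HermitianPairs

open CategoryTheory AlgebraicGeometry MvPolynomial
open scoped Quaternion Matrix

attribute [local instance] MvPolynomial.gradedAlgebra

/-! ### Isomorphisms between zero schemes of binary forms -/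

section FormIso

variable {L K : Type u} [Field L] [Field K] [Algebra L K]
  {F F' : MvPolynomial (Fin 2) L} {d d' n : ℕ} {hF : F.IsHomogeneous d} {hF' : F'.IsHomogeneous d'}
  {u u' : Fin n → Fin 2 → K}

/-- `A` maps each of the points `u i` of the line to one of the points `u' j`. -/
def MapsZeros (A : Matrix (Fin 2) (Fin 2) K) (u u' : Fin n → Fin 2 → K) : Prop :=
  ∀ i, ∃ j, planeDet (u i ᵥ* A) (u' j) = 0

/-- Extension of scalars for invertible matrices. -/
def mapUnit (K : Type u) [Field K] [Algebra L K] (A : (Matrix (Fin 2) (Fin 2) L)ˣ) :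
    (Matrix (Fin 2) (Fin 2) K)ˣ :=
  Units.map (algebraMap L K).mapMatrix.toMonoidHom A

theorem map_unit_ne_zero (A : (Matrix (Fin 2) (Fin 2) L)ˣ) {w : Fin 2 → K} (hw : w ≠ 0) :
    w ᵥ* A.val.map (algebraMap L K) ≠ 0 :=
  vecMul_ne_zero hw (mapUnit K A)

theorem SplitsAt.aeval_eq_zero_of_planeDet (h : SplitsAt F u) {w : Fin 2 → K} {i : Fin n}
    (hw : planeDet (u i) w = 0) : aeval w F = 0 :=
  (h.aeval_eq_zero_iff w).mpr ⟨i, exists_smul_of_planeDet (h.ne_zero i) hw⟩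

theorem SplitsAt.exists_planeDet (h : SplitsAt F u) {w : Fin 2 → K} (hw : aeval w F = 0) :
    ∃ i, planeDet (u i) w = 0 := by
  obtain ⟨i, c, rfl⟩ := (h.aeval_eq_zero_iff w).mp hw
  exact ⟨i, by simpa [planeDet_self] using planeDet_smul_smul 1 c (u i) (u i)⟩

theorem planeDet_comm_zero {u w : Fin 2 → K} (h : planeDet u w = 0) : planeDet w u = 0 := by
  rw [planeDet_swap, h, neg_zero]

theorem planeDet_trans {u v w : Fin 2 → K} (hv : v ≠ 0) (h : planeDet u v = 0)
    (h' : planeDet v w = 0) : planeDet u w = 0 := by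
  obtain ⟨a, rfl⟩ := exists_smul_of_planeDet hv (planeDet_comm_zero h)
  obtain ⟨b, rfl⟩ := exists_smul_of_planeDet hv h'
  rw [planeDet_smul_smul, planeDet_self, mul_zero]

/-- Pull-back reverses the direction: `A` carries zeros of `F` to zeros of `F'`, so `F'(v A)`
vanishes wherever `F` does. -/
theorem MapsZeros.substHom_mem [IsSepClosure L K] (h : SplitsAt F u) (h' : SplitsAt F' u')
    {A : Matrix (Fin 2) (Fin 2) L} (hA : MapsZeros (A.map (algebraMap L K)) u u') :
    substHom A F' ∈ Ideal.span {F} := by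
  refine Ideal.mem_span_singleton.mpr (h.dvd fun i c _ => ?_)
  obtain ⟨j, hj⟩ := hA i
  rw [aeval_substHom]
  refine h'.aeval_eq_zero_of_planeDet (i := j) ?_
  rw [Matrix.smul_vecMul]
  have := planeDet_smul_smul 1 c (u' j) (u i ᵥ* A.map (algebraMap L K))
  rw [one_smul] at this
  rw [this, planeDet_comm_zero hj, mul_zero]

theorem MapsZeros.bijective (h : SplitsAt F u) (h' : SplitsAt F' u')
    {A : (Matrix (Fin 2) (Fin 2) K)ˣ} (hA : MapsZeros A.val u u') :
    ∃ π : Fin n ≃ Fin n, ∀ i, planeDet (u i ᵥ* A.val) (u' (π i)) = 0 := by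
  choose π hπ using hA
  have hinj : Function.Injective π := fun i j hij => by
    by_contra hne
    refine h.det_ne_zero i j hne ?_
    have h1 : planeDet (u i ᵥ* A.val) (u j ᵥ* A.val) = 0 :=
      planeDet_trans (h'.ne_zero (π i)) (hπ i) (planeDet_comm_zero (by rw [hij]; exact hπ j))
    rw [planeDet_vecMul] at h1
    exact (mul_eq_zero.mp h1).resolve_right ((Matrix.isUnit_iff_isUnit_det _).mp A.isUnit).ne_zero
  exact ⟨Equiv.ofBijective π (Finite.injective_iff_bijective.mp hinj), hπ⟩

theorem planeDet_vecMul_inv {A : (Matrix (Fin 2) (Fin 2) K)ˣ} {v w : Fin 2 → K}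
    (h : planeDet (v ᵥ* A.val) w = 0) : planeDet (w ᵥ* A⁻¹.val) v = 0 := by
  have := planeDet_vecMul A⁻¹.val (v ᵥ* A.val) w
  rw [h, zero_mul, Matrix.vecMul_vecMul, Units.mul_inv, Matrix.vecMul_one] at this
  exact planeDet_comm_zero this

theorem MapsZeros.inv (h : SplitsAt F u) (h' : SplitsAt F' u')
    {A : (Matrix (Fin 2) (Fin 2) K)ˣ} (hA : MapsZeros A.val u u') : MapsZeros A⁻¹.val u' u := by
  obtain ⟨π, hπ⟩ := hA.bijective h h'
  intro j
  refine ⟨π.symm j, planeDet_vecMul_inv ?_⟩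
  simpa using hπ (π.symm j)

theorem zeroPt_congr {w w' : Fin 2 → K} (e : w = w') (hw : w ≠ 0) (h : aeval w F = 0) (hw' : w' ≠ 0)
    (h' : aeval w' F = 0) : zeroPt hF w hw h = zeroPt hF w' hw' h' := by
  subst e; rfl

theorem zeroPt_eq_of_planeDet {w w' : Fin 2 → K} (e : planeDet w w' = 0) (hw : w ≠ 0)
    (h : aeval w F = 0) (hw' : w' ≠ 0) (h' : aeval w' F = 0) :
    zeroPt hF w hw h = zeroPt hF w' hw' h' := by
  obtain ⟨c, hc⟩ := exists_smul_of_planeDet hw e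
  exact (zeroPt_smul hF w w' hw h hw' h' c hc).symm

theorem planeDet_eq_zero_of_zeroPt_eq {w w' : Fin 2 → K} {hw : w ≠ 0}
    {h : aeval w F = 0} {hw' : w' ≠ 0} {h' : aeval w' F = 0}
    (e : zeroPt hF w hw h = zeroPt hF w' hw' h') : planeDet w w' = 0 := by
  obtain ⟨c, rfl⟩ := exists_smul_of_zeroPt_eq hF e
  simpa [planeDet_self] using planeDet_smul_smul 1 c w w

theorem aeval_vecMul_of_mem {A : Matrix (Fin 2) (Fin 2) L} (hA : substHom A F' ∈ Ideal.span {F})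
    {w : Fin 2 → K} (hw : aeval w F = 0) : aeval (w ᵥ* A.map (algebraMap L K)) F' = 0 := by
  obtain ⟨q, hq⟩ := Ideal.mem_span_singleton.mp hA
  rw [← aeval_substHom, hq, _root_.map_mul, hw, zero_mul]

/-- Only the effect on the zeros counts: with two zeros, matrices giving the same morphism need not
be proportional. -/
theorem SplitsAt.substMap_eq_iff [IsSepClosure L K] (h : SplitsAt F u)
    {A A' : (Matrix (Fin 2) (Fin 2) L)ˣ} {hA : substHom A.val F' ∈ Ideal.span {F}}
    {hA' : substHom A'.val F' ∈ Ideal.span {F}} :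
    substMap hF' hF A hA = substMap hF' hF A' hA' ↔
      ∀ i, planeDet (u i ᵥ* A.val.map (algebraMap L K)) (u i ᵥ* A'.val.map (algebraMap L K)) = 0 :=
        by
  have key := fun i (A : (Matrix (Fin 2) (Fin 2) L)ˣ) hA => zeroPt_substMap hF' hF A hA (u i)
    (h.ne_zero i) (h.aeval_eq_zero i)
    (map_unit_ne_zero A (h.ne_zero i)) (aeval_vecMul_of_mem hA (h.aeval_eq_zero i))
  constructor
  · intro e i
    have h1 := key i A hA
    rw [e, key i A' hA'] at h1
    exact planeDet_comm_zero (planeDet_eq_zero_of_zeroPt_eq h1)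
  · intro e
    have : (projForm F' hF').IsSeparated := inferInstanceAs (Proj _).IsSeparated
    refine h.hom_ext hF fun i => ?_
    rw [key, key]
    exact zeroPt_eq_of_planeDet (e i) _ _ _ _

theorem SplitsAt.substMap_comp_inv [IsSepClosure L K] (h : SplitsAt F u)
    (A : (Matrix (Fin 2) (Fin 2) L)ˣ) (hA : substHom A.val F' ∈ Ideal.span {F})
    (hA' : substHom A⁻¹.val F ∈ Ideal.span {F'}) :
    substMap hF' hF A hA ≫ substMap hF hF' A⁻¹ hA' = 𝟙 _ := by
  have : (projForm F hF).IsSeparated := inferInstanceAs (Proj _).IsSeparated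
  refine h.hom_ext hF fun i => ?_
  have h1 := aeval_vecMul_of_mem hA (h.aeval_eq_zero i)
  rw [← Category.assoc, zeroPt_substMap hF' hF A hA (u i) _ _ (map_unit_ne_zero A (h.ne_zero i)) h1,
    zeroPt_substMap hF hF' A⁻¹ hA' _ _ _ (map_unit_ne_zero _ (map_unit_ne_zero A (h.ne_zero i)))
      (aeval_vecMul_of_mem hA' h1), Category.comp_id]
  refine zeroPt_congr ?_ _ _ _ _
  rw [Matrix.vecMul_vecMul, ← Matrix.map_mul, Units.mul_inv]
  simp

/-- The isomorphism between the zero schemes of two forms given by a projectivity. -/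
def formIso [IsSepClosure L K] (h : SplitsAt F u) (h' : SplitsAt F' u')
    (A : (Matrix (Fin 2) (Fin 2) L)ˣ) (hA : substHom A.val F' ∈ Ideal.span {F})
    (hA' : substHom A⁻¹.val F ∈ Ideal.span {F'}) : projFormOver F hF ≅ projFormOver F' hF' :=
  Over.isoMk ⟨substMap hF' hF A hA, substMap hF hF' A⁻¹ hA', h.substMap_comp_inv A hA hA', by
    have := h'.substMap_comp_inv (hF := hF') (hF' := hF) A⁻¹ hA' (by rwa [inv_inv])
    simp only [inv_inv] at this
    exact this⟩ (substMap_over _ _ _ _)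

theorem map_inv_unit (A : (Matrix (Fin 2) (Fin 2) L)ˣ) : (A⁻¹).val.map (algebraMap L K) =
    ((mapUnit K A)⁻¹).val := by
  rw [mapUnit, ← map_inv]; rfl

theorem MapsZeros.substHom_inv_mem [IsSepClosure L K] (h : SplitsAt F u) (h' : SplitsAt F' u')
    {A : (Matrix (Fin 2) (Fin 2) L)ˣ} (hA : MapsZeros (A.val.map (algebraMap L K)) u u') :
    substHom A⁻¹.val F ∈ Ideal.span {F'} := by
  refine MapsZeros.substHom_mem h' h ?_
  rw [map_inv_unit]
  exact MapsZeros.inv h h' hA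

theorem SplitsAt.exists_zeroPt_comp (h : SplitsAt F u) (h' : SplitsAt F' u')
    (φ : projForm F hF ⟶ projForm F' hF')
    (hφ : φ ≫ (projFormOver F' hF').hom = (projFormOver F hF).hom) (i : Fin n) :
    ∃ j, zeroPt hF (u i) (h.ne_zero i) (h.aeval_eq_zero i) ≫ φ =
      zeroPt hF' (u' j) (h'.ne_zero j) (h'.aeval_eq_zero j) := by
  obtain ⟨w, hw, hw0, e⟩ := exists_eq_zeroPt hF'
    (zeroPt hF (u i) (h.ne_zero i) (h.aeval_eq_zero i) ≫ φ)
    ((Category.assoc _ _ _).trans ((congrArg (_ ≫ ·) hφ).trans (zeroPt_over hF _ _ _)))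
  obtain ⟨j, hj⟩ := h'.exists_planeDet hw0
  exact ⟨j, e.trans (zeroPt_eq_of_planeDet (planeDet_comm_zero hj) _ _ _ _)⟩

/-- Every isomorphism between the zero schemes of two forms of degree two or three is given by a
projectivity. -/
theorem SplitsAt.exists_eq_substMap [IsSepClosure L K] (hn : n = 2 ∨ n = 3) (h : SplitsAt F u)
    (h' : SplitsAt F' u') (φ : projForm F hF ⟶ projForm F' hF') [Mono φ]
    (hφ : φ ≫ (projFormOver F' hF').hom = (projFormOver F hF).hom) :
    ∃ (A : (Matrix (Fin 2) (Fin 2) L)ˣ) (hA : MapsZeros (A.val.map (algebraMap L K)) u u'),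
      φ = substMap hF' hF A (hA.substHom_mem h h') := by
  choose π hπ using h.exists_zeroPt_comp h' φ hφ
  have hinj : Function.Injective π := fun i j hij => by
    by_contra hne
    refine h.det_ne_zero i j hne ?_
    have h1 := hπ i
    rw [zeroPt_congr (congrArg u' hij) _ _ (h'.ne_zero _) (h'.aeval_eq_zero _), ← hπ j,
      cancel_mono] at h1
    exact planeDet_eq_zero_of_zeroPt_eq h1
  have hcomp : ∀ (σ : K ≃ₐ[L] K) {v : Fin 2 → K}, v ≠ 0 → ⇑σ ∘ v ≠ 0 := fun σ v hv h =>
    hv (funext fun i => by simpa using congrFun h i)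
  have hroot : ∀ (σ : K ≃ₐ[L] K) {G : MvPolynomial (Fin 2) L} {v : Fin 2 → K}, aeval v G = 0 →
      aeval (⇑σ ∘ v) G = 0 := fun σ G v hv => by
    have : aeval (⇑σ ∘ v) G = σ (aeval v G) := by
      have : (aeval (⇑σ ∘ v) : MvPolynomial (Fin 2) L →ₐ[L] K) = (σ : K →ₐ[L] K).comp (aeval v) :=
        by
        ext i; simp
      rw [this]; rfl
    rw [this, hv, map_zero]
  -- The restriction to two or three zeros enters here. The morphism is defined over `L`, so it
  -- commutes with the Galois action on zeros and is matched by a rational projectivity.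
  obtain ⟨A, hA⟩ := exists_rational_projectivity (L := L) hn h.ne_zero
    (fun i => h'.ne_zero (π i)) h.det_ne_zero
    (fun i j hij => h'.det_ne_zero _ _ (hinj.ne hij)) (fun σ i => by
      have h1 := hroot σ (h.aeval_eq_zero i)
      obtain ⟨j, hj⟩ := h.exists_planeDet h1
      refine ⟨j, planeDet_comm_zero hj, ?_⟩
      have h2 : zeroPt hF (⇑σ ∘ u i) (hcomp σ (h.ne_zero i)) h1 ≫ φ =
          zeroPt hF' (⇑σ ∘ u' (π i)) (hcomp σ (h'.ne_zero _)) (hroot σ (h'.aeval_eq_zero _)) := by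
        have e1 : zeroPt hF (⇑σ ∘ u i) (hcomp σ (h.ne_zero i)) h1 = _ :=
          (specMap_zeroPt hF (σ : K →ₐ[L] K) (u i) (h.ne_zero i) (h.aeval_eq_zero i)
            (hcomp σ (h.ne_zero i)) h1).symm
        rw [e1, Category.assoc, hπ i]
        exact specMap_zeroPt hF' (σ : K →ₐ[L] K) _ _ _ _ _
      rw [zeroPt_eq_of_planeDet (planeDet_comm_zero hj) _ _ (h.ne_zero j) (h.aeval_eq_zero j),
        hπ j] at h2
      exact planeDet_comm_zero (planeDet_eq_zero_of_zeroPt_eq h2))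
  have hA' : MapsZeros (A.val.map (algebraMap L K)) u u' := fun i => ⟨π i, hA i⟩
  refine ⟨A, hA', ?_⟩
  have : (projForm F' hF').IsSeparated := inferInstanceAs (Proj _).IsSeparated
  refine h.hom_ext hF fun i => ?_
  refine (hπ i).trans ?_
  rw [zeroPt_substMap hF' hF A _ (u i) (h.ne_zero i) (h.aeval_eq_zero i)
    (map_unit_ne_zero A (h.ne_zero i)) (aeval_vecMul_of_mem (hA'.substHom_mem h h')
      (h.aeval_eq_zero i))]
  exact zeroPt_eq_of_planeDet (planeDet_comm_zero (hA i)) _ _ _ _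

end FormIso

end HermitianPairs

end

/-! ### Pencils and functoriality of the Pfaffian -/

noncomputable section
namespace HermitianPairs
open MvPolynomial
open scoped Quaternion Matrix
attribute [local instance] MvPolynomial.gradedAlgebra

variable {k : Type u} [Field k] {Q : QuatAlg k} {n : ℕ}

/-- The matrix `x(v) = x₁ v₁ + x₂ v₂`. -/
def pencil {R : Type u} [CommRing R] [Algebra k R] (x : Amb Q n R) (v : Fin 2 → R) :
    Matrix (Fin n) (Fin n) (Q.alg R) := ∑ i, v i • x i

section Ring

variable {R S : Type u} [CommRing R] [Algebra k R] [CommRing S] [Algebra k S]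

theorem QuatAlg.map_star (φ : R →ₐ[k] S) (q : Q.alg R) : Q.map φ (star q) = star (Q.map φ q) := by
  ext <;> simp [QuatAlg.map]

theorem qNorm_map (φ : R →ₐ[k] S) (q : Q.alg R) : qNorm Q (Q.map φ q) = φ (qNorm Q q) := by
  rw [qNorm, ← QuatAlg.map_star, ← _root_.map_mul]
  rfl

theorem qTrace_map (φ : R →ₐ[k] S) (q : Q.alg R) : qTrace Q (Q.map φ q) = φ (qTrace Q q) := by
  rw [qTrace, ← QuatAlg.map_star, ← _root_.map_add]
  rfl

theorem pfaff_map (φ : R →ₐ[k] S) : ∀ (n : ℕ) (x : Matrix (Fin n) (Fin n) (Q.alg R)),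
    pfaff Q n (x.map (Q.map φ)) = φ (pfaff Q n x)
  | 0, _ => (map_zero φ).symm
  | 1, _ => (map_zero φ).symm
  | 2, x => by
    simp only [pfaff, Matrix.map_apply, qNorm_map, _root_.map_sub, _root_.map_mul]
    rfl
  | 3, x => by
    simp only [pfaff, Matrix.map_apply, qNorm_map, ← _root_.map_mul, qTrace_map, _root_.map_sub,
      _root_.map_add]
    simp only [_root_.map_mul]
    rfl
  | (n + 4), _ => (map_zero φ).symm

theorem QuatAlg.map_smul (φ : R →ₐ[k] S) (r : R) (q : Q.alg R) :
    Q.map φ (r • q) = φ r • Q.map φ q := by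
  ext <;> simp [QuatAlg.map]

theorem pencil_map (φ : R →ₐ[k] S) (x : Amb Q n R) (v : Fin 2 → R) :
    (pencil x v).map (Q.map φ) = pencil (Amb.map φ x) (φ ∘ v) := by
  ext1 i j
  simp only [pencil, Matrix.map_apply, Matrix.sum_apply, Matrix.smul_apply, _root_.map_sum,
    QuatAlg.map_smul, Amb.map, Function.comp_apply]

theorem Amb.map_comp {T : Type u} [CommRing T] [Algebra k T] (φ : R →ₐ[k] S) (ψ : S →ₐ[k] T)
    (x : Amb Q n R) : Amb.map ψ (Amb.map φ x) = Amb.map (ψ.comp φ) x := rfl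

/-- The generic matrix is the pencil at the universal vector `X`, and the Pfaffian commutes with
specialisation of the variables. -/
theorem aeval_formF [Algebra R S] [IsScalarTower k R S] (x : Amb Q n R) (v : Fin 2 → S) :
    aeval v (formF x) = pfaff Q n (pencil (Amb.map (IsScalarTower.toAlgHom k R S) x) v) := by
  have h := pfaff_map (Q := Q) ((aeval v : MvPolynomial (Fin 2) R →ₐ[R] S).restrictScalars k) n
    (genericMatrix x)
  have e : (genericMatrix x).map
      (Q.map ((aeval v : MvPolynomial (Fin 2) R →ₐ[R] S).restrictScalars k)) =
      pencil (Amb.map (IsScalarTower.toAlgHom k R S) x) v := by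
    change (pencil (Amb.map (IsScalarTower.toAlgHom k R (MvPolynomial (Fin 2) R)) x) X).map _ = _
    rw [pencil_map, Amb.map_comp]
    congr 1
    · congr 1
      ext r
      simp
    · funext i
      simp
  rw [e] at h
  exact h.symm

theorem map_formF [Algebra R S] [IsScalarTower k R S] (x : Amb Q n R) :
    MvPolynomial.map (algebraMap R S) (formF x) =
      formF (Amb.map (IsScalarTower.toAlgHom k R S) x) := by
  let φ : MvPolynomial (Fin 2) R →ₐ[k] MvPolynomial (Fin 2) S :=
    MvPolynomial.mapAlgHom (IsScalarTower.toAlgHom k R S)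
  have h := pfaff_map (Q := Q) φ n (genericMatrix x)
  have e : (genericMatrix x).map (Q.map φ) =
      genericMatrix (Amb.map (IsScalarTower.toAlgHom k R S) x) := by
    change (pencil (Amb.map (IsScalarTower.toAlgHom k R (MvPolynomial (Fin 2) R)) x) X).map _ =
      pencil _ _
    rw [pencil_map, Amb.map_comp, Amb.map_comp]
    congr 1
    · congr 1
      ext r : 1
      simp [φ]
    · funext i
      simp [φ]
  rw [e] at h
  exact h.symm

theorem qNorm_eq (q : Q.alg R) : qNorm Q q = q.re ^ 2 + algebraMap k R Q.b * q.re * q.imI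
    - algebraMap k R Q.a * q.imI ^ 2 - algebraMap k R Q.c * q.imJ ^ 2
    - algebraMap k R Q.c * algebraMap k R Q.b * q.imJ * q.imK
    + algebraMap k R Q.a * algebraMap k R Q.c * q.imK ^ 2 := by
  simp [qNorm]
  ring

/-- In terms of pencils, `GL_n` acts by congruence and `GL_2` by a substitution in `v`; the two
components can be handled separately. -/
theorem pencil_smul (g : Grp Q n R) (x : Amb Q n R) (v : Fin 2 → R) :
    pencil (g • x) v = g.fst * pencil x (v ᵥ* g.snd) * g.fstᴴ := by
  have key : pencil x (v ᵥ* g.snd) = ∑ i, v i • ∑ j, g.snd i j • x j := by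
    simp only [pencil, Fin.sum_univ_two, Matrix.vecMul, dotProduct, smul_add, add_smul, smul_smul]
    abel
  rw [key]
  simp only [Matrix.mul_sum, Matrix.sum_mul]
  refine Finset.sum_congr rfl fun i _ => ?_
  rw [Matrix.mul_smul, Matrix.smul_mul]
  congr 1

end Ring

end HermitianPairs
end

/-! ### Splitting of the quaternion algebra; congruence of Hermitian matrices -/

noncomputable section
namespace HermitianPairs
open MvPolynomial
open scoped Quaternion Matrix
attribute [local instance] MvPolynomial.gradedAlgebra

variable {k : Type u} [Field k] {Q : QuatAlg k} {n : ℕ}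

section Ring
variable {R : Type u} [CommRing R] [Algebra k R]

theorem mul_star_eq (q : Q.alg R) : q * star q = algebraMap R _ (qNorm Q q) := by
  ext <;> simp [qNorm] <;> ring

theorem star_mul_self_eq (q : Q.alg R) : star q * q = algebraMap R _ (qNorm Q q) := by
  ext <;> simp [qNorm] <;> ring

theorem qNorm_mul (p q : Q.alg R) : qNorm Q (p * q) = qNorm Q p * qNorm Q q := by
  have h : p * q * star (p * q) = algebraMap R _ (qNorm Q p * qNorm Q q) := by
    rw [star_mul, mul_assoc, ← mul_assoc q, mul_star_eq q, ← mul_assoc, ← Algebra.commutes,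
      mul_assoc, mul_star_eq, ← _root_.map_mul, mul_comm]
  rw [mul_star_eq] at h
  simpa using congrArg QuaternionAlgebra.re h

theorem qNorm_star (q : Q.alg R) : qNorm Q (star q) = qNorm Q q := by
  simp [qNorm]; ring

theorem qTrace_mul_comm (p q : Q.alg R) : qTrace Q (p * q) = qTrace Q (q * p) := by
  simp [qTrace]; ring

theorem qTrace_algebraMap_mul (r : R) (q : Q.alg R) :
    qTrace Q (algebraMap R _ r * q) = r * qTrace Q q := by
  simp [qTrace]; ring

end Ring

section Split
variable {M : Type u} [Field M] [Algebra k M]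

/-- The isomorphism of a quaternion algebra with the algebra of `2 × 2` matrices, when the
polynomial `X² - b X - a` splits. -/
def splitEquiv {r s : M} (h₁ : r + s = algebraMap k M Q.b) (h₂ : r * s = -algebraMap k M Q.a)
    (hne : r ≠ s) : Q.alg M ≃ₐ[M] Matrix (Fin 2) (Fin 2) M where
  -- The generator `i` goes to the diagonal matrix with entries `r`, `s`, and `j` to the matrix with
  -- rows `(0, c)` and `(1, 0)`.
  toFun q := !![q.re + r * q.imI, algebraMap k M Q.c * (q.imJ + r * q.imK);
    q.imJ + s * q.imK, q.re + s * q.imI]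
  invFun m := ⟨m 0 0 - r * ((m 0 0 - m 1 1) / (r - s)), (m 0 0 - m 1 1) / (r - s),
    m 1 0 - s * ((m 0 1 / algebraMap k M Q.c - m 1 0) / (r - s)),
    (m 0 1 / algebraMap k M Q.c - m 1 0) / (r - s)⟩
  left_inv q := by
    have hc : algebraMap k M Q.c ≠ 0 := by simpa using Q.c_ne_zero
    have h := sub_ne_zero.mpr hne
    ext <;> simp <;> field_simp <;> ring
  right_inv m := by
    have hc : algebraMap k M Q.c ≠ 0 := by simpa using Q.c_ne_zero
    have h := sub_ne_zero.mpr hne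
    ext i j
    fin_cases i <;> fin_cases j <;> simp <;> field_simp <;> ring
  map_mul' p q := by
    have e : algebraMap k M Q.a = -(r * s) := by rw [h₂, neg_neg]
    ext i j
    fin_cases i <;> fin_cases j <;> simp [Matrix.mul_apply, Fin.sum_univ_two, e, ← h₁] <;> ring
  map_add' p q := by
    ext i j
    fin_cases i <;> fin_cases j <;> simp <;> ring
  commutes' c := by
    ext i j
    fin_cases i <;> fin_cases j <;> simp [Matrix.algebraMap_matrix_apply]

/-- The polynomial `X² - b X - a` has discriminant `b² + 4 a ≠ 0`, so in every characteristic it has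
two distinct roots in a separably closed field. -/
theorem exists_splitting (Q : QuatAlg k) (M : Type u) [Field M] [Algebra k M] [IsSepClosed M] :
    ∃ ψ : Q.alg M ≃ₐ[M] Matrix (Fin 2) (Fin 2) M, ∀ q, (ψ q).det = qNorm Q q := by
  obtain ⟨r, s, h₁, h₂, hne⟩ : ∃ r s : M, r + s = algebraMap k M Q.b ∧
      r * s = -algebraMap k M Q.a ∧ r ≠ s := by
    set a := algebraMap k M Q.a
    set b := algebraMap k M Q.b
    have hd : b ^ 2 + 4 * a ≠ 0 := by
      have := (map_ne_zero (algebraMap k M)).mpr Q.disc_ne_zero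
      rwa [_root_.map_add, map_pow, _root_.map_mul, map_ofNat] at this
    let f : Polynomial M := Polynomial.X ^ 2 - Polynomial.C b * Polynomial.X - Polynomial.C a
    have hdeg : f.degree = 2 := by simp only [f]; compute_degree!
    have hsep : f.Separable := by
      -- Bézout coefficients from `(2 X - b)² - 4 f = b² + 4 a`.
      refine ⟨-Polynomial.C (4 / (b ^ 2 + 4 * a)),
        Polynomial.C (1 / (b ^ 2 + 4 * a)) * (2 * Polynomial.X - Polynomial.C b), ?_⟩
      have hder : Polynomial.derivative f = 2 * Polynomial.X - Polynomial.C b := by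
        simp only [f]
        simp
        exact one_add_one_eq_two
      have e : Polynomial.C (4 / (b ^ 2 + 4 * a)) =
          (4 : Polynomial M) * Polynomial.C (1 / (b ^ 2 + 4 * a)) := by
        rw [show (4 : Polynomial M) = Polynomial.C 4 from rfl, ← Polynomial.C_mul]
        congr 1
        ring
      have e2 : Polynomial.C (1 / (b ^ 2 + 4 * a)) * (Polynomial.C b ^ 2 + 4 * Polynomial.C a) =
          (1 : Polynomial M) := by
        rw [show (4 : Polynomial M) = Polynomial.C 4 from rfl, ← Polynomial.C_pow,
          ← Polynomial.C_mul, ← Polynomial.C_add, ← Polynomial.C_mul, one_div,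
          inv_mul_cancel₀ hd, Polynomial.C_1]
      rw [hder, e]
      simp only [f]
      linear_combination e2
    obtain ⟨r, hr⟩ := IsSepClosed.exists_root f (by rw [hdeg]; decide) hsep
    have hr' : r ^ 2 - b * r - a = 0 := by simpa [f, Polynomial.IsRoot] using hr
    refine ⟨r, b - r, by ring, by linear_combination -hr', fun h => hd ?_⟩
    linear_combination (-4) * hr' + (2 * r - b) * 2 * h - (2 * r - b) * h
  refine ⟨splitEquiv h₁ h₂ hne, fun q => ?_⟩
  have e : algebraMap k M Q.a = -(r * s) := by rw [h₂, neg_neg]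
  rw [qNorm_eq, Matrix.det_fin_two]
  simp only [splitEquiv, AlgEquiv.coe_mk, Equiv.coe_fn_mk, e, ← h₁]
  simp
  ring

end Split

section Pfaffian
variable {R : Type u} [CommRing R] [Algebra k R]

theorem IsHerm.apply_eq {x : Matrix (Fin n) (Fin n) (Q.alg R)} (h : IsHerm Q n R x) (i j) :
    x i j = star (x j i) := by
  conv_lhs => rw [← h.1]
  rfl

theorem IsHerm.diag_eq {x : Matrix (Fin n) (Fin n) (Q.alg R)} (h : IsHerm Q n R x) (i) :
    x i i = algebraMap R _ (x i i).re := by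
  obtain ⟨r, hr⟩ := h.2 i
  rw [hr]; simp

/-- The terms cancel in pairs; the diagonal ones are assumed to vanish separately, as nothing is
known about division by two. -/
theorem sum_sum_eq_zero_of_alternating {A : Type*} [AddCommGroup A] (f : Fin n → Fin n → A)
    (h : ∀ i j, f i j + f j i = 0) (h' : ∀ i, f i i = 0) : ∑ i, ∑ j, f i j = 0 := by
  rw [← Fintype.sum_prod_type']
  refine Finset.sum_involution (fun p _ => p.swap) (fun p _ => h _ _) (fun p _ hp e => hp ?_)
    (fun _ _ => Finset.mem_univ _) (fun p _ => p.swap_swap)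
  have : p.2 = p.1 := congrArg Prod.fst e
  rw [this, h']

/-- In characteristic two the scalar diagonal needs an argument: a diagonal entry of `g * x * gᴴ` is
a sum of terms `q + star q` and of scalar multiples of reduced norms, all of which are scalars. -/
theorem IsHerm.conj {x : Matrix (Fin n) (Fin n) (Q.alg R)} (h : IsHerm Q n R x)
    (g : Matrix (Fin n) (Fin n) (Q.alg R)) : IsHerm Q n R (g * x * gᴴ) := by
  refine ⟨by simp only [Matrix.conjTranspose_mul, Matrix.conjTranspose_conjTranspose, h.1,
    mul_assoc], fun i => ?_⟩
  have e : (g * x * gᴴ) i i = ∑ l, ∑ j, g i j * x j l * star (g i l) := by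
    simp only [Matrix.mul_apply, Matrix.conjTranspose_apply, Finset.sum_mul]
  have hs : ∀ j l, g i j * x j l * star (g i l) = star (g i l * x l j * star (g i j)) := by
    intro j l
    rw [h.apply_eq j l]
    simp only [star_mul, star_star, mul_assoc]
  have hd : ∀ j, g i j * x j j * star (g i j) =
      algebraMap R _ ((x j j).re * qNorm Q (g i j)) := by
    intro j
    rw [h.diag_eq j, ← Algebra.commutes, mul_assoc, mul_star_eq, ← _root_.map_mul]
    simp
  refine ⟨((g * x * gᴴ) i i).re, ?_⟩
  -- Each imaginary coordinate is an additive map of this kind: it kills the scalars and every `q +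
  -- star q`.
  have key : ∀ f : Q.alg R →+ R, (∀ q, f q + f (star q) = 0) → (∀ r, f (algebraMap R _ r) = 0) →
      f ((g * x * gᴴ) i i) = 0 := by
    intro f hf hf'
    rw [e]
    simp only [_root_.map_sum]
    refine sum_sum_eq_zero_of_alternating _ (fun l j => ?_) (fun j => by rw [hd, hf'])
    rw [hs j l, add_comm, hf]
  ext
  · simp
  · refine (key ⟨⟨QuaternionAlgebra.imI, rfl⟩, fun _ _ => rfl⟩ ?_ ?_).trans ?_ <;> simp
  · refine (key ⟨⟨QuaternionAlgebra.imJ, rfl⟩, fun _ _ => rfl⟩ ?_ ?_).trans ?_ <;> simp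
  · refine (key ⟨⟨QuaternionAlgebra.imK, rfl⟩, fun _ _ => rfl⟩ ?_ ?_).trans ?_ <;> simp

theorem IsHerm.smul {x : Matrix (Fin n) (Fin n) (Q.alg R)} (h : IsHerm Q n R x) (r : R) :
    IsHerm Q n R (r • x) := by
  refine ⟨?_, fun i => ?_⟩
  · ext1 i j
    rw [Matrix.conjTranspose_apply, Matrix.smul_apply, Matrix.smul_apply, h.apply_eq i j]
    ext <;> simp
  · obtain ⟨s, hs⟩ := h.2 i
    exact ⟨r * s, by rw [Matrix.smul_apply, hs, Algebra.smul_def, ← _root_.map_mul]⟩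

theorem IsHerm.add {x y : Matrix (Fin n) (Fin n) (Q.alg R)} (h : IsHerm Q n R x)
    (h' : IsHerm Q n R y) : IsHerm Q n R (x + y) := by
  refine ⟨by rw [Matrix.conjTranspose_add, h.1, h'.1], fun i => ?_⟩
  obtain ⟨r, hr⟩ := h.2 i
  obtain ⟨s, hs⟩ := h'.2 i
  exact ⟨r + s, by rw [Matrix.add_apply, hr, hs, ← _root_.map_add]⟩

end Pfaffian

end HermitianPairs
end

/-! ### The Pfaffian under congruence -/

noncomputable section
namespace HermitianPairs
open MvPolynomial
open scoped Quaternion Matrix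
attribute [local instance] MvPolynomial.gradedAlgebra

variable {k : Type u} [Field k] {Q : QuatAlg k} {n : ℕ}
section Pfaffian
variable {R : Type u} [CommRing R] [Algebra k R]

theorem pfaff_eq_of_isHerm {x : Matrix (Fin 3) (Fin 3) (Q.alg R)} (h : IsHerm Q 3 R x) :
    pfaff Q 3 x = (x 0 0).re * (x 1 1).re * (x 2 2).re
      + qTrace Q (x 0 1 * x 1 2 * star (x 0 2))
      - (x 0 0).re * qNorm Q (x 1 2) - (x 1 1).re * qNorm Q (x 0 2)
      - (x 2 2).re * qNorm Q (x 0 1) := by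
  rw [pfaff, h.apply_eq 2 0]

theorem pfaff_diagonal_conj (hn : n = 2 ∨ n = 3) (q : Fin n → Q.alg R)
    {x : Matrix (Fin n) (Fin n) (Q.alg R)} (h : IsHerm Q n R x) :
    pfaff Q n (Matrix.diagonal q * x * (Matrix.diagonal q)ᴴ) =
      (∏ i, qNorm Q (q i)) * pfaff Q n x := by
  have e : ∀ i j, (Matrix.diagonal q * x * (Matrix.diagonal q)ᴴ) i j =
      q i * x i j * star (q j) := by
    intro i j
    rw [Matrix.diagonal_conjTranspose, Matrix.mul_diagonal, Matrix.diagonal_mul]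
    rfl
  have d : ∀ i, (q i * x i i * star (q i)).re = qNorm Q (q i) * (x i i).re := by
    intro i
    rw [h.diag_eq i, ← Algebra.commutes, mul_assoc, mul_star_eq, ← _root_.map_mul]
    simp [mul_comm]
  rcases hn with rfl | rfl
  · simp only [pfaff, e, d, qNorm_mul, qNorm_star, Fin.prod_univ_two]
    ring
  -- The cyclic product telescopes because `star q * q` is a central scalar.
  · have t : q 0 * x 0 1 * star (q 1) * (q 1 * x 1 2 * star (q 2)) * (q 2 * x 2 0 * star (q 0)) =
        algebraMap R _ (qNorm Q (q 1) * qNorm Q (q 2)) *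
          (q 0 * (x 0 1 * x 1 2 * x 2 0 * star (q 0))) := by
      calc _ = q 0 * x 0 1 * (star (q 1) * q 1) * x 1 2 * (star (q 2) * q 2) * x 2 0 *
            star (q 0) := by simp only [mul_assoc]
        _ = _ := by
          rw [star_mul_self_eq, star_mul_self_eq, ← Algebra.commutes, ← Algebra.commutes,
            mul_comm (qNorm Q (q 1)), _root_.map_mul]
          simp only [mul_assoc]
    simp only [pfaff, e, d, qNorm_mul, qNorm_star, Fin.prod_univ_three, t,
      qTrace_algebraMap_mul]
    rw [qTrace_mul_comm, mul_assoc _ (star (q 0)), star_mul_self_eq, ← Algebra.commutes,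
      qTrace_algebraMap_mul]
    ring

theorem transvection_conj_apply {ι : Type*} [Fintype ι] [DecidableEq ι] (i j : ι) (s : Q.alg R)
    (x : Matrix ι ι (Q.alg R)) (a b : ι) :
    ((1 + Matrix.single i j s : Matrix ι ι (Q.alg R)) * x *
      (1 + Matrix.single i j s : Matrix ι ι (Q.alg R))ᴴ : Matrix ι ι (Q.alg R)) a b =
      x a b + (if a = i then s * x j b else 0) + (if b = i then x a j * star s else 0) +
        (if a = i ∧ b = i then s * x j j * star s else 0) := by
  have e : ∀ y : Matrix ι ι (Q.alg R), ∀ a b,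
      ((1 + Matrix.single i j s : Matrix ι ι (Q.alg R)) * y : Matrix ι ι (Q.alg R)) a b =
      y a b + if a = i then s * y j b else 0 := by
    intro y a b
    rw [add_mul, one_mul, Matrix.add_apply]
    congr 1
    split_ifs with h
    · rw [h, Matrix.single_mul_apply_same]
    · rw [Matrix.single_mul_apply_of_ne _ _ _ _ _ h]
  have e' : ∀ y : Matrix ι ι (Q.alg R), ∀ a b,
      (y * (1 + Matrix.single i j s : Matrix ι ι (Q.alg R))ᴴ : Matrix ι ι (Q.alg R)) a b =
      y a b + if b = i then y a j * star s else 0 := by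
    intro y a b
    rw [Matrix.conjTranspose_add, Matrix.conjTranspose_one, Matrix.conjTranspose_single, mul_add,
      mul_one, Matrix.add_apply]
    congr 1
    split_ifs with h
    · rw [h, Matrix.mul_single_apply_same]
    · rw [Matrix.mul_single_apply_of_ne _ _ _ _ _ h]
  rw [e', e, e]
  by_cases ha : a = i <;> by_cases hb : b = i <;>
    (simp [ha, hb, add_mul]; try abel)

set_option maxHeartbeats 4000000 in
-- A polynomial identity in the quaternion coordinates, checked for each pair of indices. The scalar
-- diagonal of `x` is used.
theorem pfaff_transvection_conj (hn : n = 2 ∨ n = 3) {i j : Fin n} (hij : i ≠ j) (s : Q.alg R)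
    {x : Matrix (Fin n) (Fin n) (Q.alg R)} (h : IsHerm Q n R x) :
    pfaff Q n ((1 + Matrix.single i j s) * x * (1 + Matrix.single i j s)ᴴ) = pfaff Q n x := by
  rcases hn with rfl | rfl
  · have h10 := h.apply_eq 1 0
    obtain ⟨α, h0⟩ := h.2 0
    obtain ⟨β, h1⟩ := h.2 1
    have hi : i = 0 ∨ i = 1 := by fin_cases i <;> simp
    have hj : j = 0 ∨ j = 1 := by fin_cases j <;> simp
    rcases hi with rfl | rfl <;> rcases hj with rfl | rfl <;>
      first | exact absurd rfl hij | skip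
    all_goals
      simp only [pfaff, transvection_conj_apply, h10, h0, h1]
      generalize x 0 1 = p
      simp [qNorm_eq]
      ring
  · rw [pfaff_eq_of_isHerm h, pfaff_eq_of_isHerm (h.conj _)]
    have h10 := h.apply_eq 1 0
    have h20 := h.apply_eq 2 0
    have h21 := h.apply_eq 2 1
    obtain ⟨α, h0⟩ := h.2 0
    obtain ⟨β, h1⟩ := h.2 1
    obtain ⟨γ, h2⟩ := h.2 2
    have hi : i = 0 ∨ i = 1 ∨ i = 2 := by fin_cases i <;> simp
    have hj : j = 0 ∨ j = 1 ∨ j = 2 := by fin_cases j <;> simp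
    rcases hi with rfl | rfl | rfl <;> rcases hj with rfl | rfl | rfl <;>
      first | exact absurd rfl hij | skip
    all_goals
      simp only [transvection_conj_apply, h10, h20, h21, h0, h1, h2]
      generalize x 0 1 = p
      generalize x 0 2 = q
      generalize x 1 2 = r
      simp only [Fin.isValue, Fin.reduceEq, if_true, if_false, and_true, and_false, add_zero]
      simp [qNorm_eq, qTrace]
      ring

theorem eq_diagonal_of_apply {ι : Type*} [DecidableEq ι] {A : Type*} [Zero A] {m : Matrix ι ι A}
    (h : ∀ i j, i ≠ j → m i j = 0) : m = Matrix.diagonal fun i => m i i := by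
  ext i j
  by_cases hij : i = j
  · subst hij; simp
  · rw [h i j hij, Matrix.diagonal_apply_ne _ hij]

end Pfaffian

section Split
variable {M : Type u} [Field M] [Algebra k M] [IsSepClosed M]

/-- Matrices over a split quaternion algebra are generated by block diagonal matrices and block
transvections. -/
theorem matrix_induction (P : Matrix (Fin n) (Fin n) (Q.alg M) → Prop)
    (hd : ∀ q, P (Matrix.diagonal q))
    (ht : ∀ i j s, i ≠ j → P (1 + Matrix.single i j s))
    (hm : ∀ g h, P g → P h → P (g * h)) (g : Matrix (Fin n) (Fin n) (Q.alg M)) : P g := by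
  obtain ⟨ψ, -⟩ := exists_splitting Q M
  let Ψ : Matrix (Fin n) (Fin n) (Q.alg M) ≃ₐ[M] Matrix (Fin n × Fin 2) (Fin n × Fin 2) M :=
    ψ.mapMatrix.trans (Matrix.compAlgEquiv (Fin n) (Fin 2) M M)
  have hΨ : ∀ m i j a b, Ψ m (i, a) (j, b) = ψ (m i j) a b := fun _ _ _ _ _ => rfl
  have hdiag : ∀ A, (∀ i j a b, i ≠ j → A (i, a) (j, b) = 0) → P (Ψ.symm A) := by
    intro A hA
    rw [eq_diagonal_of_apply (m := Ψ.symm A)]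
    · exact hd _
    · intro i j hij
      apply ψ.injective
      ext a b
      rw [← hΨ, Ψ.apply_symm_apply, hA i j a b hij, map_zero]
      rfl
  suffices H : ∀ A, P (Ψ.symm A) by
    rw [← Ψ.symm_apply_apply g]
    exact H _
  intro A
  refine Matrix.diagonal_transvection_induction (fun A => P (Ψ.symm A)) A (fun D _ => ?_)
    (fun t => ?_) (fun A B hA hB => ?_)
  · refine hdiag _ fun i j a b hij => Matrix.diagonal_apply_ne _ ?_
    simp [hij]
  · obtain ⟨⟨i, a⟩, ⟨j, b⟩, hne, c⟩ := t
    -- A transvection inside one block is a block diagonal matrix; one between two blocks is a block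
    -- transvection.
    by_cases hij : i = j
    · refine hdiag _ fun i' j' a' b' h => ?_
      subst hij
      simp only [Matrix.TransvectionStruct.toMatrix, Matrix.transvection, Matrix.add_apply]
      rw [Matrix.one_apply_ne (by simp [h]), zero_add, Matrix.single_apply, if_neg]
      rintro ⟨h1, h2⟩
      exact h ((congrArg Prod.fst h1).symm.trans (congrArg Prod.fst h2))
    · have e : Ψ.symm (Matrix.TransvectionStruct.toMatrix ⟨(i, a), (j, b), hne, c⟩) =
          1 + Matrix.single i j (ψ.symm (Matrix.single a b c)) := by
        rw [AlgEquiv.symm_apply_eq, _root_.map_add, map_one]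
        simp only [Matrix.TransvectionStruct.toMatrix, Matrix.transvection]
        congr 1
        ext ⟨i', a'⟩ ⟨j', b'⟩
        rw [hΨ, Matrix.single_apply, Matrix.single_apply]
        by_cases h : i = i' ∧ j = j'
        · rw [if_pos h, ψ.apply_symm_apply, Matrix.single_apply]
          simp [h.1, h.2]
        · rw [if_neg h, if_neg, map_zero]
          · rfl
          · rintro ⟨h1, h2⟩
            exact h ⟨congrArg Prod.fst h1, congrArg Prod.fst h2⟩
      rw [e]
      exact ht _ _ _ hij
  · rw [_root_.map_mul]
    exact hm _ _ hA hB

/-- Matrices multiplying the Pfaffian by a constant are closed under products, since congruence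
preserves Hermitian matrices; the generators of `matrix_induction` have this property. -/
theorem exists_pfaff_conj (hn : n = 2 ∨ n = 3) (g : Matrix (Fin n) (Fin n) (Q.alg M)) :
    ∃ c : M, ∀ x, IsHerm Q n M x → pfaff Q n (g * x * gᴴ) = c * pfaff Q n x := by
  refine matrix_induction (fun g => ∃ c : M, ∀ x, IsHerm Q n M x →
    pfaff Q n (g * x * gᴴ) = c * pfaff Q n x)
      (fun q => ⟨_, fun x hx => pfaff_diagonal_conj hn q hx⟩)
    (fun i j s hij => ⟨1, fun x hx => by rw [pfaff_transvection_conj hn hij s hx, one_mul]⟩) ?_ g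
  rintro g h ⟨c, hc⟩ ⟨d, hd⟩
  refine ⟨c * d, fun x hx => ?_⟩
  rw [mul_assoc c, ← hd x hx, ← hc _ (hx.conj h), Matrix.conjTranspose_mul]
  simp only [mul_assoc]

theorem isHerm_diagonal {R : Type u} [CommRing R] [Algebra k R] (a : Fin n → R) :
    IsHerm Q n R (Matrix.diagonal fun i => algebraMap R (Q.alg R) (a i)) := by
  refine ⟨?_, fun i => ⟨a i, Matrix.diagonal_apply_eq _ _⟩⟩
  rw [Matrix.diagonal_conjTranspose]
  congr 1
  funext i
  change star (algebraMap R (Q.alg R) (a i)) = _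
  ext <;> simp

theorem pfaff_diagonal {R : Type u} [CommRing R] [Algebra k R] (hn : n = 2 ∨ n = 3)
    (a : Fin n → R) : pfaff Q n (Matrix.diagonal fun i => algebraMap R (Q.alg R) (a i)) =
      ∏ i, a i := by
  rcases hn with rfl | rfl <;> simp [pfaff, qNorm, qTrace, Fin.prod_univ_three]

theorem exists_pfaff_unit_conj (hn : n = 2 ∨ n = 3) (g : (Matrix (Fin n) (Fin n) (Q.alg M))ˣ) :
    ∃ c : M, c ≠ 0 ∧
      ∀ x, IsHerm Q n M x → pfaff Q n (g.val * x * g.valᴴ) = c * pfaff Q n x := by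
  obtain ⟨c, hc⟩ := exists_pfaff_conj hn g.val
  obtain ⟨d, hd⟩ := exists_pfaff_conj hn g⁻¹.val
  refine ⟨c, ?_, hc⟩
  rintro rfl
  -- Test matrix for a vanishing factor: `g` carries the Hermitian matrix `g⁻¹ * (g⁻¹)ᴴ` to the
  -- identity, whose Pfaffian is one.
  have h1 : IsHerm Q n M 1 := by simpa using isHerm_diagonal (Q := Q) (n := n) (fun _ => (1 : M))
  have h := hc _ (h1.conj g⁻¹.val)
  rw [zero_mul] at h
  have e : g.val * (g⁻¹.val * 1 * g⁻¹.valᴴ) * g.valᴴ = 1 := by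
    rw [mul_one, ← mul_assoc, Units.mul_inv, one_mul, ← Matrix.conjTranspose_mul, Units.mul_inv,
      Matrix.conjTranspose_one]
  rw [e] at h
  have := pfaff_diagonal (Q := Q) hn (fun _ => (1 : M))
  simp [h] at this

end Split

end HermitianPairs
end

/-! ### Discriminants and splitting of binary quadratic and cubic forms -/

noncomputable section
namespace HermitianPairs
open MvPolynomial
open scoped Quaternion Matrix
attribute [local instance] MvPolynomial.gradedAlgebra

variable {n : ℕ}

section Coefficients
variable {R S : Type u} [CommRing R] [CommRing S]

theorem eq_sum_cf {F : MvPolynomial (Fin 2) R} (hF : F.IsHomogeneous n) :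
    F = ∑ i ∈ Finset.range (n + 1), C (cf F i (n - i)) * (X 0 ^ i * X 1 ^ (n - i)) := by
  have hm : ∀ (c : R) (i j : ℕ), C c * (X 0 ^ i * X 1 ^ j : MvPolynomial (Fin 2) R) =
      monomial (Finsupp.single 0 i + Finsupp.single 1 j) c := by
    intro c i j
    rw [X_pow_eq_monomial, X_pow_eq_monomial, monomial_mul, C_mul_monomial, mul_one, mul_one]
  ext m
  simp only [hm, coeff_sum, coeff_monomial]
  have hmm : m = Finsupp.single 0 (m 0) + Finsupp.single 1 (m 1) := by
    ext i; fin_cases i <;> simp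
  have hiff : ∀ i j : ℕ, (Finsupp.single (0 : Fin 2) i + Finsupp.single 1 j = m) ↔
      i = m 0 ∧ j = m 1 := by
    intro i j
    constructor
    · rintro rfl
      simp
    · rintro ⟨rfl, rfl⟩
      exact hmm.symm
  by_cases h : m 0 + m 1 = n
  · rw [Finset.sum_eq_single (m 0)]
    · rw [if_pos ((hiff _ _).mpr ⟨rfl, by omega⟩), cf, ← (hiff (m 0) (n - m 0)).mpr ⟨rfl, by omega⟩]
      simp
    · intro i _ hi
      rw [if_neg fun e => hi ((hiff _ _).mp e).1]
    · intro hm'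
      exact absurd (Finset.mem_range.mpr (by omega)) hm'
  · rw [Finset.sum_eq_zero, hF.coeff_eq_zero]
    · rw [Finsupp.degree_eq_sum, Fin.sum_univ_two]
      exact h
    · intro i hi
      rw [if_neg fun e => h ?_]
      have := (hiff _ _).mp e
      have := Finset.mem_range.mp hi
      omega

theorem cf_map (f : R →+* S) (F : MvPolynomial (Fin 2) R) (i j : ℕ) :
    cf (MvPolynomial.map f F) i j = f (cf F i j) := coeff_map _ _ _

theorem disc_map (f : R →+* S) (F : MvPolynomial (Fin 2) R) (hn : n = 2 ∨ n = 3) :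
    disc (MvPolynomial.map f F) n = f (disc F n) := by
  rcases hn with rfl | rfl <;>
    simp only [disc, cf_map, _root_.map_add, _root_.map_sub, _root_.map_mul, map_pow, map_ofNat]

theorem cf_monomial (c : R) (i j i' j' : ℕ) :
    cf (C c * (X 0 ^ i * X 1 ^ j : MvPolynomial (Fin 2) R)) i' j' =
      if i = i' ∧ j = j' then c else 0 := by
  rw [X_pow_eq_monomial, X_pow_eq_monomial, monomial_mul, C_mul_monomial, mul_one, mul_one, cf,
    coeff_monomial]
  congr 1
  refine propext ⟨fun h => ⟨?_, ?_⟩, fun h => by rw [h.1, h.2]⟩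
  · simpa using DFunLike.congr_fun h 0
  · simpa using DFunLike.congr_fun h 1

/-- The binary quadratic form with given coefficients. -/
def quadForm (p q r : R) : MvPolynomial (Fin 2) R :=
  C p * X 0 ^ 2 + C q * (X 0 * X 1) + C r * X 1 ^ 2

/-- The binary cubic form with given coefficients. -/
def cubForm (p q r s : R) : MvPolynomial (Fin 2) R :=
  C p * X 0 ^ 3 + C q * (X 0 ^ 2 * X 1) + C r * (X 0 * X 1 ^ 2) + C s * X 1 ^ 3

theorem cf_add (F G : MvPolynomial (Fin 2) R) (i j : ℕ) : cf (F + G) i j = cf F i j + cf G i j :=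
  coeff_add _ _ _

theorem disc_quadForm (p q r : R) : disc (quadForm p q r) 2 = q ^ 2 - 4 * p * r := by
  have e : quadForm p q r = C p * (X 0 ^ 2 * X 1 ^ 0) + C q * (X 0 ^ 1 * X 1 ^ 1) +
      C r * (X 0 ^ 0 * X 1 ^ 2) := by rw [quadForm]; ring
  simp only [disc, e, cf_add, cf_monomial]
  simp

theorem disc_cubForm (p q r s : R) : disc (cubForm p q r s) 3 = q ^ 2 * r ^ 2 - 4 * p * r ^ 3
    - 4 * q ^ 3 * s + 18 * p * q * r * s - 27 * p ^ 2 * s ^ 2 := by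
  have e : cubForm p q r s = C p * (X 0 ^ 3 * X 1 ^ 0) + C q * (X 0 ^ 2 * X 1 ^ 1) +
      C r * (X 0 ^ 1 * X 1 ^ 2) + C s * (X 0 ^ 0 * X 1 ^ 3) := by rw [cubForm]; ring
  simp only [disc, e, cf_add, cf_monomial]
  simp

theorem exists_eq_quadForm {F : MvPolynomial (Fin 2) R} (hF : F.IsHomogeneous 2) :
    ∃ p q r, F = quadForm p q r := by
  refine ⟨cf F 2 0, cf F 1 1, cf F 0 2, ?_⟩
  conv_lhs => rw [eq_sum_cf hF]
  simp [Finset.sum_range_succ, quadForm]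
  ring

theorem exists_eq_cubForm {F : MvPolynomial (Fin 2) R} (hF : F.IsHomogeneous 3) :
    ∃ p q r s, F = cubForm p q r s := by
  refine ⟨cf F 3 0, cf F 2 1, cf F 1 2, cf F 0 3, ?_⟩
  conv_lhs => rw [eq_sum_cf hF]
  simp [Finset.sum_range_succ, cubForm]
  ring

end Coefficients

section Roots
variable {M : Type u} [Field M] [IsSepClosed M]

theorem quadForm_eq_prod {p q r : M} (h : q ^ 2 - 4 * p * r ≠ 0) :
    ∃ c u w, c ≠ 0 ∧ u ≠ 0 ∧ w ≠ 0 ∧ planeDet u w ≠ 0 ∧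
      quadForm p q r = C c * (linForm u * linForm w) := by
  have ne : ∀ u w : Fin 2 → M, planeDet u w ≠ 0 → u ≠ 0 ∧ w ≠ 0 := by
    refine fun u w h => ⟨?_, ?_⟩ <;> rintro rfl <;> simp [planeDet] at h
  suffices H : ∃ c u w, c ≠ 0 ∧ planeDet u w ≠ 0 ∧
      quadForm p q r = C c * (linForm u * linForm w) by
    obtain ⟨c, u, w, h1, h2, h3⟩ := H
    exact ⟨c, u, w, h1, (ne u w h2).1, (ne u w h2).2, h2, h3⟩
  -- When the leading coefficient vanishes, `(1, 0)` is a zero and splits off directly.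
  by_cases hp : p = 0
  · subst hp
    have hq : q ≠ 0 := by rintro rfl; simp at h
    refine ⟨1, ![1, 0], ![r, -q], one_ne_zero, by simpa [planeDet] using hq, ?_⟩
    simp [linForm, quadForm]
    ring
  let f : Polynomial M := Polynomial.C p * Polynomial.X ^ 2 + Polynomial.C q * Polynomial.X +
    Polynomial.C r
  have hdeg : f.degree = 2 := Polynomial.degree_quadratic hp
  have hder : Polynomial.derivative f = 2 * Polynomial.C p * Polynomial.X + Polynomial.C q := by
    simp [f, ← one_add_one_eq_two]; ring
  have hsep : f.Separable := by
    have e : Polynomial.C (q ^ 2 - 4 * p * r)⁻¹ * (Polynomial.C q ^ 2 -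
        4 * Polynomial.C p * Polynomial.C r) = (1 : Polynomial M) := by
      rw [show (4 : Polynomial M) = Polynomial.C 4 from rfl]
      simp only [← Polynomial.C_pow, ← Polynomial.C_mul, ← Polynomial.C_sub]
      rw [inv_mul_cancel₀ h, Polynomial.C_1]
    -- Bézout coefficients from `(2 p X + q)² - 4 p f = q² - 4 p r`.
    refine ⟨Polynomial.C (q ^ 2 - 4 * p * r)⁻¹ * (-4 * Polynomial.C p),
      Polynomial.C (q ^ 2 - 4 * p * r)⁻¹ * (2 * Polynomial.C p * Polynomial.X + Polynomial.C q), ?_⟩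
    rw [hder]
    simp only [f]
    linear_combination e
  obtain ⟨t, ht⟩ := IsSepClosed.exists_root f (by rw [hdeg]; decide) hsep
  have ht' : p * t ^ 2 + q * t + r = 0 := by simpa [f, Polynomial.IsRoot] using ht
  have hr : r = -(p * t ^ 2 + q * t) := by linear_combination ht'
  -- The second zero comes from the sum `-q / p` of the two roots.
  refine ⟨p, ![t, 1], ![-q / p - t, 1], hp, ?_, ?_⟩
  · intro h0
    apply h
    simp [planeDet] at h0
    have : 2 * p * t + q = 0 := by
      field_simp at h0
      linear_combination h0
    linear_combination (-4 * p) * ht' + (2 * p * t + q) * this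
  · have e : C p * C (-q / p) = (C (-q) : MvPolynomial (Fin 2) M) := by
      rw [← C_mul]; congr 1; field_simp
    simp [linForm, quadForm, hr] at e ⊢
    linear_combination (X 0 * X 1 - C t * X 1 ^ 2) * e

/-- One linear form is split off. The discriminant of the cubic is that of the quadratic cofactor
times the square of the cofactor's value at the zero, so neither vanishes: the cofactor splits, and
its zeros differ from the first one. -/
theorem cubForm_eq_prod {p q r s : M} (h : q ^ 2 * r ^ 2 - 4 * p * r ^ 3
    - 4 * q ^ 3 * s + 18 * p * q * r * s - 27 * p ^ 2 * s ^ 2 ≠ 0) :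
    ∃ c u v w, c ≠ 0 ∧ u ≠ 0 ∧ v ≠ 0 ∧ w ≠ 0 ∧ planeDet u v ≠ 0 ∧ planeDet u w ≠ 0 ∧
      planeDet v w ≠ 0 ∧ cubForm p q r s = C c * (linForm u * (linForm v * linForm w)) := by
  obtain ⟨u, a, b, c, hu, hd, ht, e⟩ : ∃ (u : Fin 2 → M) (a b c : M), u ≠ 0 ∧
      b ^ 2 - 4 * a * c ≠ 0 ∧ a * u 0 ^ 2 + b * u 0 * u 1 + c * u 1 ^ 2 ≠ 0 ∧
      cubForm p q r s = linForm u * quadForm a b c := by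
    by_cases hp : p = 0
    · subst hp
      refine ⟨![1, 0], q, r, s, by simp, ?_, ?_, ?_⟩
      · intro h0
        apply h
        linear_combination q ^ 2 * h0
      · intro h0
        apply h
        simp at h0
        simp [h0]
      · simp [cubForm, linForm, quadForm]; ring
    let f : Polynomial M := Polynomial.C p * Polynomial.X ^ 3 + Polynomial.C q * Polynomial.X ^ 2 +
      Polynomial.C r * Polynomial.X + Polynomial.C s
    have hdeg : f.degree = 3 := Polynomial.degree_cubic hp
    have hder : Polynomial.derivative f = 3 * Polynomial.C p * Polynomial.X ^ 2 +
        2 * Polynomial.C q * Polynomial.X + Polynomial.C r := by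
      have h2 : Polynomial.C (2 : M) = 2 := rfl
      have h3 : Polynomial.C (3 : M) = 3 := rfl
      simp [f, h2]
      ring
    set D := q ^ 2 * r ^ 2 - 4 * p * r ^ 3
      - 4 * q ^ 3 * s + 18 * p * q * r * s - 27 * p ^ 2 * s ^ 2 with hD
    have hsep : f.Separable := by
      have e : Polynomial.C D⁻¹ * (Polynomial.C q ^ 2 * Polynomial.C r ^ 2 -
          4 * Polynomial.C p * Polynomial.C r ^ 3 - 4 * Polynomial.C q ^ 3 * Polynomial.C s +
          18 * Polynomial.C p * Polynomial.C q * Polynomial.C r * Polynomial.C s -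
          27 * Polynomial.C p ^ 2 * Polynomial.C s ^ 2) = (1 : Polynomial M) := by
        rw [show (4 : Polynomial M) = Polynomial.C 4 from rfl,
          show (18 : Polynomial M) = Polynomial.C 18 from rfl,
          show (27 : Polynomial M) = Polynomial.C 27 from rfl]
        simp only [← Polynomial.C_pow, ← Polynomial.C_mul, ← Polynomial.C_sub, ← Polynomial.C_add]
        rw [inv_mul_cancel₀ h, Polynomial.C_1]
      let P : Polynomial M := 6 * Polynomial.C p * Polynomial.C r - 2 * Polynomial.C q ^ 2
      let T : Polynomial M := 9 * Polynomial.C p * Polynomial.C s - Polynomial.C q * Polynomial.C r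
      -- Explicit coefficients expressing the discriminant `D` through `f` and its derivative, in
      -- every characteristic.
      refine ⟨Polynomial.C D⁻¹ * (3 * Polynomial.C p * P * Polynomial.X + 2 * Polynomial.C q * P -
          3 * Polynomial.C p * T),
        -Polynomial.C D⁻¹ * (Polynomial.C p * P * Polynomial.X ^ 2 +
          (Polynomial.C q * P - Polynomial.C p * T) * Polynomial.X +
          (4 * Polynomial.C p * Polynomial.C r ^ 2 - Polynomial.C q ^ 2 * Polynomial.C r -
            3 * Polynomial.C p * Polynomial.C q * Polynomial.C s)), ?_⟩
      rw [hder]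
      simp only [f, P, T]
      linear_combination e
    obtain ⟨t, ht⟩ := IsSepClosed.exists_root f (by rw [hdeg]; decide) hsep
    have ht' : p * t ^ 3 + q * t ^ 2 + r * t + s = 0 := by simpa [f, Polynomial.IsRoot] using ht
    have hs : s = -(p * t ^ 3 + q * t ^ 2 + r * t) := by linear_combination ht'
    -- The cofactor results from division by the root `t`; its value at `(t, 1)` is minus the
    -- derivative of `f` at `t`.
    refine ⟨![t, 1], -p, -(q + p * t), -(r + q * t + p * t ^ 2), by simp, ?_, ?_, ?_⟩
    · intro h0
      apply h
      rw [hD, hs]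
      linear_combination (3 * p * t ^ 2 + 2 * q * t + r) ^ 2 * h0
    · intro h0
      apply h
      simp at h0
      rw [hD, hs]
      linear_combination -((q + p * t) ^ 2 - 4 * p * (r + q * t + p * t ^ 2)) *
        (3 * p * t ^ 2 + 2 * q * t + r) * h0
    · simp [cubForm, linForm, quadForm, hs]; ring
  obtain ⟨d, v, w, hd', hv, hw, hvw, e'⟩ := quadForm_eq_prod hd
  have hev : a * u 0 ^ 2 + b * u 0 * u 1 + c * u 1 ^ 2 = d * (planeDet v u * planeDet w u) := by
    have := congrArg (eval u) e'
    rw [_root_.map_mul, _root_.map_mul, eval_linForm, eval_linForm, eval_C] at this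
    rw [← this]
    simp [quadForm]; ring
  rw [hev] at ht
  refine ⟨d, u, v, w, hd', hu, hv, hw, ?_, ?_, hvw, by rw [e, e']; ring⟩
  · intro h0
    apply ht
    rw [planeDet_swap, h0]; simp
  · intro h0
    apply ht
    rw [planeDet_comm_zero h0]; simp

variable {L : Type u} [Field L] [Algebra L M]

theorem exists_splitsAt (hn : n = 2 ∨ n = 3) {F : MvPolynomial (Fin 2) L}
    (hF : F.IsHomogeneous n) (hd : disc F n ≠ 0) : ∃ u : Fin n → Fin 2 → M, SplitsAt F u := by
  have hd' : disc (MvPolynomial.map (algebraMap L M) F) n ≠ 0 := by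
    rw [disc_map _ _ hn]
    simpa using hd
  have hF' := hF.map (algebraMap L M)
  rcases hn with rfl | rfl
  · obtain ⟨p, q, r, e⟩ := exists_eq_quadForm hF'
    rw [e, disc_quadForm] at hd'
    obtain ⟨c, u, w, hc, hu, hw, huw, e'⟩ := quadForm_eq_prod hd'
    refine ⟨![u, w], ?_, ?_, c, hc, by rw [e, e']; simp⟩
    · intro i; fin_cases i <;> simpa
    · have huw' : planeDet w u ≠ 0 := by rw [planeDet_swap]; simpa
      intro i j hij
      fin_cases i <;> fin_cases j <;> first | exact absurd rfl hij | simpa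
  · obtain ⟨p, q, r, s, e⟩ := exists_eq_cubForm hF'
    rw [e, disc_cubForm] at hd'
    obtain ⟨c, u, v, w, hc, hu, hv, hw, h1, h2, h3, e'⟩ := cubForm_eq_prod hd'
    refine ⟨![u, v, w], ?_, ?_, c, hc, by rw [e, e']; simp [Fin.prod_univ_three, mul_assoc]⟩
    · intro i; fin_cases i <;> simpa
    · have h1' : planeDet v u ≠ 0 := by rw [planeDet_swap]; simpa
      have h2' : planeDet w u ≠ 0 := by rw [planeDet_swap]; simpa
      have h3' : planeDet w v ≠ 0 := by rw [planeDet_swap]; simpa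
      intro i j hij
      fin_cases i <;> fin_cases j <;> first | exact absurd rfl hij | simpa

/-- The discriminant of a split form is `c ^ (2 n - 2)` times the square of the product of the
determinants of pairs of zeros. -/
theorem SplitsAt.disc_ne_zero {K : Type u} [Field K] [Algebra L K] (hn : n = 2 ∨ n = 3)
    {F : MvPolynomial (Fin 2) L} {u : Fin n → Fin 2 → K} (h : SplitsAt F u) : disc F n ≠ 0 := by
  intro h0
  obtain ⟨c, hc, e⟩ := h.eq_prod
  have hd := h.det_ne_zero
  have h1 : disc (MvPolynomial.map (algebraMap L K) F) n = 0 := by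
    rw [disc_map _ _ hn, h0, map_zero]
  rw [e] at h1
  rcases hn with rfl | rfl
  · have e' : C c * ∏ i, linForm (u i) = quadForm (c * (u 0 1 * u 1 1))
        (-c * (u 0 0 * u 1 1 + u 0 1 * u 1 0)) (c * (u 0 0 * u 1 0)) := by
      simp [linForm, quadForm]; ring
    rw [e', disc_quadForm] at h1
    have : c ^ 2 * planeDet (u 0) (u 1) ^ 2 = 0 := by
      rw [← h1, planeDet]; ring
    simp [hc, hd] at this
  · have e' : C c * ∏ i, linForm (u i) = cubForm (-c * (u 0 1 * u 1 1 * u 2 1))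
        (c * (u 0 0 * u 1 1 * u 2 1 + u 0 1 * u 1 0 * u 2 1 + u 0 1 * u 1 1 * u 2 0))
        (-c * (u 0 0 * u 1 0 * u 2 1 + u 0 0 * u 1 1 * u 2 0 + u 0 1 * u 1 0 * u 2 0))
        (c * (u 0 0 * u 1 0 * u 2 0)) := by
      simp [linForm, cubForm, Fin.prod_univ_three]; ring
    rw [e', disc_cubForm] at h1
    have : c ^ 4 * (planeDet (u 0) (u 1) * planeDet (u 0) (u 2) * planeDet (u 1) (u 2)) ^ 2 = 0 :=
      by
      rw [← h1]; simp only [planeDet]; ring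
    simp [hc, hd] at this

end Roots

end HermitianPairs
end

/-! ### Diagonalisation of Hermitian matrices -/

noncomputable section
namespace HermitianPairs
open MvPolynomial
open scoped Quaternion Matrix
attribute [local instance] MvPolynomial.gradedAlgebra

variable {k : Type u} [Field k] {Q : QuatAlg k} {n : ℕ}

section Field
variable {M : Type u} [Field M] [Algebra k M]

/-- Nondegeneracy of the trace form. The Gram system in the basis `1, i, j, ij` is solved by
dividing by `c` and `b² + 4 a` only, so characteristic two is allowed. -/
theorem exists_qTrace_ne_zero {q : Q.alg M} (hq : q ≠ 0) : ∃ s, qTrace Q (s * q) ≠ 0 := by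
  by_contra! h
  apply hq
  have hc : algebraMap k M Q.c ≠ 0 := by simpa using Q.c_ne_zero
  have hd : algebraMap k M Q.b ^ 2 + 4 * algebraMap k M Q.a ≠ 0 := by
    have := (map_ne_zero (algebraMap k M)).mpr Q.disc_ne_zero
    rwa [_root_.map_add, map_pow, _root_.map_mul, map_ofNat] at this
  have h1 := h 1
  have hi := h ⟨0, 1, 0, 0⟩
  have hj := h ⟨0, 0, 1, 0⟩
  have hk := h ⟨0, 0, 0, 1⟩
  simp [qTrace] at h1 hi hj hk
  ext
  · refine (mul_eq_zero.mp ?_).resolve_left hd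
    linear_combination (2 * algebraMap k M Q.a + algebraMap k M Q.b ^ 2) * h1 -
      algebraMap k M Q.b * hi
  · refine (mul_eq_zero.mp ?_).resolve_left hd
    linear_combination 2 * hi - algebraMap k M Q.b * h1
  · refine (mul_eq_zero.mp ?_).resolve_left (mul_ne_zero hc hd)
    linear_combination (2 * algebraMap k M Q.a) * hj + algebraMap k M Q.b * hk
  · refine (mul_eq_zero.mp ?_).resolve_left (mul_ne_zero hc hd)
    linear_combination (algebraMap k M Q.b) * hj - 2 * hk

/-- A Gram–Schmidt step: multiples of row `i` are added to the rows not yet settled. Only one column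
has to be cleared, the row following by Hermitian symmetry. -/
theorem exists_congr_clear {S : Finset (Fin n)} {i : Fin n} (hi : i ∉ S)
    {y : Matrix (Fin n) (Fin n) (Q.alg M)} (hy : IsHerm Q n M y)
    (hS : ∀ a b, a ≠ b → a ∈ S ∨ b ∈ S → y a b = 0) (hne : y i i ≠ 0) :
    ∃ g : (Matrix (Fin n) (Fin n) (Q.alg M))ˣ, ∀ a b, a ≠ b → a ∈ insert i S ∨ b ∈ insert i S →
      (g.val * y * g.valᴴ : Matrix (Fin n) (Fin n) (Q.alg M)) a b = 0 := by
  obtain ⟨α, hα⟩ := hy.2 i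
  have hα0 : α ≠ 0 := by rintro rfl; exact hne (by rw [hα, map_zero])
  -- The coefficients vanish at `i`, which makes `N * N = 0` and `1 + N` invertible with inverse `1
  -- - N`.
  let c : Fin n → Q.alg M := fun a => if a ∈ insert i S then 0 else -(α⁻¹ • y a i)
  let N : Matrix (Fin n) (Fin n) (Q.alg M) := Matrix.of fun a b => if b = i then c a else 0
  have hci : c i = 0 := if_pos (Finset.mem_insert_self i S)
  have hN : N * N = 0 := by
    ext1 a b
    rw [Matrix.mul_apply]
    refine Finset.sum_eq_zero fun l _ => ?_
    simp only [N, Matrix.of_apply]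
    by_cases h : l = i
    · simp [h, hci]
    · simp [h]
  have hNl : ∀ z : Matrix (Fin n) (Fin n) (Q.alg M), ∀ a b, (N * z) a b = c a * z i b := by
    intro z a b
    rw [Matrix.mul_apply, Finset.sum_eq_single i]
    · simp [N]
    · intro l _ h
      simp [N, h]
    · simp
  have hNr : ∀ z : Matrix (Fin n) (Fin n) (Q.alg M), ∀ a b, (z * Nᴴ) a b = z a i * star (c b) := by
    intro z a b
    rw [Matrix.mul_apply, Finset.sum_eq_single i]
    · simp [N]
    · intro l _ h
      simp [N, h]
    · simp
  let g : (Matrix (Fin n) (Fin n) (Q.alg M))ˣ :=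
    ⟨1 + N, 1 - N, by rw [mul_sub, mul_one, add_mul, one_mul, hN]; abel,
      by rw [sub_mul, one_mul, mul_add, mul_one, hN]; abel⟩
  have key : ∀ a b, (g.val * y * g.valᴴ : Matrix (Fin n) (Fin n) (Q.alg M)) a b =
      y a b + c a * y i b + (y a i + c a * y i i) * star (c b) := by
    intro a b
    change ((1 + N) * y * (1 + N)ᴴ : Matrix (Fin n) (Fin n) (Q.alg M)) a b = _
    rw [Matrix.conjTranspose_add, Matrix.conjTranspose_one, mul_add, mul_one, Matrix.add_apply, hNr,
      add_mul, one_mul, Matrix.add_apply, Matrix.add_apply, hNl, hNl]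
  have hcol : ∀ a b, a ≠ b → b ∈ insert i S →
      (g.val * y * g.valᴴ : Matrix (Fin n) (Fin n) (Q.alg M)) a b = 0 := by
    intro a b hab hb
    have hcb : c b = 0 := if_pos hb
    rw [key, hcb, star_zero, mul_zero, add_zero]
    rcases Finset.mem_insert.mp hb with rfl | hb
    · by_cases ha : a ∈ S
      · rw [hS a b hab (Or.inl ha)]
        simp [c, ha]
      · have : c a = -(α⁻¹ • y a b) := if_neg (by simp [hab, ha])
        rw [this, hα, ← Algebra.commutes, ← Algebra.smul_def, smul_neg, smul_smul,
          mul_inv_cancel₀ hα0, one_smul, add_neg_cancel]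
    · rw [hS a b hab (Or.inr hb), hS i b (fun h => hi (h ▸ hb)) (Or.inr hb), mul_zero, add_zero]
  refine ⟨g, fun a b hab h => ?_⟩
  rcases h with ha | hb
  · rw [(hy.conj g.val).apply_eq a b, hcol b a hab.symm ha, star_zero]
  · exact hcol a b hab hb

/-- The unit `1 + s E_{ij}`. -/
def transvectionUnit {ι : Type*} [Fintype ι] [DecidableEq ι] {A : Type*} [Ring A] {i j : ι}
    (hij : i ≠ j) (s : A) : (Matrix ι ι A)ˣ :=
  have h : Matrix.single i j s * Matrix.single i j s = (0 : Matrix ι ι A) :=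
    Matrix.single_mul_single_of_ne _ _ _ _ hij.symm _
  ⟨1 + Matrix.single i j s, 1 - Matrix.single i j s,
    by rw [mul_sub, mul_one, add_mul, one_mul, h]; abel,
    by rw [sub_mul, one_mul, mul_add, mul_one, h]; abel⟩

/-- Induction on the number of unsettled indices, `S` being the set of those whose row and column
are already cleared. If the remaining diagonal entries are all zero but some `y j i` is not, a
transvection creates the diagonal entry `qTrace (s * y j i)`, which can be made non-zero. -/
theorem exists_congr_diagonal_aux (m : ℕ) : ∀ (S : Finset (Fin n)), Sᶜ.card ≤ m →
    ∀ y : Matrix (Fin n) (Fin n) (Q.alg M), IsHerm Q n M y →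
    (∀ a b, a ≠ b → a ∈ S ∨ b ∈ S → y a b = 0) →
    ∃ g : (Matrix (Fin n) (Fin n) (Q.alg M))ˣ, ∀ a b, a ≠ b →
      (g.val * y * g.valᴴ : Matrix (Fin n) (Fin n) (Q.alg M)) a b = 0 := by
  induction m with
  | zero =>
    intro S hS y _ h
    refine ⟨1, fun a b hab => ?_⟩
    have : a ∈ S := by
      by_contra ha
      have := Finset.card_eq_zero.mp (Nat.le_zero.mp hS)
      exact Finset.notMem_empty a (this ▸ Finset.mem_compl.mpr ha)
    simpa using h a b hab (Or.inl this)
  | succ m ih =>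
    intro S hm y hy hS
    have step : ∀ y, IsHerm Q n M y → (∀ a b, a ≠ b → a ∈ S ∨ b ∈ S → y a b = 0) →
        ∀ i ∉ S, y i i ≠ 0 → ∃ g : (Matrix (Fin n) (Fin n) (Q.alg M))ˣ, ∀ a b, a ≠ b →
          (g.val * y * g.valᴴ : Matrix (Fin n) (Fin n) (Q.alg M)) a b = 0 := by
      intro y hy hS i hi hne
      obtain ⟨g, hg⟩ := exists_congr_clear hi hy hS hne
      obtain ⟨g', hg'⟩ := ih (insert i S) (by
        have := Finset.card_compl_add_card S
        have := Finset.card_compl_add_card (insert i S)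
        rw [Finset.card_insert_of_notMem hi] at this
        omega) _ (hy.conj g.val) hg
      refine ⟨g' * g, fun a b hab => ?_⟩
      rw [← hg' a b hab, Units.val_mul, Matrix.conjTranspose_mul]
      simp only [mul_assoc]
    by_cases h1 : ∃ i ∉ S, y i i ≠ 0
    · obtain ⟨i, hi, hne⟩ := h1
      exact step y hy hS i hi hne
    push Not at h1
    by_cases h2 : ∃ i j, i ∉ S ∧ j ∉ S ∧ i ≠ j ∧ y i j ≠ 0
    · obtain ⟨i, j, hi, hj, hij, hne⟩ := h2
      have hne' : y j i ≠ 0 := by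
        intro h0
        exact hne (by rw [hy.apply_eq, h0, star_zero])
      obtain ⟨s, hs⟩ := exists_qTrace_ne_zero hne'
      have e : ∀ a b, ((transvectionUnit hij s).val * y * (transvectionUnit hij s).valᴴ :
          Matrix (Fin n) (Fin n) (Q.alg M)) a b = _ := transvection_conj_apply i j s y
      obtain ⟨g, hg⟩ := step _ (hy.conj (transvectionUnit hij s).val) (by
        intro a b hab h
        rw [e, hS a b hab h, zero_add]
        rcases h with ha | hb
        · have hai : a ≠ i := fun h => hi (h ▸ ha)
          have haj : a ≠ j := fun h => hj (h ▸ ha)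
          simp [hai, hS a j haj (Or.inl ha)]
        · have hbi : b ≠ i := fun h => hi (h ▸ hb)
          have hbj : j ≠ b := fun h => hj (h ▸ hb)
          simp [hbi, hS j b hbj (Or.inr hb)]) i hi (by
        rw [e, h1 i hi, h1 j hj]
        simp only [if_true, and_self, mul_zero, zero_mul, add_zero, zero_add]
        intro h0
        apply hs
        rw [qTrace, star_mul, ← hy.apply_eq i j, h0]
        rfl)
      refine ⟨g * transvectionUnit hij s, fun a b hab => ?_⟩
      rw [← hg a b hab, Units.val_mul, Matrix.conjTranspose_mul]
      simp only [mul_assoc]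
    · push Not at h2
      refine ⟨1, fun a b hab => ?_⟩
      have : y a b = 0 := by
        by_cases h : a ∈ S ∨ b ∈ S
        · exact hS a b hab h
        · push Not at h
          exact h2 a b h.1 h.2 hab
      simpa using this

/-- Every Hermitian matrix over a quaternion algebra is congruent to a diagonal matrix. -/
theorem IsHerm.exists_congr_diagonal {y : Matrix (Fin n) (Fin n) (Q.alg M)}
    (hy : IsHerm Q n M y) : ∃ (g : (Matrix (Fin n) (Fin n) (Q.alg M))ˣ) (a : Fin n → M),
      g.val * y * g.valᴴ = Matrix.diagonal fun i => algebraMap M (Q.alg M) (a i) := by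
  obtain ⟨g, hg⟩ := exists_congr_diagonal_aux _ ∅ le_rfl y hy (by simp)
  exact ⟨g, _, (eq_diagonal_of_apply hg).trans
    (congrArg Matrix.diagonal (funext fun i => (hy.conj g.val).diag_eq i))⟩

end Field

end HermitianPairs
end

/-! ### Diagonal normal form of semi-stable pencils -/

noncomputable section
namespace HermitianPairs
open MvPolynomial
open scoped Quaternion Matrix
attribute [local instance] MvPolynomial.gradedAlgebra

variable {k : Type u} [Field k] {Q : QuatAlg k} {n : ℕ}

theorem isHerm_pencil {R : Type u} [CommRing R] [Algebra k R] {x : Amb Q n R} (hx : x ∈ V Q n R)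
    (v : Fin 2 → R) : IsHerm Q n R (pencil x v) := by
  rw [pencil, Fin.sum_univ_two]
  exact ((hx 0).smul _).add ((hx 1).smul _)

theorem eval_formF {R : Type u} [CommRing R] [Algebra k R] (x : Amb Q n R) (v : Fin 2 → R) :
    eval v (formF x) = pfaff Q n (pencil x v) := by
  rw [← MvPolynomial.aeval_eq_eval, aeval_formF]
  rfl

theorem smul_mem_V {R : Type u} [CommRing R] [Algebra k R] {x : Amb Q n R} (hx : x ∈ V Q n R)
    (g : Grp Q n R) : g • x ∈ V Q n R := by
  intro i
  refine IsHerm.conj ?_ g.fst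
  rw [Fin.sum_univ_two]
  exact ((hx 0).smul _).add ((hx 1).smul _)

theorem pencil_add {R : Type u} [CommRing R] [Algebra k R] (x : Amb Q n R) (v w : Fin 2 → R) :
    pencil x (v + w) = pencil x v + pencil x w := by
  simp [pencil, add_smul, Finset.sum_add_distrib]

theorem pencil_const_smul {R : Type u} [CommRing R] [Algebra k R] (x : Amb Q n R) (c : R)
    (v : Fin 2 → R) : pencil x (c • v) = c • pencil x v := by
  simp [pencil, mul_smul]

section SepClosed
variable {M : Type u} [Field M] [Algebra k M]

/-- Polynomials over an infinite field are compared through their values, where the identity is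
`pencil_smul` and the multiplier of the Pfaffian. -/
theorem formF_smul [IsSepClosed M] (hn : n = 2 ∨ n = 3) {x : Amb Q n M} (hx : x ∈ V Q n M)
    (g : Grp Q n M) :
    ∃ c : M, c ≠ 0 ∧ formF (g • x) = C c * substHom g.snd (formF x) := by
  have := infinite_of_isSepClosed M
  obtain ⟨c, hc, h⟩ := exists_pfaff_unit_conj (Q := Q) hn g.1
  refine ⟨c, hc, MvPolynomial.funext fun v => ?_⟩
  rw [eval_formF, pencil_smul, _root_.map_mul, eval_C, ← MvPolynomial.aeval_eq_eval,
    aeval_substHom]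
  refine (h _ (isHerm_pencil hx _)).trans ?_
  rw [← eval_formF, MvPolynomial.aeval_eq_eval]
  simp

theorem exists_qNorm_eq [IsSepClosed M] (Q : QuatAlg k) (a : M) : ∃ q : Q.alg M, qNorm Q q = a := by
  obtain ⟨ψ, hψ⟩ := exists_splitting Q M
  exact ⟨ψ.symm (Matrix.diagonal ![a, 1]), by rw [← hψ, ψ.apply_symm_apply]; simp⟩

theorem isUnit_diagonal {q : Fin n → Q.alg M} (h : ∀ i, qNorm Q (q i) ≠ 0) :
    IsUnit (Matrix.diagonal q) := by
  refine ⟨⟨Matrix.diagonal q, Matrix.diagonal fun i => (qNorm Q (q i))⁻¹ • star (q i), ?_, ?_⟩, rfl⟩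
  · rw [Matrix.diagonal_mul_diagonal, ← Matrix.diagonal_one]
    congr 1
    funext i
    rw [mul_smul_comm, mul_star_eq, Algebra.smul_def, ← _root_.map_mul, inv_mul_cancel₀ (h i),
      map_one]
  · rw [Matrix.diagonal_mul_diagonal, ← Matrix.diagonal_one]
    congr 1
    funext i
    rw [smul_mul_assoc, star_mul_self_eq, Algebra.smul_def, ← _root_.map_mul,
      inv_mul_cancel₀ (h i), map_one]

theorem IsHerm.isUnit_of_pfaff_ne_zero [IsSepClosed M] (hn : n = 2 ∨ n = 3)
    {y : Matrix (Fin n) (Fin n) (Q.alg M)}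
    (hy : IsHerm Q n M y) (h : pfaff Q n y ≠ 0) : IsUnit y := by
  obtain ⟨g, a, hg⟩ := hy.exists_congr_diagonal
  obtain ⟨c, hc, hcg⟩ := exists_pfaff_unit_conj (Q := Q) hn g
  have h1 := hcg y hy
  rw [hg, pfaff_diagonal hn] at h1
  have ha : ∀ i, a i ≠ 0 := fun i => (Finset.prod_ne_zero_iff.mp (h1 ▸ mul_ne_zero hc h)) i
    (Finset.mem_univ i)
  have hu : IsUnit (g.val * y * g.valᴴ) := by
    rw [hg]
    refine isUnit_diagonal fun i => ?_
    simp [qNorm, ha i]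
  have e : y = g⁻¹.val * (g.val * y * g.valᴴ) * (g⁻¹.val)ᴴ := by
    rw [mul_assoc, mul_assoc (g.val * y), ← Matrix.conjTranspose_mul, Units.inv_mul,
      Matrix.conjTranspose_one, mul_one, ← mul_assoc, Units.inv_mul, one_mul]
  rw [e]
  exact (g⁻¹.isUnit.mul hu).mul (star g⁻¹).isUnit

/-- The split algebra has zero divisors, so a non-zero row would not suffice. A row of the
invertible diagonalising matrix, at an index where the diagonal form has a zero, also has no left
annihilator. -/
theorem IsHerm.exists_row_mul_eq_zero [IsSepClosed M] (hn : n = 2 ∨ n = 3)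
    {y : Matrix (Fin n) (Fin n) (Q.alg M)} (hy : IsHerm Q n M y) (h : pfaff Q n y = 0) :
    ∃ r : Fin n → Q.alg M, (∀ b, (∀ j, b * r j = 0) → b = 0) ∧ r ᵥ* y = 0 := by
  obtain ⟨g, a, hg⟩ := hy.exists_congr_diagonal
  obtain ⟨c, hc, hcg⟩ := exists_pfaff_unit_conj (Q := Q) hn g
  have h1 := hcg y hy
  rw [hg, pfaff_diagonal hn, h, mul_zero] at h1
  obtain ⟨i, -, hi⟩ := Finset.prod_eq_zero_iff.mp h1
  refine ⟨g.val i, fun b hb => ?_, ?_⟩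
  · have e : (g.val * g⁻¹.val) i i = (1 : Q.alg M) := by rw [Units.mul_inv, Matrix.one_apply_eq]
    rw [Matrix.mul_apply] at e
    rw [← mul_one b, ← e, Finset.mul_sum]
    refine Finset.sum_eq_zero fun j _ => ?_
    rw [← mul_assoc, hb, zero_mul]
  · have e : g.val * y = Matrix.diagonal (fun i => algebraMap M (Q.alg M) (a i)) *
        (g⁻¹.val)ᴴ := by
      rw [← hg, mul_assoc, ← Matrix.conjTranspose_mul, Units.inv_mul, Matrix.conjTranspose_one,
        mul_one]
    funext j
    change (g.val * y) i j = 0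
    rw [e, Matrix.diagonal_mul, hi, map_zero, zero_mul]

theorem isUnit_of_left_regular {A : Type u} [Ring A] [Algebra M A] [FiniteDimensional M A] {r : A}
    (h : ∀ a, a * r = 0 → a = 0) : IsUnit r := by
  have hinj : Function.Injective (LinearMap.mulRight M r) :=
    (injective_iff_map_eq_zero _).mpr h
  obtain ⟨a, ha⟩ := LinearMap.injective_iff_surjective.mp hinj 1
  have ha' : a * r = 1 := ha
  refine ⟨⟨r, a, ?_, ha'⟩, rfl⟩
  rw [← sub_eq_zero]
  refine h _ ?_
  rw [sub_mul, mul_assoc, ha', mul_one, one_mul, sub_self]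

theorem planeDet_smul_add (u v w : Fin 2 → M) :
    planeDet u w • v = planeDet v w • u + planeDet u v • w := by
  funext i
  fin_cases i <;> simp [planeDet] <;> ring

/-- A semi-stable pencil over a separably closed field is congruent to a diagonal pencil which is
determined by the zeros of the binary form. -/
theorem exists_congr_normalForm [IsSepClosed M] (hn : n = 2 ∨ n = 3) {x : Amb Q n M}
    (hx : x ∈ V Q n M)
    {u : Fin n → Fin 2 → M} (hu : SplitsAt (formF x) u) :
    ∃ g : (Matrix (Fin n) (Fin n) (Q.alg M))ˣ, ∀ v, g.val * pencil x v * g.valᴴ =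
      Matrix.diagonal fun i => algebraMap M (Q.alg M) (planeDet (u i) v) := by
  have := infinite_of_isSepClosed M
  have hH := isHerm_pencil hx
  have hF0 : ∀ v, eval v (formF x) = 0 ↔ ∃ i, planeDet (u i) v = 0 := by
    intro v
    obtain ⟨c, hc, e⟩ := hu.eq_prod
    have h := congrArg (eval v) e
    rw [Algebra.algebraMap_self, MvPolynomial.map_id] at h
    rw [h]
    simp [eval_linForm, hc, Finset.prod_eq_zero_iff]
  obtain ⟨w, hw⟩ : ∃ w, eval w (formF x) ≠ 0 := by
    by_contra! h
    have h0 : formF x = 0 := MvPolynomial.funext fun v => by rw [h v, map_zero]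
    refine hu.disc_ne_zero hn ?_
    rw [h0]
    rcases hn with rfl | rfl <;> simp [disc, cf]
  have hwi : ∀ i, planeDet (u i) w ≠ 0 := fun i h => hw ((hF0 w).mpr ⟨i, h⟩)
  have hrow : ∀ i, ∃ r : Fin n → Q.alg M, (∀ b, (∀ j, b * r j = 0) → b = 0) ∧
      r ᵥ* pencil x (u i) = 0 := fun i => (hH (u i)).exists_row_mul_eq_zero hn (by
    rw [← eval_formF]
    exact (hF0 _).mpr ⟨i, planeDet_self _⟩)
  choose r hr hr0 using hrow
  let R : Matrix (Fin n) (Fin n) (Q.alg M) := Matrix.of r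
  have hR0 : ∀ i j, (R * pencil x (u i)) i j = 0 := fun i j => congrFun (hr0 i) j
  -- The `i`-th row of `R * pencil x v` is linear in `v` and vanishes at `u i`, hence is
  -- proportional to `planeDet (u i) v`.
  have hT : ∀ v i j, (R * pencil x v) i j =
      (planeDet (u i) v / planeDet (u i) w) • (R * pencil x w) i j := by
    intro v i j
    have e : planeDet (u i) w • (R * pencil x v) i j =
        planeDet (u i) v • (R * pencil x w) i j := by
      have := congrArg (fun z => (R * pencil x z) i j) (planeDet_smul_add (u i) v w)
      simp only [pencil_add, pencil_const_smul, mul_add, Matrix.mul_smul, Matrix.add_apply,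
        Matrix.smul_apply, hR0, smul_zero, zero_add] at this
      exact this
    rw [div_eq_inv_mul, mul_smul, ← e, smul_smul, inv_mul_cancel₀ (hwi i), one_smul]
  obtain ⟨Y, hY⟩ := (hH w).isUnit_of_pfaff_ne_zero hn (by rwa [← eval_formF])
  -- The rows of `R` are eigenvectors of the pencil at `v` relative to the pencil at `w`, so left
  -- relations among them stay relations after multiplication by the eigenvalues.
  have hscale : ∀ (b : Fin n → Q.alg M) (v : Fin 2 → M), b ᵥ* R = 0 →
      (fun i => (planeDet (u i) v / planeDet (u i) w) • b i) ᵥ* R = 0 := by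
    intro b v hb
    have e : (fun i => (planeDet (u i) v / planeDet (u i) w) • b i) ᵥ* (R * pencil x w) =
        b ᵥ* (R * pencil x v) := by
      funext j
      simp only [Matrix.vecMul, dotProduct]
      refine Finset.sum_congr rfl fun i _ => ?_
      rw [hT v, mul_smul_comm, smul_mul_assoc]
    rw [← Matrix.vecMul_vecMul, ← Matrix.vecMul_vecMul, hb, Matrix.zero_vecMul, ← hY] at e
    have := congrArg (fun z => z ᵥ* Y⁻¹.val) e
    simpa only [Matrix.vecMul_vecMul, mul_assoc, Units.mul_inv, mul_one, Matrix.vecMul_one,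
      Matrix.zero_vecMul] using
      this
  -- Eigenvectors with different eigenvalues are independent: scaling by the eigenvalues at all `u
  -- l` with `l ≠ i₀` kills every coordinate of a relation except the one at `i₀`.
  have hinj : ∀ b : Fin n → Q.alg M, b ᵥ* R = 0 → b = 0 := by
    intro b hb
    funext i₀
    have hs : ∀ s : Finset (Fin n), (fun i => (∏ l ∈ s, planeDet (u i) (u l) / planeDet (u i) w) •
        b i) ᵥ* R = 0 := by
      intro s
      induction s using Finset.induction_on with
      | empty => simpa using hb
      | insert l s hl ih =>
        have := hscale _ (u l) ih
        simpa only [Finset.prod_insert hl, mul_smul] using this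
    have h := hs (Finset.univ.erase i₀)
    have hne : (∏ l ∈ Finset.univ.erase i₀, planeDet (u i₀) (u l) / planeDet (u i₀) w) ≠ 0 :=
      Finset.prod_ne_zero_iff.mpr fun l hl =>
        div_ne_zero (hu.det_ne_zero _ _ (Finset.ne_of_mem_erase hl).symm) (hwi i₀)
    have h0 : (∏ l ∈ Finset.univ.erase i₀, planeDet (u i₀) (u l) / planeDet (u i₀) w) • b i₀ = 0 :=
      by
      refine hr i₀ _ fun j => ?_
      have := congrFun h j
      simp only [Matrix.vecMul, dotProduct] at this
      rw [Finset.sum_eq_single i₀] at this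
      · exact this
      · intro i _ hi
        rw [Finset.prod_eq_zero (i := i) (Finset.mem_erase.mpr ⟨hi, Finset.mem_univ _⟩), zero_smul,
          zero_mul]
        rw [planeDet_self, zero_div]
      · simp
    exact (smul_eq_zero.mp h0).resolve_left hne
  have hRu : IsUnit R := isUnit_of_left_regular (M := M) fun a ha => by
    funext i
    exact hinj (a i) (congrFun ha i)
  -- At `v = u j` row `j` vanishes, hence column `j` by symmetry; in row `i` this column is a
  -- non-zero multiple of the one at `w`.
  have hoff : ∀ i j, i ≠ j → (R * pencil x w * Rᴴ) i j = 0 := by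
    intro i j hij
    have e : (R * pencil x (u j) * Rᴴ) i j =
        (planeDet (u i) (u j) / planeDet (u i) w) • (R * pencil x w * Rᴴ) i j := by
      rw [Matrix.mul_apply, Matrix.mul_apply, Finset.smul_sum]
      refine Finset.sum_congr rfl fun l _ => ?_
      rw [hT, smul_mul_assoc]
    have e0 : (R * pencil x (u j) * Rᴴ) i j = 0 := by
      rw [((hH (u j)).conj R).apply_eq i j, Matrix.mul_apply, Finset.sum_eq_zero, star_zero]
      intro l _
      rw [hR0, zero_mul]
    rw [e0] at e
    exact (smul_eq_zero.mp e.symm).resolve_left (div_ne_zero (hu.det_ne_zero _ _ hij) (hwi i))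
  choose l hl using ((hH w).conj R).2
  have hdiag : R * pencil x w * Rᴴ = Matrix.diagonal fun i => algebraMap M (Q.alg M) (l i) := by
    rw [eq_diagonal_of_apply hoff]
    congr 1
    funext i
    exact hl i
  have hl0 : ∀ i, l i ≠ 0 := by
    obtain ⟨c, hc, hcR⟩ := exists_pfaff_unit_conj (Q := Q) hn hRu.unit
    have h := hcR _ (hH w)
    rw [IsUnit.unit_spec, hdiag, pfaff_diagonal hn, ← eval_formF] at h
    exact fun i => Finset.prod_ne_zero_iff.mp (h ▸ mul_ne_zero hc hw) i (Finset.mem_univ i)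
  -- The reduced norm is surjective here, so each diagonal entry can be rescaled to the prescribed
  -- value.
  choose q hq using fun i => exists_qNorm_eq Q (planeDet (u i) w / l i)
  have hqu : IsUnit (Matrix.diagonal q) := isUnit_diagonal fun i => by
    rw [hq]
    exact div_ne_zero (hwi i) (hl0 i)
  refine ⟨(hqu.mul hRu).unit, fun v => ?_⟩
  have hv : R * pencil x v * Rᴴ = Matrix.diagonal fun i =>
      algebraMap M (Q.alg M) (planeDet (u i) v / planeDet (u i) w * l i) := by
    ext1 i j
    have e : (R * pencil x v * Rᴴ) i j =
        (planeDet (u i) v / planeDet (u i) w) • (R * pencil x w * Rᴴ) i j := by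
      rw [Matrix.mul_apply, Matrix.mul_apply, Finset.smul_sum]
      refine Finset.sum_congr rfl fun l _ => ?_
      rw [hT, smul_mul_assoc]
    rw [e, hdiag]
    by_cases hij : i = j
    · subst hij
      rw [Matrix.diagonal_apply_eq, Matrix.diagonal_apply_eq, Algebra.smul_def, ← _root_.map_mul]
    · rw [Matrix.diagonal_apply_ne _ hij, Matrix.diagonal_apply_ne _ hij, smul_zero]
  rw [IsUnit.unit_spec, Matrix.conjTranspose_mul]
  calc _ = Matrix.diagonal q * (R * pencil x v * Rᴴ) * (Matrix.diagonal q)ᴴ := by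
        simp only [mul_assoc]
    _ = _ := by
      rw [hv, Matrix.diagonal_conjTranspose, Matrix.diagonal_mul_diagonal,
        Matrix.diagonal_mul_diagonal]
      congr 1
      funext i
      change _ * _ * star (q i) = _
      rw [← Algebra.commutes, mul_assoc, mul_star_eq, ← _root_.map_mul, hq]
      congr 1
      have := hwi i
      have := hl0 i
      field_simp

end SepClosed

end HermitianPairs
end

/-! ### Laurent curves and the identity component -/

noncomputable section
namespace HermitianPairs
open MvPolynomial
open scoped Quaternion Matrix
attribute [local instance] MvPolynomial.gradedAlgebra

variable {k : Type u} [Field k] {Q : QuatAlg k} {n : ℕ}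

section Curves
variable (M : Type u) [Field M] [Algebra k M]

/-- Laurent polynomial functions on the multiplicative group. -/
def laurent : Subalgebra M (Mˣ → M) :=
  Algebra.adjoin M {fun t => t.val, fun t => t⁻¹.val}

variable {M}

theorem val_mem_laurent : (fun t : Mˣ => t.val) ∈ laurent M :=
  Algebra.subset_adjoin (Or.inl rfl)

theorem inv_mem_laurent : (fun t : Mˣ => t⁻¹.val) ∈ laurent M :=
  Algebra.subset_adjoin (Or.inr rfl)

theorem const_mem_laurent (c : M) : (fun _ : Mˣ => c) ∈ laurent M := (laurent M).algebraMap_mem c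

theorem exists_polynomial_of_laurent {f : Mˣ → M} (hf : f ∈ laurent M) :
    ∃ (N : ℕ) (p : Polynomial M), ∀ t : Mˣ, f t * t.val ^ N = p.eval t.val := by
  induction hf using Algebra.adjoin_induction with
  | mem f hf =>
    rcases hf with rfl | rfl
    · exact ⟨0, Polynomial.X, fun t => by simp⟩
    · exact ⟨1, 1, fun t => by simp⟩
  | algebraMap r => exact ⟨0, Polynomial.C r, fun t => by simp⟩
  | add f g _ _ hf hg =>
    obtain ⟨N, p, hp⟩ := hf
    obtain ⟨N', p', hp'⟩ := hg
    refine ⟨N + N', p * Polynomial.X ^ N' + p' * Polynomial.X ^ N, fun t => ?_⟩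
    simp [← hp, ← hp']
    ring
  | mul f g _ _ hf hg =>
    obtain ⟨N, p, hp⟩ := hf
    obtain ⟨N', p', hp'⟩ := hg
    refine ⟨N + N', p * p', fun t => ?_⟩
    simp [← hp, ← hp']
    ring

theorem finite_zeros_of_laurent {f : Mˣ → M} (hf : f ∈ laurent M) (h : f ≠ 0) :
    {t | f t = 0}.Finite := by
  obtain ⟨N, p, hp⟩ := exists_polynomial_of_laurent hf
  have hp0 : p ≠ 0 := by
    rintro rfl
    apply h
    funext t
    have := hp t
    simpa using this
  refine Set.Finite.of_finite_image (f := Units.val) (s := {t | f t = 0}) ?_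
    Units.val_injective.injOn
  refine (p.rootSet_finite M).subset ?_
  rintro _ ⟨t, ht, rfl⟩
  rw [Polynomial.mem_rootSet]
  refine ⟨hp0, ?_⟩
  have ht' : f t = 0 := ht
  rw [Polynomial.coe_aeval_eq_eval, ← hp, ht', zero_mul]

/-- A quaternion-valued function with Laurent polynomial coordinates. -/
def QLaurent (q : Mˣ → Q.alg M) : Prop :=
  (fun t => (q t).re) ∈ laurent M ∧ (fun t => (q t).imI) ∈ laurent M ∧
    (fun t => (q t).imJ) ∈ laurent M ∧ (fun t => (q t).imK) ∈ laurent M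

theorem QLaurent.congr_fun {p q : Mˣ → Q.alg M} (hp : QLaurent p) (h : ∀ t, p t = q t) :
    QLaurent q := (funext h : p = q) ▸ hp

theorem QLaurent.const (c : Q.alg M) : QLaurent fun _ : Mˣ => c :=
  ⟨const_mem_laurent _, const_mem_laurent _, const_mem_laurent _, const_mem_laurent _⟩

theorem QLaurent.add {p q : Mˣ → Q.alg M} (hp : QLaurent p) (hq : QLaurent q) :
    QLaurent fun t => p t + q t :=
  ⟨add_mem hp.1 hq.1, add_mem hp.2.1 hq.2.1, add_mem hp.2.2.1 hq.2.2.1, add_mem hp.2.2.2 hq.2.2.2⟩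

theorem QLaurent.smul {f : Mˣ → M} {q : Mˣ → Q.alg M} (hf : f ∈ laurent M) (hq : QLaurent q) :
    QLaurent fun t => f t • q t :=
  ⟨mul_mem hf hq.1, mul_mem hf hq.2.1, mul_mem hf hq.2.2.1, mul_mem hf hq.2.2.2⟩

theorem QLaurent.mul {p q : Mˣ → Q.alg M} (hp : QLaurent p) (hq : QLaurent q) :
    QLaurent fun t => p t * q t := by
  obtain ⟨a1, a2, a3, a4⟩ := hp
  obtain ⟨b1, b2, b3, b4⟩ := hq
  have m : ∀ (c : M) {f g : Mˣ → M}, f ∈ laurent M → g ∈ laurent M →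
      (fun t => c * f t * g t) ∈ laurent M := fun c f g hf hg =>
    mul_mem (mul_mem (const_mem_laurent c) hf) hg
  have mm : ∀ {f g : Mˣ → M}, f ∈ laurent M → g ∈ laurent M →
      (fun t => f t * g t) ∈ laurent M := fun hf hg => mul_mem hf hg
  have ad : ∀ {f g : Mˣ → M}, f ∈ laurent M → g ∈ laurent M →
      (fun t => f t + g t) ∈ laurent M := fun hf hg => add_mem hf hg
  have sb : ∀ {f g : Mˣ → M}, f ∈ laurent M → g ∈ laurent M →
      (fun t => f t - g t) ∈ laurent M := fun hf hg => sub_mem hf hg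
  refine ⟨?_, ?_, ?_, ?_⟩
  · simp only [QuaternionAlgebra.re_mul]
    exact sb (ad (ad (ad (mm a1 b1) (m _ a2 b2)) (m _ a3 b3)) (m _ a3 b4)) (m _ a4 b4)
  · simp only [QuaternionAlgebra.imI_mul]
    exact ad (sb (ad (ad (mm a1 b2) (mm a2 b1)) (m _ a2 b2)) (m _ a3 b4)) (m _ a4 b3)
  · simp only [QuaternionAlgebra.imJ_mul]
    exact sb (ad (ad (ad (mm a1 b3) (m _ a2 b4)) (mm a3 b1)) (m _ a3 b2)) (m _ a4 b2)
  · simp only [QuaternionAlgebra.imK_mul]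
    exact ad (sb (ad (ad (mm a1 b4) (mm a2 b3)) (m _ a2 b4)) (mm a3 b2)) (mm a4 b1)

theorem QLaurent.sum {ι : Type*} (s : Finset ι) {q : ι → Mˣ → Q.alg M}
    (h : ∀ i ∈ s, QLaurent (q i)) : QLaurent fun t => ∑ i ∈ s, q i t := by
  classical
  induction s using Finset.induction_on with
  | empty => exact QLaurent.const 0
  | insert i s hi ih =>
    simp only [Finset.sum_insert hi]
    exact (h i (Finset.mem_insert_self i s)).add (ih fun j hj => h j (Finset.mem_insert_of_mem hj))

/-- A Laurent polynomial curve on the group. -/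
def GLaurent (φ : Mˣ → Grp Q n M) : Prop :=
  (∀ i j, QLaurent fun t => (φ t).fst i j) ∧ ∀ i j, (fun t => (φ t).snd i j) ∈ laurent M

theorem GLaurent.const (g : Grp Q n M) : GLaurent fun _ : Mˣ => g :=
  ⟨fun _ _ => QLaurent.const _, fun _ _ => const_mem_laurent _⟩

theorem GLaurent.mul {φ ψ : Mˣ → Grp Q n M} (hφ : GLaurent φ) (hψ : GLaurent ψ) :
    GLaurent fun t => φ t * ψ t := by
  refine ⟨fun i j => ?_, fun i j => ?_⟩
  · simp only [Grp.fst_mul, Matrix.mul_apply]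
    exact QLaurent.sum _ fun l _ => (hφ.1 i l).mul (hψ.1 l j)
  · simp only [Grp.snd_mul, Matrix.mul_apply, Fin.sum_univ_two]
    exact add_mem (mul_mem (hφ.2 _ _) (hψ.2 _ _)) (mul_mem (hφ.2 _ _) (hψ.2 _ _))

theorem GLaurent.comp {φ : Mˣ → Grp Q n M} (hφ : GLaurent φ) {f : Grp Q n M → M}
    (hf : f ∈ polyFun Q n M) : (fun t => f (φ t)) ∈ laurent M := by
  induction hf using Algebra.adjoin_induction with
  | mem f hf =>
    cases hf with
    | re i j => exact (hφ.1 i j).1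
    | imI i j => exact (hφ.1 i j).2.1
    | imJ i j => exact (hφ.1 i j).2.2.1
    | imK i j => exact (hφ.1 i j).2.2.2
    | snd i j => exact hφ.2 i j
  | algebraMap r => exact const_mem_laurent r
  | add f g _ _ hf hg => exact add_mem hf hg
  | mul f g _ _ hf hg => exact mul_mem hf hg

/-- The infinite set `Mˣ` is connected in the cofinite topology. A Laurent curve is continuous from
it to the Zariski topology because a non-zero Laurent polynomial has finitely many zeros. -/
theorem GLaurent.mem_idComp [Infinite M] {φ : Mˣ → Grp Q n M} (hφ : GLaurent φ)
    {S : Subgroup (Grp Q n M)} (hS : ∀ t, φ t ∈ S) (h1 : φ 1 = 1) (t : Mˣ) : φ t ∈ idComp S := by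
  let _ := zariski Q n M
  have : Infinite Mˣ :=
    have : Infinite ({0}ᶜ : Set M) := (Set.finite_singleton (0 : M)).infinite_compl.to_subtype
    Infinite.of_injective (fun a : ({0}ᶜ : Set M) => Units.mk0 a.1 a.2) fun a b h =>
      Subtype.ext (congrArg Units.val h)
  let ψ : CofiniteTopology Mˣ → Grp Q n M := fun t => φ (CofiniteTopology.of.symm t)
  have hc : Continuous ψ := by
    refine continuous_generateFrom_iff.mpr ?_
    rintro _ ⟨f, hf, rfl⟩
    rw [CofiniteTopology.isOpen_iff']
    by_cases h0 : (fun t => f (φ t)) = 0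
    · left
      ext t
      have := congrFun h0 (CofiniteTopology.of.symm t)
      simpa [ψ] using this
    · right
      have := finite_zeros_of_laurent (hφ.comp hf) h0
      refine (this.image CofiniteTopology.of).subset ?_
      intro t ht
      refine ⟨CofiniteTopology.of.symm t, ?_, CofiniteTopology.of.apply_symm_apply t⟩
      simpa [ψ] using ht
  have hpre : IsPreconnected (Set.range ψ) := isPreconnected_range hc
  refine hpre.subset_connectedComponentIn (F := (S : Set (Grp Q n M))) (x := 1)
    ⟨CofiniteTopology.of 1, ?_⟩ ?_ ⟨CofiniteTopology.of t, ?_⟩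
  · simpa [ψ] using h1
  · rintro _ ⟨t, rfl⟩
    exact hS _
  · simp [ψ]

end Curves

end HermitianPairs
end

/-! ### Action of the stabilizer on the zeros -/

noncomputable section
namespace HermitianPairs
open MvPolynomial
open scoped Quaternion Matrix
attribute [local instance] MvPolynomial.gradedAlgebra

variable {k : Type u} [Field k] {Q : QuatAlg k} {n : ℕ}

theorem pencil_ext {R : Type u} [CommRing R] [Algebra k R] {x y : Amb Q n R}
    (h : ∀ v, pencil x v = pencil y v) : x = y := by
  funext i
  have := h (Pi.single i 1)
  fin_cases i <;> simpa [pencil] using this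

/-- The element of `G` with given components. -/
def Grp.of {R : Type u} [CommRing R] [Algebra k R] (a : (Matrix (Fin n) (Fin n) (Q.alg R))ˣ)
    (A : (Matrix (Fin 2) (Fin 2) R)ˣ) : Grp Q n R := (a, A)

theorem SplitsAt.aeval_eq_zero_iff_planeDet {L K : Type u} [Field L] [Field K] [Algebra L K]
    {F : MvPolynomial (Fin 2) L} {u : Fin n → Fin 2 → K} (h : SplitsAt F u) (v : Fin 2 → K) :
    aeval v F = 0 ↔ ∃ i, planeDet (u i) v = 0 := by
  obtain ⟨c, hc, e⟩ := h.eq_prod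
  rw [aeval_def, ← eval_map, e]
  simp [eval_linForm, hc, Finset.prod_eq_zero_iff]

section SepClosed
variable {M : Type u} [Field M] [Algebra k M]

theorem mapsZeros_of_smul [IsSepClosed M] (hn : n = 2 ∨ n = 3) {z : Amb Q n M} (hz : z ∈ V Q n M)
    (g : Grp Q n M)
    {u u' : Fin n → Fin 2 → M} (hu : SplitsAt (formF z) u) (hu' : SplitsAt (formF (g • z)) u') :
    MapsZeros g.snd u' u := by
  intro i
  obtain ⟨c, hc, e⟩ := formF_smul hn hz g
  have h := hu'.aeval_eq_zero i
  rw [e, _root_.map_mul, aeval_C, mul_eq_zero, aeval_substHom] at h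
  have h1 := h.resolve_left (by simpa using hc)
  obtain ⟨j, hj⟩ := (hu.aeval_eq_zero_iff_planeDet _).mp h1
  refine ⟨j, planeDet_comm_zero ?_⟩
  convert hj using 2
  ext a
  simp

/-- Both pencils are congruent to the same diagonal pencil, since the normal form involves only the
zeros. -/
theorem exists_smul_of_common_zeros [IsSepClosed M] (hn : n = 2 ∨ n = 3) {z z' : Amb Q n M}
    (hz : z ∈ V Q n M)
    (hz' : z' ∈ V Q n M) {u : Fin n → Fin 2 → M} (hu : SplitsAt (formF z) u)
    (hu' : SplitsAt (formF z') u) :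
    ∃ g : (Matrix (Fin n) (Fin n) (Q.alg M))ˣ, Grp.of g 1 • z = z' := by
  obtain ⟨g, hg⟩ := exists_congr_normalForm hn hz hu
  obtain ⟨g', hg'⟩ := exists_congr_normalForm hn hz' hu'
  refine ⟨g'⁻¹ * g, pencil_ext fun v => ?_⟩
  rw [pencil_smul]
  change g'⁻¹.val * g.val * pencil z (v ᵥ* (1 : Matrix (Fin 2) (Fin 2) M)) *
    (g'⁻¹.val * g.val)ᴴ = _
  rw [Matrix.vecMul_one, Matrix.conjTranspose_mul]
  calc _ = g'⁻¹.val * (g.val * pencil z v * g.valᴴ) * (g'⁻¹.val)ᴴ := by simp only [mul_assoc]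
    _ = g'⁻¹.val * g'.val * pencil z' v * (g'⁻¹.val * g'.val)ᴴ := by
      rw [hg, ← hg', Matrix.conjTranspose_mul]
      simp only [mul_assoc]
    _ = _ := by rw [Units.inv_mul, Matrix.conjTranspose_one, one_mul, mul_one]

theorem planeDet_mem_polyFun (u w : Fin 2 → M) :
    (fun g : Grp Q n M => planeDet (u ᵥ* g.snd) w) ∈ polyFun Q n M := by
  have hc : ∀ i j, (fun g : Grp Q n M => g.snd i j) ∈ polyFun Q n M :=
    fun i j => Algebra.subset_adjoin (.snd i j)
  have : (fun g : Grp Q n M => planeDet (u ᵥ* g.snd) w) =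
      (w 1 * u 0) • (fun g : Grp Q n M => g.snd 0 0) +
      (w 1 * u 1) • (fun g : Grp Q n M => g.snd 1 0) -
      (w 0 * u 0) • (fun g : Grp Q n M => g.snd 0 1) -
      (w 0 * u 1) • (fun g : Grp Q n M => g.snd 1 1) := by
    funext g
    simp [planeDet, Matrix.vecMul, dotProduct, Fin.sum_univ_two]
    ring
  rw [this]
  exact sub_mem (sub_mem (add_mem (Subalgebra.smul_mem _ (hc 0 0) _)
    (Subalgebra.smul_mem _ (hc 1 0) _)) (Subalgebra.smul_mem _ (hc 0 1) _))
    (Subalgebra.smul_mem _ (hc 1 1) _)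

/-- The stabilizer is covered by two disjoint closed sets: the elements fixing every zero, and those
inducing one of the finitely many other maps on zeros. A connected set through the identity stays in
the first. -/
theorem fixes_zeros_of_mem_idComp [IsSepClosed M] (hn : n = 2 ∨ n = 3) {z : Amb Q n M}
    (hz : z ∈ V Q n M)
    {u : Fin n → Fin 2 → M} (hu : SplitsAt (formF z) u) {g : Grp Q n M}
    (hg : g ∈ idComp (MulAction.stabilizer (Grp Q n M) z)) (i : Fin n) :
    planeDet (u i ᵥ* g.snd) (u i) = 0 := by
  let _ := zariski Q n M
  have hclosed : ∀ u w : Fin 2 → M, IsClosed {g : Grp Q n M | planeDet (u ᵥ* g.snd) w = 0} := by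
    intro u w
    rw [← isOpen_compl_iff]
    exact TopologicalSpace.isOpen_generateFrom_of_mem ⟨_, planeDet_mem_polyFun u w, rfl⟩
  let A : Set (Grp Q n M) := ⋂ i, {g | planeDet (u i ᵥ* g.snd) (u i) = 0}
  let B : Set (Grp Q n M) := ⋃ π ∈ {π : Fin n → Fin n | π ≠ id},
    ⋂ i, {g | planeDet (u i ᵥ* g.snd) (u (π i)) = 0}
  have hA : IsClosed A := isClosed_iInter fun i => hclosed _ _
  have hB : IsClosed B := (Set.toFinite _).isClosed_biUnion fun π _ =>
    isClosed_iInter fun i => hclosed _ _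
  have hpre : IsPreconnected (idCompSet (MulAction.stabilizer (Grp Q n M) z)) :=
    isPreconnected_connectedComponentIn
  by_contra hne
  have hsub : idCompSet (MulAction.stabilizer (Grp Q n M) z) ⊆ A ∪ B := by
    intro h hh
    have hs : h • z = z := idCompSet_subset _ hh
    choose π hπ using mapsZeros_of_smul hn hz h hu (by rwa [hs])
    by_cases hid : π = id
    · left
      refine Set.mem_iInter.mpr fun i => ?_
      have := hπ i
      rwa [hid] at this
    · right
      exact Set.mem_biUnion (show π ∈ {π : Fin n → Fin n | π ≠ id} from hid)
        (Set.mem_iInter.mpr hπ)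
  obtain ⟨h, -, hhA, hhB⟩ := isPreconnected_closed_iff.mp hpre A B hA hB hsub
    ⟨1, one_mem_idCompSet _, Set.mem_iInter.mpr fun i => by
      change planeDet (u i ᵥ* (1 : Matrix (Fin 2) (Fin 2) M)) (u i) = 0
      rw [Matrix.vecMul_one, planeDet_self]⟩
    ⟨g, hg, (hsub hg).resolve_left fun h => hne (Set.mem_iInter.mp h i)⟩
  obtain ⟨π, hπ, hhB⟩ := Set.mem_iUnion₂.mp hhB
  obtain ⟨j, hj⟩ := Function.ne_iff.mp (show π ≠ id from hπ)
  have h1 : planeDet (u j ᵥ* h.snd) (u j) = 0 := Set.mem_iInter.mp hhA j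
  have h2 : planeDet (u j ᵥ* h.snd) (u (π j)) = 0 := Set.mem_iInter.mp hhB j
  exact hu.det_ne_zero _ _ (Ne.symm hj)
    (planeDet_trans (vecMul_ne_zero (hu.ne_zero j) h.sndUnit) (planeDet_comm_zero h1) h2)

end SepClosed

end HermitianPairs
end

/-! ### Stabilizer elements that fix every zero -/

noncomputable section
namespace HermitianPairs
open MvPolynomial
open scoped Quaternion Matrix
attribute [local instance] MvPolynomial.gradedAlgebra

variable {k : Type u} [Field k] {Q : QuatAlg k} {n : ℕ}

section Slots
variable {M : Type u} [Field M] [Algebra k M]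

/-- The diagonal matrices with invertible entries, conjugated by `g`, together with the second
component of the group. -/
def slotHom (g : (Matrix (Fin n) (Fin n) (Q.alg M))ˣ) :
    (Fin n → (Q.alg M)ˣ) × (Matrix (Fin 2) (Fin 2) M)ˣ →* Grp Q n M :=
  MonoidHom.prodMap ((MulAut.conj g⁻¹).toMonoidHom.comp
    ((Units.map (Matrix.diagonalRingHom (Fin n) (Q.alg M)).toMonoidHom).comp
      MulEquiv.piUnits.symm.toMonoidHom)) (MonoidHom.id _)

theorem slotHom_fst (g : (Matrix (Fin n) (Fin n) (Q.alg M))ˣ)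
    (p : (Fin n → (Q.alg M)ˣ) × (Matrix (Fin 2) (Fin 2) M)ˣ) :
    (slotHom g p).fst = g⁻¹.val * Matrix.diagonal (fun i => (p.1 i).val) * g.val := rfl

theorem slotHom_eq (g : (Matrix (Fin n) (Fin n) (Q.alg M))ˣ)
    (p : (Fin n → (Q.alg M)ˣ) × (Matrix (Fin 2) (Fin 2) M)ˣ) :
    slotHom g p = Grp.of g⁻¹ 1 * slotHom 1 p * Grp.of g 1 := by
  refine Grp.ext' ?_ ?_
  · rw [Grp.fst_mul, Grp.fst_mul, slotHom_fst, slotHom_fst]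
    change _ = g⁻¹.val * (1 * _ * 1) * g.val
    rw [one_mul, mul_one]
  · rw [Grp.snd_mul, Grp.snd_mul]
    change p.2.val = 1 * p.2.val * 1
    rw [one_mul, mul_one]

/-- The condition on the reduced norms under which a pair stabilizes the diagonal pencil with
zeros `u`. -/
def Fits (u : Fin n → Fin 2 → M) (p : (Fin n → (Q.alg M)ˣ) × (Matrix (Fin 2) (Fin 2) M)ˣ) : Prop :=
  ∀ i v, qNorm Q (p.1 i).val * planeDet (u i) (v ᵥ* p.2.val) = planeDet (u i) v

variable {u : Fin n → Fin 2 → M} {p p' : (Fin n → (Q.alg M)ˣ) × (Matrix (Fin 2) (Fin 2) M)ˣ}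

theorem Fits.mul (h : Fits u p) (h' : Fits u p') : Fits u (p * p') := by
  intro i v
  change qNorm Q ((p.1 i).val * (p'.1 i).val) * planeDet (u i) (v ᵥ* (p.2.val * p'.2.val)) = _
  rw [qNorm_mul, ← Matrix.vecMul_vecMul, mul_assoc, h' i, h i]

theorem Fits.inv (h : Fits u p) : Fits u p⁻¹ := by
  intro i v
  have := h i (v ᵥ* p.2⁻¹.val)
  rw [Matrix.vecMul_vecMul, Units.inv_mul, Matrix.vecMul_one] at this
  change qNorm Q (p.1 i)⁻¹.val * planeDet (u i) (v ᵥ* p.2⁻¹.val) = _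
  rw [← this, ← mul_assoc, ← qNorm_mul, Units.inv_mul]
  simp [qNorm]

theorem fits_of_qNorm_eq_one {q : Fin n → (Q.alg M)ˣ} (h : ∀ i, qNorm Q (q i).val = 1) :
    Fits u (q, 1) := by
  intro i v
  change qNorm Q (q i).val * planeDet (u i) (v ᵥ* (1 : Matrix (Fin 2) (Fin 2) M)) = _
  rw [h i, one_mul, Matrix.vecMul_one]

theorem Fits.qNorm_eq_one {q : Fin n → (Q.alg M)ˣ} (hu : ∀ i, u i ≠ 0) (h : Fits u (q, 1)) (i) :
    qNorm Q (q i).val = 1 := by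
  obtain ⟨v, hv⟩ : ∃ v, planeDet (u i) v ≠ 0 := by
    by_contra! h
    apply hu i
    funext j
    have h0 := h ![1, 0]
    have h1 := h ![0, 1]
    simp [planeDet] at h0 h1
    fin_cases j <;> assumption
  have := h i v
  change qNorm Q (q i).val * planeDet (u i) (v ᵥ* (1 : Matrix (Fin 2) (Fin 2) M)) = _ at this
  rw [Matrix.vecMul_one] at this
  exact mul_right_cancel₀ hv (this.trans (one_mul _).symm)

theorem Fits.smul_eq {z : Amb Q n M} {g : (Matrix (Fin n) (Fin n) (Q.alg M))ˣ}
    (hg : ∀ v, g.val * pencil z v * g.valᴴ =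
      Matrix.diagonal fun i => algebraMap M (Q.alg M) (planeDet (u i) v)) (h : Fits u p) :
    slotHom g p • z = z := by
  refine pencil_ext fun v => ?_
  rw [pencil_smul, slotHom_fst]
  change _ * pencil z (v ᵥ* p.2.val) * _ = _
  have hd : Matrix.diagonal (fun i => (p.1 i).val) * (g.val * pencil z (v ᵥ* p.2.val) * g.valᴴ) *
      (Matrix.diagonal (fun i => (p.1 i).val))ᴴ = g.val * pencil z v * g.valᴴ := by
    rw [hg, hg, Matrix.diagonal_conjTranspose, Matrix.diagonal_mul_diagonal,
      Matrix.diagonal_mul_diagonal]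
    congr 1
    funext i
    change _ * _ * star (p.1 i).val = _
    rw [← Algebra.commutes, mul_assoc, mul_star_eq, ← _root_.map_mul, mul_comm, h i]
  calc _ = g⁻¹.val * (Matrix.diagonal (fun i => (p.1 i).val) *
        (g.val * pencil z (v ᵥ* p.2.val) * g.valᴴ) *
          (Matrix.diagonal (fun i => (p.1 i).val))ᴴ) * (g⁻¹.val)ᴴ := by
        simp only [Matrix.conjTranspose_mul, mul_assoc]
    _ = g⁻¹.val * g.val * pencil z v * (g⁻¹.val * g.val)ᴴ := by
        rw [hd, Matrix.conjTranspose_mul]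
        simp only [mul_assoc]
    _ = _ := by rw [Units.inv_mul, Matrix.conjTranspose_one, one_mul, mul_one]

/-- With `m'` the inverse of `m`, invariance reads `m * D(v h₂) = D(v) * m'ᴴ` for the diagonal
pencil `D`. At `v = u i` the `i`-th row on the right vanishes, while on the left `m i j` carries a
non-zero factor: `u i` is fixed and independent of `u j`. -/
theorem isDiag_of_smul_eq {z : Amb Q n M} {g : (Matrix (Fin n) (Fin n) (Q.alg M))ˣ}
    (hdet : ∀ i j, i ≠ j → planeDet (u i) (u j) ≠ 0) (hu0 : ∀ i, u i ≠ 0)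
    (hg : ∀ v, g.val * pencil z v * g.valᴴ =
      Matrix.diagonal fun i => algebraMap M (Q.alg M) (planeDet (u i) v)) {h : Grp Q n M}
    (hz : h • z = z) (hfix : ∀ i, planeDet (u i ᵥ* h.snd) (u i) = 0) {i j : Fin n} (hij : i ≠ j) :
    (g.val * h.fst * g⁻¹.val) i j = 0 := by
  set m := g.val * h.fst * g⁻¹.val with hm
  let m' := g.val * h⁻¹.fst * g⁻¹.val
  have hmm : m * m' = 1 := by
    have : h.fst * h⁻¹.fst = 1 := by rw [← Grp.fst_mul, mul_inv_cancel]; rfl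
    calc m * m' = g.val * (h.fst * (g⁻¹.val * g.val) * h⁻¹.fst) * g⁻¹.val := by
          simp only [m, m', mul_assoc]
      _ = 1 := by rw [Units.inv_mul, mul_one, this, mul_one, Units.mul_inv]
  have hmm' : m' * m = 1 := by
    have : h⁻¹.fst * h.fst = 1 := by rw [← Grp.fst_mul, inv_mul_cancel]; rfl
    calc m' * m = g.val * (h⁻¹.fst * (g⁻¹.val * g.val) * h.fst) * g⁻¹.val := by
          simp only [m, m', mul_assoc]
      _ = 1 := by rw [Units.inv_mul, mul_one, this, mul_one, Units.mul_inv]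
  have key : ∀ v, m * (Matrix.diagonal fun i =>
      algebraMap M (Q.alg M) (planeDet (u i) (v ᵥ* h.snd))) =
      (Matrix.diagonal fun i => algebraMap M (Q.alg M) (planeDet (u i) v)) * m'ᴴ := by
    intro v
    have e : pencil z v = h.fst * pencil z (v ᵥ* h.snd) * h.fstᴴ := by
      rw [← pencil_smul, hz]
    have e1 : m * (Matrix.diagonal fun i =>
        algebraMap M (Q.alg M) (planeDet (u i) (v ᵥ* h.snd))) * mᴴ =
        Matrix.diagonal fun i => algebraMap M (Q.alg M) (planeDet (u i) v) := by
      rw [← hg v, e, ← hg]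
      calc _ = g.val * h.fst * (g⁻¹.val * g.val) * pencil z (v ᵥ* h.snd) *
            (g.val * h.fst * (g⁻¹.val * g.val))ᴴ := by
            simp only [hm, Matrix.conjTranspose_mul, mul_assoc]
        _ = _ := by
          rw [Units.inv_mul, mul_one, Matrix.conjTranspose_mul]
          simp only [mul_assoc]
    rw [← e1, mul_assoc _ mᴴ, ← Matrix.conjTranspose_mul, hmm', Matrix.conjTranspose_one, mul_one]
  have hij' := congrFun (congrFun (key (u i)) i) j
  rw [Matrix.mul_diagonal, Matrix.diagonal_mul, planeDet_self, map_zero, zero_mul,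
    ← Algebra.commutes, ← Algebra.smul_def] at hij'
  refine (smul_eq_zero.mp hij').resolve_left fun h0 => hdet j i hij.symm ?_
  exact planeDet_trans (vecMul_ne_zero (hu0 i) h.sndUnit) h0 (hfix i)

/-- The conjugates of `h` and of its inverse are both diagonal, so the entries are units; the
diagonal part of the invariance is then the norm condition `Fits`. -/
theorem exists_slotHom_eq {z : Amb Q n M} {g : (Matrix (Fin n) (Fin n) (Q.alg M))ˣ}
    (hdet : ∀ i j, i ≠ j → planeDet (u i) (u j) ≠ 0) (hu0 : ∀ i, u i ≠ 0)
    (hg : ∀ v, g.val * pencil z v * g.valᴴ =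
      Matrix.diagonal fun i => algebraMap M (Q.alg M) (planeDet (u i) v)) {h : Grp Q n M}
    (hz : h • z = z) (hfix : ∀ i, planeDet (u i ᵥ* h.snd) (u i) = 0) :
    ∃ p, Fits u p ∧ slotHom g p = h := by
  have hz' : h⁻¹ • z = z := by rw [inv_smul_eq_iff, hz]
  have hfix' : ∀ i, planeDet (u i ᵥ* h⁻¹.snd) (u i) = 0 := fun i =>
    planeDet_vecMul_inv (A := h.sndUnit) (hfix i)
  have d := eq_diagonal_of_apply fun i j hij => isDiag_of_smul_eq hdet hu0 hg hz hfix (i := i)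
    (j := j) hij
  have d' := eq_diagonal_of_apply fun i j hij => isDiag_of_smul_eq hdet hu0 hg hz' hfix' (i := i)
    (j := j) hij
  set m := g.val * h.fst * g⁻¹.val with hm
  set m' := g.val * h⁻¹.fst * g⁻¹.val with hm'
  have hmm : m * m' = 1 := by
    have : h.fst * h⁻¹.fst = 1 := by rw [← Grp.fst_mul, mul_inv_cancel]; rfl
    calc m * m' = g.val * (h.fst * (g⁻¹.val * g.val) * h⁻¹.fst) * g⁻¹.val := by
          simp only [m, m', mul_assoc]
      _ = 1 := by rw [Units.inv_mul, mul_one, this, mul_one, Units.mul_inv]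
  have hmm' : m' * m = 1 := by
    have : h⁻¹.fst * h.fst = 1 := by rw [← Grp.fst_mul, inv_mul_cancel]; rfl
    calc m' * m = g.val * (h⁻¹.fst * (g⁻¹.val * g.val) * h.fst) * g⁻¹.val := by
          simp only [m, m', mul_assoc]
      _ = 1 := by rw [Units.inv_mul, mul_one, this, mul_one, Units.mul_inv]
  have c1 : ∀ i, m i i * m' i i = 1 := by
    intro i
    rw [d, d', Matrix.diagonal_mul_diagonal] at hmm
    simpa using congrFun (congrFun hmm i) i
  have c2 : ∀ i, m' i i * m i i = 1 := by
    intro i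
    rw [d, d', Matrix.diagonal_mul_diagonal] at hmm'
    simpa using congrFun (congrFun hmm' i) i
  let q : Fin n → (Q.alg M)ˣ := fun i => ⟨m i i, m' i i, c1 i, c2 i⟩
  have hq : slotHom g (q, h.sndUnit) = h := by
    refine Grp.ext' ?_ rfl
    rw [slotHom_fst]
    change g⁻¹.val * (Matrix.diagonal fun i => m i i) * g.val = _
    rw [← d, hm]
    calc _ = (g⁻¹.val * g.val) * h.fst * (g⁻¹.val * g.val) := by simp only [mul_assoc]
      _ = _ := by rw [Units.inv_mul, one_mul, mul_one]
  refine ⟨(q, h.sndUnit), fun i v => ?_, hq⟩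
  have e1 : m * (Matrix.diagonal fun i =>
      algebraMap M (Q.alg M) (planeDet (u i) (v ᵥ* h.snd))) * mᴴ =
      Matrix.diagonal fun i => algebraMap M (Q.alg M) (planeDet (u i) v) := by
    have e : pencil z v = h.fst * pencil z (v ᵥ* h.snd) * h.fstᴴ := by
      rw [← pencil_smul, hz]
    rw [← hg v, e, ← hg]
    calc _ = g.val * h.fst * (g⁻¹.val * g.val) * pencil z (v ᵥ* h.snd) *
          (g.val * h.fst * (g⁻¹.val * g.val))ᴴ := by
          simp only [hm, Matrix.conjTranspose_mul, mul_assoc]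
      _ = _ := by
        rw [Units.inv_mul, mul_one, Matrix.conjTranspose_mul]
        simp only [mul_assoc]
  rw [d, Matrix.diagonal_conjTranspose, Matrix.diagonal_mul_diagonal,
    Matrix.diagonal_mul_diagonal] at e1
  have e2 := congrFun (congrFun e1 i) i
  rw [Matrix.diagonal_apply_eq, Matrix.diagonal_apply_eq] at e2
  change m i i * _ * star (m i i) = _ at e2
  rw [← Algebra.commutes, mul_assoc, mul_star_eq, ← _root_.map_mul] at e2
  have e3 := congrArg QuaternionAlgebra.re e2
  simp only [QuaternionAlgebra.algebraMap_eq] at e3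
  rw [mul_comm]
  exact e3

end Slots

end HermitianPairs
end

/-! ### Joining norm-one elements and tori to the identity -/

noncomputable section
namespace HermitianPairs
open MvPolynomial
open scoped Quaternion Matrix MatrixGroups
attribute [local instance] MvPolynomial.gradedAlgebra

variable {k : Type u} [Field k] {Q : QuatAlg k} {n : ℕ}

section SepClosed
variable {M : Type u} [Field M] [Algebra k M]
variable {u : Fin n → Fin 2 → M} {z : Amb Q n M} {g : (Matrix (Fin n) (Fin n) (Q.alg M))ˣ}

theorem slotHom_mem_idComp_of_curve [IsSepClosed M]
    (hg : ∀ v, g.val * pencil z v * g.valᴴ =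
      Matrix.diagonal fun i => algebraMap M (Q.alg M) (planeDet (u i) v))
    {φ : Mˣ → (Fin n → (Q.alg M)ˣ) × (Matrix (Fin 2) (Fin 2) M)ˣ} (hφ : ∀ t, Fits u (φ t))
    (h₁ : ∀ i, QLaurent fun t => ((φ t).1 i).val)
    (h₂ : ∀ i j, (fun t => (φ t).2.val i j) ∈ laurent M) (h0 : φ 1 = 1) (t : Mˣ) :
    slotHom g (φ t) ∈ idComp (MulAction.stabilizer (Grp Q n M) z) := by
  have := infinite_of_isSepClosed M
  refine GLaurent.mem_idComp (φ := fun t => slotHom g (φ t)) ?_ (fun t => (hφ t).smul_eq hg)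
    (by rw [h0, map_one]) t
  simp only [slotHom_eq g]
  refine ((GLaurent.const _).mul ⟨fun i j => ?_, h₂⟩).mul (GLaurent.const _)
  by_cases hij : i = j
  · subst hij
    refine (h₁ i).congr_fun fun t => ?_
    rw [slotHom_fst]
    change _ = (1 * Matrix.diagonal (fun i => ((φ t).1 i).val) * 1 : Matrix _ _ (Q.alg M)) i i
    rw [one_mul, mul_one, Matrix.diagonal_apply_eq]
  · refine (QLaurent.const 0).congr_fun fun t => ?_
    rw [slotHom_fst]
    change _ = (1 * Matrix.diagonal (fun i => ((φ t).1 i).val) * 1 : Matrix _ _ (Q.alg M)) i j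
    rw [one_mul, mul_one, Matrix.diagonal_apply_ne _ hij]

theorem exists_unit_ne_one (M : Type u) [Field M] [IsSepClosed M] : ∃ t : Mˣ, t.val ≠ 1 := by
  have := infinite_of_isSepClosed M
  classical
  obtain ⟨t, ht⟩ := Infinite.exists_notMem_finset ({0, 1} : Finset M)
  simp only [Finset.mem_insert, Finset.mem_singleton, not_or] at ht
  exact ⟨Units.mk0 t ht.1, ht.2⟩

/-- The elements of reduced norm one of a split quaternion algebra. -/
def normOneHom (ψ : Q.alg M ≃ₐ[M] Matrix (Fin 2) (Fin 2) M) : SL(2, M) →* (Q.alg M)ˣ :=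
  (Units.map ψ.symm.toRingEquiv.toMonoidHom).comp Matrix.SpecialLinearGroup.toGL

theorem normOneHom_val (ψ : Q.alg M ≃ₐ[M] Matrix (Fin 2) (Fin 2) M) (A : SL(2, M)) :
    (normOneHom ψ A).val = ψ.symm A.val := rfl

theorem qNorm_normOneHom {ψ : Q.alg M ≃ₐ[M] Matrix (Fin 2) (Fin 2) M}
    (hψ : ∀ q, (ψ q).det = qNorm Q q) (A : SL(2, M)) : qNorm Q (normOneHom ψ A).val = 1 := by
  rw [normOneHom_val, ← hψ, ψ.apply_symm_apply, A.2]

theorem slotHom_transvection_mem [IsSepClosed M] (hg : ∀ v, g.val * pencil z v * g.valᴴ =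
      Matrix.diagonal fun i => algebraMap M (Q.alg M) (planeDet (u i) v))
    {ψ : Q.alg M ≃ₐ[M] Matrix (Fin 2) (Fin 2) M} (hψ : ∀ q, (ψ q).det = qNorm Q q) (i : Fin n)
    {a b : Fin 2} (hab : a ≠ b) (c : M) :
    slotHom g (Pi.mulSingle i (normOneHom ψ (Matrix.SpecialLinearGroup.transvection hab c)), 1) ∈
      idComp (MulAction.stabilizer (Grp Q n M) z) := by
  obtain ⟨t₀, ht₀⟩ := exists_unit_ne_one M
  have ht₀' : t₀.val - 1 ≠ 0 := sub_ne_zero.mpr ht₀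
  -- The additive parameter is rescaled so that the curve is trivial at `t = 1` and reaches the
  -- given transvection at `t₀`.
  let φ : Mˣ → (Fin n → (Q.alg M)ˣ) × (Matrix (Fin 2) (Fin 2) M)ˣ := fun t =>
    (Pi.mulSingle i (normOneHom ψ (Matrix.SpecialLinearGroup.transvection hab
      ((t.val - 1) * (c / (t₀.val - 1))))), 1)
  have hφ : ∀ t, Fits u (φ t) := fun t => fits_of_qNorm_eq_one fun j => by
    by_cases hj : j = i
    · subst hj
      rw [Pi.mulSingle_eq_same, qNorm_normOneHom hψ]
    · rw [Pi.mulSingle_eq_of_ne hj]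
      simp [qNorm]
  have hL : ∀ j, QLaurent fun t => ((φ t).1 j).val := by
    intro j
    by_cases hj : j = i
    · subst hj
      refine ((QLaurent.const 1).add (QLaurent.smul (sub_mem val_mem_laurent
        (const_mem_laurent 1)) (QLaurent.const (ψ.symm (Matrix.single a b
          (c / (t₀.val - 1))))))).congr_fun fun t => ?_
      simp only [φ]
      rw [Pi.mulSingle_eq_same, normOneHom_val, Matrix.SpecialLinearGroup.transvection_coe,
        _root_.map_add, map_one, ← smul_eq_mul, ← Matrix.smul_single, _root_.map_smul]
      rfl
    · refine (QLaurent.const 1).congr_fun fun t => ?_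
      simp only [φ]
      rw [Pi.mulSingle_eq_of_ne hj]
      rfl
  have h1 : φ 1 = 1 := by
    simp only [φ, Units.val_one, sub_self, zero_mul,
      Matrix.SpecialLinearGroup.transvection_coeff_zero, map_one, Pi.mulSingle_one]
    rfl
  have h := slotHom_mem_idComp_of_curve hg hφ hL (fun a b => const_mem_laurent _) h1 t₀
  have e : (t₀.val - 1) * (c / (t₀.val - 1)) = c := by field_simp
  simp only [φ, e] at h
  exact h

/-- With trivial second component the norm condition says that every quaternion has reduced norm
one. This gives `n` copies of `SL₂`, which is generated by transvections. -/
theorem slotHom_norm_one_mem [IsSepClosed M] (hu : ∀ i, u i ≠ 0)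
    (hg : ∀ v, g.val * pencil z v * g.valᴴ =
      Matrix.diagonal fun i => algebraMap M (Q.alg M) (planeDet (u i) v))
    {q : Fin n → (Q.alg M)ˣ} (hq : Fits u (q, 1)) :
    slotHom g (q, 1) ∈ idComp (MulAction.stabilizer (Grp Q n M) z) := by
  obtain ⟨ψ, hψ⟩ := exists_splitting Q M
  obtain ⟨W, hW⟩ : ∃ W : Subgroup (Fin n → (Q.alg M)ˣ), ∀ q, q ∈ W ↔
      slotHom g (q, 1) ∈ idComp (MulAction.stabilizer (Grp Q n M) z) :=
    ⟨(idComp (MulAction.stabilizer (Grp Q n M) z)).comap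
      ((slotHom g).comp (MonoidHom.inl _ _)), fun _ => Iff.rfl⟩
  have hslot : ∀ i A, Pi.mulSingle i (normOneHom ψ A) ∈ W := by
    intro i A
    refine Matrix.SL2.transvection_induction (fun A => Pi.mulSingle i (normOneHom ψ A) ∈ W)
      (fun a b hab c => ?_) (fun A B hA hB => ?_) A
    · rw [hW]
      exact slotHom_transvection_mem hg hψ i hab c
    rw [_root_.map_mul, Pi.mulSingle_mul]
    exact W.mul_mem hA hB
  rw [← hW]
  refine Subgroup.pi_mem_of_mulSingle_mem q fun i => ?_
  let A : SL(2, M) := ⟨ψ (q i).val, by rw [hψ, hq.qNorm_eq_one hu]⟩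
  have e : q i = normOneHom ψ A := Units.ext (ψ.symm_apply_apply _).symm
  rw [e]
  exact hslot _ _

/-- A quaternion of reduced norm `t⁻¹` depending on `t` by Laurent polynomials. -/
def torusUnit (ψ : Q.alg M ≃ₐ[M] Matrix (Fin 2) (Fin 2) M) (t : Mˣ) : (Q.alg M)ˣ where
  val := ψ.symm (Matrix.diagonal ![t⁻¹.val, 1])
  inv := ψ.symm (Matrix.diagonal ![t.val, 1])
  val_inv := by
    rw [← _root_.map_mul, Matrix.diagonal_mul_diagonal, ← map_one ψ.symm]
    congr 1
    ext i j
    fin_cases i <;> fin_cases j <;> simp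
  inv_val := by
    rw [← _root_.map_mul, Matrix.diagonal_mul_diagonal, ← map_one ψ.symm]
    congr 1
    ext i j
    fin_cases i <;> fin_cases j <;> simp

/-- The factor `t` acquired by the determinants with index in `s` is compensated by quaternions of
reduced norm `t⁻¹`, and the resulting curve has Laurent coordinates. -/
theorem exists_fits_mem_idComp_of_torus [IsSepClosed M]
    (hg : ∀ v, g.val * pencil z v * g.valᴴ =
      Matrix.diagonal fun i => algebraMap M (Q.alg M) (planeDet (u i) v))
    (A : Mˣ → (Matrix (Fin 2) (Fin 2) M)ˣ) (hA : ∀ i j, (fun t => (A t).val i j) ∈ laurent M)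
    (hA1 : A 1 = 1) (s : Set (Fin n))
    (hAs : ∀ t, ∀ i ∈ s, ∀ v, planeDet (u i) (v ᵥ* (A t).val) = t.val * planeDet (u i) v)
    (hAs' : ∀ t, ∀ i ∉ s, ∀ v, planeDet (u i) (v ᵥ* (A t).val) = planeDet (u i) v) (t : Mˣ) :
    ∃ q, Fits u (q, A t) ∧
      slotHom g (q, A t) ∈ idComp (MulAction.stabilizer (Grp Q n M) z) := by
  classical
  obtain ⟨ψ, hψ⟩ := exists_splitting Q M
  let φ : Mˣ → (Fin n → (Q.alg M)ˣ) × (Matrix (Fin 2) (Fin 2) M)ˣ := fun t =>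
    (fun i => if i ∈ s then torusUnit ψ t else 1, A t)
  have hfits : ∀ t, Fits u (φ t) := by
    intro t i v
    change qNorm Q (if i ∈ s then torusUnit ψ t else 1 : (Q.alg M)ˣ).val *
      planeDet (u i) (v ᵥ* (A t).val) = _
    by_cases hi : i ∈ s
    · rw [if_pos hi, hAs t i hi, ← hψ, torusUnit, ψ.apply_symm_apply]
      simp
    · rw [if_neg hi, hAs' t i hi]
      simp [qNorm]
  refine ⟨(φ t).1, hfits t, slotHom_mem_idComp_of_curve hg hfits (fun i => ?_) hA ?_ t⟩
  · by_cases hi : i ∈ s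
    · refine ((QLaurent.smul inv_mem_laurent (QLaurent.const (ψ.symm (Matrix.single 0 0 1)))).add
        (QLaurent.const (ψ.symm (Matrix.single 1 1 1)))).congr_fun fun t => ?_
      change _ = (if i ∈ s then torusUnit ψ t else 1 : (Q.alg M)ˣ).val
      rw [if_pos hi, torusUnit, ← _root_.map_smul, ← _root_.map_add]
      change ψ.symm _ = ψ.symm _
      congr 1
      ext i j
      fin_cases i <;> fin_cases j <;> simp
    · refine (QLaurent.const 1).congr_fun fun t => ?_
      change _ = (if i ∈ s then torusUnit ψ t else 1 : (Q.alg M)ˣ).val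
      rw [if_neg hi]
      rfl
  · refine Prod.ext (funext fun i => ?_) hA1
    by_cases hi : i ∈ s
    · simp only [φ, if_pos hi]
      refine Units.ext ?_
      rw [torusUnit]
      change ψ.symm _ = 1
      rw [← map_one ψ.symm]
      congr 1
      ext i j
      fin_cases i <;> fin_cases j <;> simp
    · simp only [φ, if_neg hi]
      rfl

/-- The scalar matrices. -/
def scalarUnit (t : Mˣ) : (Matrix (Fin 2) (Fin 2) M)ˣ :=
  Units.map (Matrix.scalar (Fin 2)).toMonoidHom t

theorem scalarUnit_val (t : Mˣ) : (scalarUnit t).val = t.val • (1 : Matrix (Fin 2) (Fin 2) M) := by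
  rw [Matrix.smul_one_eq_diagonal]
  rfl

theorem ext_of_vecMul {v w : Fin 2 → M} (h : planeDet v w ≠ 0) {A B : Matrix (Fin 2) (Fin 2) M}
    (hv : v ᵥ* A = v ᵥ* B) (hw : w ᵥ* A = w ᵥ* B) : A = B := by
  have key : ∀ r, r ᵥ* A = r ᵥ* B := by
    intro r
    have e : r = (planeDet v w)⁻¹ • (planeDet r w • v + planeDet v r • w) := by
      rw [← planeDet_smul_add, smul_smul, inv_mul_cancel₀ h, one_smul]
    rw [e, Matrix.smul_vecMul, Matrix.smul_vecMul, Matrix.add_vecMul, Matrix.add_vecMul,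
      Matrix.smul_vecMul, Matrix.smul_vecMul, Matrix.smul_vecMul, Matrix.smul_vecMul, hv, hw]
  ext i j
  have := congrFun (key (Pi.single i 1)) j
  simpa using this

/-- The matrix fixing `v` and multiplying `w` by `t`. -/
def stretchUnit {v w : Fin 2 → M} (h : planeDet v w ≠ 0) (t : Mˣ) :
    (Matrix (Fin 2) (Fin 2) M)ˣ :=
  let N : Matrix (Fin 2) (Fin 2) M := Matrix.vecMulVec (fun i => planeDet v (Pi.single i 1)) w
  have hN : N * N = planeDet v w • N := by
    ext i j
    fin_cases i <;> fin_cases j <;>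
      simp [N, Matrix.mul_apply, Matrix.vecMulVec_apply, planeDet, Fin.sum_univ_two] <;> ring
  -- The matrix `N / planeDet v w` is idempotent, so `1 + a P` and `1 + b P` multiply to one when
  -- `(a + 1) * (b + 1) = 1`.
  have key : ∀ a b : M, (a + 1) * (b + 1) = 1 →
      (1 + (a / planeDet v w) • N) * (1 + (b / planeDet v w) • N) = 1 := by
    intro a b hab
    rw [mul_add, mul_one, add_mul, one_mul, smul_mul_smul_comm, hN, smul_smul, add_assoc,
      ← add_smul, ← add_smul]
    have : a / planeDet v w + (b / planeDet v w +
        a / planeDet v w * (b / planeDet v w) * planeDet v w) = 0 := by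
      field_simp
      linear_combination hab
    rw [this, zero_smul, add_zero]
  ⟨1 + ((t.val - 1) / planeDet v w) • N, 1 + ((t⁻¹.val - 1) / planeDet v w) • N,
    key _ _ (by simp), key _ _ (by simp)⟩

theorem vecMul_stretchUnit {v w : Fin 2 → M} (h : planeDet v w ≠ 0) (t : Mˣ) (r : Fin 2 → M) :
    r ᵥ* (stretchUnit h t).val = r + ((t.val - 1) / planeDet v w * planeDet v r) • w := by
  simp only [stretchUnit]
  rw [Matrix.vecMul_add, Matrix.vecMul_one, Matrix.vecMul_smul, Matrix.vecMul_vecMulVec]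
  congr 1
  rw [smul_smul]
  congr 2
  simp [dotProduct, Fin.sum_univ_two, planeDet]
  ring

end SepClosed

end HermitianPairs
end

/-! ### The identity component is the pointwise fixer of the zeros -/

noncomputable section
namespace HermitianPairs
open MvPolynomial
open scoped Quaternion Matrix MatrixGroups
attribute [local instance] MvPolynomial.gradedAlgebra

variable {k : Type u} [Field k] {Q : QuatAlg k} {n : ℕ}

section SepClosed
variable {M : Type u} [Field M] [Algebra k M] [IsSepClosed M]
variable {u : Fin n → Fin 2 → M} {z : Amb Q n M} {g : (Matrix (Fin n) (Fin n) (Q.alg M))ˣ}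

theorem exists_fits_mem_idComp_scalar (hg : ∀ v, g.val * pencil z v * g.valᴴ =
      Matrix.diagonal fun i => algebraMap M (Q.alg M) (planeDet (u i) v)) (t : Mˣ) :
    ∃ q, Fits u (q, scalarUnit t) ∧
      slotHom g (q, scalarUnit t) ∈ idComp (MulAction.stabilizer (Grp Q n M) z) := by
  refine exists_fits_mem_idComp_of_torus hg scalarUnit (fun i j => ?_) (map_one _) Set.univ
    (fun t i _ v => ?_) (fun t i hi => absurd (Set.mem_univ i) hi) t
  · simp only [scalarUnit_val]
    exact mul_mem val_mem_laurent (const_mem_laurent _)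
  · rw [scalarUnit_val, Matrix.vecMul_smul, Matrix.vecMul_one]
    simp [planeDet]
    ring

/-- The stretch multiplies determinants with `u 0` by `t` and leaves those with `u 1` unchanged, so
only the slot `0` is compensated. -/
theorem exists_fits_mem_idComp_stretch {z : Amb Q 2 M} {u : Fin 2 → Fin 2 → M}
    {g : (Matrix (Fin 2) (Fin 2) (Q.alg M))ˣ} (hg : ∀ v, g.val * pencil z v * g.valᴴ =
      Matrix.diagonal fun i => algebraMap M (Q.alg M) (planeDet (u i) v))
    (h : planeDet (u 0) (u 1) ≠ 0) (t : Mˣ) :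
    ∃ q, Fits u (q, stretchUnit h t) ∧
      slotHom g (q, stretchUnit h t) ∈ idComp (MulAction.stabilizer (Grp Q 2 M) z) := by
  have hdet : ∀ w t r, planeDet w (r ᵥ* (stretchUnit h t).val) = planeDet w r +
      ((t.val - 1) / planeDet (u 0) (u 1) * planeDet (u 0) r) * planeDet w (u 1) := by
    intro w t r
    rw [vecMul_stretchUnit]
    simp [planeDet]
    ring
  refine exists_fits_mem_idComp_of_torus hg (stretchUnit h) (fun i j => ?_) ?_ {0}
    (fun t i hi v => ?_) (fun t i hi v => ?_) t
  · simp only [stretchUnit, div_eq_mul_inv]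
    exact add_mem (const_mem_laurent _) (mul_mem (mul_mem (sub_mem val_mem_laurent
      (const_mem_laurent 1)) (const_mem_laurent (planeDet (u 0) (u 1))⁻¹)) (const_mem_laurent _))
  · refine Units.ext ?_
    simp [stretchUnit]
  · rw [Set.mem_singleton_iff.mp hi, hdet]
    field_simp
    ring
  · have : i = 1 := by
      fin_cases i
      · simp at hi
      · rfl
    rw [this, hdet, planeDet_self, mul_zero, add_zero]

/-- The elements of the stabilizer whose second component fixes the zeros of the binary form lie in
the identity component. -/
theorem mem_idComp_of_fixes_zeros (hn : n = 2 ∨ n = 3) (hz : z ∈ V Q n M)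
    (hu : SplitsAt (formF z) u) {h : Grp Q n M} (hh : h • z = z)
    (hfix : ∀ i, planeDet (u i ᵥ* h.snd) (u i) = 0) :
    h ∈ idComp (MulAction.stabilizer (Grp Q n M) z) := by
  obtain ⟨g, hg⟩ := exists_congr_normalForm hn hz hu
  obtain ⟨p, hp, rfl⟩ := exists_slotHom_eq hu.det_ne_zero hu.ne_zero hg hh hfix
  -- One element of the identity component with the same second component is enough: the quotient
  -- has second component one and is covered by `slotHom_norm_one_mem`.
  suffices H : ∃ q, Fits u (q, p.2) ∧
      slotHom g (q, p.2) ∈ idComp (MulAction.stabilizer (Grp Q n M) z) by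
    obtain ⟨q, hq, hqm⟩ := H
    have h1 : Fits u (p.1 * q⁻¹, 1) := by
      have := hp.mul hq.inv
      rwa [show p * (q, p.2)⁻¹ = (p.1 * q⁻¹, 1) from Prod.ext rfl (mul_inv_cancel p.2)] at this
    have h2 := (idComp _).mul_mem (slotHom_norm_one_mem hu.ne_zero hg h1) hqm
    rwa [← _root_.map_mul, show ((p.1 * q⁻¹, 1) * (q, p.2) : (Fin n → (Q.alg M)ˣ) ×
      (Matrix (Fin 2) (Fin 2) M)ˣ) = p from
      Prod.ext (inv_mul_cancel_right p.1 q) (one_mul p.2)] at h2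
  have heig : ∀ i, ∃ a : Mˣ, u i ᵥ* p.2.val = a.val • u i := by
    intro i
    obtain ⟨a, ha⟩ := exists_smul_of_planeDet (hu.ne_zero i) (planeDet_comm_zero (hfix i))
    have ha' : u i ᵥ* p.2.val = a • u i := ha
    have ha0 : a ≠ 0 := by
      rintro rfl
      rw [zero_smul] at ha'
      exact vecMul_ne_zero (hu.ne_zero i) p.2 ha'
    exact ⟨Units.mk0 a ha0, ha'⟩
  choose a ha using heig
  have hscal : ∀ t : Mˣ, ∀ v, v ᵥ* (scalarUnit t).val = t.val • v := fun t v => by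
    rw [scalarUnit_val, Matrix.vecMul_smul, Matrix.vecMul_one]
  rcases hn with rfl | rfl
  -- For two zeros the second component is diagonal in the basis `u 0, u 1`, hence a scalar times a
  -- stretch.
  · have hne := hu.det_ne_zero 0 1 (by decide)
    have e : p.2 = scalarUnit (a 0) * stretchUnit hne (a 1 / a 0) := by
      refine Units.ext (ext_of_vecMul hne ?_ ?_)
      · rw [ha, Units.val_mul, ← Matrix.vecMul_vecMul, hscal, vecMul_stretchUnit]
        have e0 : planeDet (u 0) ((a 0).val • u 0) = 0 := by simp [planeDet]; ring
        rw [e0, mul_zero, zero_smul, add_zero]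
      · rw [ha, Units.val_mul, ← Matrix.vecMul_vecMul, hscal, vecMul_stretchUnit]
        have e1 : planeDet (u 0) ((a 0).val • u 1) = (a 0).val * planeDet (u 0) (u 1) := by
          simp [planeDet]; ring
        rw [e1, ← add_smul]
        congr 1
        have := (a 0).ne_zero
        rw [Units.val_div_eq_div_val]
        field_simp
        ring
    obtain ⟨q, hq, hqm⟩ := exists_fits_mem_idComp_scalar hg (a 0)
    obtain ⟨q', hq', hqm'⟩ := exists_fits_mem_idComp_stretch hg hne (a 1 / a 0)
    have h1 := hq.mul hq'
    have h2 := (idComp _).mul_mem hqm hqm'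
    rw [← _root_.map_mul] at h2
    rw [Prod.mk_mul_mk, ← e] at h1 h2
    exact ⟨q * q', h1, h2⟩
  -- For three zeros any two eigenvalues multiply to the determinant, so they all coincide: a
  -- projectivity fixing three points is scalar.
  · have hmul : ∀ i j, i ≠ j → (a i).val * (a j).val = p.2.val.det := by
      intro i j hij
      have h1 := planeDet_vecMul p.2.val (u i) (u j)
      rw [ha, ha, planeDet_smul_smul, mul_comm (planeDet _ _)] at h1
      exact mul_right_cancel₀ (hu.det_ne_zero i j hij) h1
    have h01 : (a 0).val = (a 1).val := by
      have := (hmul 0 2 (by decide)).trans (hmul 1 2 (by decide)).symm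
      exact mul_right_cancel₀ (a 2).ne_zero this
    have e : p.2 = scalarUnit (a 0) := by
      refine Units.ext (ext_of_vecMul (hu.det_ne_zero 0 1 (by decide)) ?_ ?_)
      · rw [ha, hscal]
      · rw [ha, hscal, h01]
    rw [e]
    exact exists_fits_mem_idComp_scalar hg (a 0)

theorem mem_idComp_stabilizer_iff (hn : n = 2 ∨ n = 3) (hz : z ∈ V Q n M)
    (hu : SplitsAt (formF z) u) {h : Grp Q n M} :
    h ∈ idComp (MulAction.stabilizer (Grp Q n M) z) ↔
      h • z = z ∧ ∀ i, planeDet (u i ᵥ* h.snd) (u i) = 0 :=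
  ⟨fun hm => ⟨idCompSet_subset _ hm, fixes_zeros_of_mem_idComp hn hz hu hm⟩,
    fun hm => mem_idComp_of_fixes_zeros hn hz hu hm.1 hm.2⟩

end SepClosed

end HermitianPairs
end

/-! ### Extension of scalars and the description of `G_x°` -/

noncomputable section
namespace HermitianPairs
open MvPolynomial
open scoped Quaternion Matrix
attribute [local instance] MvPolynomial.gradedAlgebra

variable {k : Type u} [Field k] {Q : QuatAlg k} {n : ℕ}

theorem formF_ext (K : Type u) [Field K] [Algebra k K] (x : Amb Q n k) :
    formF (ext K x) = MvPolynomial.map (algebraMap k K) (formF x) :=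
  (map_formF (R := k) (S := K) x).symm

theorem isHerm_map {R S : Type u} [CommRing R] [Algebra k R] [CommRing S] [Algebra k S]
    (φ : R →ₐ[k] S) {x : Matrix (Fin n) (Fin n) (Q.alg R)} (hx : IsHerm Q n R x) :
    IsHerm Q n S (x.map (Q.map φ)) := by
  refine ⟨?_, fun i => ?_⟩
  · ext1 i j
    rw [Matrix.conjTranspose_apply, Matrix.map_apply, Matrix.map_apply, hx.apply_eq i j,
      QuatAlg.map_star]
  · obtain ⟨r, hr⟩ := hx.2 i
    refine ⟨φ r, ?_⟩
    rw [Matrix.map_apply, hr]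
    ext <;> simp [QuatAlg.map]

theorem map_mem_V {R S : Type u} [CommRing R] [Algebra k R] [CommRing S] [Algebra k S]
    (φ : R →ₐ[k] S) {x : Amb Q n R} (hx : x ∈ V Q n R) : Amb.map φ x ∈ V Q n S :=
  fun i => isHerm_map φ (hx i)

theorem ext_mem_V (K : Type u) [Field K] [Algebra k K] {x : Amb Q n k} (hx : x ∈ V Q n k) :
    ext K x ∈ V Q n K := map_mem_V _ hx

theorem SplitsAt.map {L K M : Type u} [Field L] [Field K] [Field M] [Algebra L K] [Algebra L M]
    {F : MvPolynomial (Fin 2) L} {u : Fin n → Fin 2 → K} (h : SplitsAt F u) (φ : K →ₐ[L] M) :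
    SplitsAt F fun i => φ ∘ u i := by
  refine ⟨fun i h0 => h.ne_zero i ?_, fun i j hij => ?_, ?_⟩
  · funext j
    exact (map_eq_zero φ).mp (congrFun h0 j)
  · have : planeDet (φ ∘ u i) (φ ∘ u j) = φ (planeDet (u i) (u j)) := by simp [planeDet]
    rw [this]
    exact (map_ne_zero φ).mpr (h.det_ne_zero i j hij)
  · obtain ⟨c, hc, e⟩ := h.eq_prod
    refine ⟨φ c, (map_ne_zero φ).mpr hc, ?_⟩
    have := congrArg (MvPolynomial.map (φ : K →+* M)) e
    rw [MvPolynomial.map_map, AlgHom.comp_algebraMap] at this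
    rw [this]
    simp [linForm]

theorem SplitsAt.ext {K M : Type u} [Field K] [Field M] [Algebra k K] [Algebra k M]
    {x : Amb Q n k} {u : Fin n → Fin 2 → K} (h : SplitsAt (formF x) u) (φ : K →ₐ[k] M) :
    SplitsAt (formF (HermitianPairs.ext M x)) fun i => φ ∘ u i := by
  rw [formF_ext]
  exact (h.map φ).base

theorem Grp.map_smul {R S : Type u} [CommRing R] [Algebra k R] [CommRing S] [Algebra k S]
    (φ : R →ₐ[k] S) (g : Grp Q n R) (x : Amb Q n R) :
    Amb.map φ (g • x) = Grp.map φ g • Amb.map φ x := by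
  funext i
  change (g.fst * (∑ j, g.snd i j • x j) * g.fstᴴ).map (Q.map φ) =
    g.fst.map (Q.map φ) * (∑ j, φ (g.snd i j) • (x j).map (Q.map φ)) * (g.fst.map (Q.map φ))ᴴ
  rw [Matrix.map_mul, Matrix.map_mul]
  congr 1
  · congr 1
    ext1 a b
    simp only [Matrix.map_apply, Matrix.sum_apply, Matrix.smul_apply, _root_.map_sum,
      QuatAlg.map_smul]
  · ext1 a b
    simp only [Matrix.map_apply, Matrix.conjTranspose_apply, QuatAlg.map_star]

/-- The component is taken over an algebraic closure, but the criterion there is the vanishing of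
determinants defined over `K`. All further use of `G_x°` rests on this description. -/
theorem mem_stabConn_iff (hn : n = 2 ∨ n = 3) (K : Type u) [Field K] [Algebra k K] [IsSepClosed K]
    {x : Amb Q n k} (hx : x ∈ V Q n k) {u : Fin n → Fin 2 → K} (hu : SplitsAt (formF x) u)
    {g : Grp Q n K} : g ∈ stabConn K x ↔
      g ∈ stab K x ∧ ∀ i, planeDet (u i ᵥ* g.snd) (u i) = 0 := by
  have := infinite_of_isSepClosed K
  have h := mem_idComp_stabilizer_iff hn (ext_mem_V (AlgebraicClosure K) hx)
    (hu.ext (IsScalarTower.toAlgHom k K (AlgebraicClosure K)))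
    (h := Grp.map (IsScalarTower.toAlgHom k K (AlgebraicClosure K)) g)
  have e : ∀ i, planeDet (((IsScalarTower.toAlgHom k K (AlgebraicClosure K)) ∘ u i) ᵥ*
      (Grp.map (IsScalarTower.toAlgHom k K (AlgebraicClosure K)) g).snd)
      ((IsScalarTower.toAlgHom k K (AlgebraicClosure K)) ∘ u i) =
      algebraMap K (AlgebraicClosure K) (planeDet (u i ᵥ* g.snd) (u i)) := by
    intro i
    have : (Grp.map (IsScalarTower.toAlgHom k K (AlgebraicClosure K)) g).snd =
      g.snd.map (algebraMap K (AlgebraicClosure K)) := rfl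
    rw [this]
    simp [planeDet, Matrix.vecMul, dotProduct, Fin.sum_univ_two]
  change (g ∈ stab K x ∧ _) ↔ _
  refine and_congr_right fun hg => ?_
  refine h.trans ⟨fun H i => ?_, fun H => ⟨?_, fun i => ?_⟩⟩
  · have := H.2 i
    rw [e, map_eq_zero] at this
    exact this
  · have h1 : g • ext K x = ext K x := hg
    have h2 : ext (AlgebraicClosure K) x =
        Amb.map (IsScalarTower.toAlgHom k K (AlgebraicClosure K)) (ext K x) := by
      rw [ext, ext, Amb.map_comp]
      congr 1
    rw [h2, ← Grp.map_smul, h1]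
  · rw [e, H i, map_zero]

end HermitianPairs
end

/-! ### Hilbert's Theorem 90 for simple algebras -/

noncomputable section
namespace HermitianPairs

section Modules

variable {k A W : Type u} [Field k] [Ring A] [Algebra k A] [FiniteDimensional k A] [IsSimpleRing A]
  [AddCommGroup W] [Module A W] [Module k W] [IsScalarTower k A W] [FiniteDimensional k W]

/-- Modules of the same dimension over a simple algebra are isomorphic. -/
theorem nonempty_linearEquiv_of_finrank_eq (h : Module.finrank k W = Module.finrank k A) :
    Nonempty (A ≃ₗ[A] W) := by
  have : IsArtinianRing A := IsArtinianRing.of_finite k A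
  have : Module.Finite A W := Module.Finite.of_restrictScalars_finite k A W
  -- A simple left ideal is the only simple module up to isomorphism; both modules are powers of it,
  -- and the dimension determines the exponent.
  obtain ⟨S, hS⟩ := IsAtomic.exists_atom (Submodule A A)
  rw [← isSimpleModule_iff_isAtom] at hS
  have hA : IsIsotypicOfType A A S := IsSimpleRing.isIsotypic A A S
  have hW : IsIsotypicOfType A W S := fun m _ => by
    obtain ⟨I, ⟨e⟩⟩ := IsSemisimpleRing.exists_linearEquiv_ideal_of_isSimpleModule A m
    have := IsSimpleModule.congr e.symm
    exact ⟨e.trans (hA I).some⟩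
  obtain ⟨a, ⟨ea⟩⟩ := hA.linearEquiv_fun
  obtain ⟨b, ⟨eb⟩⟩ := hW.linearEquiv_fun
  have : Nontrivial S := IsSimpleModule.nontrivial A S
  have : FiniteDimensional k S := FiniteDimensional.of_injective
    ((S.subtype).restrictScalars k) Subtype.val_injective
  have h1 : Module.finrank k A = a * Module.finrank k S := by
    rw [(ea.restrictScalars k).finrank_eq, Module.finrank_pi_fintype]
    simp
  have h2 : Module.finrank k W = b * Module.finrank k S := by
    rw [(eb.restrictScalars k).finrank_eq, Module.finrank_pi_fintype]
    simp
  have hab : a = b := by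
    rw [h1, h2] at h
    exact (Nat.eq_of_mul_eq_mul_right Module.finrank_pos h).symm
  subst hab
  exact ⟨ea.trans eb.symm⟩

end Modules

section Descent

variable {k K E : Type u} [Field k] [Field K] [Algebra k K] [IsGalois k K] [Ring E] [Algebra K E]
  (act : (K ≃ₐ[k] K) →* (E →+* E))

theorem exists_liftNormal (F : IntermediateField k K) (τ : F →ₐ[k] K) :
    ∃ σ : K ≃ₐ[k] K, ∀ c : F, σ c = τ c := by
  refine ⟨AlgEquiv.ofBijective (τ.liftNormal K) (AlgHom.normal_bijective k K K _), fun c => ?_⟩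
  exact τ.liftNormal_commutes K c

/-- The coordinates of `e` in an invariant basis generate a finite extension, and whatever fixes
that extension fixes `e`. -/
theorem isOpen_fixing (act : (K ≃ₐ[k] K) →* (E →+* E))
    (hsmul : ∀ σ (c : K) e, act σ (c • e) = σ c • act σ e) {I : Type*} [Finite I]
    (b : Module.Basis I K E) (hb : ∀ σ i, act σ (b i) = b i) (e : E) :
    {σ | act σ e = e} ∈ nhds (1 : K ≃ₐ[k] K) := by
  have := Fintype.ofFinite I
  rw [krullTopology_mem_nhds_one_iff]
  refine ⟨IntermediateField.adjoin k (Set.range (b.repr e)), ?_, fun σ hσ => ?_⟩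
  · exact IntermediateField.finiteDimensional_adjoin fun x _ =>
      (Algebra.IsIntegral.isIntegral (R := k) x)
  · have hc : ∀ i, σ (b.repr e i) = b.repr e i := fun i =>
      (IntermediateField.mem_fixingSubgroup_iff _ _).mp hσ _
        (IntermediateField.subset_adjoin k _ ⟨i, rfl⟩)
    change act σ e = e
    conv_lhs => rw [← b.sum_repr e]
    rw [map_sum]
    conv_rhs => rw [← b.sum_repr e]
    exact Finset.sum_congr rfl fun i _ => by rw [hsmul, hb, hc]

variable {act}

/-- Let a functional `φ` kill all twisted invariants, and let `e` be given. A finite subextension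
`F`, whose fixing group lies where `h` is trivial and `e` is fixed, yields the twisted invariants `∑
τ c • f τ`; linear independence of the embeddings of `F` forces `φ e = 0`. -/
theorem span_invariants_eq_top (hsmul : ∀ σ (c : K) e, act σ (c • e) = σ c • act σ e)
    {I : Type*} [Finite I] (b : Module.Basis I K E) (hb : ∀ σ i, act σ (b i) = b i)
    {h : (K ≃ₐ[k] K) → Eˣ} (hlc : IsLocallyConstant h)
    (hmul : ∀ σ τ, (h (σ * τ)).val = (h σ).val * act σ (h τ).val) :
    Submodule.span K {e | ∀ σ, act σ e = e * (h σ).val} = ⊤ := by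
  classical
  by_contra hne
  obtain ⟨φ, hφ0, hφ⟩ := Submodule.exists_le_ker_of_lt_top _ (lt_top_iff_ne_top.mpr hne)
  apply hφ0
  ext e
  rw [LinearMap.zero_apply]
  have h1 : h 1 = 1 := by
    have := hmul 1 1
    rw [mul_one, map_one, RingHom.one_def, RingHom.id_apply] at this
    exact Units.ext ((h 1).isUnit.mul_left_cancel ((mul_one _).trans this)).symm
  have hU : {σ | h σ = 1} ∩ {σ | act σ e = e} ∈ nhds (1 : K ≃ₐ[k] K) :=
    Filter.inter_mem ((hlc.isOpen_fiber 1).mem_nhds h1) (isOpen_fixing act hsmul b hb e)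
  obtain ⟨F, hF, hFU⟩ := (krullTopology_mem_nhds_one_iff k K _).mp hU
  choose ext hext using exists_liftNormal F
  -- By the choice of `F` this does not depend on the extension of `τ` to `K`, which is the content
  -- of `hf`.
  let f : (F →ₐ[k] K) → E := fun τ => act (ext τ) e * (h (ext τ))⁻¹.val
  have hf : ∀ (τ : F →ₐ[k] K) (σ : K ≃ₐ[k] K), (∀ c : F, σ c = τ c) →
      f τ = act σ e * (h σ)⁻¹.val := by
    intro τ σ hσ
    have hρ : (ext τ)⁻¹ * σ ∈ F.fixingSubgroup := by
      rw [IntermediateField.mem_fixingSubgroup_iff]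
      intro c hc
      change (ext τ).symm (σ c) = c
      rw [AlgEquiv.symm_apply_eq, hσ ⟨c, hc⟩, hext τ ⟨c, hc⟩]
    obtain ⟨e1, e2⟩ := hFU hρ
    have e1' : h ((ext τ)⁻¹ * σ) = 1 := e1
    have e2' : act ((ext τ)⁻¹ * σ) e = e := e2
    have e3 : σ = ext τ * ((ext τ)⁻¹ * σ) := by group
    have e4 : h σ = h (ext τ) := by
      refine Units.ext ?_
      rw [e3, hmul, e1', Units.val_one, map_one, mul_one]
    have e5 : act σ e = act (ext τ) e := by
      rw [e3, map_mul]
      change act (ext τ) (act ((ext τ)⁻¹ * σ) e) = _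
      rw [e2']
    rw [e4, e5]
  have hact : ∀ (σ : K ≃ₐ[k] K) (τ : F →ₐ[k] K),
      act σ (f τ) = f ((σ : K →ₐ[k] K).comp τ) * (h σ).val := by
    intro σ τ
    rw [hf ((σ : K →ₐ[k] K).comp τ) (σ * ext τ) fun c => congrArg σ (hext τ c), map_mul, map_mul]
    have e1 : act σ (h (ext τ))⁻¹.val * act σ (h (ext τ)).val = 1 := by
      rw [← map_mul, Units.inv_mul, map_one]
    have e2 : (h (σ * ext τ))⁻¹.val * (h σ).val = act σ (h (ext τ))⁻¹.val := by
      have : (h (σ * ext τ)).val * act σ (h (ext τ))⁻¹.val = (h σ).val := by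
        rw [hmul, mul_assoc, ← map_mul, Units.mul_inv, map_one, mul_one]
      rw [← this, ← mul_assoc, Units.inv_mul, one_mul]
    rw [mul_assoc, e2]
    rfl
  have : Fintype (F →ₐ[k] K) := Fintype.ofFinite _
  have hT : ∀ c : F, ∑ τ : F →ₐ[k] K, τ c * φ (f τ) = 0 := by
    intro c
    have hmem : ∑ τ : F →ₐ[k] K, τ c • f τ ∈ {e | ∀ σ, act σ e = e * (h σ).val} := by
      intro σ
      rw [map_sum, Finset.sum_mul]
      refine Fintype.sum_bijective (fun τ => (σ : K →ₐ[k] K).comp τ) ⟨fun τ τ' e => ?_, fun τ => ?_⟩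
        _ _ fun τ => ?_
      · ext c
        exact σ.injective (DFunLike.congr_fun e c)
      · refine ⟨(σ.symm : K →ₐ[k] K).comp τ, ?_⟩
        ext c
        simp
      · rw [hsmul, hact, smul_mul_assoc]
        rfl
    have := hφ (Submodule.subset_span hmem)
    rw [LinearMap.mem_ker, map_sum] at this
    simpa using this
  have hli := (linearIndependent_monoidHom F K).comp (fun τ : F →ₐ[k] K => (τ : F →* K))
    (fun τ τ' e => AlgHom.ext fun c => DFunLike.congr_fun e c)
  rw [Fintype.linearIndependent_iff] at hli
  have h0 := hli (fun τ => φ (f τ)) (by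
    funext c
    rw [Finset.sum_apply]
    refine Eq.trans (Finset.sum_congr rfl fun τ _ => ?_) (hT c)
    exact mul_comm _ _) F.val
  -- For the inclusion of `F` the term `f` is `e` itself.
  rw [hf F.val 1 fun c => rfl, map_one, h1] at h0
  simpa using h0

/-- Hilbert's Theorem 90 for the group of units of a simple algebra. -/
theorem exists_eq_inv_mul_of_cocycle {A : Type u} [Ring A] [Algebra k A] [FiniteDimensional k A]
    [IsSimpleRing A] [FiniteDimensional K E] (ι : A →+* E)
    (hι : ∀ c : k, ι (algebraMap k A c) = algebraMap K E (algebraMap k K c))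
    (hact : ∀ σ a, act σ (ι a) = ι a)
    (hsmul : ∀ σ (c : K) e, act σ (c • e) = σ c • act σ e)
    {I : Type*} [Finite I] (b : Module.Basis I k A) (b' : Module.Basis I K E)
    (hb : ∀ i, b' i = ι (b i))
    {h : (K ≃ₐ[k] K) → Eˣ} (hlc : IsLocallyConstant h)
    (hmul : ∀ σ τ, (h (σ * τ)).val = (h σ).val * act σ (h τ).val) :
    ∃ g : Eˣ, ∀ σ, (h σ).val = g⁻¹.val * act σ g.val := by
  have hspan := span_invariants_eq_top hsmul b' (fun σ i => by rw [hb, hact]) hlc hmul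
  let _ : Module A E := Module.compHom E ι
  -- A left `A`-module because the Galois group fixes the image of `A`; the twist by `h` is on the
  -- right.
  let W : Submodule A E :=
    { carrier := {e | ∀ σ, act σ e = e * (h σ).val}
      zero_mem' := fun σ => by rw [map_zero, zero_mul]
      add_mem' := fun {x y} hx hy σ => by rw [map_add, hx σ, hy σ, add_mul]
      smul_mem' := fun a x hx σ => by
        change act σ (ι a * x) = ι a * x * _
        rw [map_mul, hact, hx σ, mul_assoc] }
  let _ : Module k W := Module.compHom W (algebraMap k A)
  have hsk : ∀ (c : k) (w : W), ((c • w : W) : E) = algebraMap k K c • (w : E) := by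
    intro c w
    change ι (algebraMap k A c) * (w : E) = _
    rw [hι, ← Algebra.smul_def]
  have : IsScalarTower k A W := ⟨fun c a w => by
    change (c • a) • w = algebraMap k A c • a • w
    rw [smul_smul, ← Algebra.smul_def]⟩
  -- A `K`-basis of `E` made of twisted invariants is a `k`-basis of `W`: the coordinates of an
  -- element of `W` are Galois fixed. So `W` and `A` have the same dimension over `k`.
  obtain ⟨s, hsW, hs, hli⟩ := exists_linearIndependent K (W : Set E)
  have hspanW : Submodule.span K (W : Set E) = ⊤ := hspan
  have hfin : Finite s := hli.finite
  have := Fintype.ofFinite s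
  let B : Module.Basis s K E := Module.Basis.mk hli (by
    rw [Subtype.range_coe, hs, hspanW])
  have hB : ∀ i : s, B i = i := fun i => Module.Basis.mk_apply _ _ i
  let w : s → W := fun i => ⟨i, hsW i.2⟩
  have hwli : LinearIndependent k w := by
    rw [Fintype.linearIndependent_iff]
    intro c hc i
    have h1 : ∑ j, algebraMap k K (c j) • (j : E) = 0 := by
      have := congrArg (W.subtype) hc
      rw [map_sum, map_zero] at this
      rw [← this]
      exact Finset.sum_congr rfl fun j _ => (hsk (c j) (w j)).symm
    have := Fintype.linearIndependent_iff.mp hli _ h1 i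
    exact (map_eq_zero _).mp this
  have hwspan : ⊤ ≤ Submodule.span k (Set.range w) := by
    rintro x -
    have hc : ∀ i, ∃ c : k, algebraMap k K c = B.repr x.1 i := by
      intro i
      refine (InfiniteGalois.mem_range_algebraMap_iff_fixed _).mpr fun σ => ?_
      have e1 : ∑ j, σ (B.repr x.1 j) • B j = x.1 := by
        have hx := x.2 σ
        rw [← B.sum_repr x.1, map_sum, Finset.sum_mul] at hx
        have : (∑ j, σ (B.repr x.1 j) • B j) * (h σ).val = x.1 * (h σ).val := by
          rw [Finset.sum_mul]
          conv_rhs => rw [← B.sum_repr x.1, Finset.sum_mul]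
          rw [← hx]
          refine Finset.sum_congr rfl fun j _ => ?_
          have hj : act σ (B j) = B j * (h σ).val := by
            rw [hB]
            exact hsW j.2 σ
          rw [hsmul, hj, smul_mul_assoc]
        exact (h σ).isUnit.mul_right_cancel this
      have e2 := congrArg (fun z => B.repr z i) e1
      simp only [map_sum, map_smul, Module.Basis.repr_self, Finsupp.coe_finsetSum,
        Finset.sum_apply, Finsupp.smul_apply, smul_eq_mul] at e2
      rw [Finset.sum_eq_single i] at e2
      · simpa using e2
      · intro j _ hj
        rw [Finsupp.single_eq_of_ne hj.symm, mul_zero]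
      · simp
    choose c hc using hc
    have : x = ∑ i, c i • w i := by
      refine Subtype.ext ?_
      have : ((∑ i, c i • w i : W) : E) = ∑ i, algebraMap k K (c i) • (i : E) := by
        rw [AddSubmonoidClass.coe_finsetSum]
        exact Finset.sum_congr rfl fun j _ => hsk _ _
      rw [this]
      conv_lhs => rw [← B.sum_repr x.1]
      exact Finset.sum_congr rfl fun j _ => by rw [hc, hB]
    rw [this]
    exact Submodule.sum_mem _ fun i _ => Submodule.smul_mem _ _ (Submodule.subset_span ⟨i, rfl⟩)
  let BW : Module.Basis s k W := Module.Basis.mk hwli hwspan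
  have : FiniteDimensional k W := BW.finiteDimensional_of_finite
  have := Fintype.ofFinite I
  have hfr : Module.finrank k W = Module.finrank k A := by
    rw [Module.finrank_eq_card_basis BW, Module.finrank_eq_card_basis b,
      ← Module.finrank_eq_card_basis B, Module.finrank_eq_card_basis b']
  obtain ⟨e⟩ := nonempty_linearEquiv_of_finrank_eq hfr
  have he : ∀ a, (e a : E) = ι a * (e 1 : E) := by
    intro a
    conv_lhs => rw [← mul_one a, ← smul_eq_mul, map_smul]
    rfl
  -- `W` is generated by the image of `1` over `A` and spans `E`, so right multiplication by this
  -- image is onto; it is a unit and trivialises the cocycle.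
  have hsurj : LinearMap.range (LinearMap.mulRight K (e 1 : E)) = ⊤ := by
    rw [eq_top_iff, ← hspanW, Submodule.span_le]
    intro x hx
    refine ⟨ι (e.symm ⟨x, hx⟩), ?_⟩
    rw [LinearMap.mulRight_apply, ← he, e.apply_symm_apply]
  have hinj : LinearMap.ker (LinearMap.mulRight K (e 1 : E)) = ⊥ :=
    LinearMap.ker_eq_bot_iff_range_eq_top.mpr hsurj
  have hu : IsUnit (e 1 : E) := isUnit_of_left_regular (M := K) fun a ha => by
    have : a ∈ LinearMap.ker (LinearMap.mulRight K (e 1 : E)) := ha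
    rwa [hinj, Submodule.mem_bot] at this
  refine ⟨hu.unit, fun σ => ?_⟩
  rw [IsUnit.unit_spec, (e 1).2 σ, ← mul_assoc, IsUnit.val_inv_mul, one_mul]

end Descent

end HermitianPairs
end

/-! ### Simplicity of `B`, Theorem 90 for `G`, and descent of points -/

noncomputable section
namespace HermitianPairs
open scoped Quaternion Matrix

variable {k : Type u} [Field k] (Q : QuatAlg k)

/-- Up to the factor `(b² + 4 a) c` this is the Casimir sum `∑ e q e'` over the basis `1, i, j, ij`
and its dual for the trace form, which equals the reduced trace of `q`. The left side lies in every
two-sided ideal containing `q`. -/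
theorem casimir_eq_trace (a b c : k) (q : ℍ[k, a, b, c]) :
    c • (q * ⟨2 * a + b ^ 2, -b, 0, 0⟩ + ⟨0, 1, 0, 0⟩ * q * ⟨-b, 2, 0, 0⟩) +
      (⟨0, 0, 1, 0⟩ * q * ⟨0, 0, 1, 0⟩ * ⟨2 * a + b ^ 2, -b, 0, 0⟩ +
      ⟨0, 0, 0, 1⟩ * q * ⟨0, 0, 1, 0⟩ * ⟨-b, 2, 0, 0⟩) =
      ⟨(b ^ 2 + 4 * a) * c * (2 * q.re + b * q.imI), 0, 0, 0⟩ := by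
  ext <;> simp <;> ring

/-- An ideal containing an element of non-zero trace contains an invertible scalar by
`casimir_eq_trace`; nondegeneracy of the trace form supplies such an element in any non-zero ideal.
-/
instance isSimpleRing_alg : IsSimpleRing (Q.alg k) := by
  refine IsSimpleRing.of_eq_bot_or_eq_top fun I => or_iff_not_imp_left.mpr fun hI => ?_
  rw [← TwoSidedIdeal.one_mem_iff]
  have htr : ∀ q : Q.alg k, q ∈ I → 2 * q.re + Q.b * q.imI ≠ 0 → (1 : Q.alg k) ∈ I := by
    intro q hq h0
    have h1 := casimir_eq_trace Q.a Q.b Q.c q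
    have hs : ∀ (r : k) (p : Q.alg k), p ∈ I → r • p ∈ I := fun r p hp => by
      rw [Algebra.smul_def]
      exact I.mul_mem_left _ _ hp
    have hm : algebraMap k (Q.alg k) ((Q.b ^ 2 + 4 * Q.a) * Q.c * (2 * q.re + Q.b * q.imI)) ∈ I :=
      by
      refine (congrArg (· ∈ I) h1).mp ?_
      refine I.add_mem (hs _ _ (I.add_mem (I.mul_mem_right _ _ hq)
        (I.mul_mem_right _ _ (I.mul_mem_left _ _ hq))))
        (I.add_mem (I.mul_mem_right _ _ (I.mul_mem_right _ _ (I.mul_mem_left _ _ hq)))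
        (I.mul_mem_right _ _ (I.mul_mem_right _ _ (I.mul_mem_left _ _ hq))))
    have hne : (Q.b ^ 2 + 4 * Q.a) * Q.c * (2 * q.re + Q.b * q.imI) ≠ 0 :=
      mul_ne_zero (mul_ne_zero Q.disc_ne_zero Q.c_ne_zero) h0
    have := hs ((Q.b ^ 2 + 4 * Q.a) * Q.c * (2 * q.re + Q.b * q.imI))⁻¹ _ hm
    rwa [Algebra.smul_def, ← map_mul, inv_mul_cancel₀ hne, map_one] at this
  obtain ⟨q, hq, h0⟩ : ∃ q ∈ I, q ≠ 0 := by
    by_contra! H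
    exact hI (by
      ext q
      rw [TwoSidedIdeal.mem_bot]
      exact ⟨H q, fun h => h ▸ I.zero_mem⟩)
  by_contra hone
  have h1 : ∀ p : Q.alg k, 2 * (p * q).re + Q.b * (p * q).imI = 0 := fun p => by
    by_contra H
    exact hone (htr _ (I.mul_mem_left _ _ hq) H)
  have e0 := h1 1
  have e1 := h1 ⟨0, 1, 0, 0⟩
  have e2 := h1 ⟨0, 0, 1, 0⟩
  have e3 := h1 ⟨0, 0, 0, 1⟩
  simp at e0 e1 e2 e3
  have hd := Q.disc_ne_zero
  have hc := Q.c_ne_zero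
  have two : ∀ x y : k, (Q.b ^ 2 + 4 * Q.a) * Q.c * x = 0 → x = 0 := fun x y h =>
    (mul_eq_zero.mp h).resolve_left (mul_ne_zero hd hc)
  apply h0
  ext
  · refine two _ 0 ?_
    linear_combination Q.c * ((Q.b ^ 2 + 2 * Q.a) * e0 - Q.b * e1)
  · refine two _ 0 ?_
    linear_combination Q.c * (2 * e1 - Q.b * e0)
  · refine two _ 0 ?_
    linear_combination 2 * Q.a * e2 + Q.b * e3
  · refine two _ 0 ?_
    linear_combination Q.b * e2 - 2 * e3

/-- The basis of `M_n(B ⊗ R)` over `R` consisting of the matrix units times `1, i, j, ij`. -/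
def matBasis (R : Type u) [CommRing R] [Algebra k R] (n : ℕ) :
    Module.Basis (Fin n × Fin n × Fin 4) R (Matrix (Fin n) (Fin n) (Q.alg R)) :=
  (QuaternionAlgebra.basisOneIJK _ _ _).matrix (Fin n) (Fin n)

theorem matBasis_map {R S : Type u} [CommRing R] [Algebra k R] [CommRing S] [Algebra k S]
    (φ : R →ₐ[k] S) (n : ℕ) (i : Fin n × Fin n × Fin 4) :
    matBasis Q S n i = (matBasis Q R n i).map (Q.map φ) := by
  obtain ⟨i, j, l⟩ := i
  simp only [matBasis, Module.Basis.matrix_apply]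
  rw [Matrix.map_single]
  congr 1
  fin_cases l <;> simp [QuatAlg.map, QuaternionAlgebra.basisOneIJK]

theorem scalarBasis_map {R S : Type u} [CommRing R] [CommRing S]
    (φ : R →+* S) (n : ℕ) (i : Fin n × Fin n) :
    Matrix.stdBasis S (Fin n) (Fin n) i = (Matrix.stdBasis R (Fin n) (Fin n) i).map φ := by
  obtain ⟨i, j⟩ := i
  rw [Matrix.stdBasis_eq_single, Matrix.stdBasis_eq_single, Matrix.map_single, map_one]

variable {Q} {n : ℕ} {K : Type u} [Field K] [Algebra k K]

theorem QuatAlg.map_smul_of_algEquiv (σ : K ≃ₐ[k] K) (c : K)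
    (e : Matrix (Fin n) (Fin n) (Q.alg K)) :
    (c • e).map (Q.map (σ : K →ₐ[k] K)) = σ c • e.map (Q.map (σ : K →ₐ[k] K)) := by
  ext1 i j
  simp only [Matrix.map_apply, Matrix.smul_apply]
  exact QuatAlg.map_smul (σ : K →ₐ[k] K) c (e i j)

/-- Hilbert's Theorem 90 for `GL_n(B) × GL_2`. -/
theorem Grp.exists_eq_inv_mul_of_cocycle [IsGalois k K] [NeZero n] {h : (K ≃ₐ[k] K) → Grp Q n K}
    (hlc : IsLocallyConstant h) (hmul : ∀ σ τ, h (σ * τ) = h σ * σ • h τ) :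
    ∃ g : Grp Q n K, ∀ σ, h σ = g⁻¹ * σ • g := by
  let act₁ : (K ≃ₐ[k] K) →* (Matrix (Fin n) (Fin n) (Q.alg K) →+* Matrix (Fin n) (Fin n)
    (Q.alg K)) :=
    { toFun := fun σ => (Q.map (σ : K →ₐ[k] K)).mapMatrix
      map_one' := rfl
      map_mul' := fun _ _ => rfl }
  let act₂ : (K ≃ₐ[k] K) →* (Matrix (Fin 2) (Fin 2) K →+* Matrix (Fin 2) (Fin 2) K) :=
    { toFun := fun σ => (σ : K →+* K).mapMatrix
      map_one' := rfl
      map_mul' := fun _ _ => rfl }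
  have hι₁ : ∀ c : k, (Q.map (Algebra.ofId k K)).mapMatrix (algebraMap k _ c) =
      algebraMap K (Matrix (Fin n) (Fin n) (Q.alg K)) (algebraMap k K c) := fun c => by
    rw [RingHom.mapMatrix_apply, Matrix.algebraMap_eq_diagonal, Matrix.algebraMap_eq_diagonal,
      Matrix.diagonal_map (map_zero _)]
    refine congrArg Matrix.diagonal (funext fun i => ?_)
    ext <;> simp [QuatAlg.map, Algebra.ofId_apply]
  have hι₂ : ∀ c : k, (algebraMap k K).mapMatrix (algebraMap k _ c) =
      algebraMap K (Matrix (Fin 2) (Fin 2) K) (algebraMap k K c) := fun c => by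
    rw [RingHom.mapMatrix_apply, Matrix.algebraMap_eq_diagonal, Matrix.algebraMap_eq_diagonal,
      Matrix.diagonal_map (map_zero _)]
    rfl
  obtain ⟨g₁, hg₁⟩ := HermitianPairs.exists_eq_inv_mul_of_cocycle (act := act₁)
    (Q.map (Algebra.ofId k K)).mapMatrix hι₁
    (fun σ a => by ext1 i j; ext <;> exact σ.commutes _)
    (fun σ c e => QuatAlg.map_smul_of_algEquiv σ c e)
    (matBasis Q k n) (matBasis Q K n) (fun i => matBasis_map Q (Algebra.ofId k K) n i)
    (h := fun σ => (h σ).1) (hlc.comp Prod.fst) (fun σ τ => congrArg Grp.fst (hmul σ τ))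
  obtain ⟨g₂, hg₂⟩ := HermitianPairs.exists_eq_inv_mul_of_cocycle (act := act₂)
    (algebraMap k K).mapMatrix hι₂
    (fun σ a => by ext1 i j; exact σ.commutes _) (fun σ c e => by ext1 i j; exact map_mul σ _ _)
    (Matrix.stdBasis k (Fin 2) (Fin 2)) (Matrix.stdBasis K (Fin 2) (Fin 2))
    (fun i => scalarBasis_map (algebraMap k K) 2 i)
    (h := fun σ => (h σ).2) (hlc.comp Prod.snd) (fun σ τ => congrArg Grp.snd (hmul σ τ))
  exact ⟨(g₁, g₂), fun σ => Grp.ext' (hg₁ σ) (hg₂ σ)⟩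

/-- Continuity of the coboundaries `g⁻¹ σ(g)` comes from here. -/
theorem Grp.isLocallyConstant_smul [IsGalois k K] (g : Grp Q n K) :
    IsLocallyConstant fun σ : K ≃ₐ[k] K => σ • g := by
  have h1 : {σ : K ≃ₐ[k] K | σ • g = g} ∈ nhds 1 := by
    let act₁ : (K ≃ₐ[k] K) →* (Matrix (Fin n) (Fin n) (Q.alg K) →+*
        Matrix (Fin n) (Fin n) (Q.alg K)) :=
      { toFun := fun σ => (Q.map (σ : K →ₐ[k] K)).mapMatrix
        map_one' := rfl
        map_mul' := fun _ _ => rfl }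
    let act₂ : (K ≃ₐ[k] K) →* (Matrix (Fin 2) (Fin 2) K →+* Matrix (Fin 2) (Fin 2) K) :=
      { toFun := fun σ => (σ : K →+* K).mapMatrix
        map_one' := rfl
        map_mul' := fun _ _ => rfl }
    filter_upwards [isOpen_fixing act₁ (fun σ c e => QuatAlg.map_smul_of_algEquiv σ c e)
      (matBasis Q K n) (fun σ i => (matBasis_map Q (σ : K →ₐ[k] K) n i).symm) g.fst,
      isOpen_fixing act₂ (fun σ c e => by ext1 i j; exact map_mul σ _ _)
      (Matrix.stdBasis K (Fin 2) (Fin 2))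
      (fun σ i => (scalarBasis_map (σ : K →+* K) 2 i).symm) g.snd] with σ e1 e2
    exact Grp.ext' e1 e2
  rw [IsLocallyConstant.iff_eventually_eq]
  intro σ
  have h2 : Filter.Tendsto (fun τ : K ≃ₐ[k] K => σ⁻¹ * τ) (nhds σ) (nhds 1) := by
    have := (continuous_const_mul σ⁻¹).tendsto σ
    rwa [inv_mul_cancel] at this
  filter_upwards [h2 h1] with τ hτ
  have : (σ⁻¹ * τ) • g = g := hτ
  rw [mul_smul, inv_smul_eq_iff] at this
  exact this

theorem QuatAlg.map_injective {S T : Type u} [Field S] [Field T] [Algebra k S] [Algebra k T]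
    (φ : S →ₐ[k] T) : Function.Injective (Q.map φ) := fun _ _ e =>
  QuaternionAlgebra.ext (φ.injective (congrArg QuaternionAlgebra.re e))
    (φ.injective (congrArg QuaternionAlgebra.imI e))
      (φ.injective (congrArg QuaternionAlgebra.imJ e))
    (φ.injective (congrArg QuaternionAlgebra.imK e))

theorem ext_injective : Function.Injective (ext K : Amb Q n k → Amb Q n K) := fun _ _ e =>
  funext fun l => Matrix.map_injective (QuatAlg.map_injective _) (congrFun e l)

theorem map_ext (σ : K ≃ₐ[k] K) (x : Amb Q n k) :
    Amb.map (σ : K →ₐ[k] K) (ext K x) = ext K x := by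
  rw [ext, Amb.map_comp]
  congr 1
  exact Subsingleton.elim _ _

theorem QuatAlg.exists_map_eq [IsGalois k K] {q : Q.alg K}
    (h : ∀ σ : K ≃ₐ[k] K, Q.map (σ : K →ₐ[k] K) q = q) :
    ∃ p : Q.alg k, Q.map (Algebra.ofId k K) p = q := by
  have hf : ∀ c : K, (∀ σ : K ≃ₐ[k] K, σ c = c) → ∃ r, algebraMap k K r = c := fun c hc =>
    (InfiniteGalois.mem_range_algebraMap_iff_fixed c).mpr hc
  obtain ⟨a, ha⟩ := hf q.re fun σ => congrArg QuaternionAlgebra.re (h σ)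
  obtain ⟨b, hb⟩ := hf q.imI fun σ => congrArg QuaternionAlgebra.imI (h σ)
  obtain ⟨c, hc⟩ := hf q.imJ fun σ => congrArg QuaternionAlgebra.imJ (h σ)
  obtain ⟨d, hd⟩ := hf q.imK fun σ => congrArg QuaternionAlgebra.imK (h σ)
  exact ⟨⟨a, b, c, d⟩, QuaternionAlgebra.ext ha hb hc hd⟩

theorem exists_ext_eq [IsGalois k K] {z : Amb Q n K}
    (h : ∀ σ : K ≃ₐ[k] K, Amb.map (σ : K →ₐ[k] K) z = z) : ∃ y : Amb Q n k, ext K y = z := by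
  have : ∀ l i j, ∃ p : Q.alg k, Q.map (Algebra.ofId k K) p = z l i j := fun l i j =>
    QuatAlg.exists_map_eq fun σ => congrFun (congrFun (congrFun (h σ) l) i) j
  choose y hy using this
  exact ⟨fun l => Matrix.of (y l), funext fun l => by ext1 i j; exact hy l i j⟩

theorem mem_V_of_ext {y : Amb Q n k} (h : ext K y ∈ V Q n K) : y ∈ V Q n k := by
  intro l
  have hinj := (Algebra.ofId k K).injective
  refine ⟨?_, fun i => ⟨(y l i i).re, ?_⟩⟩
  · ext1 i j
    refine QuatAlg.map_injective (Algebra.ofId k K) ?_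
    rw [Matrix.conjTranspose_apply, QuatAlg.map_star]
    exact congrFun (congrFun (h l).1 i) j
  · obtain ⟨r, hr⟩ := (h l).2 i
    have hr' : Q.map (Algebra.ofId k K) (y l i i) = algebraMap K (Q.alg K) r := hr
    refine QuaternionAlgebra.ext rfl ?_ ?_ ?_
    · exact hinj ((congrArg QuaternionAlgebra.imI hr').trans (map_zero _).symm)
    · exact hinj ((congrArg QuaternionAlgebra.imJ hr').trans (map_zero _).symm)
    · exact hinj ((congrArg QuaternionAlgebra.imK hr').trans (map_zero _).symm)

/-- The inverse of a Galois fixed element is fixed too, and the two rational matrices obtained in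
each component are inverse to each other already over `k`. -/
theorem exists_grpMap_eq [IsGalois k K] {g : Grp Q n K} (h : ∀ σ : K ≃ₐ[k] K, σ • g = g) :
    ∃ g₀ : Grp Q n k, Grp.map (Algebra.ofId k K) g₀ = g := by
  have hd : ∀ g : Grp Q n K, (∀ σ : K ≃ₐ[k] K, σ • g = g) →
      ∃ (a : Matrix (Fin n) (Fin n) (Q.alg k)) (A : Matrix (Fin 2) (Fin 2) k),
        a.map (Q.map (Algebra.ofId k K)) = g.fst ∧ A.map (Algebra.ofId k K) = g.snd := by
    intro g h
    have h1 : ∀ i j, ∃ p : Q.alg k, Q.map (Algebra.ofId k K) p = g.fst i j := fun i j =>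
      QuatAlg.exists_map_eq fun σ => congrFun (congrFun (congrArg Grp.fst (h σ)) i) j
    have h2 : ∀ i j, ∃ p : k, algebraMap k K p = g.snd i j := fun i j =>
      (InfiniteGalois.mem_range_algebraMap_iff_fixed _).mpr fun σ =>
        congrFun (congrFun (congrArg Grp.snd (h σ)) i) j
    choose a ha using h1
    choose A hA using h2
    exact ⟨Matrix.of a, Matrix.of A, by ext1 i j; exact ha i j, by ext1 i j; exact hA i j⟩
  obtain ⟨a, A, ha, hA⟩ := hd g h
  obtain ⟨b, B, hb, hB⟩ := hd g⁻¹ fun σ => by rw [smul_inv', h]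
  have i1 := Matrix.map_injective (m := Fin n) (n := Fin n) (QuatAlg.map_injective (Q := Q)
    (Algebra.ofId k K))
  have i2 : Function.Injective fun M : Matrix (Fin 2) (Fin 2) k => M.map (Algebra.ofId k K) :=
    Matrix.map_injective (Algebra.ofId k K).injective
  have o1 : (1 : Matrix (Fin n) (Fin n) (Q.alg k)).map (Q.map (Algebra.ofId k K)) = 1 :=
    map_one (Q.map (Algebra.ofId k K)).mapMatrix
  have o2 : (1 : Matrix (Fin 2) (Fin 2) k).map (Algebra.ofId k K) = 1 :=
    map_one (Algebra.ofId k K : k →+* K).mapMatrix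
  refine ⟨(⟨a, b, i1 ?_, i1 ?_⟩, ⟨A, B, i2 ?_, i2 ?_⟩), Grp.ext' ha hA⟩
  · dsimp only
    rw [Matrix.map_mul, ha, hb, o1, ← Grp.fst_mul, mul_inv_cancel, Grp.fst_one]
  · dsimp only
    rw [Matrix.map_mul, ha, hb, o1, ← Grp.fst_mul, inv_mul_cancel, Grp.fst_one]
  · dsimp only
    rw [Matrix.map_mul, hA, hB, o2, ← Grp.snd_mul, mul_inv_cancel, Grp.snd_one]
  · dsimp only
    rw [Matrix.map_mul, hA, hB, o2, ← Grp.snd_mul, inv_mul_cancel, Grp.snd_one]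

end HermitianPairs
end

/-! ### Automorphisms of zero schemes as projectivities -/

noncomputable section
namespace HermitianPairs
open CategoryTheory AlgebraicGeometry MvPolynomial
open scoped Quaternion Matrix
attribute [local instance] MvPolynomial.gradedAlgebra

section Automorphisms

variable {L K : Type u} [Field L] [Field K] [Algebra L K]
  {F F' : MvPolynomial (Fin 2) L} {d d' n : ℕ} {hF : F.IsHomogeneous d} {hF' : F'.IsHomogeneous d'}
  {u u' : Fin n → Fin 2 → K}

theorem MapsZeros.one : MapsZeros (1 : Matrix (Fin 2) (Fin 2) K) u u := fun i =>
  ⟨i, by rw [Matrix.vecMul_one, planeDet_self]⟩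

variable [IsSepClosure L K]

/-- The automorphism of the zero scheme of a form given by a projectivity. -/
def formAut (hF : F.IsHomogeneous d) (h : SplitsAt F u) (A : (Matrix (Fin 2) (Fin 2) L)ˣ)
    (hA : MapsZeros (A.val.map (algebraMap L K)) u u) : Aut (projFormOver F hF) :=
  formIso h h A (hA.substHom_mem h h) (hA.substHom_inv_mem h h)

theorem formAut_eq_iff (h : SplitsAt F u) {A B : (Matrix (Fin 2) (Fin 2) L)ˣ}
    {hA : MapsZeros (A.val.map (algebraMap L K)) u u}
    {hB : MapsZeros (B.val.map (algebraMap L K)) u u} :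
    formAut hF h A hA = formAut hF h B hB ↔
      ∀ i, planeDet (u i ᵥ* A.val.map (algebraMap L K)) (u i ᵥ* B.val.map (algebraMap L K)) = 0 :=
        by
  rw [← h.substMap_eq_iff (hF := hF) (hF' := hF) (hA := hA.substHom_mem h h)
    (hA' := hB.substHom_mem h h)]
  refine ⟨fun e => congrArg (fun α : Aut (projFormOver F hF) => α.hom.left) e, fun e => ?_⟩
  exact Iso.ext (Over.OverMorphism.ext e)

theorem zeroPt_formAut (h : SplitsAt F u) (A : (Matrix (Fin 2) (Fin 2) L)ˣ)
    (hA : MapsZeros (A.val.map (algebraMap L K)) u u) {w : Fin 2 → K} (hw : w ≠ 0)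
    (hw0 : aeval w F = 0) :
    zeroPt hF w hw hw0 ≫ (formAut hF h A hA).hom.left =
      zeroPt hF (w ᵥ* A.val.map (algebraMap L K)) (map_unit_ne_zero A hw)
        (aeval_vecMul_of_mem (hA.substHom_mem h h) hw0) :=
  zeroPt_substMap _ _ _ _ _ _ _ _ _

/-- The factors are reversed because matrices act on row vectors from the right, whereas the product
in `Aut` applies its right factor first. -/
theorem formAut_mul (h : SplitsAt F u) {A B : (Matrix (Fin 2) (Fin 2) L)ˣ}
    {hA : MapsZeros (A.val.map (algebraMap L K)) u u}
    {hB : MapsZeros (B.val.map (algebraMap L K)) u u}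
    {hAB : MapsZeros ((A * B).val.map (algebraMap L K)) u u} :
    formAut hF h B hB * formAut hF h A hA = formAut hF h (A * B) hAB := by
  refine Iso.ext (Over.OverMorphism.ext ?_)
  change (formAut hF h A hA).hom.left ≫ (formAut hF h B hB).hom.left =
    (formAut hF h (A * B) hAB).hom.left
  have : (projForm F hF).IsSeparated := inferInstanceAs (Proj _).IsSeparated
  refine h.hom_ext hF (Y := projForm F hF) fun i => ?_
  refine (Category.assoc _ _ _).symm.trans ?_
  refine (congrArg (· ≫ (formAut hF h B hB).hom.left) (zeroPt_formAut h A hA _ _)).trans ?_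
  refine (zeroPt_formAut h B hB _ _).trans (Eq.trans ?_ (zeroPt_formAut h (A * B) hAB _ _).symm)
  refine zeroPt_congr ?_ _ _ _ _
  rw [Matrix.vecMul_vecMul, ← Matrix.map_mul, Units.val_mul]

theorem exists_eq_formAut (hn : n = 2 ∨ n = 3) (h : SplitsAt F u) (α : Aut (projFormOver F hF)) :
    ∃ A hA, α = formAut hF h A hA := by
  let β : projFormOver F hF ≅ projFormOver F hF := α
  let φ : projForm F hF ⟶ projForm F hF := β.hom.left
  have : Mono φ := inferInstanceAs (Mono β.hom.left)
  obtain ⟨A, hA, e⟩ := h.exists_eq_substMap (hF := hF) (hF' := hF) hn h φ (Over.w β.hom)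
  exact ⟨A, hA, Iso.ext (Over.OverMorphism.ext e)⟩

theorem exists_mapsZeros_of_iso (hn : n = 2 ∨ n = 3) (h : SplitsAt F u) (h' : SplitsAt F' u')
    (α : projFormOver F hF ≅ projFormOver F' hF') :
    ∃ A : (Matrix (Fin 2) (Fin 2) L)ˣ, MapsZeros (A.val.map (algebraMap L K)) u u' := by
  let φ : projForm F hF ⟶ projForm F' hF' := α.hom.left
  have : Mono φ := inferInstanceAs (Mono α.hom.left)
  obtain ⟨A, hA, -⟩ := h.exists_eq_substMap (hF := hF) (hF' := hF') hn h' φ (Over.w α.hom)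
  exact ⟨A, hA⟩

end Automorphisms

section ZeroScheme

variable {k : Type u} [Field k] {Q : QuatAlg k} {n : ℕ} {K : Type u} [Field K] [Algebra k K]
  {x : Amb Q n k} {u : Fin n → Fin 2 → K}

/-- The automorphism of `Z_x` given by a projectivity. -/
def zAut [IsSepClosure k K] (h : SplitsAt (formF x) u) (A : (Matrix (Fin 2) (Fin 2) k)ˣ)
    (hA : MapsZeros (A.val.map (algebraMap k K)) u u) : Aut (Z x) :=
  formAut (formF_isHomogeneous n x) h A hA

/-- The automorphism of `Z_x ×ₖ K` given by a projectivity. -/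
def zBaseAut [IsSepClosed K] (h : SplitsAt (formF x) u) (A : (Matrix (Fin 2) (Fin 2) K)ˣ)
    (hA : MapsZeros A.val u u) : Aut (ZBase K x) :=
  formAut ((formF_isHomogeneous n x).map _) h.base A hA

theorem zBaseAut_eq_iff [IsSepClosed K] (h : SplitsAt (formF x) u)
    {A B : (Matrix (Fin 2) (Fin 2) K)ˣ}
    {hA : MapsZeros A.val u u} {hB : MapsZeros B.val u u} :
    zBaseAut h A hA = zBaseAut h B hB ↔ ∀ i, planeDet (u i ᵥ* A.val) (u i ᵥ* B.val) = 0 :=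
  formAut_eq_iff h.base

theorem zBaseAut_mul [IsSepClosed K] (h : SplitsAt (formF x) u) {A B : (Matrix (Fin 2) (Fin 2) K)ˣ}
    {hA : MapsZeros A.val u u} {hB : MapsZeros B.val u u} {hAB : MapsZeros (A * B).val u u} :
    zBaseAut h B hB * zBaseAut h A hA = zBaseAut h (A * B) hAB :=
  formAut_mul h.base

theorem zBaseAut_one [IsSepClosed K] (h : SplitsAt (formF x) u) : zBaseAut h 1 MapsZeros.one = 1 :=
    by
  have h1 : MapsZeros (1 * 1 : (Matrix (Fin 2) (Fin 2) K)ˣ).val u u := by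
    rw [mul_one]
    exact MapsZeros.one
  have e : zBaseAut h 1 MapsZeros.one * zBaseAut h 1 MapsZeros.one = zBaseAut h 1 MapsZeros.one :=
    (zBaseAut_mul h (hAB := h1)).trans ((zBaseAut_eq_iff h).mpr fun i => by
      rw [mul_one, planeDet_self])
  exact mul_eq_left.mp e

theorem isInduced_zBaseAut [IsSepClosed K] (h : SplitsAt (formF x) u) {g : Grp Q n K}
    {hg : MapsZeros g.sndUnit.val u u} : IsInduced x g (zBaseAut h g.sndUnit hg) := by
  have : (P1 K).IsSeparated := inferInstanceAs (Proj _).IsSeparated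
  refine h.base.hom_ext ((formF_isHomogeneous n x).map _) fun i => ?_
  refine (Category.assoc _ _ _).symm.trans ((congrArg (· ≫ ZIncl K x)
    (zeroPt_formAut h.base g.sndUnit hg (h.base.ne_zero i) (h.base.aeval_eq_zero i))).trans ?_)
  refine (zeroPt_projIncl _ _ _ _).trans ?_
  refine Eq.trans ?_ ((congrArg (· ≫ actP1 g.sndUnit)
    (zeroPt_projIncl _ (u i) (h.base.ne_zero i) (h.base.aeval_eq_zero i))).symm.trans
      (Category.assoc _ _ _))
  exact (linePt_actP1 _ _ _ _).symm

/-- The two sides of the square are compared at the points `u i`, where they give the lines of `u i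
B` and `u i A`. -/
theorem isBaseChange_iff [IsSepClosure k K] [IsSepClosed K] (h : SplitsAt (formF x) u)
    {A : (Matrix (Fin 2) (Fin 2) k)ˣ}
    {B : (Matrix (Fin 2) (Fin 2) K)ˣ} {hA : MapsZeros (A.val.map (algebraMap k K)) u u}
    {hB : MapsZeros B.val u u} :
    IsBaseChange x (zAut h A hA) (zBaseAut h B hB) ↔
      ∀ i, planeDet (u i ᵥ* A.val.map (algebraMap k K)) (u i ᵥ* B.val) = 0 := by
  have : (Z x).left.IsSeparated := inferInstanceAs (Proj _).IsSeparated
  have hr : ∀ w : Fin 2 → K, aeval w (formF x) = 0 →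
      aeval w (MvPolynomial.map (algebraMap k K) (formF x)) = 0 := fun w hw => by
    rw [aeval_map_algebraMap]
    exact hw
  have hB0 : ∀ i, aeval (u i ᵥ* B.val) (formF x) = 0 := fun i => by
    obtain ⟨j, hj⟩ := hB i
    exact h.aeval_eq_zero_of_planeDet (planeDet_comm_zero hj)
  have e1 : ∀ i, zeroPt ((formF_isHomogeneous n x).map _) (u i) (h.ne_zero i)
      (h.base.aeval_eq_zero i) ≫ (zBaseAut h B hB).hom.left ≫ ZProj K x =
      zeroPt (formF_isHomogeneous n x) (u i ᵥ* B.val) (vecMul_ne_zero (h.ne_zero i) B) (hB0 i) := by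
    intro i
    refine (Category.assoc _ _ _).symm.trans ((congrArg (· ≫ ZProj K x)
      (zeroPt_formAut h.base B hB (h.base.ne_zero i) (h.base.aeval_eq_zero i))).trans ?_)
    exact zeroPt_projBase _ _ _ _ _
  have e2 : ∀ i, zeroPt ((formF_isHomogeneous n x).map _) (u i) (h.ne_zero i)
      (h.base.aeval_eq_zero i) ≫ ZProj K x ≫ (zAut h A hA).hom.left =
      zeroPt (formF_isHomogeneous n x) (u i ᵥ* A.val.map (algebraMap k K))
        (map_unit_ne_zero A (h.ne_zero i))
        (aeval_vecMul_of_mem (hA.substHom_mem h h) (h.aeval_eq_zero i)) := by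
    intro i
    refine (Category.assoc _ _ _).symm.trans ((congrArg (· ≫ (zAut h A hA).hom.left)
      (zeroPt_projBase _ _ _ (h.aeval_eq_zero i) _)).trans ?_)
    exact zeroPt_formAut h A hA _ _
  refine ⟨fun e i => ?_, fun e => h.base.hom_ext ((formF_isHomogeneous n x).map _) fun i => ?_⟩
  · exact planeDet_eq_zero_of_zeroPt_eq
      ((e2 i).symm.trans ((congrArg (_ ≫ ·) e).symm.trans (e1 i)))
  · exact (e1 i).trans ((zeroPt_eq_of_planeDet (planeDet_comm_zero (e i)) _ _ _ _).trans
      (e2 i).symm)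

theorem exists_eq_zAut [IsSepClosure k K] (hn : n = 2 ∨ n = 3) (h : SplitsAt (formF x) u)
    (γ : Aut (Z x)) :
    ∃ A hA, γ = zAut h A hA := exists_eq_formAut hn h γ

theorem exists_eq_zBaseAut [IsSepClosed K] (hn : n = 2 ∨ n = 3) (h : SplitsAt (formF x) u)
    (α : Aut (ZBase K x)) : ∃ A hA, α = zBaseAut h A hA := exists_eq_formAut hn h.base α

theorem nonempty_iso_of_mapsZeros [IsSepClosure k K] {y : Amb Q n k} {w : Fin n → Fin 2 → K}
    (h : SplitsAt (formF x) u) (h' : SplitsAt (formF y) w) {A : (Matrix (Fin 2) (Fin 2) k)ˣ}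
    (hA : MapsZeros (A.val.map (algebraMap k K)) u w) : Nonempty (Z x ≅ Z y) :=
  ⟨formIso h h' A (hA.substHom_mem h h') (hA.substHom_inv_mem h h')⟩

end ZeroScheme

end HermitianPairs
end

/-! ### Lifting projectivities to the group; Galois action on zeros -/

noncomputable section
namespace HermitianPairs
open MvPolynomial
open scoped Quaternion Matrix
attribute [local instance] MvPolynomial.gradedAlgebra

section Splitting

variable {L K : Type u} [Field L] [Field K] [Algebra L K] {n : ℕ} {F : MvPolynomial (Fin 2) L}
  {u w : Fin n → Fin 2 → K}

theorem linForm_smul (c : K) (v : Fin 2 → K) : linForm (c • v) = C c * linForm v := by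
  simp [linForm]
  ring

theorem SplitsAt.of_base (h : SplitsAt (MvPolynomial.map (algebraMap L K) F) u) : SplitsAt F u := by
  refine ⟨h.ne_zero, h.det_ne_zero, ?_⟩
  obtain ⟨c, hc, e⟩ := h.eq_prod
  exact ⟨c, hc, by rw [← e, Algebra.algebraMap_self, MvPolynomial.map_id]⟩

/-- A splitting is not affected by permutations and by scaling. -/
theorem SplitsAt.congr (h : SplitsAt F u) (hw : ∀ i, w i ≠ 0) (π : Fin n ≃ Fin n)
    (e : ∀ i, planeDet (u (π i)) (w i) = 0) : SplitsAt F w := by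
  choose c hc using fun i => exists_smul_of_planeDet (hw i) (planeDet_comm_zero (e i))
  have hc0 : ∀ i, c i ≠ 0 := fun i h0 => h.ne_zero (π i) (by rw [hc, h0, zero_smul])
  refine ⟨hw, fun i j hij h0 => h.det_ne_zero _ _ (π.injective.ne hij) ?_, ?_⟩
  · rw [hc, hc, planeDet_smul_smul, h0, mul_zero]
  · obtain ⟨d, hd, e⟩ := h.eq_prod
    refine ⟨d * ∏ i, c i, mul_ne_zero hd (Finset.prod_ne_zero_iff.mpr fun i _ => hc0 i), ?_⟩
    rw [e, ← Equiv.prod_comp π, _root_.map_mul, mul_assoc, _root_.map_prod,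
      ← Finset.prod_mul_distrib]
    congr 1
    exact Finset.prod_congr rfl fun i _ => by rw [hc, linForm_smul]

theorem substHom_linForm [Infinite K] (A : (Matrix (Fin 2) (Fin 2) K)ˣ) (v : Fin 2 → K) :
    substHom A.val (linForm v) = C A.val.det * linForm (v ᵥ* A⁻¹.val) := by
  refine MvPolynomial.funext fun r => ?_
  rw [← MvPolynomial.aeval_eq_eval, aeval_substHom, MvPolynomial.aeval_eq_eval,
    MvPolynomial.aeval_eq_eval]
  change eval (r ᵥ* A.val) (linForm v) = eval r _
  rw [eval_linForm, _root_.map_mul, eval_C, eval_linForm]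
  have : v = v ᵥ* A⁻¹.val ᵥ* A.val := by
    rw [Matrix.vecMul_vecMul, Units.inv_mul, Matrix.vecMul_one]
  conv_lhs => rw [this]
  rw [planeDet_vecMul, mul_comm]

theorem SplitsAt.subst [Infinite K] {F : MvPolynomial (Fin 2) K} (h : SplitsAt F u)
    (A : (Matrix (Fin 2) (Fin 2) K)ˣ) {c : K} (hc : c ≠ 0) :
    SplitsAt (C c * substHom A.val F) fun i => u i ᵥ* A⁻¹.val := by
  refine ⟨fun i => vecMul_ne_zero (h.ne_zero i) _, fun i j hij => ?_, ?_⟩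
  · rw [planeDet_vecMul]
    exact mul_ne_zero (h.det_ne_zero i j hij)
      ((Matrix.isUnit_iff_isUnit_det _).mp A⁻¹.isUnit).ne_zero
  · obtain ⟨d, hd, e⟩ := h.eq_prod
    rw [Algebra.algebraMap_self, MvPolynomial.map_id] at e
    refine ⟨c * (d * A.val.det ^ n), mul_ne_zero hc (mul_ne_zero hd (pow_ne_zero _
      ((Matrix.isUnit_iff_isUnit_det _).mp A.isUnit).ne_zero)), ?_⟩
    rw [Algebra.algebraMap_self, MvPolynomial.map_id, e, _root_.map_mul, _root_.map_prod,
      Finset.prod_congr rfl fun i _ => substHom_linForm A (u i), Finset.prod_mul_distrib]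
    have : substHom A.val (C d) = C d := (substHom A.val).commutes d
    rw [this]
    simp
    ring

end Splitting

variable {k : Type u} [Field k] {Q : QuatAlg k} {n : ℕ} {K : Type u} [Field K] [Algebra k K]
  {x y : Amb Q n k} {u w : Fin n → Fin 2 → K}

theorem SplitsAt.ext_self (h : SplitsAt (formF x) u) : SplitsAt
    (formF (HermitianPairs.ext K x)) u := by
  rw [formF_ext]
  exact h.base

theorem SplitsAt.of_ext (h : SplitsAt (formF (HermitianPairs.ext K x)) u) : SplitsAt (formF x) u :=
    by
  rw [formF_ext] at h
  exact h.of_base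

theorem SplitsAt.smul [IsSepClosed K] (hn : n = 2 ∨ n = 3) {z : Amb Q n K} (hz : z ∈ V Q n K)
    (h : SplitsAt (formF z) u) (g : Grp Q n K) :
    SplitsAt (formF (g • z)) fun i => u i ᵥ* g.sndUnit⁻¹.val := by
  have := infinite_of_isSepClosed K
  obtain ⟨c, hc, e⟩ := formF_smul hn hz g
  rw [e]
  exact h.subst g.sndUnit hc

theorem SplitsAt.smul_of_mapsZeros [IsSepClosed K] (hn : n = 2 ∨ n = 3) {z : Amb Q n K}
    (hz : z ∈ V Q n K) (h : SplitsAt (formF z) u) (hw : ∀ i, w i ≠ 0) (g : Grp Q n K)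
    (π : Fin n ≃ Fin n) (hg : ∀ i, planeDet (w i ᵥ* g.snd) (u (π i)) = 0) :
    SplitsAt (formF (g • z)) w :=
  (h.smul hn hz g).congr hw π fun i => planeDet_vecMul_inv (A := g.sndUnit) (hg i)

theorem mapsZeros_of_mem_stab [IsSepClosed K] (hn : n = 2 ∨ n = 3) (hx : x ∈ V Q n k)
    (h : SplitsAt (formF x) u) {g : Grp Q n K} (hg : g ∈ stab K x) : MapsZeros g.snd u u := by
  refine mapsZeros_of_smul hn (ext_mem_V K hx) g h.ext_self ?_
  have : g • ext K x = ext K x := hg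
  rw [this]
  exact h.ext_self

/-- Every projectivity permuting the zeros of `F_x` extends to an element of the stabilizer. -/
theorem exists_mem_stab [IsSepClosed K] (hn : n = 2 ∨ n = 3) (hx : x ∈ V Q n k)
    (h : SplitsAt (formF x) u) {A : (Matrix (Fin 2) (Fin 2) K)ˣ} (hA : MapsZeros A.val u u) :
    ∃ g ∈ stab K x, g.sndUnit = A := by
  obtain ⟨π, hπ⟩ := MapsZeros.bijective h.ext_self h.ext_self hA
  have hxV := ext_mem_V K hx
  -- The pair `(1, A) • x` has the same zeros as `x`, so a congruence brings it back to `x` without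
  -- touching the second component.
  obtain ⟨a, ha⟩ := exists_smul_of_common_zeros hn (smul_mem_V hxV (Grp.of 1 A)) hxV
    (h.ext_self.smul_of_mapsZeros hn hxV h.ne_zero (Grp.of 1 A) π hπ) h.ext_self
  refine ⟨Grp.of a 1 * Grp.of 1 A, ?_, Units.ext ((Grp.snd_mul _ _).trans (one_mul A.val))⟩
  change (Grp.of a 1 * Grp.of 1 A) • ext K x = ext K x
  rw [mul_smul, ha]

/-- If `F_x` and `F_y` are related by a rational projectivity, then the orbit of `y` contains a
point which is related to `x` by an element of `GL_n(B ⊗ K)`. -/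
theorem exists_smul_eq_ext_smul [IsSepClosed K] (hn : n = 2 ∨ n = 3) (hx : x ∈ V Q n k)
    (hy : y ∈ V Q n k) (h : SplitsAt (formF x) u) (h' : SplitsAt (formF y) w)
    {A : (Matrix (Fin 2) (Fin 2) k)ˣ} (hA : MapsZeros (A.val.map (algebraMap k K)) u w) :
    ∃ (g : Grp Q n k) (a : (Matrix (Fin n) (Fin n) (Q.alg K))ˣ),
      Grp.of a 1 • ext K x = ext K (g • y) := by
  -- The rational element `(1, A)` gives `y` the zeros of `x`; what remains is a congruence over
  -- `K`.
  obtain ⟨π, hπ⟩ := MapsZeros.bijective (A := mapUnit K A) h.ext_self h'.ext_self hA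
  have hg : ext K (Grp.of 1 A • y) = Grp.map (Algebra.ofId k K) (Grp.of 1 A) • ext K y :=
    Grp.map_smul _ _ _
  obtain ⟨a, ha⟩ := exists_smul_of_common_zeros hn (ext_mem_V K hx)
    (ext_mem_V K (smul_mem_V hy (Grp.of 1 A))) h.ext_self (by
      rw [hg]
      exact h'.ext_self.smul_of_mapsZeros hn (ext_mem_V K hy) h.ne_zero _ π hπ)
  exact ⟨_, a, ha⟩

section Galois

variable (σ : K ≃ₐ[k] K)

theorem SplitsAt.exists_planeDet_galois {F : MvPolynomial (Fin 2) k} (h : SplitsAt F u)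
    (i : Fin n) : ∃ j, planeDet (⇑σ ∘ u i) (u j) = 0 := by
  have h0 : aeval (⇑σ ∘ u i) F = 0 := by
    have := congrArg σ (h.aeval_eq_zero i)
    rw [map_zero] at this
    rw [← this]
    exact (MvPolynomial.comp_aeval_apply (u i) (σ : K →ₐ[k] K) F).symm
  obtain ⟨j, hj⟩ := h.exists_planeDet h0
  exact ⟨j, planeDet_comm_zero hj⟩

theorem galois_comp_vecMul (v : Fin 2 → K) (g : Grp Q n K) :
    ⇑σ ∘ (v ᵥ* g.snd) = (⇑σ ∘ v) ᵥ* (σ • g).snd :=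
  (comp_vecMul (σ : K →+* K) g.snd v).symm

theorem planeDet_galois (v w : Fin 2 → K) : planeDet (⇑σ ∘ v) (⇑σ ∘ w) = σ (planeDet v w) :=
  planeDet_comp (σ : K →+* K) v w

theorem galois_smul_ext (g : Grp Q n K) : (σ • g) • ext K x = Amb.map (σ : K →ₐ[k] K)
    (g • ext K x) := by
  rw [Grp.map_smul, map_ext]
  rfl

theorem galois_smul_mem_stab {g : Grp Q n K} (hg : g ∈ stab K x) : σ • g ∈ stab K x := by
  change (σ • g) • ext K x = ext K x
  rw [galois_smul_ext, show g • ext K x = ext K x from hg, map_ext]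

theorem planeDet_vecMul_of_planeDet {v w : Fin 2 → K} (h : planeDet v w = 0)
    (A : Matrix (Fin 2) (Fin 2) K) : planeDet (v ᵥ* A) (w ᵥ* A) = 0 := by
  rw [planeDet_vecMul, h, zero_mul]

/-- If `t` acts on the zeros as a rational projectivity, then so do its conjugates. -/
theorem planeDet_galois_smul_of_rational {F : MvPolynomial (Fin 2) k} (h : SplitsAt F u)
    {t : Grp Q n K} {A : (Matrix (Fin 2) (Fin 2) k)ˣ}
    (hA : ∀ i, planeDet (u i ᵥ* A.val.map (algebraMap k K)) (u i ᵥ* t.snd) = 0) (i : Fin n) :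
    planeDet (u i ᵥ* (σ • t).snd) (u i ᵥ* t.snd) = 0 := by
  -- With `j` such that `σ (u j)` lies on the line of `u i`, the lines of `u i σ(t)`, `σ (u j t)`,
  -- `σ (u j) A`, `u i A` and `u i t` coincide in turn.
  obtain ⟨j, hj⟩ := h.exists_planeDet_galois σ⁻¹ i
  have hj' : planeDet (u i) (⇑σ ∘ u j) = 0 := by
    have := congrArg σ hj
    rw [← planeDet_galois, map_zero] at this
    convert this using 2
    funext l
    exact (σ.apply_symm_apply (u i l)).symm
  have h1 : planeDet (u i ᵥ* (σ • t).snd) (⇑σ ∘ (u j ᵥ* t.snd)) = 0 := by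
    rw [galois_comp_vecMul]
    exact planeDet_vecMul_of_planeDet hj' _
  have h2 : planeDet (⇑σ ∘ (u j ᵥ* t.snd)) ((⇑σ ∘ u j) ᵥ* A.val.map (algebraMap k K)) = 0 := by
    have e : (⇑σ ∘ u j) ᵥ* A.val.map (algebraMap k K) =
        ⇑σ ∘ (u j ᵥ* A.val.map (algebraMap k K)) := by
      have := comp_vecMul (σ : K →+* K) (A.val.map (algebraMap k K)) (u j)
      refine Eq.trans ?_ this
      congr 1
      ext1 a b
      exact (σ.commutes _).symm
    rw [e, planeDet_galois, planeDet_comm_zero (hA j), map_zero]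
  have hne : ∀ {v : Fin 2 → K}, v ≠ 0 → ⇑σ ∘ v ≠ 0 := fun hv h0 =>
    hv (funext fun l => by simpa using congrFun h0 l)
  have h3 : planeDet ((⇑σ ∘ u j) ᵥ* A.val.map (algebraMap k K))
      (u i ᵥ* A.val.map (algebraMap k K)) = 0 :=
    planeDet_vecMul_of_planeDet (planeDet_comm_zero hj') _
  refine planeDet_trans (hne (vecMul_ne_zero (h.ne_zero j) t.sndUnit)) h1 ?_
  refine planeDet_trans (map_unit_ne_zero A (hne (h.ne_zero j))) h2 ?_
  exact planeDet_trans (map_unit_ne_zero A (h.ne_zero i)) h3 (hA i)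

/-- A point of the group which acts on the zeros of a rational form in a Galois invariant way
acts as a rational projectivity. -/
theorem exists_rational_of_galois_stable [IsGalois k K] (hn : n = 2 ∨ n = 3)
    {F : MvPolynomial (Fin 2) k}
    (h : SplitsAt F u) (t : Grp Q n K)
    (ht : ∀ (σ : K ≃ₐ[k] K) i, planeDet (u i ᵥ* (σ • t).snd) (u i ᵥ* t.snd) = 0) :
    ∃ A : (Matrix (Fin 2) (Fin 2) k)ˣ,
      ∀ i, planeDet (u i ᵥ* A.val.map (algebraMap k K)) (u i ᵥ* t.snd) = 0 := by
  -- Descent is applied to the families `u i` and `u i t`, which the Galois group permutes in the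
  -- same way by `ht`.
  refine exists_rational_projectivity hn h.ne_zero
    (fun i => vecMul_ne_zero (h.ne_zero i) t.sndUnit) h.det_ne_zero (fun i j hij => ?_)
    fun σ i => ?_
  · rw [planeDet_vecMul]
    exact mul_ne_zero (h.det_ne_zero i j hij)
      ((Matrix.isUnit_iff_isUnit_det _).mp t.sndUnit.isUnit).ne_zero
  · obtain ⟨j, hj⟩ := h.exists_planeDet_galois σ i
    refine ⟨j, hj, ?_⟩
    rw [galois_comp_vecMul]
    exact planeDet_trans (vecMul_ne_zero (h.ne_zero j) (σ • t).sndUnit)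
      (planeDet_vecMul_of_planeDet hj _) (ht σ j)

end Galois

end HermitianPairs
end

/-! ### Twisting of cocycles and the homomorphism `c_x` -/

noncomputable section
namespace HermitianPairs
open CategoryTheory AlgebraicGeometry
open scoped Quaternion Matrix
attribute [local instance] MvPolynomial.gradedAlgebra

section Twist

variable {Γ : Type u} [Group Γ] [TopologicalSpace Γ] {A : Type u} [Group A]
  [MulDistribMulAction Γ A] {H : Subgroup A} {N : Type*} [Group N]

/-- The relation `R γ t`, for `γ` in a group `N` and `t` in a group containing `H`, identifies `N`
with a group of Galois invariant cosets of `H` in its normalizer, up to reversal of the product. -/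
structure IsTwisting (Γ : Type u) [Group Γ] [TopologicalSpace Γ] [MulDistribMulAction Γ A]
    (H : Subgroup A) (R : N → A → Prop) : Prop where
  exists_rel : ∀ γ, ∃ t, R γ t
  conj_mem : ∀ {γ t h}, R γ t → h ∈ H → t⁻¹ * h * t ∈ H
  inv_mul_mem : ∀ {γ t t'}, R γ t → R γ t' → t⁻¹ * t' ∈ H
  inv_mul_smul_mem : ∀ {γ t}, R γ t → ∀ σ : Γ, t⁻¹ * σ • t ∈ H
  isLocallyConstant : ∀ {γ t}, R γ t → IsLocallyConstant fun σ : Γ => σ • t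
  one : R 1 1
  mul : ∀ {γ t γ' t'}, R γ t → R γ' t' → R (γ' * γ) (t * t')

variable {R : N → A → Prop} (hR : IsTwisting Γ H R)

theorem Cocycle.ext_of_apply {h h' : Cocycle Γ H} (e : ∀ σ, h.toFun σ = h'.toFun σ) : h = h' := by
  cases h
  cases h'
  congr 1
  exact funext e

/-- The twist `t⁻¹ h_σ t^σ` of a cocycle `h_σ`. -/
def IsTwisting.twist {γ : N} {t : A} (ht : R γ t) (h : Cocycle Γ H) : Cocycle Γ H where
  toFun σ := t⁻¹ * h.toFun σ * σ • t
  mem' σ := by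
    have := H.mul_mem (hR.conj_mem ht (h.mem' σ)) (hR.inv_mul_smul_mem ht σ)
    have e : t⁻¹ * h.toFun σ * t * (t⁻¹ * σ • t) = t⁻¹ * h.toFun σ * σ • t := by group
    rwa [e] at this
  cont' := ((IsLocallyConstant.const t⁻¹).mul h.cont').mul (hR.isLocallyConstant ht)
  map_mul' σ τ := by
    rw [h.map_mul', smul_mul', smul_mul', smul_inv', mul_smul]
    group

/-- Independence of the lift and of the representative: if `h'` is `h` modified by `a`, the two
twists differ by the element `t⁻¹ a t'` of `H`. -/
theorem IsTwisting.twist_cls_eq {γ : N} {t t' : A} (ht : R γ t) (ht' : R γ t')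
    {h h' : Cocycle Γ H} (e : h.cls = h'.cls) :
    (hR.twist ht h).cls = (hR.twist ht' h').cls := by
  obtain ⟨a, ha, e⟩ := Quotient.exact e
  refine Quotient.sound ⟨t⁻¹ * a * t * (t⁻¹ * t'), H.mul_mem (hR.conj_mem ht ha)
    (hR.inv_mul_mem ht ht'), fun σ => ?_⟩
  change t'⁻¹ * h'.toFun σ * σ • t' = _ * (t⁻¹ * h.toFun σ * σ • t) * _
  simp only [e, smul_mul', smul_inv']
  group

/-- The action on cohomology classes by twisting. -/
@[reducible] def IsTwisting.mulAction : MulAction N (H1 Γ H) where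
  smul γ := Quotient.lift (fun h => (hR.twist (hR.exists_rel γ).choose_spec h).cls)
    fun _ _ e => hR.twist_cls_eq _ _ (Quotient.sound e)
  one_smul c := by
    induction c using Quotient.inductionOn with
    | h h =>
      refine (hR.twist_cls_eq (hR.exists_rel 1).choose_spec hR.one rfl).trans ?_
      exact congrArg Cocycle.cls (Cocycle.ext_of_apply fun σ => by simp [IsTwisting.twist])
  mul_smul γ γ' c := by
    induction c using Quotient.inductionOn with
    | h h =>
      refine (hR.twist_cls_eq (hR.exists_rel (γ * γ')).choose_spec
        (hR.mul (hR.exists_rel γ').choose_spec (hR.exists_rel γ).choose_spec) rfl).trans ?_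
      refine congrArg Cocycle.cls (Cocycle.ext_of_apply fun σ => ?_)
      simp only [IsTwisting.twist, smul_mul']
      group

theorem IsTwisting.smul_cls {γ : N} {t : A} (ht : R γ t) (h : Cocycle Γ H) :
    hR.mulAction.toSMul.smul γ h.cls = (hR.twist ht h).cls :=
  hR.twist_cls_eq _ _ rfl

end Twist

section BaseChange

variable {k : Type u} [Field k] {Q : QuatAlg k} {n : ℕ} {K : Type u} [Field K] [Algebra k K]
  {x : Amb Q n k} {γ γ' : Aut (Z x)} {α α' : Aut (ZBase K x)}

theorem IsBaseChange.one : IsBaseChange (K := K) x 1 1 :=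
  (Category.id_comp _).trans (Category.comp_id _).symm

theorem IsBaseChange.mul (h : IsBaseChange x γ α) (h' : IsBaseChange x γ' α') :
    IsBaseChange x (γ' * γ) (α' * α) := by
  change (α.hom.left ≫ α'.hom.left) ≫ ZProj K x = ZProj K x ≫ γ.hom.left ≫ γ'.hom.left
  have e : α.hom.left ≫ ZProj K x = ZProj K x ≫ γ.hom.left := h
  have e' : α'.hom.left ≫ ZProj K x = ZProj K x ≫ γ'.hom.left := h'
  rw [Category.assoc, e', ← Category.assoc, e, Category.assoc]

end BaseChange

section Stabilizer

variable {k : Type u} [Field k] {Q : QuatAlg k} {n : ℕ} {K : Type u} [Field K] [Algebra k K]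
  [IsSepClosed K] {x : Amb Q n k} {u : Fin n → Fin 2 → K}

/-- The homomorphism `c_x` from the stabilizer to the automorphism group of `Z_x`. -/
def stabHom (hn : n = 2 ∨ n = 3) (hx : x ∈ V Q n k) (h : SplitsAt (formF x) u) :
    stab K x →* (Aut (ZBase K x))ᵐᵒᵖ where
  toFun g := .op (zBaseAut h g.1.sndUnit (mapsZeros_of_mem_stab hn hx h g.2))
  map_one' := congrArg MulOpposite.op (zBaseAut_one h)
  map_mul' g g' := (congrArg MulOpposite.op (zBaseAut_mul h (A := g.1.sndUnit)
    (B := g'.1.sndUnit) (hA := mapsZeros_of_mem_stab hn hx h g.2)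
    (hB := mapsZeros_of_mem_stab hn hx h g'.2)
    (hAB := mapsZeros_of_mem_stab hn hx h (g * g').2))).symm

variable {hn : n = 2 ∨ n = 3} {hx : x ∈ V Q n k} {h : SplitsAt (formF x) u}

theorem stabHom_apply (g : stab K x) : stabHom hn hx h g =
    .op (zBaseAut h g.1.sndUnit (mapsZeros_of_mem_stab hn hx h g.2)) := rfl

theorem isInduced_stabHom (g : stab K x) : IsInduced x g.1 (stabHom hn hx h g).unop := by
  rw [stabHom_apply]
  exact isInduced_zBaseAut h (hg := mapsZeros_of_mem_stab hn hx h g.2)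

theorem stabHom_eq_iff {s t : stab K x} : stabHom hn hx h s = stabHom hn hx h t ↔
    ∀ i, planeDet (u i ᵥ* s.1.snd) (u i ᵥ* t.1.snd) = 0 := by
  rw [stabHom_apply, stabHom_apply, MulOpposite.op_inj]
  exact zBaseAut_eq_iff h

/-- Both conditions say that every zero is fixed: automorphisms are determined by their effect on
zeros, and `G_x°` is described by `mem_stabConn_iff`. -/
theorem stabHom_eq_one_iff {g : stab K x} : stabHom hn hx h g = 1 ↔ g.1 ∈ stabConn K x := by
  rw [mem_stabConn_iff hn K hx h, ← map_one (stabHom hn hx h), stabHom_eq_iff]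
  have : (1 : stab K x).1.snd = 1 := rfl
  simp only [this, Matrix.vecMul_one]
  exact ⟨fun e => ⟨g.2, e⟩, fun e => e.2⟩

theorem stabHom_surjective : Function.Surjective (stabHom hn hx h) := by
  intro α
  obtain ⟨A, hA, e⟩ := exists_eq_zBaseAut hn h α.unop
  obtain ⟨g, hg, rfl⟩ := exists_mem_stab hn hx h hA
  refine ⟨⟨g, hg⟩, ?_⟩
  rw [stabHom_apply]
  exact (congrArg MulOpposite.op e).symm

theorem inv_mul_mem_stabConn {s t : stab K x} (e : stabHom hn hx h s = stabHom hn hx h t) :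
    s.1⁻¹ * t.1 ∈ stabConn K x := by
  have : stabHom hn hx h (s⁻¹ * t) = 1 := by rw [map_mul, map_inv, e, inv_mul_cancel]
  rw [stabHom_eq_one_iff] at this
  exact this

theorem conj_mem_stabConn (hn : n = 2 ∨ n = 3) (hx : x ∈ V Q n k) (h : SplitsAt (formF x) u)
    {t a : stab K x} (ha : a.1 ∈ stabConn K x) :
    t.1⁻¹ * a.1 * t.1 ∈ stabConn K x := by
  rw [← stabHom_eq_one_iff (hn := hn) (hx := hx) (h := h)] at ha
  have : stabHom hn hx h (t⁻¹ * a * t) = 1 := by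
    rw [map_mul, map_mul, ha, mul_one, ← map_mul, inv_mul_cancel, map_one]
  rw [stabHom_eq_one_iff] at this
  exact this

theorem isBaseChange_stabHom_mul {γ γ' : Aut (Z x)} {s t : stab K x}
    (hs : IsBaseChange x γ (stabHom hn hx h s).unop)
    (ht : IsBaseChange x γ' (stabHom hn hx h t).unop) :
    IsBaseChange x (γ' * γ) (stabHom hn hx h (s * t)).unop := by
  rw [map_mul, MulOpposite.unop_mul]
  exact hs.mul ht

variable [IsSepClosure k K]

theorem isBaseChange_stabHom_iff {A : (Matrix (Fin 2) (Fin 2) k)ˣ}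
    {hA : MapsZeros (A.val.map (algebraMap k K)) u u} {t : stab K x} :
    IsBaseChange x (zAut h A hA) (stabHom hn hx h t).unop ↔
      ∀ i, planeDet (u i ᵥ* A.val.map (algebraMap k K)) (u i ᵥ* t.1.snd) = 0 := by
  rw [stabHom_apply]
  exact isBaseChange_iff h (hB := mapsZeros_of_mem_stab hn hx h t.2)

theorem exists_isBaseChange (γ : Aut (Z x)) : ∃ t, IsBaseChange x γ (stabHom hn hx h t).unop := by
  obtain ⟨A, hA, rfl⟩ := exists_eq_zAut hn h γ
  obtain ⟨t, ht, e⟩ := exists_mem_stab hn hx h (A := mapUnit K A) hA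
  refine ⟨⟨t, ht⟩, isBaseChange_stabHom_iff.mpr fun i => ?_⟩
  have : t.snd = A.val.map (algebraMap k K) := congrArg Units.val e
  rw [this, planeDet_self]

theorem stabHom_eq_of_isBaseChange {γ : Aut (Z x)} {s t : stab K x}
    (hs : IsBaseChange x γ (stabHom hn hx h s).unop)
    (ht : IsBaseChange x γ (stabHom hn hx h t).unop) :
    stabHom hn hx h s = stabHom hn hx h t := by
  obtain ⟨A, hA, rfl⟩ := exists_eq_zAut hn h γ
  rw [isBaseChange_stabHom_iff] at hs ht
  exact stabHom_eq_iff.mpr fun i =>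
    planeDet_trans (map_unit_ne_zero A (h.ne_zero i)) (planeDet_comm_zero (hs i)) (ht i)

theorem stabHom_galois_smul {γ : Aut (Z x)} {t : stab K x}
    (ht : IsBaseChange x γ (stabHom hn hx h t).unop) (σ : K ≃ₐ[k] K) :
    stabHom hn hx h ⟨σ • t.1, galois_smul_mem_stab σ t.2⟩ = stabHom hn hx h t := by
  obtain ⟨A, hA, rfl⟩ := exists_eq_zAut hn h γ
  rw [isBaseChange_stabHom_iff] at ht
  exact stabHom_eq_iff.mpr fun i => planeDet_galois_smul_of_rational σ h ht i

/-- The hypothesis says that `t` and its conjugates act alike on the zeros, so by descent the action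
is that of a rational projectivity. -/
theorem exists_isBaseChange_of_galois_stable {t : stab K x}
    (ht : ∀ σ : K ≃ₐ[k] K, t.1⁻¹ * σ • t.1 ∈ stabConn K x) :
    ∃ γ : Aut (Z x), IsBaseChange x γ (stabHom hn hx h t).unop := by
  have e : ∀ (σ : K ≃ₐ[k] K) i, planeDet (u i ᵥ* (σ • t.1).snd) (u i ᵥ* t.1.snd) = 0 := by
    intro σ
    refine (stabHom_eq_iff (hn := hn) (hx := hx) (h := h)
      (s := ⟨σ • t.1, galois_smul_mem_stab σ t.2⟩)).mp ?_
    refine (inv_mul_eq_one.mp ?_).symm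
    rw [← map_inv, ← map_mul, stabHom_eq_one_iff]
    exact ht σ
  obtain ⟨A, hA⟩ := exists_rational_of_galois_stable hn h t.1 e
  have hA' : MapsZeros (A.val.map (algebraMap k K)) u u := fun i => by
    obtain ⟨j, hj⟩ := mapsZeros_of_mem_stab hn hx h t.2 i
    exact ⟨j, planeDet_trans (vecMul_ne_zero (h.ne_zero i) t.1.sndUnit) (hA i) hj⟩
  exact ⟨zAut h A hA', isBaseChange_stabHom_iff.mpr hA⟩

variable (hn hx h) in
/-- The element `t` of the stabilizer acts on `Z_x ×ₖ K` as the automorphism `γ` of `Z_x`. -/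
def IsLift (γ : Aut (Z x)) (t : Grp Q n K) : Prop :=
  ∃ ht : t ∈ stab K x, IsBaseChange x γ (stabHom hn hx h ⟨t, ht⟩).unop

variable (hn hx h) in
theorem isTwisting_isLift : IsTwisting (N := Aut (Z x)) (K ≃ₐ[k] K) (stabConn K x)
    (IsLift hn hx h) where
  exists_rel γ := by
    obtain ⟨t, ht⟩ := exists_isBaseChange (hn := hn) (hx := hx) (h := h) γ
    exact ⟨t.1, t.2, ht⟩
  conj_mem := fun ⟨ht, _⟩ ha =>
    conj_mem_stabConn hn hx h (t := ⟨_, ht⟩) (a := ⟨_, ha.1⟩) ha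
  inv_mul_mem := fun ⟨ht, e⟩ ⟨ht', e'⟩ =>
    inv_mul_mem_stabConn (s := ⟨_, ht⟩) (t := ⟨_, ht'⟩) (stabHom_eq_of_isBaseChange e e')
  inv_mul_smul_mem := fun ⟨ht, e⟩ σ =>
    inv_mul_mem_stabConn (s := ⟨_, ht⟩) (t := ⟨_, galois_smul_mem_stab σ ht⟩)
      (stabHom_galois_smul e σ).symm
  isLocallyConstant {_ t} _ := Grp.isLocallyConstant_smul t
  one := by
    refine ⟨(stab K x).one_mem, ?_⟩
    have e : (stabHom hn hx h 1).unop = 1 := congrArg MulOpposite.unop (map_one _)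
    exact (congrArg (IsBaseChange x 1) e).mpr IsBaseChange.one
  mul := fun ⟨ht, e⟩ ⟨ht', e'⟩ =>
    ⟨(stab K x).mul_mem ht ht', isBaseChange_stabHom_mul (s := ⟨_, ht⟩) (t := ⟨_, ht'⟩) e e'⟩

end Stabilizer

end HermitianPairs
end

/-! ### Orbits in the fibre and cocycles -/

noncomputable section
namespace HermitianPairs
open CategoryTheory AlgebraicGeometry
open scoped Quaternion Matrix
attribute [local instance] MvPolynomial.gradedAlgebra

variable {k : Type u} [Field k] {Q : QuatAlg k} {n : ℕ}

theorem Vss.exists_splitsAt (hn : n = 2 ∨ n = 3) (K : Type u) [Field K] [Algebra k K]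
    [IsSepClosed K] (x : Vss Q n) : ∃ u : Fin n → Fin 2 → K, SplitsAt (formF x.1) u :=
  HermitianPairs.exists_splitsAt hn (formF_isHomogeneous n x.1) x.2.2

variable {K : Type u} [Field K] [Algebra k K] [IsSepClosure k K]

/-- The relation between the cocycles makes `g' * t⁻¹ * g⁻¹` Galois invariant, hence rational, and
this element carries `y` to `y'`. -/
theorem orbit_eq_of_cocycle {x y y' : Vss Q n} {g g' t : Grp Q n K}
    {c c' : Cocycle (K ≃ₐ[k] K) (stabConn K x.1)}
    (hg : ∀ σ : K ≃ₐ[k] K, c.toFun σ = g⁻¹ * σ • g)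
    (hg' : ∀ σ : K ≃ₐ[k] K, c'.toFun σ = g'⁻¹ * σ • g') (hy : ext K y.1 = g • ext K x.1)
    (hy' : ext K y'.1 = g' • ext K x.1) (ht : t ∈ stab K x.1)
    (hc : ∀ σ : K ≃ₐ[k] K, c'.toFun σ = t⁻¹ * c.toFun σ * σ • t) : y'.orbit = y.orbit := by
  obtain ⟨a, ha⟩ := exists_grpMap_eq (g := g' * t⁻¹ * g⁻¹) fun σ => by
    have h1 : σ • g = g * c.toFun σ := by rw [hg]; group
    have h2 : σ • g' = g' * c'.toFun σ := by rw [hg']; group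
    rw [smul_mul', smul_mul', smul_inv', smul_inv', h1, h2, hc]
    group
  refine Quotient.sound ⟨a, ext_injective (K := K) ?_⟩
  have h1 : ext K (a • y.1) = Grp.map (Algebra.ofId k K) a • ext K y.1 := Grp.map_smul _ _ _
  have h2 : t⁻¹ • ext K x.1 = ext K x.1 := inv_smul_eq_iff.mpr (show t • _ = _ from ht).symm
  change ext K (a • y.1) = ext K y'.1
  rw [h1, ha, hy, hy', mul_smul, inv_smul_smul, mul_smul, h2]

variable [IsSepClosed K] {x y : Amb Q n k} {u : Fin n → Fin 2 → K}

/-- The zeros of the new form are those of the old one multiplied by the inverse of the second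
component, which is rational. -/
theorem nonempty_iso_of_smul (hn : n = 2 ∨ n = 3) (hx : x ∈ V Q n k) (h : SplitsAt (formF x) u)
    (g : Grp Q n k) : Nonempty (Z (g • x) ≅ Z x) := by
  have e : ext K (g • x) = Grp.map (Algebra.ofId k K) g • ext K x := Grp.map_smul _ _ _
  have h' : SplitsAt (formF (g • x)) _ := SplitsAt.of_ext (K := K) (by
    rw [e]
    exact h.ext_self.smul hn (ext_mem_V K hx) (Grp.map (Algebra.ofId k K) g))
  refine nonempty_iso_of_mapsZeros h' h (A := g.sndUnit) fun i => ⟨i, ?_⟩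
  have : u i ᵥ* (Grp.map (Algebra.ofId k K) g).sndUnit⁻¹.val ᵥ*
      g.sndUnit.val.map (algebraMap k K) = u i := by
    rw [show g.sndUnit.val.map (algebraMap k K) = (Grp.map (Algebra.ofId k K) g).sndUnit.val
      from rfl, Matrix.vecMul_vecMul, Units.inv_mul, Matrix.vecMul_one]
  rw [this, planeDet_self]

/-- A point of `G(K) x` given by a cocycle with values in the identity component of the stabilizer
is rational, and its zero scheme is isomorphic to that of `x`. -/
theorem exists_point_of_cocycle (hn : n = 2 ∨ n = 3) (hx : x ∈ V Q n k)
    (h : SplitsAt (formF x) u) {g : Grp Q n K}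
    (hg : ∀ σ : K ≃ₐ[k] K, g⁻¹ * σ • g ∈ stabConn K x) :
    ∃ y : Vss Q n, ext K y.1 = g • ext K x ∧ Nonempty (Z y.1 ≅ Z x) := by
  have hσ : ∀ σ : K ≃ₐ[k] K, Amb.map (σ : K →ₐ[k] K) (g • ext K x) = g • ext K x := by
    intro σ
    have h1 : (g⁻¹ * σ • g) • ext K x = ext K x := (hg σ).1
    rw [← galois_smul_ext]
    rwa [mul_smul, inv_smul_eq_iff] at h1
  obtain ⟨y, hy⟩ := exists_ext_eq hσ
  have hyV : y ∈ V Q n k := mem_V_of_ext (K := K) (by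
    rw [hy]
    exact smul_mem_V (ext_mem_V K hx) g)
  have h' : SplitsAt (formF y) fun i => u i ᵥ* g.sndUnit⁻¹.val := SplitsAt.of_ext (by
    rw [hy]
    exact h.ext_self.smul hn (ext_mem_V K hx) g)
  refine ⟨⟨y, hyV, h'.disc_ne_zero hn⟩, hy, ?_⟩
  -- The inverse of `g` maps the zeros of `F_x` to those of `F_y`. Its conjugates differ from it by
  -- elements of `G_x°`, which fix the zeros of `F_x`, so this map is a rational projectivity.
  obtain ⟨A, hA⟩ := exists_rational_of_galois_stable hn h g⁻¹ fun σ i => by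
    have h1 := ((mem_stabConn_iff hn K hx h).mp ((stabConn K x).inv_mem (hg σ))).2 i
    have h2 : σ • g⁻¹ = (g⁻¹ * σ • g)⁻¹ * g⁻¹ := by
      rw [smul_inv']
      group
    rw [h2, Grp.snd_mul, ← Matrix.vecMul_vecMul]
    exact planeDet_vecMul_of_planeDet h1 _
  obtain ⟨e⟩ := nonempty_iso_of_mapsZeros h h' (A := A) fun i => ⟨i, hA i⟩
  exact ⟨e.symm⟩

/-- Every point whose zero scheme is isomorphic to that of `x` comes, up to the action of `G(k)`,
from a cocycle with values in the identity component of the stabilizer. -/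
theorem exists_cocycle_of_iso (hn : n = 2 ∨ n = 3) (x y : Vss Q n)
    (e : Nonempty (Z y.1 ≅ Z x.1)) :
    ∃ (g : Grp Q n K) (h : Cocycle (K ≃ₐ[k] K) (stabConn K x.1)) (y' : Vss Q n),
      (∀ σ : K ≃ₐ[k] K, h.toFun σ = g⁻¹ * σ • g) ∧ ext K y'.1 = g • ext K x.1 ∧
        y'.orbit = y.orbit := by
  obtain ⟨u, hu⟩ := x.exists_splitsAt hn K
  obtain ⟨w, hw⟩ := y.exists_splitsAt hn K
  obtain ⟨e⟩ := e
  obtain ⟨A, hA⟩ := exists_mapsZeros_of_iso hn hu hw e.symm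
  obtain ⟨b, a, hab⟩ := exists_smul_eq_ext_smul hn x.2.1 y.2.1 hu hw hA
  -- Trivial second component: this is why `g⁻¹ σ(g)` fixes every zero and lies in `G_x°`, not
  -- merely in `G_x`.
  let g : Grp Q n K := Grp.of a 1
  have hg : ∀ σ : K ≃ₐ[k] K, g⁻¹ * σ • g ∈ stabConn K x.1 := by
    intro σ
    refine (mem_stabConn_iff hn K x.2.1 hu).mpr ⟨?_, fun i => ?_⟩
    · change (g⁻¹ * σ • g) • ext K x.1 = ext K x.1
      rw [mul_smul, galois_smul_ext, inv_smul_eq_iff]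
      change Amb.map _ (Grp.of a 1 • ext K x.1) = Grp.of a 1 • ext K x.1
      rw [hab, map_ext]
    · have h1 : (g⁻¹ * σ • g).snd = 1 := by
        have h2 : (g⁻¹).snd = 1 := congrArg Units.val (inv_one (G := (Matrix (Fin 2) (Fin 2) K)ˣ))
        have h3 : (σ • g).snd = 1 := map_one (σ : K →+* K).mapMatrix
        rw [Grp.snd_mul, h2, h3, one_mul]
      rw [h1, Matrix.vecMul_one, planeDet_self]
  have hσ : ∀ σ τ : K ≃ₐ[k] K, g⁻¹ * (σ * τ) • g = g⁻¹ * σ • g * σ • (g⁻¹ * τ • g) := by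
    intro σ τ
    rw [smul_mul', smul_inv', mul_smul]
    group
  obtain ⟨y', hy', -⟩ := exists_point_of_cocycle hn x.2.1 hu hg
  refine ⟨g, ⟨fun σ => g⁻¹ * σ • g, hg,
    (IsLocallyConstant.const g⁻¹).mul (Grp.isLocallyConstant_smul g), hσ⟩, y', fun _ => rfl, hy',
      ?_⟩
  refine Quotient.sound ⟨b, ?_⟩
  exact ext_injective (K := K) (hab.symm.trans hy'.symm)

/-- If the rational element `b` carries `y` to `y'`, then `t = g⁻¹ b⁻¹ g'` stabilizes `x` and
relates the cocycles. As these have values in the normal subgroup `G_x°`, so does `t⁻¹ σ(t)`, and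
`t` induces an automorphism over `k`. -/
theorem exists_isLift_of_orbit_eq {hn : n = 2 ∨ n = 3} {x y y' : Vss Q n}
    {h : SplitsAt (formF x.1) u} {g g' : Grp Q n K} {c c' : Cocycle (K ≃ₐ[k] K) (stabConn K x.1)}
    (hg : ∀ σ : K ≃ₐ[k] K, c.toFun σ = g⁻¹ * σ • g)
    (hg' : ∀ σ : K ≃ₐ[k] K, c'.toFun σ = g'⁻¹ * σ • g') (hy : ext K y.1 = g • ext K x.1)
    (hy' : ext K y'.1 = g' • ext K x.1) (e : y'.orbit = y.orbit) :
    ∃ (γ : Aut (Z x.1)) (t : Grp Q n K), IsLift hn x.2.1 h γ t ∧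
      ∀ σ : K ≃ₐ[k] K, c'.toFun σ = t⁻¹ * c.toFun σ * σ • t := by
  obtain ⟨a, ha⟩ := Quotient.exact e
  have ha' : a • y.1 = y'.1 := ha
  have hya : ext K y'.1 = Grp.map (Algebra.ofId k K) a • ext K y.1 := by
    rw [← ha']
    exact Grp.map_smul _ _ _
  set b := Grp.map (Algebra.ofId k K) a with hb
  have hσb : ∀ σ : K ≃ₐ[k] K, σ • b = b := fun σ => by
    refine Grp.ext' ?_ ?_
    · ext1 i j
      ext <;> exact σ.commutes _
    · ext1 i j
      exact σ.commutes _
  have ht : g⁻¹ * b⁻¹ * g' ∈ stab K x.1 := by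
    change (g⁻¹ * b⁻¹ * g') • ext K x.1 = ext K x.1
    rw [mul_smul, mul_smul, ← hy', hya, inv_smul_smul, hy, inv_smul_smul]
  have hc : ∀ σ : K ≃ₐ[k] K, c'.toFun σ =
      (g⁻¹ * b⁻¹ * g')⁻¹ * c.toFun σ * σ • (g⁻¹ * b⁻¹ * g') := by
    intro σ
    rw [hg, hg', smul_mul', smul_mul', smul_inv', smul_inv', hσb]
    group
  obtain ⟨γ, hγ⟩ := exists_isBaseChange_of_galois_stable (hn := hn) (hx := x.2.1) (h := h)
    (t := ⟨_, ht⟩) fun σ => by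
      have h1 := conj_mem_stabConn hn x.2.1 h (t := ⟨_, ht⟩) (a := ⟨_, (c.mem' σ).1⟩) (c.mem' σ)
      have h2 := c'.mem' σ
      rw [hc σ] at h2
      -- The quotient of `c'` by the conjugate `t⁻¹ c t` is `t⁻¹ σ(t)`.
      have h3 := (stabConn K x.1).mul_mem ((stabConn K x.1).inv_mem h1) h2
      dsimp only at h3 ⊢
      convert h3 using 1
      group
  exact ⟨γ, _, ⟨ht, hγ⟩, hc⟩

end HermitianPairs
end

open HermitianPairs CategoryTheory in
/-- For `x ∈ V^ss(k)`: the map `Φ : G(k) \ V^ss(k) → {schemes over k} / ≅`, `G(k) x ↦ [Z_x]`, is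
well defined; `1 → G_x° → G_x → Aut(Z_x) → 1` is exact; and for the induced action of
`Aut(Z_x)(k)` on `H¹(k, G_x°)`, the orbit set is in bijection with the fibre `Φ⁻¹([Z_x])`, where
the class of `(g⁻¹ g^σ)` corresponds to the orbit of `g • x`. Automorphisms of `Z_x` act on it
from the right, so that a right action of their group is an action of Mathlib's `Aut`, whose
product `γ' * γ` is `γ` followed by `γ'`. -/
theorem corollary3 {k : Type u} [Field k] (B : QuatAlg k) (n : ℕ) (hn : n = 2 ∨ n = 3)
    (K : Type u) [Field K] [Algebra k K] [IsSepClosure k K] :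
    ∃ Φ : Orb B n → IsoClass k,
      (∀ y : Vss B n, Φ y.orbit = isoClass (Z y.1)) ∧
      ∀ x : Vss B n,
        ∃ c : stab K x.1 →* (Aut (ZBase K x.1))ᵐᵒᵖ,
          (∀ g : stab K x.1, IsInduced x.1 g.1 (c g).unop) ∧
          Function.Surjective c ∧
          (∀ g : stab K x.1, c g = 1 ↔ g.1 ∈ stabConn K x.1) ∧
          (∀ γ : Aut (Z x.1), ∃ t : stab K x.1, IsBaseChange x.1 γ (c t).unop) ∧
          ∃ _act : MulAction (Aut (Z x.1)) (H1Stab K x.1),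
            (∀ (γ : Aut (Z x.1)) (t : stab K x.1), IsBaseChange x.1 γ (c t).unop →
              ∀ h : Cocycle (K ≃ₐ[k] K) (stabConn K x.1),
                ∃ h' : Cocycle (K ≃ₐ[k] K) (stabConn K x.1),
                  (∀ σ : K ≃ₐ[k] K, h'.toFun σ = t.1⁻¹ * h.toFun σ * σ • t.1) ∧
                  γ • h.cls = h'.cls) ∧
            ∃ β : MulAction.orbitRel.Quotient (Aut (Z x.1)) (H1Stab K x.1) ≃
                {O : Orb B n // Φ O = isoClass (Z x.1)},
              ∀ (g : Grp B n K) (h : Cocycle (K ≃ₐ[k] K) (stabConn K x.1)),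
                (∀ σ : K ≃ₐ[k] K, h.toFun σ = g⁻¹ * σ • g) →
                ∃ y : Vss B n, ext K y.1 = g • ext K x.1 ∧
                  (β (Quotient.mk _ h.cls)).1 = y.orbit := by
  have : IsSepClosed K := IsSepClosure.sep_closed k
  have hΦ : ∀ y y' : Vss B n, y ≈ y' → isoClass (Z y.1) = isoClass (Z y'.1) := by
    rintro y y' ⟨g, hg⟩
    obtain ⟨u, hu⟩ := y'.exists_splitsAt hn K
    have hg' : g • y'.1 = y.1 := hg
    refine Quotient.sound ?_
    rw [← hg']
    exact nonempty_iso_of_smul hn y'.2.1 hu g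
  refine ⟨Quotient.lift (fun y : Vss B n => isoClass (Z y.1)) hΦ, fun y => rfl, fun x => ?_⟩
  obtain ⟨u, hu⟩ := x.exists_splitsAt hn K
  have hR := isTwisting_isLift hn x.2.1 hu
  refine ⟨stabHom hn x.2.1 hu, isInduced_stabHom, stabHom_surjective,
    fun g => stabHom_eq_one_iff, exists_isBaseChange, hR.mulAction, fun γ t ht h =>
      ⟨hR.twist ⟨t.2, ht⟩ h, fun σ => rfl, hR.smul_cls ⟨t.2, ht⟩ h⟩, ?_⟩
  let _ := hR.mulAction
  -- Theorem 90 trivialises the cocycle in `G(K)`, and the trivialising element moves `x` to a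
  -- rational point of the fibre.
  have hpt : ∀ h : Cocycle (K ≃ₐ[k] K) (stabConn K x.1), ∃ (g : Grp B n K) (y : Vss B n),
      (∀ σ : K ≃ₐ[k] K, h.toFun σ = g⁻¹ * σ • g) ∧ ext K y.1 = g • ext K x.1 ∧
        isoClass (Z y.1) = isoClass (Z x.1) := by
    intro h
    have : NeZero n := ⟨by omega⟩
    obtain ⟨g, hg⟩ := Grp.exists_eq_inv_mul_of_cocycle h.cont' h.map_mul'
    obtain ⟨y, hy, e⟩ := exists_point_of_cocycle hn x.2.1 hu fun σ => hg σ ▸ h.mem' σ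
    exact ⟨g, y, hg, hy, Quotient.sound e⟩
  choose g y hg hy hyx using hpt
  -- Stated for arbitrary trivialisations `b`, `b'`, so that it yields at once that the map is well
  -- defined and injective and that the choice of `g` is immaterial.
  have key : ∀ (h h' : Cocycle (K ≃ₐ[k] K) (stabConn K x.1)) (b b' : Grp B n K) (z z' : Vss B n),
      (∀ σ : K ≃ₐ[k] K, h.toFun σ = b⁻¹ * σ • b) → (∀ σ : K ≃ₐ[k] K, h'.toFun σ = b'⁻¹ * σ • b') →
      ext K z.1 = b • ext K x.1 → ext K z'.1 = b' • ext K x.1 →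
      ((∃ γ : Aut (Z x.1), γ • h.cls = h'.cls) ↔ z'.orbit = z.orbit) := by
    intro h h' b b' z z' hb hb' hz hz'
    refine ⟨?_, fun e => ?_⟩
    · rintro ⟨γ, hγ⟩
      obtain ⟨t, ht⟩ := hR.exists_rel γ
      obtain ⟨s, hs, e⟩ := Quotient.exact ((hR.smul_cls ht h).symm.trans hγ)
      have htS : t ∈ stab K x.1 := ht.elim fun a _ => a
      refine orbit_eq_of_cocycle hb hb' hz hz' ((stab K x.1).mul_mem htS hs.1) fun σ => ?_
      refine (e σ).trans ?_
      change s⁻¹ * (t⁻¹ * h.toFun σ * σ • t) * σ • s = _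
      rw [smul_mul']
      group
    · obtain ⟨γ, t, ht, hc⟩ := exists_isLift_of_orbit_eq (h := hu) hb hb' hz hz' e
      refine ⟨γ, (hR.smul_cls ht h).trans (congrArg Cocycle.cls ?_)⟩
      exact Cocycle.ext_of_apply fun σ => (hc σ).symm
  have hcls : ∀ h h' : Cocycle (K ≃ₐ[k] K) (stabConn K x.1), h.cls = h'.cls →
      (y h).orbit = (y h').orbit := fun h h' e =>
    (key h' h _ _ _ _ (hg h') (hg h) (hy h') (hy h)).mp ⟨1, (one_smul _ _).trans e.symm⟩
  let f : H1Stab K x.1 → {O : Orb B n // Quotient.lift (fun y : Vss B n => isoClass (Z y.1)) hΦ O =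
      isoClass (Z x.1)} :=
    Quotient.lift (fun h => ⟨(y h).orbit, hyx h⟩) fun h h' e =>
      Subtype.ext (hcls h h' (Quotient.sound e))
  have hf : ∀ c c' : H1Stab K x.1,
      (MulAction.orbitRel (Aut (Z x.1)) (H1Stab K x.1)) c c' ↔ f c = f c' := by
    intro c c'
    induction c using Quotient.inductionOn with
    | h h =>
      induction c' using Quotient.inductionOn with
      | h h' =>
        refine (key h' h _ _ _ _ (hg h') (hg h) (hy h') (hy h)).trans ?_
        exact ⟨fun e => Subtype.ext e, fun e => congrArg Subtype.val e⟩
  let β : MulAction.orbitRel.Quotient (Aut (Z x.1)) (H1Stab K x.1) →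
      {O : Orb B n // Quotient.lift (fun y : Vss B n => isoClass (Z y.1)) hΦ O =
        isoClass (Z x.1)} :=
    Quotient.lift f fun c c' e => (hf c c').mp e
  have hβ : Function.Bijective β := by
    refine ⟨fun c c' e => ?_, ?_⟩
    · induction c using Quotient.inductionOn with
      | h c =>
        induction c' using Quotient.inductionOn with
        | h c' => exact Quotient.sound ((hf c c').mpr e)
    · rintro ⟨O, hO⟩
      induction O using Quotient.inductionOn with
      | h z =>
        -- Surjectivity: the cocycle comes with its own trivialisation `b`, which `key` compares
        -- with the chosen one.
        obtain ⟨b, h, z', hb, hz, e⟩ := exists_cocycle_of_iso (K := K) hn x z (Quotient.exact hO)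
        refine ⟨Quotient.mk _ h.cls, Subtype.ext ?_⟩
        exact ((key h h b (g h) z' (y h) hb (hg h) hz (hy h)).mp ⟨1, one_smul _ _⟩).trans e
  refine ⟨Equiv.ofBijective β hβ, fun b h hb => ?_⟩
  obtain ⟨z, hz, -⟩ := exists_point_of_cocycle hn x.2.1 hu fun σ => hb σ ▸ h.mem' σ
  exact ⟨z, hz, (key h h b (g h) z (y h) hb (hg h) hz (hy h)).mp ⟨1, one_smul _ _⟩⟩
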